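/- \textbf{Theorem.} Every atomic flow has a unique normal form under the rewriting system $\mathsf{norm}$, and the function that maps a flow to its normal form under $\mathsf{norm}$ lifts polynomially to $\mathsf{SKS}$. That is, there are an algorithm and a polynomial $q$ such that, given any $\mathsf{SKS}$ derivation $\Phi$, the algorithm constructs an $\mathsf{SKS}$ derivation $\Psi$ with the same premiss and the same conclusion as $\Phi$ whose flow is the normal form $\psi$ under $\mathsf{norm}$ of the flow of $\Phi$, in time at most $q(|\Phi|+|\psi|)$. Here formulae are built from literals (\emph{atoms}) $a,\bar a,\dots$ and the units $\top,\bot$ by $\wedge$ and $\vee$. The rules of $\mathsf{SKS}$ are, with the premiss on the left and the conclusion on the right, \[ \mathsf{ai}{\downarrow}:\ \top\to a\vee\bar a,\quad \mathsf{aw}{\downarrow}:\ \bot\to a,\quad \mathsf{ac}{\downarrow}:\ a\vee a\to a,\quad \mathsf{ai}{\uparrow}:\ a\wedge\bar a\to\bot,\quad \mathsf{aw}{\uparrow}:\ a\to\top,\quad \mathsf{ac}{\uparrow}:\ a\to a\wedge a, \] \[ \mathsf{s}:\ A\wedge(B\vee C)\to(A\wedge B)\vee C,\qquad \mathsf{m}:\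 (A\wedge B)\vee(C\wedge D)\to(A\vee C)\wedge(B\vee D), \] and the rule $=$, which replaces a formula by one equal to it under commutativity and associativity of $\wedge$ and $\vee$ and the equations $A\vee\bot=A$, $A\wedge\top=A$, $\top\vee\top=\top$, $\bot\wedge\bot=\bot$, applied in any context; an instance of $=$ includes the information which atom occurrence of the premiss becomes which atom occurrence of the conclusion under these equations. A derivation is a formula $A$ (with premiss and conclusion $A$), or $\Phi\star\Psi$ with $\star\in\{\wedge,\vee\}$ for derivations $\Phi,\Psi$ (premisses and conclusions being joined by $\star$), or consists of derivations $\Phi$ and $\Psi$ and a rule instance leading from the conclusion of $\Phi$ to the premiss of $\Psi$ (with the premiss of $\Phi$ and the conclusion of $\Psi$). The size $|\Phi|$ is the number of occurrences of atoms and units in $\Phi$, and in measuring time the name of a propositional variable counts as a single symbol. An \emph{atomic flow} is a finite graph, all of whose edges can be simultaneously directed downwards, built from nodes of six kinds: $\mathsf{i}{\downarrow}$ (two lower edges), $\mathsf{w}{\downarrow}$ (one lower edge), $\mathsf{c}{\downarrow}$ (two upper edges, one lower edge), $\mathsf{i}{\uparrow}$ (two upper edges), $\mathsf{w}{\uparrow}$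 (one upper edge), $\mathsf{c}{\uparrow}$ (one upper edge, two lower edges); the ends of edges may be pending (attached to no node), and flows are considered up to isomorphism. The size $|\phi|$ of a flow $\phi$ is its number of edges. The flow of a derivation is obtained by tracing its atom occurrences from premiss to conclusion, with one node for each instance of $\mathsf{ai}{\downarrow},\mathsf{aw}{\downarrow},\mathsf{ac}{\downarrow},\mathsf{ai}{\uparrow},\mathsf{aw}{\uparrow},\mathsf{ac}{\uparrow}$ and none for the rules $\mathsf{s}$, $\mathsf{m}$ and $=$. The system $\mathsf{norm}$ consists of the following rules, each of which rewrites two nodes joined by an edge $e$ (directed from the first node to the second one): \begin{itemize} \item $\mathsf{w}{\downarrow}$-$\mathsf{c}{\downarrow}$: delete both nodes and $e$, and join the two remaining edges of the $\mathsf{c}{\downarrow}$ node into one; \item $\mathsf{i}{\downarrow}$-$\mathsf{w}{\uparrow}$: replace both nodes and $e$ by a $\mathsf{w}{\downarrow}$ node on the other edge of the $\mathsf{i}{\downarrow}$ node; \item $\mathsf{c}{\uparrow}$-$\mathsf{w}{\uparrow}$: delete both nodes and $e$, and join the two remaining edges of the $\mathsf{c}{\uparrow}$ node into one; \item $\mathsf{w}{\downarrow}$-$\mathsf{c}{\uparrow}$: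 replace both nodes and $e$ by a $\mathsf{w}{\downarrow}$ node on each lower edge of the $\mathsf{c}{\uparrow}$ node; \item $\mathsf{w}{\downarrow}$-$\mathsf{w}{\uparrow}$: delete both nodes and $e$; \item $\mathsf{c}{\downarrow}$-$\mathsf{w}{\uparrow}$: replace both nodes and $e$ by a $\mathsf{w}{\uparrow}$ node on each upper edge of the $\mathsf{c}{\downarrow}$ node; \item $\mathsf{c}{\downarrow}$-$\mathsf{c}{\uparrow}$, with upper edges $a,b$ and lower edges $c,d$: replace both nodes and $e$ by two $\mathsf{c}{\uparrow}$ nodes with upper edges $a$ and $b$ and two $\mathsf{c}{\downarrow}$ nodes with lower edges $c$ and $d$, each of these $\mathsf{c}{\uparrow}$ nodes being joined to each of these $\mathsf{c}{\downarrow}$ nodes by a new edge; \item $\mathsf{i}{\downarrow}$-$\mathsf{c}{\uparrow}$, with $b$ the other edge of the $\mathsf{i}{\downarrow}$ node and $c,d$ the lower edges of the $\mathsf{c}{\uparrow}$ node: replace both nodes and $e$ by two $\mathsf{i}{\downarrow}$ nodes with lower edges $c,p$ and $d,q$ and a $\mathsf{c}{\downarrow}$ node with upper edges $p,q$ and lower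 edge $b$, where $p,q$ are new. \end{itemize} A normal form of a flow $\phi$ is a flow that is reachable from $\phi$ by finitely many (possibly zero) such steps and to which no rule applies. -/

import Mathlib

namespace SKS

/-! ### Formulae -/

/-- Propositional formulae in negation normal form whose atoms are taken from `α`. -/
inductive Fm (α : Type) : Type
  | top : Fm α
  | bot : Fm α
  | atom (a : α) : Fm α
  | and (A B : Fm α) : Fm α
  | or (A B : Fm α) : Fm α

/-- A literal: a propositional variable (`pos = true`) or its dual (`pos = false`). -/
structure Lit where
  var : ℕ
  pos : Bool

/-- The dual of a literal. -/
def Lit.dual (a : Lit) : Lit := ⟨a.var, !a.pos⟩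

/-- Propositional formulae over literals. -/
abbrev Formula : Type := Fm Lit

namespace Fm

variable {α : Type}

/-- The number of occurrences of atoms. -/
def numAtoms : Fm α → ℕ
  | top => 0
  | bot => 0
  | atom _ => 1
  | and A B => A.numAtoms + B.numAtoms
  | or A B => A.numAtoms + B.numAtoms

/-- The number of occurrences of atoms and units. -/
def size : Fm α → ℕ
  | top => 1
  | bot => 1
  | atom _ => 1
  | and A B => A.size + B.size
  | or A B => A.size + B.size

/-- The atoms occurring in a formula, with multiplicity. -/
def atoms : Fm α → Multiset α
  | top => 0
  | bot => 0
  | atom a => {a}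
  | and A B => A.atoms + B.atoms
  | or A B => A.atoms + B.atoms

/-- The equational theory: commutativity, associativity and unit equations, closed under
reflexivity, symmetry, transitivity and contexts. Every equation is linear in its formula
variables, so an equation between formulae whose atom occurrences carry pairwise distinct marks
also records which occurrence becomes which. -/
inductive Eqv : Fm α → Fm α → Prop
  | refl (A : Fm α) : Eqv A A
  | symm {A B : Fm α} : Eqv A B → Eqv B A
  | trans {A B C : Fm α} : Eqv A B → Eqv B C → Eqv A C
  | and_congr (C : Fm α) {A B : Fm α} : Eqv A B → Eqv (and C A) (and C B)
  | or_congr (C : Fm α) {A B : Fm α} : Eqv A B → Eqv (or C A) (or C B)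
  | or_comm (A B : Fm α) : Eqv (or A B) (or B A)
  | and_comm (A B : Fm α) : Eqv (and A B) (and B A)
  | or_assoc (A B C : Fm α) : Eqv (or (or A B) C) (or A (or B C))
  | and_assoc (A B C : Fm α) : Eqv (and (and A B) C) (and A (and B C))
  | or_bot (A : Fm α) : Eqv (or A bot) A
  | and_top (A : Fm α) : Eqv (and A top) A
  | top_or_top : Eqv (or top top) top
  | bot_and_bot : Eqv (and bot bot) bot

theorem Eqv.atoms_eq {A B : Fm α} (h : Eqv A B) : A.atoms = B.atoms := by
  induction h with
  | refl => rfl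
  | symm _ ih => exact ih.symm
  | trans _ _ ih₁ ih₂ => exact ih₁.trans ih₂
  | and_congr C _ ih => simp [atoms, ih]
  | or_congr C _ ih => simp [atoms, ih]
  | or_comm A B => simp [atoms, add_comm]
  | and_comm A B => simp [atoms, add_comm]
  | or_assoc A B C => simp [atoms, add_assoc]
  | and_assoc A B C => simp [atoms, add_assoc]
  | or_bot A => simp [atoms]
  | and_top A => simp [atoms]
  | top_or_top => simp [atoms]
  | bot_and_bot => simp [atoms]

/-- A labelling of the atom occurrences of a formula by natural numbers. -/
def Lab : Fm α → Type
  | top => Unit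
  | bot => Unit
  | atom _ => ℕ
  | and A B => A.Lab × B.Lab
  | or A B => A.Lab × B.Lab

/-- The labels, read from left to right. -/
def Lab.toList : (A : Fm α) → A.Lab → List ℕ
  | top, _ => []
  | bot, _ => []
  | atom _, n => [n]
  | and A B, l => Lab.toList A l.1 ++ Lab.toList B l.2
  | or A B, l => Lab.toList A l.1 ++ Lab.toList B l.2

/-- Apply a function to all labels. -/
def Lab.map (f : ℕ → ℕ) : (A : Fm α) → A.Lab → A.Lab
  | top, _ => ()
  | bot, _ => ()
  | atom _, n => f n
  | and A B, l => (Lab.map f A l.1, Lab.map f B l.2)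
  | or A B, l => (Lab.map f A l.1, Lab.map f B l.2)

/-- Number the atom occurrences from left to right, starting with `n`. -/
def numbering : (A : Fm α) → (n : ℕ) → A.Lab
  | top, _ => ()
  | bot, _ => ()
  | atom _, n => n
  | and A B, n => (A.numbering n, B.numbering (n + A.numAtoms))
  | or A B, n => (A.numbering n, B.numbering (n + A.numAtoms))

/-- Attach the labels to the atom occurrences. -/
def decorate : (A : Fm α) → A.Lab → Fm (α × ℕ)
  | top, _ => top
  | bot, _ => bot
  | atom a, n => atom (a, n)
  | and A B, l => and (A.decorate l.1) (B.decorate l.2)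
  | or A B, l => or (A.decorate l.1) (B.decorate l.2)

theorem Lab.toList_map (f : ℕ → ℕ) (A : Fm α) (l : A.Lab) :
    Lab.toList A (Lab.map f A l) = (Lab.toList A l).map f := by
  induction A with
  | top => rfl
  | bot => rfl
  | atom a => rfl
  | and A B ihA ihB => simp [toList, map, ihA, ihB]
  | or A B ihA ihB => simp [toList, map, ihA, ihB]

theorem Lab.length_toList (A : Fm α) (l : A.Lab) : (Lab.toList A l).length = A.numAtoms := by
  induction A with
  | top => rfl
  | bot => rfl
  | atom a => rfl
  | and A B ihA ihB => simp [toList, numAtoms, ihA, ihB]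
  | or A B ihA ihB => simp [toList, numAtoms, ihA, ihB]

theorem toList_numbering (A : Fm α) (n : ℕ) :
    Lab.toList A (A.numbering n) = List.range' n A.numAtoms := by
  induction A generalizing n with
  | top => rfl
  | bot => rfl
  | atom a => rfl
  | and A B ihA ihB => simp [Lab.toList, numbering, numAtoms, ihA, ihB]
  | or A B ihA ihB => simp [Lab.toList, numbering, numAtoms, ihA, ihB]

theorem atoms_decorate (A : Fm α) (l : A.Lab) :
    (A.decorate l).atoms.map Prod.snd = (Lab.toList A l : Multiset ℕ) := by
  induction A with
  | top => rfl
  | bot => rfl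
  | atom a => rfl
  | and A B ihA ihB =>
    simp only [decorate, atoms, Multiset.map_add, ihA, ihB, Lab.toList, Multiset.coe_add]
  | or A B ihA ihB =>
    simp only [decorate, atoms, Multiset.map_add, ihA, ihB, Lab.toList, Multiset.coe_add]

end Fm

/-! ### Derivations -/

/-- Instances of the inference rules of `SKS`, indexed by premiss and conclusion. An instance of
the logical rule `=` comes with the tracing of atoms that makes its flow well defined: `t` assigns
to each atom occurrence of the conclusion the position (counted from the left, from `0`) of the
atom occurrence of the premiss from which it comes, and the equation holds for the formulae
decorated accordingly. -/
inductive Inf : Formula → Formula → Type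
  | eq {A B : Formula} (t : B.Lab)
      (h : Fm.Eqv (A.decorate (A.numbering 0)) (B.decorate t)) : Inf A B
  | iDown (a : Lit) : Inf .top (.or (.atom a) (.atom a.dual))
  | wDown (a : Lit) : Inf .bot (.atom a)
  | cDown (a : Lit) : Inf (.or (.atom a) (.atom a)) (.atom a)
  | iUp (a : Lit) : Inf (.and (.atom a) (.atom a.dual)) .bot
  | wUp (a : Lit) : Inf (.atom a) .top
  | cUp (a : Lit) : Inf (.atom a) (.and (.atom a) (.atom a))
  | switch (A B C : Formula) : Inf (.and A (.or B C)) (.or (.and A B) C)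
  | medial (A B C D : Formula) :
      Inf (.or (.and A B) (.and C D)) (.and (.or A C) (.or B D))

/-- `Der A B` is the type of `SKS` derivations with premiss `A` and conclusion `B`. -/
inductive Der : Formula → Formula → Type
  | fm (A : Formula) : Der A A
  | and {A B C D : Formula} (Φ : Der A B) (Ψ : Der C D) : Der (.and A C) (.and B D)
  | or {A B C D : Formula} (Φ : Der A B) (Ψ : Der C D) : Der (.or A C) (.or B D)
  | step {A B C D : Formula} (Φ : Der A B) (ρ : Inf B C) (Ψ : Der C D) : Der A D

/-- The size of a derivation: the number of occurrences of atoms and units in it. -/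
def Der.size : {A B : Formula} → Der A B → ℕ
  | _, _, fm A => A.size
  | _, _, and Φ Ψ => Φ.size + Ψ.size
  | _, _, or Φ Ψ => Φ.size + Ψ.size
  | _, _, step Φ _ Ψ => Φ.size + Ψ.size

/-! ### Atomic flows -/

/-- A node of a flow, given by the edges that enter it from above (`ins`) and the edges that leave
it below (`outs`). The two numbers of edges determine which of the six kinds of node it is, and the
edges on one side of a node are not ordered. -/
@[ext] structure Node where
  ins : Multiset ℕ
  outs : Multiset ℕ

namespace Node

/-- Identity node, with lower edges `a` and `b`. -/
def iD (a b : ℕ) : Node := ⟨0, {a, b}⟩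
/-- Weakening node, with lower edge `a`. -/
def wD (a : ℕ) : Node := ⟨0, {a}⟩
/-- Contraction node, with upper edges `a` and `b` and lower edge `c`. -/
def cD (a b c : ℕ) : Node := ⟨{a, b}, {c}⟩
/-- Cut node, with upper edges `a` and `b`. -/
def iU (a b : ℕ) : Node := ⟨{a, b}, 0⟩
/-- Coweakening node, with upper edge `a`. -/
def wU (a : ℕ) : Node := ⟨{a}, 0⟩
/-- Cocontraction node, with upper edge `a` and lower edges `b` and `c`. -/
def cU (a b c : ℕ) : Node := ⟨{a}, {b, c}⟩

/-- Rename the edges at a node. -/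
def map (f : ℕ → ℕ) (n : Node) : Node := ⟨n.ins.map f, n.outs.map f⟩

end Node

/-- Raw flow diagrams: finitely many edges, named by natural numbers, and a multiset of nodes. An
edge at whose upper (lower) end there is no node is pending at that end. -/
@[ext] structure Diagram where
  edges : Finset ℕ
  nodes : Multiset Node

namespace Diagram

/-- A diagram is a flow diagram if its nodes are of the six kinds, the ends of each edge are
attached to at most one node each, and the diagram can be drawn with all edges directed downwards:
there is an assignment `h` of depths to edges that increases from top to bottom through every
node. -/
structure IsFlow (D : Diagram) : Prop where
  kind : ∀ n ∈ D.nodes, (∃ a b, n = .iD a b) ∨ (∃ a, n = .wD a) ∨ (∃ a b c, n = .cD a b c) ∨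
    (∃ a b, n = .iU a b) ∨ (∃ a, n = .wU a) ∨ (∃ a b c, n = .cU a b c)
  ins_mem : ∀ n ∈ D.nodes, ∀ e ∈ n.ins, e ∈ D.edges
  outs_mem : ∀ n ∈ D.nodes, ∀ e ∈ n.outs, e ∈ D.edges
  ins_nodup : (D.nodes.bind Node.ins).Nodup
  outs_nodup : (D.nodes.bind Node.outs).Nodup
  vertical : ∃ h : ℕ → ℕ, ∀ n ∈ D.nodes, ∀ a ∈ n.ins, ∀ b ∈ n.outs, h a < h b

/-- Rename all edges. -/
def rename (σ : Equiv.Perm ℕ) (D : Diagram) : Diagram :=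
  ⟨D.edges.map σ.toEmbedding, D.nodes.map (Node.map σ)⟩

/-- The rewriting rules of the system `norm`, applied anywhere in a diagram: `E` is the set of
edges and `Γ` the multiset of the nodes that are not involved. Where a rule
removes a node so that two edges are joined to a single one, one of the two names is replaced by the
other in `Γ`. -/
inductive Step : Diagram → Diagram → Prop
  | wDown_cDown (E : Finset ℕ) (Γ : Multiset Node) (a b c : ℕ) :
      Step ⟨E, .wD a ::ₘ .cD a b c ::ₘ Γ⟩
        ⟨(E.erase a).erase c, Γ.map (Node.map fun e => if e = c then b else e)⟩
  | iDown_wUp (E : Finset ℕ) (Γ : Multiset Node) (a b : ℕ) :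
      Step ⟨E, .iD a b ::ₘ .wU a ::ₘ Γ⟩ ⟨E.erase a, .wD b ::ₘ Γ⟩
  | cUp_wUp (E : Finset ℕ) (Γ : Multiset Node) (a b c : ℕ) :
      Step ⟨E, .cU a b c ::ₘ .wU b ::ₘ Γ⟩
        ⟨(E.erase b).erase c, Γ.map (Node.map fun e => if e = c then a else e)⟩
  | wDown_cUp (E : Finset ℕ) (Γ : Multiset Node) (a b c : ℕ) :
      Step ⟨E, .wD a ::ₘ .cU a b c ::ₘ Γ⟩ ⟨E.erase a, .wD b ::ₘ .wD c ::ₘ Γ⟩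
  | wDown_wUp (E : Finset ℕ) (Γ : Multiset Node) (a : ℕ) :
      Step ⟨E, .wD a ::ₘ .wU a ::ₘ Γ⟩ ⟨E.erase a, Γ⟩
  | cDown_wUp (E : Finset ℕ) (Γ : Multiset Node) (a b c : ℕ) :
      Step ⟨E, .cD a b c ::ₘ .wU c ::ₘ Γ⟩ ⟨E.erase c, .wU a ::ₘ .wU b ::ₘ Γ⟩
  | cDown_cUp (E : Finset ℕ) (Γ : Multiset Node) (a b m c d p q r s : ℕ)
      (fresh : [p, q, r, s].Nodup ∧ ∀ e ∈ [p, q, r, s], e ∉ E) :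
      Step ⟨E, .cD a b m ::ₘ .cU m c d ::ₘ Γ⟩
        ⟨E.erase m ∪ {p, q, r, s},
          .cU a p q ::ₘ .cU b r s ::ₘ .cD p r c ::ₘ .cD q s d ::ₘ Γ⟩
  | iDown_cUp (E : Finset ℕ) (Γ : Multiset Node) (m b c d p q : ℕ)
      (fresh : [p, q].Nodup ∧ ∀ e ∈ [p, q], e ∉ E) :
      Step ⟨E, .iD m b ::ₘ .cU m c d ::ₘ Γ⟩
        ⟨E.erase m ∪ {p, q}, .iD c p ::ₘ .iD d q ::ₘ .cD p q b ::ₘ Γ⟩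

end Diagram

/-- Two flow diagrams are identified if they differ only in the names of the edges. -/
instance flowSetoid : Setoid {D : Diagram // D.IsFlow} where
  r D D' := ∃ σ : Equiv.Perm ℕ, D'.1 = D.1.rename σ
  iseqv :=
    { refl := fun D => ⟨1, by
        have h : Node.map (⇑(1 : Equiv.Perm ℕ)) = id := by
          funext n; simp [Node.map]
        have h' : (1 : Equiv.Perm ℕ).toEmbedding = Function.Embedding.refl ℕ := rfl
        ext1
        · simp only [Diagram.rename, h', Finset.map_refl]
        · simp only [Diagram.rename, h, Multiset.map_id]⟩
      symm := by
        rintro D D' ⟨σ, h⟩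
        refine ⟨σ⁻¹, ?_⟩
        have hh : Node.map (⇑σ⁻¹) ∘ Node.map (⇑σ) = id := by
          funext n; simp [Node.map]
        have h' : σ.toEmbedding.trans (σ⁻¹).toEmbedding = Function.Embedding.refl ℕ := by
          ext x; simp
        rw [h]
        ext1
        · simp only [Diagram.rename, Finset.map_map, h', Finset.map_refl]
        · simp only [Diagram.rename, Multiset.map_map, hh, Multiset.map_id]
      trans := by
        rintro D D' D'' ⟨σ, h⟩ ⟨τ, h'⟩
        refine ⟨τ * σ, ?_⟩
        have hh : Node.map (⇑τ) ∘ Node.map (⇑σ) = Node.map (⇑(τ * σ)) := by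
          funext n; simp [Node.map, Function.comp_def]
        have hm : σ.toEmbedding.trans τ.toEmbedding = (τ * σ).toEmbedding := rfl
        rw [h', h]
        ext1
        · simp only [Diagram.rename, Finset.map_map, hm]
        · simp only [Diagram.rename, Multiset.map_map, hh] }

/-- Atomic flows: flow diagrams up to deformation. -/
abbrev Flow : Type := Quotient flowSetoid

namespace Flow

/-- The size of a flow: its number of edges. -/
def size : Flow → ℕ :=
  Quotient.lift (fun D => D.1.edges.card) (by
    rintro D D' ⟨σ, h⟩
    simp [h, Diagram.rename])

/-- One-step reduction of flows under `norm`. -/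
def Step (φ ψ : Flow) : Prop :=
  ∃ D D' : {D : Diagram // D.IsFlow}, (⟦D⟧ : Flow) = φ ∧ (⟦D'⟧ : Flow) = ψ ∧ D.1.Step D'.1

/-- `ψ` is a normal form of `φ` under `norm`. -/
def IsNormalForm (φ ψ : Flow) : Prop :=
  Relation.ReflTransGen Step φ ψ ∧ ∀ χ, ¬ Step ψ χ

end Flow

/-! ### The flow of a derivation

Atoms are traced from the premiss to the conclusion: from names `l` of the edges that arrive at the
atom occurrences of the premiss, and the least name `k` that has not been used, we compute the names
of the edges that leave at the atom occurrences of the conclusion, the nodes created and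
the least name unused then. -/

/-- Tracing through a single inference step. -/
def Inf.trace : {A B : Formula} → Inf A B → A.Lab → ℕ → B.Lab × Multiset Node × ℕ
  | A, B, eq t _, l, k => (Fm.Lab.map (fun i => (Fm.Lab.toList A l).getD i 0) B t, 0, k)
  | _, _, iDown _, _, k => ((k, k + 1), {.iD k (k + 1)}, k + 2)
  | _, _, wDown _, _, k => (k, {.wD k}, k + 1)
  | _, _, cDown _, l, k => (k, {.cD l.1 l.2 k}, k + 1)
  | _, _, iUp _, l, k => ((), {.iU l.1 l.2}, k)
  | _, _, wUp _, l, k => ((), {.wU l}, k)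
  | _, _, cUp _, l, k => ((k, k + 1), {.cU l k (k + 1)}, k + 2)
  | _, _, switch _ _ _, l, k => (((l.1, l.2.1), l.2.2), 0, k)
  | _, _, medial _ _ _ _, l, k => (((l.1.1, l.2.1), (l.1.2, l.2.2)), 0, k)

/-- Tracing through a derivation. -/
def Der.trace : {A B : Formula} → Der A B → A.Lab → ℕ → B.Lab × Multiset Node × ℕ
  | _, _, fm _, l, k => (l, 0, k)
  | _, _, and Φ Ψ, l, k =>
    let x := Φ.trace l.1 k
    let y := Ψ.trace l.2 x.2.2
    ((x.1, y.1), x.2.1 + y.2.1, y.2.2)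
  | _, _, or Φ Ψ, l, k =>
    let x := Φ.trace l.1 k
    let y := Ψ.trace l.2 x.2.2
    ((x.1, y.1), x.2.1 + y.2.1, y.2.2)
  | _, _, step Φ ρ Ψ, l, k =>
    let x := Φ.trace l k
    let y := ρ.trace x.1 x.2.2
    let z := Ψ.trace y.1 y.2.2
    (z.1, x.2.1 + y.2.1 + z.2.1, z.2.2)

/-- The diagram obtained by tracing the atoms through a derivation. -/
def Der.diagram {A B : Formula} (Φ : Der A B) : Diagram :=
  let x := Φ.trace (A.numbering 0) A.numAtoms
  ⟨Finset.range x.2.2, x.2.1⟩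

/-- What tracing guarantees, as needed to see that it produces a flow. -/
structure TraceOK (l l' : Multiset ℕ) (k k' : ℕ) (N : Multiset Node) : Prop where
  le : k ≤ k'
  outs : N.bind Node.outs = Multiset.Ico k k'
  conserve : l + Multiset.Ico k k' = N.bind Node.ins + l'
  lt : (∀ e ∈ l, e < k) → ∀ n ∈ N, ∀ a ∈ n.ins, ∀ b ∈ n.outs, a < b
  kind : ∀ n ∈ N, (∃ a b, n = .iD a b) ∨ (∃ a, n = .wD a) ∨ (∃ a b c, n = .cD a b c) ∨
    (∃ a b, n = .iU a b) ∨ (∃ a, n = .wU a) ∨ (∃ a b c, n = .cU a b c)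

namespace TraceOK

theorem lt_next {l l' : Multiset ℕ} {k k' : ℕ} {N : Multiset Node}
    (h : TraceOK l l' k k' N) (hl : ∀ e ∈ l, e < k) : ∀ e ∈ l', e < k' := by
  intro e he
  have h1 : e ∈ l + Multiset.Ico k k' := by
    rw [h.conserve]; exact Multiset.mem_add.2 (Or.inr he)
  have hle := h.le
  rw [Multiset.mem_add, Multiset.mem_Ico] at h1
  rcases h1 with h1 | h1
  · have := hl e h1; omega
  · exact h1.2

theorem nil {l l' : Multiset ℕ} (k : ℕ) (h : l = l') : TraceOK l l' k k 0 :=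
  ⟨le_rfl, by simp, by simp [h], by simp, by simp⟩

theorem seq {l m l' : Multiset ℕ} {k k' k'' : ℕ} {N M : Multiset Node}
    (h₁ : TraceOK l m k k' N) (h₂ : TraceOK m l' k' k'' M) : TraceOK l l' k k'' (N + M) := by
  have hI := Multiset.Ico_add_Ico_eq_Ico h₁.le h₂.le
  refine ⟨h₁.le.trans h₂.le, ?_, ?_, ?_, ?_⟩
  · rw [Multiset.add_bind, h₁.outs, h₂.outs, hI]
  · rw [← hI, ← add_assoc, h₁.conserve, Multiset.add_bind, add_assoc, h₂.conserve, add_assoc]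
  · intro hl n hn
    rcases Multiset.mem_add.1 hn with hn | hn
    · exact h₁.lt hl n hn
    · exact h₂.lt (h₁.lt_next hl) n hn
  · intro n hn
    rcases Multiset.mem_add.1 hn with hn | hn
    · exact h₁.kind n hn
    · exact h₂.kind n hn

theorem frame {l l' : Multiset ℕ} {k k' : ℕ} {N : Multiset Node} (f : Multiset ℕ)
    (h : TraceOK l l' k k' N) : TraceOK (l + f) (l' + f) k k' N := by
  refine ⟨h.le, h.outs, ?_, ?_, h.kind⟩
  · rw [add_right_comm, h.conserve, add_assoc]
  · exact fun hl => h.lt fun e he => hl e (Multiset.mem_add.2 (Or.inl he))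

theorem par {l₁ l₁' l₂ l₂' : Multiset ℕ} {k k' k'' : ℕ} {N M : Multiset Node}
    (h₁ : TraceOK l₁ l₁' k k' N) (h₂ : TraceOK l₂ l₂' k' k'' M) :
    TraceOK (l₁ + l₂) (l₁' + l₂') k k'' (N + M) := by
  have h := h₂.frame l₁'
  rw [add_comm l₂, add_comm l₂'] at h
  exact (h₁.frame l₂).seq h

theorem Ico_one (k : ℕ) : Multiset.Ico k (k + 1) = {k} := by
  simp [Multiset.Ico]

theorem Ico_two (k : ℕ) : Multiset.Ico k (k + 2) = {k, k + 1} := by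
  rw [← Multiset.Ico_add_Ico_eq_Ico (show k ≤ k + 1 by omega) (show k + 1 ≤ k + 2 by omega),
    Ico_one, show k + 2 = (k + 1) + 1 from rfl, Ico_one]
  rfl

theorem iD (k : ℕ) : TraceOK 0 {k, k + 1} k (k + 2) {.iD k (k + 1)} :=
  ⟨by simp, by simp [Ico_two, Node.iD], by simp [Ico_two, Node.iD], by simp [Node.iD],
    by simp⟩

theorem wD (k : ℕ) : TraceOK 0 {k} k (k + 1) {.wD k} :=
  ⟨by simp, by simp [Ico_one, Node.wD], by simp [Ico_one, Node.wD], by simp [Node.wD],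
    by simp⟩

theorem cD (a b k : ℕ) : TraceOK {a, b} {k} k (k + 1) {.cD a b k} :=
  ⟨by simp, by simp [Ico_one, Node.cD], by simp [Ico_one, Node.cD], by simp [Node.cD],
    by simp⟩

theorem iU (a b k : ℕ) : TraceOK {a, b} 0 k k {.iU a b} :=
  ⟨by simp, by simp [Node.iU], by simp [Node.iU], by simp [Node.iU],
    by simp⟩

theorem wU (a k : ℕ) : TraceOK {a} 0 k k {.wU a} :=
  ⟨by simp, by simp [Node.wU], by simp [Node.wU], by simp [Node.wU],
    by simp⟩

theorem cU (a k : ℕ) : TraceOK {a} {k, k + 1} k (k + 2) {.cU a k (k + 1)} :=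
  ⟨by simp, by simp [Ico_two, Node.cU], by simp [Ico_two, Node.cU],
    by simp [Node.cU]; omega,
    by simp⟩

end TraceOK

theorem Inf.traceOK {A B : Formula} (ρ : Inf A B) (l : A.Lab) (k : ℕ) :
    TraceOK (Fm.Lab.toList A l) (Fm.Lab.toList B (ρ.trace l k).1) k (ρ.trace l k).2.2
      (ρ.trace l k).2.1 := by
  cases ρ with
  | eq t h =>
    apply TraceOK.nil
    have h1 := congrArg (Multiset.map Prod.snd) h.atoms_eq
    rw [Fm.atoms_decorate, Fm.atoms_decorate, Fm.toList_numbering] at h1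
    simp only [Inf.trace, Fm.Lab.toList_map]
    rw [← Multiset.map_coe, ← h1, Multiset.map_coe, Multiset.coe_eq_coe]
    have h2 : (List.range' 0 A.numAtoms).map (fun i => (Fm.Lab.toList A l).getD i 0)
        = Fm.Lab.toList A l := by
      apply List.ext_getElem
      · simp [Fm.Lab.length_toList]
      · intro i h3 h4
        simp [h4]
    rw [h2]
  | iDown a => exact TraceOK.iD k
  | wDown a => exact TraceOK.wD k
  | cDown a => exact TraceOK.cD l.1 l.2 k
  | iUp a => exact TraceOK.iU l.1 l.2 k
  | wUp a => exact TraceOK.wU l k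
  | cUp a => exact TraceOK.cU l k
  | switch A B C => exact TraceOK.nil _ (by simp [Inf.trace, Fm.Lab.toList])
  | medial A B C D =>
    apply TraceOK.nil
    simp only [Inf.trace, Fm.Lab.toList, ← Multiset.coe_add]
    exact add_add_add_comm _ _ _ _

theorem Der.traceOK {A B : Formula} (Φ : Der A B) (l : A.Lab) (k : ℕ) :
    TraceOK (Fm.Lab.toList A l) (Fm.Lab.toList B (Φ.trace l k).1) k (Φ.trace l k).2.2
      (Φ.trace l k).2.1 := by
  induction Φ generalizing k with
  | fm A => exact TraceOK.nil _ rfl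
  | and Φ Ψ ihΦ ihΨ => exact (ihΦ l.1 k).par (ihΨ l.2 _)
  | or Φ Ψ ihΦ ihΨ => exact (ihΦ l.1 k).par (ihΨ l.2 _)
  | step Φ ρ Ψ ihΦ ihΨ => exact ((ihΦ l k).seq (ρ.traceOK _ _)).seq (ihΨ _ _)

theorem Der.diagram_isFlow {A B : Formula} (Φ : Der A B) : Φ.diagram.IsFlow := by
  have h := Φ.traceOK (A.numbering 0) A.numAtoms
  have hl : ((Fm.Lab.toList A (A.numbering 0) : List ℕ) : Multiset ℕ)
      = Multiset.Ico 0 A.numAtoms := by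
    rw [Fm.toList_numbering]; rfl
  have hc := h.conserve
  rw [hl, Multiset.Ico_add_Ico_eq_Ico (Nat.zero_le _) h.le] at hc
  refine ⟨h.kind, ?_, ?_, ?_, ?_, id, h.lt ?_⟩
  · intro n hn e he
    have : e ∈ Multiset.Ico 0 (Φ.trace (A.numbering 0) A.numAtoms).2.2 := by
      rw [hc]
      exact Multiset.mem_add.2 (Or.inl (Multiset.mem_bind.2 ⟨n, hn, he⟩))
    exact Finset.mem_range.2 (Multiset.mem_Ico.1 this).2
  · intro n hn e he
    have : e ∈ (Φ.trace (A.numbering 0) A.numAtoms).2.1.bind Node.outs :=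
      Multiset.mem_bind.2 ⟨n, hn, he⟩
    rw [h.outs] at this
    exact Finset.mem_range.2 (Multiset.mem_Ico.1 this).2
  · have hn : (Multiset.Ico 0 (Φ.trace (A.numbering 0) A.numAtoms).2.2).Nodup :=
      Multiset.nodup_Ico
    rw [hc] at hn
    exact (Multiset.nodup_add.1 hn).1
  · exact h.outs ▸ Multiset.nodup_Ico
  · intro e he
    rw [hl] at he
    exact (Multiset.mem_Ico.1 he).2

/-- The atomic flow of a derivation. -/
def Der.flow {A B : Formula} (Φ : Der A B) : Flow := ⟦⟨Φ.diagram, Φ.diagram_isFlow⟩⟧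

/-! ### Computation

A programming language over binary trees whose leaves are either empty or names. Each step is charged
at least the size of all the trees that it reads or builds, so running times agree up to a polynomial
with those of Turing machines (a name, which programs can only copy and compare, has size one). -/

/-- Data: binary trees. -/
inductive Tree : Type
  | nil : Tree
  | name (n : ℕ) : Tree
  | cons (x y : Tree) : Tree

namespace Tree

/-- The number of constructors. -/
def size : Tree → ℕ
  | nil => 1
  | name _ => 1
  | cons x y => x.size + y.size + 1

/-- The left component. -/
def fst : Tree → Tree
  | cons x _ => x
  | _ => nil

/-- The right component. -/
def snd : Tree → Tree
  | cons _ y => y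
  | _ => nil

/-- Pairs serve as the value "true" in tests; names and `nil` as "false". -/
def IsPair : Tree → Prop
  | cons _ _ => True
  | _ => False

/-- Comparison of two names. -/
def sameName : Tree → Tree
  | cons (name m) (name n) => if m = n then cons nil nil else nil
  | _ => nil

/-- The numeral `n` in unary. -/
def ofNat : ℕ → Tree
  | 0 => nil
  | n + 1 => cons nil (ofNat n)

end Tree

/-- Programs, each taking one tree to one tree. -/
inductive Prog : Type
  | nil : Prog
  | id : Prog
  | fst : Prog
  | snd : Prog
  | sameName : Prog
  | pair (p q : Prog) : Prog
  | comp (q p : Prog) : Prog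
  | ite (c p q : Prog) : Prog
  | while (c p : Prog) : Prog

/-- `Runs p x y t`: on input `x` the program `p` halts with output `y` at cost `t`. -/
inductive Runs : Prog → Tree → Tree → ℕ → Prop
  | nil (x : Tree) : Runs .nil x .nil x.size
  | id (x : Tree) : Runs .id x x x.size
  | fst (x : Tree) : Runs .fst x x.fst x.size
  | snd (x : Tree) : Runs .snd x x.snd x.size
  | sameName (x : Tree) : Runs .sameName x x.sameName x.size
  | pair {p q : Prog} {x y z : Tree} {s t : ℕ} : Runs p x y s → Runs q x z t →
      Runs (.pair p q) x (.cons y z) (s + t + 1)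
  | comp {p q : Prog} {x y z : Tree} {s t : ℕ} : Runs p x y s → Runs q y z t →
      Runs (.comp q p) x z (s + t + 1)
  | ite_true {c p q : Prog} {x b y : Tree} {s t : ℕ} : Runs c x b s → b.IsPair →
      Runs p x y t → Runs (.ite c p q) x y (s + t + 1)
  | ite_false {c p q : Prog} {x b y : Tree} {s t : ℕ} : Runs c x b s → ¬ b.IsPair →
      Runs q x y t → Runs (.ite c p q) x y (s + t + 1)
  | while_stop {c p : Prog} {x b : Tree} {s : ℕ} : Runs c x b s → ¬ b.IsPair →
      Runs (.while c p) x x (s + 1)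
  | while_step {c p : Prog} {x b y z : Tree} {s t u : ℕ} : Runs c x b s → b.IsPair →
      Runs p x y t → Runs (.while c p) y z u → Runs (.while c p) x z (s + t + u + 1)

/-! ### Derivations as data -/

/-- A formula as data. -/
def Formula.toTree : Formula → Tree
  | .top => .cons (.ofNat 0) .nil
  | .bot => .cons (.ofNat 1) .nil
  | .atom a => .cons (.ofNat 2) (.cons (.name a.var) (if a.pos then .ofNat 1 else .ofNat 0))
  | .and A B => .cons (.ofNat 3) (.cons (toTree A) (toTree B))
  | .or A B => .cons (.ofNat 4) (.cons (toTree A) (toTree B))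

/-- The labels of a formula as data, arranged like the formula. -/
def labToTree : (A : Formula) → A.Lab → Tree
  | .top, _ => .nil
  | .bot, _ => .nil
  | .atom _, n => .ofNat n
  | .and A B, l => .cons (labToTree A l.1) (labToTree B l.2)
  | .or A B, l => .cons (labToTree A l.1) (labToTree B l.2)

/-- A rule instance as data: the name of the rule and, for `=`, the tracing of atoms. Premiss and
conclusion are found in the adjacent derivations. -/
def Inf.toTree : {A B : Formula} → Inf A B → Tree
  | _, B, eq t _ => .cons (.ofNat 0) (labToTree B t)
  | _, _, iDown _ => .cons (.ofNat 1) .nil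
  | _, _, wDown _ => .cons (.ofNat 2) .nil
  | _, _, cDown _ => .cons (.ofNat 3) .nil
  | _, _, iUp _ => .cons (.ofNat 4) .nil
  | _, _, wUp _ => .cons (.ofNat 5) .nil
  | _, _, cUp _ => .cons (.ofNat 6) .nil
  | _, _, switch _ _ _ => .cons (.ofNat 7) .nil
  | _, _, medial _ _ _ _ => .cons (.ofNat 8) .nil

/-- A derivation as data. -/
def Der.toTree : {A B : Formula} → Der A B → Tree
  | _, _, fm A => .cons (.ofNat 0) (Formula.toTree A)
  | _, _, and Φ Ψ => .cons (.ofNat 1) (.cons Φ.toTree Ψ.toTree)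
  | _, _, or Φ Ψ => .cons (.ofNat 2) (.cons Φ.toTree Ψ.toTree)
  | _, _, step Φ ρ Ψ => .cons (.ofNat 3) (.cons Φ.toTree (.cons ρ.toTree Ψ.toTree))

/-- `R`, the graph of a function on flows, lifts polynomially to `SKS`: there are one program and one
polynomial such that, whenever the flow of a derivation `Φ` is mapped to `ψ`, the program computes
from `Φ` a derivation with the same premiss and conclusion as `Φ` and with flow `ψ`, in time
polynomial in the sum of the sizes of `Φ` and `ψ`. -/
def LiftsPolynomially (R : Flow → Flow → Prop) : Prop :=
  ∃ (p : Prog) (q : Polynomial ℕ), ∀ (A B : Formula) (Φ : Der A B) (ψ : Flow), R Φ.flow ψ →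
    ∃ (Ψ : Der A B) (t : ℕ), Ψ.flow = ψ ∧ Runs p Φ.toTree Ψ.toTree t ∧
      t ≤ q.eval (Φ.size + ψ.size)

end SKS

namespace SKS
open Relation Fm
open Multiset (singleton_add mem_add nodup_add disjoint_left mem_singleton forall_mem_cons
  mem_singleton_self)
open Node (cU cD wD wU iD iU)

namespace Node

/-- A wire: a node that merely joins two edges. -/
def wire (a b : ℕ) : Node := ⟨{a}, {b}⟩

/-- Wires have one upper and one lower edge. -/
def IsWire (n : Node) : Prop := n.ins.card = 1 ∧ n.outs.card = 1

instance : DecidablePred IsWire := fun _ => inferInstanceAs (Decidable (_ ∧ _))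

/-- The six kinds of nodes of atomic flows. -/
def Kind (n : Node) : Prop :=
  (∃ a b, n = .iD a b) ∨ (∃ a, n = .wD a) ∨ (∃ a b c, n = .cD a b c) ∨
    (∃ a b, n = .iU a b) ∨ (∃ a, n = .wU a) ∨ (∃ a b c, n = .cU a b c)

theorem isWire_iff {n : Node} : n.IsWire ↔ ∃ a b, n = wire a b := by
  constructor
  · rintro ⟨h, h'⟩
    obtain ⟨a, ha⟩ := Multiset.card_eq_one.1 h
    obtain ⟨b, hb⟩ := Multiset.card_eq_one.1 h'
    exact ⟨a, b, by ext1 <;> simp [wire, ha, hb]⟩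
  · rintro ⟨a, b, rfl⟩; simp [wire, IsWire]

@[simp] theorem isWire_wire (a b : ℕ) : (wire a b).IsWire := by simp [wire, IsWire]
@[simp] theorem isWire_map (f : ℕ → ℕ) (n : Node) : (n.map f).IsWire ↔ n.IsWire := by
  simp [IsWire, map]
@[simp] theorem isWire_iD (a b : ℕ) : ¬ (iD a b).IsWire := by simp [iD, IsWire]
@[simp] theorem isWire_wD (a : ℕ) : ¬ (wD a).IsWire := by simp [wD, IsWire]
@[simp] theorem isWire_cD (a b c : ℕ) : ¬ (cD a b c).IsWire := by simp [cD, IsWire]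
@[simp] theorem isWire_iU (a b : ℕ) : ¬ (iU a b).IsWire := by simp [iU, IsWire]
@[simp] theorem isWire_wU (a : ℕ) : ¬ (wU a).IsWire := by simp [wU, IsWire]
@[simp] theorem isWire_cU (a b c : ℕ) : ¬ (cU a b c).IsWire := by simp [cU, IsWire]

@[simp] theorem map_wire (f : ℕ → ℕ) (a b : ℕ) : (wire a b).map f = wire (f a) (f b) := by
  simp [wire, map]
@[simp] theorem map_iD (f : ℕ → ℕ) (a b : ℕ) : (iD a b).map f = iD (f a) (f b) := by
  simp [iD, map]
@[simp] theorem map_wD (f : ℕ → ℕ) (a : ℕ) : (wD a).map f = wD (f a) := by simp [wD, map]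
@[simp] theorem map_cD (f : ℕ → ℕ) (a b c : ℕ) : (cD a b c).map f = cD (f a) (f b) (f c) := by
  simp [cD, map]
@[simp] theorem map_iU (f : ℕ → ℕ) (a b : ℕ) : (iU a b).map f = iU (f a) (f b) := by
  simp [iU, map]
@[simp] theorem map_wU (f : ℕ → ℕ) (a : ℕ) : (wU a).map f = wU (f a) := by simp [wU, map]
@[simp] theorem map_cU (f : ℕ → ℕ) (a b c : ℕ) : (cU a b c).map f = cU (f a) (f b) (f c) := by
  simp [cU, map]

theorem map_map (g f : ℕ → ℕ) (n : Node) : (n.map f).map g = n.map (g ∘ f) := by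
  simp [map]

theorem map_congr {f g : ℕ → ℕ} {n : Node} (hi : ∀ x ∈ n.ins, f x = g x)
    (ho : ∀ x ∈ n.outs, f x = g x) : n.map f = n.map g := by
  ext1
  · exact Multiset.map_congr rfl hi
  · exact Multiset.map_congr rfl ho

@[simp] theorem map_id (n : Node) : n.map id = n := by simp [map]

theorem Kind.map {n : Node} (h : n.Kind) (f : ℕ → ℕ) : (n.map f).Kind := by
  rcases h with ⟨a, b, rfl⟩ | ⟨a, rfl⟩ | ⟨a, b, c, rfl⟩ | ⟨a, b, rfl⟩ | ⟨a, rfl⟩ | ⟨a, b, c, rfl⟩ <;>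
    simp only [map_iD, map_wD, map_cD, map_iU, map_wU, map_cU]
  · exact Or.inl ⟨_, _, rfl⟩
  · exact Or.inr (Or.inl ⟨_, rfl⟩)
  · exact Or.inr (Or.inr (Or.inl ⟨_, _, _, rfl⟩))
  · exact Or.inr (Or.inr (Or.inr (Or.inl ⟨_, _, rfl⟩)))
  · exact Or.inr (Or.inr (Or.inr (Or.inr (Or.inl ⟨_, rfl⟩))))
  · exact Or.inr (Or.inr (Or.inr (Or.inr (Or.inr ⟨_, _, _, rfl⟩))))

end Node

/-- Rename the edges at all nodes. -/
abbrev nmap (f : ℕ → ℕ) (N : Multiset Node) : Multiset Node := N.map (Node.map f)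

/-- Upper edges of all nodes. -/
def nins (N : Multiset Node) : Multiset ℕ := N.bind Node.ins
/-- Lower edges of all nodes. -/
def nouts (N : Multiset Node) : Multiset ℕ := N.bind Node.outs
/-- All edges at the nodes. -/
def nm (N : Multiset Node) : Finset ℕ := (nins N + nouts N).toFinset

section names
variable (N M : Multiset Node) (n : Node) (f : ℕ → ℕ) (x : ℕ)

@[simp] theorem nins_zero : nins 0 = 0 := rfl
@[simp] theorem nouts_zero : nouts 0 = 0 := rfl
@[simp] theorem nins_add : nins (N + M) = nins N + nins M := Multiset.add_bind _ _ _
@[simp] theorem nouts_add : nouts (N + M) = nouts N + nouts M := Multiset.add_bind _ _ _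
@[simp] theorem nins_cons : nins (n ::ₘ N) = n.ins + nins N := Multiset.cons_bind _ _ _
@[simp] theorem nouts_cons : nouts (n ::ₘ N) = n.outs + nouts N := Multiset.cons_bind _ _ _
@[simp] theorem nins_singleton : nins {n} = n.ins := Multiset.singleton_bind _ _
@[simp] theorem nouts_singleton : nouts {n} = n.outs := Multiset.singleton_bind _ _
@[simp] theorem nins_map : nins (nmap f N) = (nins N).map f := by
  simp only [nins, Multiset.bind_map, Multiset.map_bind]; rfl
@[simp] theorem nouts_map : nouts (nmap f N) = (nouts N).map f := by
  simp only [nouts, Multiset.bind_map, Multiset.map_bind]; rfl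
variable {N M n f x}
theorem mem_nm : x ∈ nm N ↔ x ∈ nins N ∨ x ∈ nouts N := by simp [nm]
theorem mem_nins : x ∈ nins N ↔ ∃ n ∈ N, x ∈ n.ins := Multiset.mem_bind
theorem mem_nouts : x ∈ nouts N ↔ ∃ n ∈ N, x ∈ n.outs := Multiset.mem_bind
theorem nm_add : nm (N + M) = nm N ∪ nm M := by
  ext x; simp only [mem_nm, nins_add, nouts_add, mem_add, Finset.mem_union]; tauto
theorem nm_map : nm (nmap f N) = (nm N).image f := by
  ext x; simp only [mem_nm, nins_map, nouts_map, Multiset.mem_map, Finset.mem_image]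
  constructor
  · rintro (⟨y, hy, rfl⟩ | ⟨y, hy, rfl⟩)
    · exact ⟨y, Or.inl hy, rfl⟩
    · exact ⟨y, Or.inr hy, rfl⟩
  · rintro ⟨y, hy | hy, rfl⟩
    · exact Or.inl ⟨y, hy, rfl⟩
    · exact Or.inr ⟨y, hy, rfl⟩

theorem nmap_congr {f g : ℕ → ℕ} (h : ∀ x ∈ nm N, f x = g x) : nmap f N = nmap g N :=
  Multiset.map_congr rfl fun n hn => Node.map_congr
    (fun x hx => h x (mem_nm.2 (Or.inl (mem_nins.2 ⟨n, hn, hx⟩))))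
    (fun x hx => h x (mem_nm.2 (Or.inr (mem_nouts.2 ⟨n, hn, hx⟩))))

theorem nmap_id' {f : ℕ → ℕ} (h : ∀ x ∈ nm N, f x = x) : nmap f N = N := by
  rw [nmap_congr (g := id) h]
  conv_rhs => rw [← Multiset.map_id N]
  exact Multiset.map_congr rfl fun n _ => Node.map_id n

theorem nmap_nmap (g f : ℕ → ℕ) (N : Multiset Node) : nmap g (nmap f N) = nmap (g ∘ f) N := by
  simp only [nmap, Multiset.map_map]
  exact Multiset.map_congr rfl fun n _ => Node.map_map g f n

theorem ins_unique (h : (nins N).Nodup) {n m : Node} (hn : n ∈ N) (hm : m ∈ N)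
    (hx : x ∈ n.ins) (hx' : x ∈ m.ins) : n = m := by
  by_contra hne
  obtain ⟨N', rfl⟩ := Multiset.exists_cons_of_mem hn
  have hm' : m ∈ N' := (Multiset.mem_cons.1 hm).resolve_left (fun h => hne h.symm)
  rw [nins_cons, nodup_add] at h
  exact Multiset.disjoint_left.1 h.2.2 hx (mem_nins.2 ⟨m, hm', hx'⟩)

theorem outs_unique (h : (nouts N).Nodup) {n m : Node} (hn : n ∈ N) (hm : m ∈ N)
    (hx : x ∈ n.outs) (hx' : x ∈ m.outs) : n = m := by
  by_contra hne
  obtain ⟨N', rfl⟩ := Multiset.exists_cons_of_mem hn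
  have hm' : m ∈ N' := (Multiset.mem_cons.1 hm).resolve_left (fun h => hne h.symm)
  rw [nouts_cons, nodup_add] at h
  exact Multiset.disjoint_left.1 h.2.2 hx (mem_nouts.2 ⟨m, hm', hx'⟩)

end names

/-- Flow diagrams that may contain wires. -/
structure WFlow (N : Multiset Node) : Prop where
  kind : ∀ n ∈ N, n.Kind ∨ n.IsWire
  ins_nodup : (nins N).Nodup
  outs_nodup : (nouts N).Nodup
  vertical : ∃ h : ℕ → ℕ, ∀ n ∈ N, ∀ a ∈ n.ins, ∀ b ∈ n.outs, h a < h b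

/-- Two edges are joined by a wire. -/
def WRel (W : Multiset Node) (a b : ℕ) : Prop := Node.wire a b ∈ W

theorem WRel.mem_ins {W : Multiset Node} {a b : ℕ} (h : WRel W a b) : a ∈ nins W :=
  mem_nins.2 ⟨_, h, by simp [Node.wire]⟩

theorem WRel.mem_outs {W : Multiset Node} {a b : ℕ} (h : WRel W a b) : b ∈ nouts W :=
  mem_nouts.2 ⟨_, h, by simp [Node.wire]⟩

theorem eqvGen_comparable {W : Multiset Node} (hi : (nins W).Nodup) (ho : (nouts W).Nodup)
    {x y : ℕ} (h : EqvGen (WRel W) x y) :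
    ReflTransGen (WRel W) x y ∨ ReflTransGen (WRel W) y x := by
  have hR : Relator.RightUnique (WRel W) := by
    intro a b c hab hac
    have := ins_unique hi hab hac (x := a) (by simp [Node.wire]) (by simp [Node.wire])
    simpa [Node.wire] using this
  have hL : Relator.RightUnique (Function.swap (WRel W)) := by
    intro a b c hab hac
    have := outs_unique ho hab hac (x := a) (by simp [Node.wire]) (by simp [Node.wire])
    simpa [Node.wire] using this
  induction h with
  | rel x y h => exact Or.inl (.single h)
  | refl x => exact Or.inl .refl
  | symm x y _ ih => exact ih.symm
  | trans x y z _ _ ih₁ ih₂ =>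
    rcases ih₁ with h₁ | h₁ <;> rcases ih₂ with h₂ | h₂
    · exact Or.inl (h₁.trans h₂)
    · have := ReflTransGen.total_of_right_unique hL (reflTransGen_swap.2 h₁)
        (reflTransGen_swap.2 h₂)
      exact (this.imp reflTransGen_swap.1 reflTransGen_swap.1).symm
    · exact ReflTransGen.total_of_right_unique hR h₁ h₂
    · exact Or.inr (h₂.trans h₁)

theorem eqvGen_isolated {r : ℕ → ℕ → Prop} {x y : ℕ} (h : EqvGen r x y)
    (h1 : ∀ z, ¬ r x z) (h2 : ∀ z, ¬ r z x) : x = y := by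
  have key : ∀ a b, EqvGen r a b → (a = x ↔ b = x) := by
    intro a b hab
    induction hab with
    | rel a b hab =>
      constructor
      · rintro rfl; exact absurd hab (h1 _)
      · rintro rfl; exact absurd hab (h2 _)
    | refl a => rfl
    | symm _ _ _ ih => exact ih.symm
    | trans _ _ _ _ _ ih₁ ih₂ => exact ih₁.trans ih₂
  exact ((key _ _ h).1 rfl).symm

theorem WFlow.contract {W Γ : Multiset Node} {g : ℕ → ℕ}
    (ker : ∀ x ∈ nm (W + Γ), ∀ y ∈ nm (W + Γ), g x = g y ↔ EqvGen (WRel W) x y)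
    (h : WFlow (W + Γ)) : WFlow (nmap g Γ) := by
  obtain ⟨hk, hi, ho, d, hd⟩ := h
  rw [nins_add, nodup_add] at hi
  rw [nouts_add, nodup_add] at ho
  have hmi : ∀ {x}, x ∈ nins Γ → x ∈ nm (W + Γ) := fun hx => by simp [mem_nm, hx]
  have hmo : ∀ {x}, x ∈ nouts Γ → x ∈ nm (W + Γ) := fun hx => by simp [mem_nm, hx]
  have bot : ∀ {x y}, x ∈ nins Γ → ReflTransGen (WRel W) x y → x = y := by
    intro x y hx hxy
    rcases hxy.cases_head with h | ⟨z, hz, -⟩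
    · exact h
    · exact absurd hx (Multiset.disjoint_left.1 hi.2.2 hz.mem_ins)
  have top : ∀ {x y}, x ∈ nouts Γ → ReflTransGen (WRel W) y x → y = x := by
    intro x y hx hxy
    rcases hxy.cases_tail with h | ⟨z, -, hz⟩
    · exact h.symm
    · exact absurd hx (Multiset.disjoint_left.1 ho.2.2 hz.mem_outs)
  refine ⟨?_, ?_, ?_, fun e => sInf {k | ∃ x ∈ nm (W + Γ), g x = e ∧ d x = k}, ?_⟩
  · intro n hn
    obtain ⟨m, hm, rfl⟩ := Multiset.mem_map.1 hn
    rcases hk m (Multiset.mem_add.2 (Or.inr hm)) with h | h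
    · exact Or.inl (h.map g)
    · exact Or.inr ((Node.isWire_map g m).2 h)
  · rw [nins_map]
    refine Multiset.Nodup.map_on ?_ hi.2.1
    intro x hx y hy hxy
    rcases eqvGen_comparable hi.1 ho.1 ((ker x (hmi hx) y (hmi hy)).1 hxy) with h | h
    · exact bot hx h
    · exact (bot hy h).symm
  · rw [nouts_map]
    refine Multiset.Nodup.map_on ?_ ho.2.1
    intro x hx y hy hxy
    rcases eqvGen_comparable hi.1 ho.1 ((ker x (hmo hx) y (hmo hy)).1 hxy) with h | h
    · exact top hy h
    · exact (top hx h).symm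
  · intro n hn a ha b hb
    obtain ⟨m, hm, rfl⟩ := Multiset.mem_map.1 hn
    obtain ⟨a, hma, rfl⟩ := Multiset.mem_map.1 ha
    obtain ⟨b, hmb, rfl⟩ := Multiset.mem_map.1 hb
    have ha' : a ∈ nins Γ := mem_nins.2 ⟨m, hm, hma⟩
    have hb' : b ∈ nouts Γ := mem_nouts.2 ⟨m, hm, hmb⟩
    have h1 : sInf {k | ∃ x ∈ nm (W + Γ), g x = g a ∧ d x = k} ≤ d a :=
      Nat.sInf_le ⟨a, hmi ha', rfl, rfl⟩
    have h2 : d a < d b := hd m (Multiset.mem_add.2 (Or.inr hm)) a hma b hmb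
    obtain ⟨x, hx, hgx, hdx⟩ := Nat.sInf_mem (s := {k | ∃ x ∈ nm (W + Γ), g x = g b ∧ d x = k})
      ⟨_, b, hmo hb', rfl, rfl⟩
    have h3 : d b ≤ d x := by
      rcases eqvGen_comparable hi.1 ho.1 ((ker x hx b (hmo hb')).1 hgx) with h | h
      · rw [top hb' h]
      · clear hdx hgx hx
        induction h with
        | refl => exact le_rfl
        | tail _ h ih =>
          exact ih.trans (hd _ (Multiset.mem_add.2 (Or.inl h)) _ (by simp [Node.wire]) _
            (by simp [Node.wire])).le
    show sInf _ < sInf _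
    omega

/-- The flow diagram `F` is obtained from `N` by contracting all wires by means of `f`. -/
structure Rep (f : ℕ → ℕ) (N : Multiset Node) (F : Diagram) : Prop where
  edges : F.edges = (nm N).image f
  nodes : F.nodes = nmap f (N.filter fun n => ¬ n.IsWire)
  ker : ∀ x ∈ nm N, ∀ y ∈ nm N, f x = f y ↔ EqvGen (WRel N) x y

theorem wRel_filter {N : Multiset Node} : WRel (N.filter Node.IsWire) = WRel N := by
  funext a b; simp [WRel]

theorem Rep.isFlow {f : ℕ → ℕ} {N : Multiset Node} {F : Diagram} (h : WFlow N) (hf : Rep f N F) :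
    F.IsFlow := by
  have hN : N.filter Node.IsWire + N.filter (fun n => ¬ n.IsWire) = N :=
    Multiset.filter_add_not _ _
  have h' : WFlow (nmap f (N.filter fun n => ¬ n.IsWire)) := by
    apply WFlow.contract (W := N.filter Node.IsWire)
    · rw [hN, wRel_filter]; exact hf.ker
    · rwa [hN]
  rw [← hf.nodes] at h'
  have hsub : ∀ n ∈ F.nodes, ∃ m ∈ N, ¬ m.IsWire ∧ n = m.map f := by
    intro n hn
    rw [hf.nodes] at hn
    obtain ⟨m, hm, rfl⟩ := Multiset.mem_map.1 hn
    rw [Multiset.mem_filter] at hm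
    exact ⟨m, hm.1, hm.2, rfl⟩
  refine ⟨?_, ?_, ?_, h'.ins_nodup, h'.outs_nodup, h'.vertical⟩
  · intro n hn
    refine (h'.kind n hn).resolve_right ?_
    obtain ⟨m, hm, hm', rfl⟩ := hsub n hn
    rwa [Node.isWire_map]
  · intro n hn e he
    obtain ⟨m, hm, hm', rfl⟩ := hsub n hn
    obtain ⟨x, hx, rfl⟩ := Multiset.mem_map.1 he
    rw [hf.edges]
    exact Finset.mem_image_of_mem _ (mem_nm.2 (Or.inl (mem_nins.2 ⟨m, hm, hx⟩)))
  · intro n hn e he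
    obtain ⟨m, hm, hm', rfl⟩ := hsub n hn
    obtain ⟨x, hx, rfl⟩ := Multiset.mem_map.1 he
    rw [hf.edges]
    exact Finset.mem_image_of_mem _ (mem_nm.2 (Or.inr (mem_nouts.2 ⟨m, hm, hx⟩)))

theorem Rep.exists (N : Multiset Node) : ∃ f F, Rep f N F := by
  let s : Setoid ℕ := EqvGen.setoid (WRel N)
  refine ⟨fun x => (Quotient.mk s x).out, ⟨_, _⟩, rfl, rfl, ?_⟩
  intro x _ y _
  rw [Quotient.out_inj, Quotient.eq]
  rfl

theorem exists_perm_extend {s : Finset ℕ} {f g : ℕ → ℕ}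
    (h : ∀ x ∈ s, ∀ y ∈ s, f x = f y ↔ g x = g y) : ∃ σ : Equiv.Perm ℕ, ∀ x ∈ s, σ (f x) = g x := by
  classical
  have hc : ∀ e : {e // e ∈ s.image f}, ∃ x ∈ s, f x = e := fun e => Finset.mem_image.1 e.2
  choose r hr hr' using hc
  let φ : {e // e ∈ ((s.image f : Finset ℕ) : Set ℕ)} ↪ ℕ :=
    ⟨fun e => g (r ⟨e.1, e.2⟩), by
      intro a b hab
      have := (h _ (hr ⟨a.1, a.2⟩) _ (hr ⟨b.1, b.2⟩)).2 hab
      rw [hr', hr'] at this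
      exact Subtype.ext this⟩
  obtain ⟨σ, hσ⟩ := Cardinal.extend_function_of_lt φ
    (lt_of_lt_of_le (Cardinal.lt_aleph0_of_finite _) (Cardinal.aleph0_le_mk ℕ)) ⟨Equiv.refl _⟩
  refine ⟨σ, fun x hx => ?_⟩
  have hx' : f x ∈ s.image f := Finset.mem_image_of_mem _ hx
  rw [hσ ⟨f x, hx'⟩]
  exact (h _ (hr ⟨f x, hx'⟩) _ hx).1 (hr' ⟨f x, hx'⟩)

theorem Rep.unique {f g : ℕ → ℕ} {N : Multiset Node} {F G : Diagram} (hf : Rep f N F)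
    (hg : Rep g N G) : ∃ σ : Equiv.Perm ℕ, G = F.rename σ := by
  obtain ⟨σ, hσ⟩ := exists_perm_extend (s := nm N) (f := f) (g := g)
    fun x hx y hy => (hf.ker x hx y hy).trans (hg.ker x hx y hy).symm
  refine ⟨σ, ?_⟩
  ext1
  · rw [hg.edges, Diagram.rename, hf.edges]
    ext e
    simp only [Finset.mem_image, Finset.mem_map, Equiv.coe_toEmbedding]
    constructor
    · rintro ⟨x, hx, rfl⟩; exact ⟨f x, ⟨x, hx, rfl⟩, hσ x hx⟩
    · rintro ⟨_, ⟨x, hx, rfl⟩, rfl⟩; exact ⟨x, hx, (hσ x hx).symm⟩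
  · rw [hg.nodes, Diagram.rename, hf.nodes]
    show _ = nmap σ (nmap f _)
    rw [nmap_nmap]
    refine nmap_congr fun x hx => (hσ x ?_).symm
    have hle := Multiset.filter_le (fun n : Node => ¬ n.IsWire) N
    obtain ⟨M, hM⟩ := Multiset.le_iff_exists_add.1 hle
    rw [hM, nm_add]
    exact Finset.mem_union_left _ hx

/-- `φ` is the flow that is obtained from `N` by contracting all wires. -/
def Den (N : Multiset Node) (φ : Flow) : Prop :=
  ∃ (f : ℕ → ℕ) (F : Diagram) (hF : F.IsFlow), Rep f N F ∧ (⟦⟨F, hF⟩⟧ : Flow) = φ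

theorem Den.exists {N : Multiset Node} (h : WFlow N) : ∃ φ, Den N φ := by
  obtain ⟨f, F, hf⟩ := Rep.exists N
  exact ⟨_, f, F, hf.isFlow h, hf, rfl⟩

theorem Den.unique {N : Multiset Node} {φ ψ : Flow} (h : Den N φ) (h' : Den N ψ) : φ = ψ := by
  obtain ⟨f, F, hF, hf, rfl⟩ := h
  obtain ⟨g, G, hG, hg, rfl⟩ := h'
  exact Quotient.sound (hf.unique hg)

/-- Reduction of diagrams with wires. -/
def Red (N N' : Multiset Node) : Prop :=
  WFlow N → WFlow N' ∧ ∀ φ φ', Den N φ → Den N' φ' → ReflTransGen Flow.Step φ φ'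

theorem Red.refl (N : Multiset Node) : Red N N :=
  fun h => ⟨h, fun _ _ h₁ h₂ => h₁.unique h₂ ▸ .refl⟩

theorem Red.trans {N₁ N₂ N₃ : Multiset Node} (h : Red N₁ N₂) (h' : Red N₂ N₃) : Red N₁ N₃ := by
  intro hw
  obtain ⟨hw₂, h₂⟩ := h hw
  obtain ⟨hw₃, h₃⟩ := h' hw₂
  obtain ⟨χ, hχ⟩ := Den.exists hw₂
  exact ⟨hw₃, fun φ φ' hφ hφ' => (h₂ _ _ hφ hχ).trans (h₃ _ _ hχ hφ')⟩

theorem Red.with {N N' : Multiset Node} (h : WFlow N → Red N N') : Red N N' := fun hw => h hw hw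

/-- Contraction of the wires `W` by means of `g`. -/
structure Contr (g : ℕ → ℕ) (W Γ : Multiset Node) : Prop where
  wire : ∀ n ∈ W, n.IsWire
  ker : ∀ x ∈ nm (W + Γ), ∀ y ∈ nm (W + Γ), g x = g y ↔ EqvGen (WRel W) x y
  cover : ∀ x ∈ nm W, ∃ y ∈ nm Γ, g y = g x

theorem Contr.rep {f g : ℕ → ℕ} {W Γ : Multiset Node} {F : Diagram} (h : Contr g W Γ)
    (hf : Rep f (nmap g Γ) F) : Rep (f ∘ g) (W + Γ) F := by
  have hnm : (nm (W + Γ)).image g = nm (nmap g Γ) := by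
    rw [nm_map, nm_add, Finset.image_union]
    refine Finset.union_eq_right.2 fun e he => ?_
    obtain ⟨x, hx, rfl⟩ := Finset.mem_image.1 he
    obtain ⟨y, hy, hxy⟩ := h.cover x hx
    exact hxy ▸ Finset.mem_image_of_mem _ hy
  refine ⟨?_, ?_, ?_⟩
  · rw [hf.edges, ← hnm, Finset.image_image]
  · have hW : W.filter (fun n => ¬ n.IsWire) = 0 :=
      Multiset.filter_eq_nil.2 fun n hn => not_not.2 (h.wire n hn)
    rw [hf.nodes, Multiset.filter_add, hW, zero_add, ← nmap_nmap, Multiset.filter_map]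
    congr 2
    exact Multiset.filter_congr fun n _ => by simp
  · intro x hx y hy
    have hx' : g x ∈ nm (nmap g Γ) := hnm ▸ Finset.mem_image_of_mem _ hx
    have hy' : g y ∈ nm (nmap g Γ) := hnm ▸ Finset.mem_image_of_mem _ hy
    rw [Function.comp, Function.comp, hf.ker _ hx' _ hy']
    have lift : ∀ {a b}, EqvGen (WRel W) a b → EqvGen (WRel (W + Γ)) a b := fun hab =>
      hab.mono fun _ _ hr => Multiset.mem_add.2 (Or.inl hr)
    have hr : ∀ {a b}, WRel (W + Γ) a b → a ∈ nm (W + Γ) ∧ b ∈ nm (W + Γ) := fun hr =>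
      ⟨mem_nm.2 (Or.inl hr.mem_ins), mem_nm.2 (Or.inr hr.mem_outs)⟩
    constructor
    · intro hxy
      have key : ∀ u v, EqvGen (WRel (nmap g Γ)) u v →
          (∀ x ∈ nm (W + Γ), g x = u → ∃ y ∈ nm (W + Γ), g y = v ∧ EqvGen (WRel (W + Γ)) x y) ∧
          (∀ x ∈ nm (W + Γ), g x = v → ∃ y ∈ nm (W + Γ), g y = u ∧ EqvGen (WRel (W + Γ)) x y) := by
        intro u v huv
        induction huv with
        | rel u v huv =>
          obtain ⟨n, hn, hn'⟩ := Multiset.mem_map.1 huv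
          have hw : n.IsWire := by rw [← Node.isWire_map g, hn']; simp
          obtain ⟨a, b, rfl⟩ := Node.isWire_iff.1 hw
          have hab : WRel (W + Γ) a b := Multiset.mem_add.2 (Or.inr hn)
          obtain ⟨ha, hb⟩ := hr hab
          rw [Node.map_wire] at hn'
          have h1 : g a = u ∧ g b = v := by simpa [Node.wire] using hn'
          obtain ⟨rfl, rfl⟩ := h1
          exact ⟨fun x hx hxu => ⟨b, hb, rfl, (lift ((h.ker _ hx _ ha).1 hxu)).trans _ _ _
              (.rel _ _ hab)⟩,
            fun x hx hxu => ⟨a, ha, rfl, (lift ((h.ker _ hx _ hb).1 hxu)).trans _ _ _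
              (.symm _ _ (.rel _ _ hab))⟩⟩
        | refl u => exact ⟨fun x hx hxu => ⟨x, hx, hxu, .refl _⟩,
            fun x hx hxu => ⟨x, hx, hxu, .refl _⟩⟩
        | symm u v _ ih => exact ih.symm
        | trans u v w _ _ ih₁ ih₂ =>
          refine ⟨fun x hx hxu => ?_, fun x hx hxu => ?_⟩
          · obtain ⟨y, hy, hyv, hxy⟩ := ih₁.1 x hx hxu
            obtain ⟨z, hz, hzv, hyz⟩ := ih₂.1 y hy hyv
            exact ⟨z, hz, hzv, hxy.trans _ _ _ hyz⟩
          · obtain ⟨y, hy, hyv, hxy⟩ := ih₂.2 x hx hxu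
            obtain ⟨z, hz, hzv, hyz⟩ := ih₁.2 y hy hyv
            exact ⟨z, hz, hzv, hxy.trans _ _ _ hyz⟩
      obtain ⟨y', hy', hyy', hxy'⟩ := (key _ _ hxy).1 x hx rfl
      exact hxy'.trans _ _ _ (lift ((h.ker _ hy' _ hy).1 hyy'))
    · intro hxy
      clear hx hy hx' hy'
      induction hxy with
      | rel a b hab =>
        obtain ⟨ha, hb⟩ := hr hab
        rcases Multiset.mem_add.1 hab with hW | hΓ
        · rw [(h.ker a ha b hb).2 (.rel _ _ hW)]; exact .refl _
        · refine .rel _ _ (Multiset.mem_map.2 ⟨_, hΓ, by simp⟩)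
      | refl a => exact .refl _
      | symm a b _ ih => exact .symm _ _ ih
      | trans a b c _ _ ih₁ ih₂ => exact ih₁.trans _ _ _ ih₂

theorem Contr.den {g : ℕ → ℕ} {W Γ : Multiset Node} (h : Contr g W Γ) {φ : Flow}
    (hd : Den (nmap g Γ) φ) : Den (W + Γ) φ := by
  obtain ⟨f, F, hF, hf, rfl⟩ := hd
  exact ⟨_, F, hF, h.rep hf, rfl⟩

theorem Contr.red {g : ℕ → ℕ} {W Γ : Multiset Node} (h : Contr g W Γ) :
    Red (W + Γ) (nmap g Γ) := fun hw =>
  ⟨hw.contract h.ker, fun _ _ h₁ h₂ => h₁.unique (h.den h₂) ▸ .refl⟩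

open Node (wire)

/-- Equality of multisets up to rearrangement. -/
theorem ac_eq {α : Type} {N M : Multiset α} (h : N = M := by
    simp only [← singleton_add, Multiset.insert_eq_cons, zero_add] <;> ac_rfl) : N = M := h

theorem nm_cons (n : Node) (N : Multiset Node) :
    nm (n ::ₘ N) = n.ins.toFinset ∪ n.outs.toFinset ∪ nm N := by
  ext x; simp only [mem_nm, nins_cons, nouts_cons, mem_add, Finset.mem_union,
    Multiset.mem_toFinset]; tauto

theorem nm_mono {N M : Multiset Node} (h : N ≤ M) : nm N ⊆ nm M := by
  obtain ⟨K, rfl⟩ := Multiset.le_iff_exists_add.1 h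
  rw [nm_add]; exact Finset.subset_union_left

section
variable {f f' : ℕ → ℕ} {L R Γ N : Multiset Node} {F : Diagram}

theorem Rep.isolated (hf : Rep f N F) (hw : WFlow N) {n m : Node} {e : ℕ} (hn : n ∈ N)
    (hm : m ∈ N) (hn' : ¬ n.IsWire) (hm' : ¬ m.IsWire) (he : e ∈ n.outs) (he' : e ∈ m.ins) :
    ∀ x ∈ nm N, f x = f e → x = e := by
  intro x hx hxe
  have h := (hf.ker x hx e (mem_nm.2 (Or.inl (mem_nins.2 ⟨m, hm, he'⟩)))).1 hxe
  refine (eqvGen_isolated (.symm _ _ h) ?_ ?_).symm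
  · intro z hz
    have := ins_unique hw.ins_nodup hm hz he' (by simp [wire])
    exact hm' (this ▸ Node.isWire_wire _ _)
  · intro z hz
    have := outs_unique hw.outs_nodup hn hz he (by simp [wire])
    exact hn' (this ▸ Node.isWire_wire _ _)

theorem Rep.ne (hf : Rep f N F) (hw : WFlow N) {n : Node} {b c : ℕ} (hn : n ∈ N)
    (hn' : ¬ n.IsWire) (hb : b ∈ n.ins) (hc : c ∈ n.outs) : f b ≠ f c := by
  intro h
  have h := (hf.ker b (mem_nm.2 (Or.inl (mem_nins.2 ⟨n, hn, hb⟩))) c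
    (mem_nm.2 (Or.inr (mem_nouts.2 ⟨n, hn, hc⟩)))).1 h
  obtain ⟨d, hd⟩ := hw.vertical
  have hbc := hd n hn b hb c hc
  have mono : ∀ {x y}, ReflTransGen (WRel N) x y → d x ≤ d y := by
    intro x y h
    induction h with
    | refl => exact le_rfl
    | tail _ h ih => exact ih.trans (hd _ h _ (by simp [wire]) _ (by simp [wire])).le
  rcases eqvGen_comparable hw.ins_nodup hw.outs_nodup h with h | h
  · rcases h.cases_head with h | ⟨z, hz, -⟩
    · subst h; omega
    · have := ins_unique hw.ins_nodup hn hz hb (by simp [wire])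
      exact hn' (this ▸ Node.isWire_wire _ _)
  · have := mono h
    omega

theorem Rep.congr (hf : Rep f N F) (hff : ∀ x ∈ nm N, f' x = f x) : Rep f' N F :=
  ⟨hf.edges.trans (Finset.image_congr fun x hx => (hff x hx).symm), hf.nodes.trans
    (nmap_congr fun x hx => (hff x (nm_mono (Multiset.filter_le _ _) hx)).symm),
    fun x hx y hy => by rw [hff x hx, hff y hy]; exact hf.ker x hx y hy⟩

theorem Rep.replace (hf : Rep f (L + Γ) F) (hL : ∀ n ∈ L, ¬ n.IsWire) (hR : ∀ n ∈ R, ¬ n.IsWire)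
    (S : Finset ℕ) (hold : ∀ x ∈ nm (R + Γ), x ∈ nm (L + Γ) ∨ x ∈ S)
    (hinj : ∀ x ∈ S, ∀ y ∈ S, f x = f y → x = y) (hfr : ∀ x ∈ S, f x ∉ F.edges) :
    Rep f (R + Γ) ⟨(nm (R + Γ)).image f, nmap f R + nmap f (Γ.filter fun n => ¬ n.IsWire)⟩ := by
  have hrel : WRel (R + Γ) = WRel (L + Γ) := by
    funext a b
    have h1 := fun h => hR _ h (Node.isWire_wire a b)
    have h2 := fun h => hL _ h (Node.isWire_wire a b)
    simp only [WRel, mem_add, eq_iff_iff]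
    tauto
  have hfo : ∀ x ∈ nm (L + Γ), f x ∈ F.edges := fun x hx => by
    rw [hf.edges]; exact Finset.mem_image_of_mem _ hx
  have hnew : ∀ x ∈ S, ∀ y, EqvGen (WRel (L + Γ)) x y → x = y := by
    intro x hx y h
    have hx' : x ∉ nm (L + Γ) := fun h => hfr x hx (hfo x h)
    refine eqvGen_isolated h (fun z hz => hx' (mem_nm.2 (Or.inl hz.mem_ins)))
      (fun z hz => hx' (mem_nm.2 (Or.inr hz.mem_outs)))
  refine ⟨rfl, by simp [Multiset.filter_eq_self.2 hR], fun x hx y hy => ?_⟩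
  rw [hrel]
  rcases hold x hx with hx | hx <;> rcases hold y hy with hy | hy
  · exact hf.ker x hx y hy
  · refine ⟨fun h => absurd (h ▸ hfo x hx) (hfr y hy), fun h => ?_⟩
    rw [hnew y hy x (.symm _ _ h)]
  · refine ⟨fun h => absurd (h ▸ hfo y hy) (hfr x hx), fun h => ?_⟩
    rw [hnew x hx y h]
  · refine ⟨fun h => ?_, fun h => by rw [hnew x hx y h]⟩
    rw [hinj x hx y hy h]; exact .refl _

theorem Rep.merge (hf : Rep f (L + Γ) F) (hL : ∀ n ∈ L, ¬ n.IsWire) {b c : ℕ}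
    (hb : b ∈ nm (L + Γ)) (hc : c ∈ nm (L + Γ)) :
    Rep (fun x => if f x = f c then f b else f x) (wire b c ::ₘ Γ)
      ⟨(nm (wire b c ::ₘ Γ)).image (fun x => if f x = f c then f b else f x),
        nmap (fun e => if e = f c then f b else e)
          (nmap f (Γ.filter fun n => ¬ n.IsWire))⟩ := by
  have hrel : WRel (L + Γ) = WRel Γ := by
    funext a b
    simp only [WRel, mem_add, eq_iff_iff]
    exact ⟨fun h => h.resolve_left fun h => hL _ h (Node.isWire_wire _ _), Or.inr⟩
  have hnm : ∀ x ∈ nm (wire b c ::ₘ Γ), x ∈ nm (L + Γ) := by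
    intro x hx
    rw [nm_cons] at hx
    simp only [wire, Finset.mem_union, Multiset.mem_toFinset, mem_singleton] at hx
    rcases hx with (rfl | rfl) | hx
    · exact hb
    · exact hc
    · rw [nm_add]; exact Finset.mem_union_right _ hx
  have lift : ∀ {x y}, EqvGen (WRel (L + Γ)) x y → EqvGen (WRel (wire b c ::ₘ Γ)) x y := by
    rw [hrel]
    exact fun h => h.mono fun _ _ h => Multiset.mem_cons_of_mem h
  have hbc : EqvGen (WRel (wire b c ::ₘ Γ)) b c := .rel _ _ (Multiset.mem_cons_self _ _)
  refine ⟨rfl, ?_, ?_⟩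
  · show nmap _ _ = nmap _ ((wire b c ::ₘ Γ).filter _)
    rw [Multiset.filter_cons_of_neg _ (by simp), nmap_nmap]
    rfl
  · intro x hx y hy
    constructor
    · intro h
      have hx := hnm x hx
      have hy := hnm y hy
      split_ifs at h with h1 h2 h2
      · exact lift ((hf.ker x hx y hy).1 (h1.trans h2.symm))
      · exact ((lift ((hf.ker x hx c hc).1 h1)).trans _ _ _ (.symm _ _ hbc)).trans _ _ _
          (lift ((hf.ker b hb y hy).1 h))
      · exact (lift ((hf.ker x hx b hb).1 h)).trans _ _ _ (hbc.trans _ _ _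
          (.symm _ _ (lift ((hf.ker y hy c hc).1 h2))))
      · exact lift ((hf.ker x hx y hy).1 h)
    · intro h
      clear hx hy
      induction h with
      | rel x y h =>
        rcases Multiset.mem_cons.1 h with h | h
        · have : x = b ∧ y = c := by simpa [wire] using h
          obtain ⟨rfl, rfl⟩ := this
          simp
        · have h' : WRel (L + Γ) x y := by rw [hrel]; exact h
          rw [(hf.ker x (mem_nm.2 (Or.inl h'.mem_ins)) y (mem_nm.2 (Or.inr h'.mem_outs))).2
            (.rel _ _ h')]
      | refl x => rfl
      | symm x y _ ih => exact ih.symm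
      | trans x y z _ _ ih₁ ih₂ => exact ih₁.trans ih₂

theorem image_erase_of_isolated {A : Finset ℕ} {m : ℕ} (h : ∀ x ∈ A, f x = f m → x = m) :
    (A.erase m).image f = (A.image f).erase (f m) := by
  ext e
  simp only [Finset.mem_image, Finset.mem_erase]
  constructor
  · rintro ⟨x, ⟨hx, hx'⟩, rfl⟩; exact ⟨fun h' => hx (h x hx' h'), x, hx', rfl⟩
  · rintro ⟨he, x, hx, rfl⟩; exact ⟨x, ⟨fun h' => he (h' ▸ rfl), hx⟩, rfl⟩

theorem image_merge {A : Finset ℕ} {b c : ℕ} (hb : b ∈ A) (hbc : f b ≠ f c) :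
    A.image (fun x => if f x = f c then f b else f x) = (A.image f).erase (f c) := by
  ext e
  simp only [Finset.mem_image, Finset.mem_erase]
  constructor
  · rintro ⟨x, hx, rfl⟩
    split_ifs with h
    · exact ⟨hbc, b, hb, rfl⟩
    · exact ⟨h, x, hx, rfl⟩
  · rintro ⟨he, x, hx, rfl⟩; exact ⟨x, hx, if_neg he⟩

end

/-- The rewriting rules for diagrams with wires. -/
inductive RS : Multiset Node → Multiset Node → Prop
  | wDown_cDown (Γ : Multiset Node) (a b c : ℕ) :
      RS (.wD a ::ₘ .cD a b c ::ₘ Γ) (.wire b c ::ₘ Γ)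
  | iDown_wUp (Γ : Multiset Node) (a b : ℕ) : RS (.iD a b ::ₘ .wU a ::ₘ Γ) (.wD b ::ₘ Γ)
  | cUp_wUp (Γ : Multiset Node) (a b c : ℕ) :
      RS (.cU a b c ::ₘ .wU b ::ₘ Γ) (.wire a c ::ₘ Γ)
  | wDown_cUp (Γ : Multiset Node) (a b c : ℕ) :
      RS (.wD a ::ₘ .cU a b c ::ₘ Γ) (.wD b ::ₘ .wD c ::ₘ Γ)
  | wDown_wUp (Γ : Multiset Node) (a : ℕ) : RS (.wD a ::ₘ .wU a ::ₘ Γ) Γ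
  | cDown_wUp (Γ : Multiset Node) (a b c : ℕ) :
      RS (.cD a b c ::ₘ .wU c ::ₘ Γ) (.wU a ::ₘ .wU b ::ₘ Γ)
  | cDown_cUp (Γ : Multiset Node) (a b m c d p q r s : ℕ)
      (fresh : [p, q, r, s].Nodup ∧ ∀ e ∈ [p, q, r, s], e ∉ nm (.cD a b m ::ₘ .cU m c d ::ₘ Γ)) :
      RS (.cD a b m ::ₘ .cU m c d ::ₘ Γ)
        (.cU a p q ::ₘ .cU b r s ::ₘ .cD p r c ::ₘ .cD q s d ::ₘ Γ)
  | iDown_cUp (Γ : Multiset Node) (m b c d p q : ℕ)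
      (fresh : [p, q].Nodup ∧ ∀ e ∈ [p, q], e ∉ nm (.iD m b ::ₘ .cU m c d ::ₘ Γ)) :
      RS (.iD m b ::ₘ .cU m c d ::ₘ Γ) (.iD c p ::ₘ .iD d q ::ₘ .cD p q b ::ₘ Γ)

/-- Extends `f` by sending the edge `p` to `P`. -/
theorem exists_update {N : Multiset Node} (f : ℕ → ℕ) (l : List (ℕ × ℕ)) (h : (l.map Prod.fst).Nodup)
    (hl : ∀ e ∈ l, e.1 ∉ nm N) :
    ∃ f' : ℕ → ℕ, (∀ x ∈ nm N, f' x = f x) ∧ ∀ e ∈ l, f' e.1 = e.2 := by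
  induction l with
  | nil => exact ⟨f, fun _ _ => rfl, by simp⟩
  | cons e l ih =>
    rw [List.map_cons, List.nodup_cons] at h
    obtain ⟨f', h1, h2⟩ := ih h.2 fun e he => hl e (List.mem_cons_of_mem _ he)
    refine ⟨Function.update f' e.1 e.2, fun x hx => ?_, fun e' he' => ?_⟩
    · rw [Function.update_of_ne, h1 x hx]
      rintro rfl; exact hl e List.mem_cons_self hx
    · rcases List.mem_cons.1 he' with rfl | he'
      · simp
      · rw [Function.update_of_ne, h2 _ he']
        intro h'; exact h.1 (h' ▸ List.mem_map_of_mem he')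

theorem exists_fresh (S : Finset ℕ) (k : ℕ) : ∃ n, ∀ i, n ≤ i → i ∉ S ∧ k ≤ i := by
  refine ⟨max k (S.sup id + 1), fun i hi => ⟨fun h => ?_, (le_max_left _ _).trans hi⟩⟩
  have := Finset.le_sup (f := id) h
  simp only [id] at this
  have := (le_max_right k (S.sup id + 1)).trans hi
  omega

theorem Node.kind_or_isWire_simps :
    (∀ a b, (iD a b).Kind) ∧ (∀ a, (wD a).Kind) ∧ (∀ a b c, (cD a b c).Kind) ∧
      (∀ a b, (iU a b).Kind) ∧ (∀ a, (wU a).Kind) ∧ (∀ a b c, (cU a b c).Kind) :=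
  ⟨fun a b => Or.inl ⟨a, b, rfl⟩, fun a => Or.inr (Or.inl ⟨a, rfl⟩),
    fun a b c => Or.inr (Or.inr (Or.inl ⟨a, b, c, rfl⟩)),
    fun a b => Or.inr (Or.inr (Or.inr (Or.inl ⟨a, b, rfl⟩))),
    fun a => Or.inr (Or.inr (Or.inr (Or.inr (Or.inl ⟨a, rfl⟩)))),
    fun a b c => Or.inr (Or.inr (Or.inr (Or.inr (Or.inr ⟨a, b, c, rfl⟩))))⟩

theorem RS.wflow {N N' : Multiset Node} (h : RS N N') (hw : WFlow N) : WFlow N' := by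
  obtain ⟨hk, hi, ho, d, hd⟩ := hw
  have mem : ∀ {Γ n x y}, n ∈ Γ → x ∈ n.ins → y ∈ n.outs → x ∈ nm Γ ∧ y ∈ nm Γ :=
    fun hn hx hy => ⟨mem_nm.2 (Or.inl (mem_nins.2 ⟨_, hn, hx⟩)),
      mem_nm.2 (Or.inr (mem_nouts.2 ⟨_, hn, hy⟩))⟩
  cases h with
  | cDown_cUp Γ a b m c d' p q r s fresh =>
    simp only [forall_mem_cons] at hk
    simp [cD, cU, nm_cons] at hi ho hd fresh
    refine ⟨by simpa [Node.kind_or_isWire_simps] using hk.2.2, ?_, ?_,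
      fun x => if x = p ∨ x = q ∨ x = r ∨ x = s then d m else d x, ?_⟩
    iterate 2 simp [mem_nm] at fresh; simp [cU, cD]; grind
    simp only [forall_mem_cons]
    refine ⟨by simp [cU]; grind, by simp [cU]; grind, by simp [cD]; grind,
      by simp [cD]; grind, fun n hn x hx y hy => ?_⟩
    have := hd.2.2 n hn x hx y hy
    grind
  | iDown_cUp Γ m b c d' p q fresh =>
    simp only [forall_mem_cons] at hk
    simp [iD, cU, nm_cons] at hi ho hd fresh
    refine ⟨by simpa [Node.kind_or_isWire_simps] using hk.2.2, ?_, ?_,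
      fun x => if x = p ∨ x = q then 0 else d x + 1, ?_⟩
    iterate 2 simp [mem_nm] at fresh; simp [iD, cD]; grind
    simp only [forall_mem_cons]
    refine ⟨by simp [iD], by simp [iD], by simp [cD]; grind,
      fun n hn x hx y hy => ?_⟩
    have := hd.2 n hn x hx y hy
    grind
  | _ =>
    simp only [forall_mem_cons] at hk
    simp [wD, iD, cD, cU, wU] at hi ho hd
    exact ⟨by simpa [Node.kind_or_isWire_simps] using hk.2.2,
      by (try simp [wD, iD, cD, cU, wU, wire]) <;> grind, by (try simp [wD, iD, cD, cU, wU, wire]) <;> grind,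
      d, by (try simp [wD, iD, cD, cU, wU, wire]) <;> grind⟩

section reps
variable {f : ℕ → ℕ} {Γ R N : Multiset Node} {F : Diagram} {n m : Node} {a b c d e p q r s : ℕ}

/-- The edges that remain when the edge `e` is removed. -/
theorem Rep.image_erase (hf : Rep f (n ::ₘ m ::ₘ Γ) F) (hw : WFlow (n ::ₘ m ::ₘ Γ))
    (hn : ¬ n.IsWire) (hm : ¬ m.IsWire) (he : e ∈ n.outs) (he' : e ∈ m.ins) :
    ((nm (n ::ₘ m ::ₘ Γ)).erase e).image f = F.edges.erase (f e) := by
  rw [image_erase_of_isolated (hf.isolated hw (n := n) (m := m) (by simp) (by simp) hn hm he he'),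
    hf.edges]

theorem Rep.rewrite (hf : Rep f (n ::ₘ m ::ₘ Γ) F) (hw : WFlow (n ::ₘ m ::ₘ Γ)) (e : ℕ)
    (R : Multiset Node) (S : Finset ℕ)
    (hinj : ∀ x ∈ S, ∀ y ∈ S, f x = f y → x = y := by simp)
    (hfr : ∀ x ∈ S, f x ∉ F.edges := by simp)
    (hn : ¬ n.IsWire := by simp) (hm : ¬ m.IsWire := by simp)
    (he : e ∈ n.outs := by simp [wD, iD, cD, cU, wU])
    (he' : e ∈ m.ins := by simp [wD, iD, cD, cU, wU]) (hR : ∀ n ∈ R, ¬ n.IsWire := by simp)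
    (hA : ∀ Γ, WFlow (n ::ₘ m ::ₘ Γ) → nm (R + Γ) = (nm (n ::ₘ m ::ₘ Γ)).erase e ∪ S := by
      rintro Γ ⟨-, hi, ho, d, hd⟩
      simp [wD, iD, cD, cU, wU] at hi ho hd
      ext x; simp [wD, iD, cD, cU, wU, mem_nm]; grind)
    (hN : R + Γ = N := by simp) :
    Rep f N ⟨F.edges.erase (f e) ∪ S.image f,
      nmap f R + nmap f (Γ.filter fun n => ¬ n.IsWire)⟩ := by
  subst hN
  rw [← hf.image_erase hw hn hm he he', ← Finset.image_union, ← hA _ hw]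
  refine Rep.replace (L := {n, m}) (by simpa using hf) (by simp [hn, hm]) hR S (fun x hx => ?_)
    hinj hfr
  rw [hA _ hw] at hx
  simp at hx ⊢
  tauto

theorem Rep.contract (hf : Rep f (n ::ₘ m ::ₘ Γ) F) (hw : WFlow (n ::ₘ m ::ₘ Γ)) (e b c : ℕ)
    (hn : ¬ n.IsWire := by simp) (hm : ¬ m.IsWire := by simp)
    (he : e ∈ n.outs := by simp [wD, iD, cD, cU, wU]) (he' : e ∈ m.ins := by simp [wD, iD, cD, cU, wU])
    (hk : ∃ k ∈ ({n, m} : Multiset Node), b ∈ k.ins ∧ c ∈ k.outs := by simp [wD, iD, cD, cU, wU])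
    (hA : ∀ Γ, WFlow (n ::ₘ m ::ₘ Γ) → nm (.wire b c ::ₘ Γ) = (nm (n ::ₘ m ::ₘ Γ)).erase e := by
      rintro Γ ⟨-, hi, ho, d, hd⟩
      simp [wD, iD, cD, cU, wU] at hi ho hd
      ext x; simp [wD, iD, cD, cU, wU, wire, mem_nm]; grind) :
    Rep (fun x => if f x = f c then f b else f x) (.wire b c ::ₘ Γ)
      ⟨(F.edges.erase (f e)).erase (f c), nmap (fun e => if e = f c then f b else e)
        (nmap f (Γ.filter fun n => ¬ n.IsWire))⟩ := by
  obtain ⟨k, hk, hb, hc⟩ := hk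
  have hL : ∀ k ∈ ({n, m} : Multiset Node), ¬ k.IsWire := by simp [hn, hm]
  have hk' : k ∈ n ::ₘ m ::ₘ Γ := by simp at hk ⊢; tauto
  rw [← hf.image_erase hw hn hm he he',
    ← image_merge (b := b) (by rw [← hA _ hw]; simp [nm_cons, wire])
      (hf.ne hw hk' (hL k hk) hb hc), ← hA _ hw]
  exact Rep.merge (L := {n, m}) (by simpa using hf) hL
    (mem_nm.2 (Or.inl (mem_nins.2 ⟨k, by simpa using hk', hb⟩)))
    (mem_nm.2 (Or.inr (mem_nouts.2 ⟨k, by simpa using hk', hc⟩)))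

end reps

theorem RS.rep {N N' : Multiset Node} (h : RS N N') (hw : WFlow N) {f : ℕ → ℕ} {F : Diagram}
    (hf : Rep f N F) : ∃ f' F', Rep f' N' F' ∧ F.Step F' := by
  have key : ∀ {M F'}, F.nodes = M → Diagram.Step ⟨F.edges, M⟩ F' → F.Step F' := by
    rintro _ _ rfl h; exact h
  obtain ⟨P, hP⟩ := exists_fresh F.edges 0
  have hP : ∀ i, P + i ∉ F.edges := fun i => (hP _ (by omega)).1
  have hn := hf.nodes
  cases h with
  | wDown_cDown Γ a b c =>
    simp at hn
    exact ⟨_, _, hf.contract hw a b c, key hn (.wDown_cDown _ _ _ _ _)⟩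
  | iDown_wUp Γ a b =>
    simp at hn
    exact ⟨f, _, by simpa using hf.rewrite hw a {.wD b} ∅, key hn (.iDown_wUp _ _ _ _)⟩
  | cUp_wUp Γ a b c =>
    simp at hn
    exact ⟨_, _, hf.contract hw b a c, key hn (.cUp_wUp _ _ _ _ _)⟩
  | wDown_cUp Γ a b c =>
    simp at hn
    exact ⟨f, _, by simpa using hf.rewrite hw a {.wD b, .wD c} ∅, key hn (.wDown_cUp _ _ _ _ _)⟩
  | wDown_wUp Γ a =>
    simp at hn
    exact ⟨f, _, by simpa using hf.rewrite hw a 0 ∅, key hn (.wDown_wUp _ _ _)⟩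
  | cDown_wUp Γ a b c =>
    simp at hn
    exact ⟨f, _, by simpa using hf.rewrite hw c {.wU a, .wU b} ∅, key hn (.cDown_wUp _ _ _ _ _)⟩
  | cDown_cUp Γ a b m c d p q r s fresh =>
    obtain ⟨f', h1, h2⟩ := exists_update f [(p, P + 1), (q, P + 2), (r, P + 3), (s, P + 4)]
      (by simpa using fresh.1) (by simpa using fresh.2)
    have hf := hf.congr h1
    have hn := hf.nodes
    simp at h2 hn
    have h := hf.rewrite hw m {.cU a p q, .cU b r s, .cD p r c, .cD q s d} {p, q, r, s}
      (by simp [h2]) (by simp [h2, hP]) (hN := rfl)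
    exact ⟨f', _, by simpa using h, key hn
      (.cDown_cUp _ _ _ _ _ _ _ _ _ _ _ (by simp [h2, hP]))⟩
  | iDown_cUp Γ m b c d p q fresh =>
    obtain ⟨f', h1, h2⟩ := exists_update f [(p, P + 1), (q, P + 2)]
      (by simpa using fresh.1) (by simpa using fresh.2)
    have hf := hf.congr h1
    have hn := hf.nodes
    simp at h2 hn
    have h := hf.rewrite hw m {.iD c p, .iD d q, .cD p q b} {p, q} (by simp [h2])
      (by simp [h2, hP]) (hN := rfl)
    exact ⟨f', _, by simpa using h, key hn
      (.iDown_cUp _ _ _ _ _ _ _ _ (by simp [h2, hP]))⟩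

theorem RS.red {N N' : Multiset Node} (h : RS N N') : Red N N' := fun hw => by
  refine ⟨h.wflow hw, ?_⟩
  rintro φ φ' ⟨f, F, hF, hf, rfl⟩ hφ'
  obtain ⟨f', F', hf', hs⟩ := h.rep hw hf
  have hF' := hf'.isFlow (h.wflow hw)
  have : Den N' ⟦⟨F', hF'⟩⟧ := ⟨f', F', hF', hf', rfl⟩
  rw [hφ'.unique this]
  exact .single ⟨⟨F, hF⟩, ⟨F', hF'⟩, rfl, rfl, hs⟩

/-- A diagram with wires for the flow diagram `D`: each edge that is not attached to any node is
replaced by a wire. -/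
def lift (D : Diagram) (n : ℕ) : Multiset Node :=
  D.nodes + (D.edges \ nm D.nodes).val.map fun e => wire e (n + e)

section lift
variable {D : Diagram} {n : ℕ}

theorem Diagram.IsFlow.nm_subset (h : D.IsFlow) : nm D.nodes ⊆ D.edges := by
  intro x hx
  rcases mem_nm.1 hx with hx | hx
  · obtain ⟨m, hm, hx⟩ := mem_nins.1 hx; exact h.ins_mem m hm x hx
  · obtain ⟨m, hm, hx⟩ := mem_nouts.1 hx; exact h.outs_mem m hm x hx

theorem not_isWire_of_kind {m : Node} (h : m.Kind) : ¬ m.IsWire := by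
  rcases h with ⟨a, b, rfl⟩ | ⟨a, rfl⟩ | ⟨a, b, c, rfl⟩ | ⟨a, b, rfl⟩ | ⟨a, rfl⟩ | ⟨a, b, c, rfl⟩ <;>
    simp

theorem nins_wires (s : Finset ℕ) (n : ℕ) :
    nins (s.val.map fun e => wire e (n + e)) = s.val := by
  simpa [nins, Multiset.bind_map, wire] using Multiset.bind_singleton s.val id

theorem nouts_wires (s : Finset ℕ) (n : ℕ) :
    nouts (s.val.map fun e => wire e (n + e)) = s.val.map (n + ·) := by
  simp [nouts, Multiset.bind_map, wire, Multiset.bind_singleton]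

theorem lift_wflow (h : D.IsFlow) (hn : ∀ e ∈ D.edges, e < n) : WFlow (lift D n) := by
  obtain ⟨d, hd⟩ := h.vertical
  have hsub := h.nm_subset
  refine ⟨?_, ?_, ?_, fun x => if x < n then d x else d (x - n) + 1, ?_⟩
  · intro m hm
    rcases Multiset.mem_add.1 hm with hm | hm
    · exact Or.inl (h.kind m hm)
    · obtain ⟨e, -, rfl⟩ := Multiset.mem_map.1 hm
      exact Or.inr (Node.isWire_wire _ _)
  · rw [lift, nins_add, nins_wires, nodup_add]
    refine ⟨h.ins_nodup, Finset.nodup _, Multiset.disjoint_left.2 fun {x} hx hx' => ?_⟩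
    exact (Finset.mem_sdiff.1 hx').2 (mem_nm.2 (Or.inl hx))
  · rw [lift, nouts_add, nouts_wires, nodup_add]
    refine ⟨h.outs_nodup, Multiset.Nodup.map (add_right_injective n) (Finset.nodup _),
      Multiset.disjoint_left.2 fun {x} hx hx' => ?_⟩
    obtain ⟨e, he, rfl⟩ := Multiset.mem_map.1 hx'
    have := hn _ (hsub (mem_nm.2 (Or.inr hx)))
    omega
  · intro m hm a ha b hb
    rcases Multiset.mem_add.1 hm with hm | hm
    · have h1 := hn _ (h.ins_mem m hm a ha)
      have h2 := hn _ (h.outs_mem m hm b hb)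
      simp only [h1, h2, if_true]
      exact hd m hm a ha b hb
    · obtain ⟨e, he, rfl⟩ := Multiset.mem_map.1 hm
      have h1 := hn e (Finset.mem_sdiff.1 he).1
      simp only [wire, mem_singleton] at ha hb
      subst ha hb
      simp [h1]

theorem lift_rep (h : D.IsFlow) (hn : ∀ e ∈ D.edges, e < n) :
    Rep (fun x => if x < n then x else x - n) (lift D n) D := by
  have hsub := h.nm_subset
  have hmem : ∀ x, x ∈ nm (lift D n) ↔ x ∈ D.edges ∨ ∃ e ∈ D.edges \ nm D.nodes, n + e = x := by
    intro x
    rw [lift, nm_add, Finset.mem_union, mem_nm (N := Multiset.map _ _), nins_wires, nouts_wires]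
    simp only [Finset.mem_val, Multiset.mem_map, Finset.mem_sdiff]
    have := @hsub x
    tauto
  have hw : ∀ a b, WRel (lift D n) a b ↔ a ∈ D.edges \ nm D.nodes ∧ b = n + a := by
    intro a b
    simp only [WRel, lift, mem_add, Multiset.mem_map, Finset.mem_val]
    constructor
    · rintro (h' | ⟨e, he, h'⟩)
      · exact absurd (Node.isWire_wire _ _) (not_isWire_of_kind (h.kind _ h'))
      · simp [wire] at h'
        obtain ⟨rfl, rfl⟩ := h'
        exact ⟨he, rfl⟩
    · rintro ⟨he, rfl⟩; exact Or.inr ⟨a, he, rfl⟩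
  have key : ∀ x ∈ nm (lift D n), EqvGen (WRel (lift D n)) (if x < n then x else x - n) x := by
    intro x hx
    rcases (hmem x).1 hx with hx | ⟨e, he, rfl⟩
    · simp only [hn x hx, if_true]; exact .refl _
    · simp only [show ¬ n + e < n by omega, if_false, Nat.add_sub_cancel_left]
      exact .rel _ _ ((hw _ _).2 ⟨he, rfl⟩)
  refine ⟨?_, ?_, ?_⟩
  · ext x
    simp only [Finset.mem_image, hmem]
    constructor
    · intro hx; exact ⟨x, Or.inl hx, by simp [hn x hx]⟩
    · rintro ⟨y, hy | ⟨e, he, rfl⟩, rfl⟩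
      · simpa [hn y hy] using hy
      · simpa using (Finset.mem_sdiff.1 he).1
  · rw [lift, Multiset.filter_add, Multiset.filter_eq_self.2, Multiset.filter_eq_nil.2, add_zero,
      nmap_id']
    · intro x hx; simp [hn x (hsub hx)]
    · intro m hm
      obtain ⟨e, -, rfl⟩ := Multiset.mem_map.1 hm
      simp
    · exact fun m hm => not_isWire_of_kind (h.kind m hm)
  · intro x hx y hy
    constructor
    · intro hxy
      have h1 := key x hx
      have h2 := key y hy
      rw [hxy] at h1
      exact (EqvGen.symm _ _ h1).trans _ _ _ h2
    · intro hxy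
      clear hx hy
      induction hxy with
      | rel x y hxy =>
        obtain ⟨hx, rfl⟩ := (hw _ _).1 hxy
        simp [hn x (Finset.mem_sdiff.1 hx).1]
      | refl x => rfl
      | symm x y _ ih => exact ih.symm
      | trans x y z _ _ ih₁ ih₂ => exact ih₁.trans ih₂

theorem lift_step {D₁ : Diagram} (h : D.IsFlow) (h₁ : D₁.IsFlow) (hs : D.Step D₁) :
    ∃ k, ∀ n, k ≤ n → ∃ N₁, RS (lift D n) N₁ ∧ Den N₁ ⟦⟨D₁, h₁⟩⟧ := by
  obtain ⟨k, hk⟩ := (D.edges ∪ D₁.edges).exists_nat_subset_range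
  refine ⟨k, fun n hn => ?_⟩
  have hlt : ∀ e ∈ D.edges ∪ D₁.edges, e < n := fun e he => (Finset.mem_range.1 (hk he)).trans_le hn
  simp only [Finset.mem_union] at hlt
  have hD := fun e he => hlt e (Or.inl he)
  have hsub := h.nm_subset
  have hr := lift_rep h hD
  have hw := lift_wflow h hD
  have hn := hr.nodes.symm
  have hx := fun x hx => hD x (hsub hx)
  have hfresh : ∀ {p}, p ∈ D₁.edges → p ∉ D.edges → p ∉ nm (lift D n) := by
    intro p hp hpe
    rw [lift, nm_add, Finset.mem_union, mem_nm (N := Multiset.map _ _), nins_wires, nouts_wires]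
    simp only [Finset.mem_val, Multiset.mem_map, Finset.mem_sdiff]
    rintro (h | ⟨h, -⟩ | ⟨e, -, rfl⟩)
    · exact hpe (hsub h)
    · exact hpe h
    · exact absurd (hlt _ (Or.inr hp)) (by omega)
  have hden : ∀ {N g D'}, RS (lift D n) N → Rep g N D' → D' = D₁ →
      ∃ N₁, RS (lift D n) N₁ ∧ Den N₁ ⟦⟨D₁, h₁⟩⟧ := by
    rintro N g _ hN hr rfl; exact ⟨N, hN, g, _, h₁, hr, rfl⟩
  cases hs <;> simp only [lift, Multiset.cons_add] at hr hw hn hden hfresh ⊢ <;>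
    simp [nm_cons, wD, cD, iD, cU] at hx <;> simp [hx] at hn
  case wDown_cDown E Γ a b c =>
    exact hden (.wDown_cDown _ _ _ _) (hr.contract hw a b c) (by simp [hx, hn])
  case iDown_wUp E Γ a b =>
    exact hden (.iDown_wUp _ _ _) (hr.rewrite hw a {.wD b} ∅) (by simp [hx, hn])
  case cUp_wUp E Γ a b c =>
    exact hden (.cUp_wUp _ _ _ _) (hr.contract hw b a c) (by simp [hx, hn])
  case wDown_cUp E Γ a b c =>
    exact hden (.wDown_cUp _ _ _ _) (hr.rewrite hw a {.wD b, .wD c} ∅) (by simp [hx, hn])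
  case wDown_wUp E Γ a =>
    exact hden (.wDown_wUp _ _) (hr.rewrite hw a 0 ∅) (by simp [hx, hn])
  case cDown_wUp E Γ a b c =>
    exact hden (.cDown_wUp _ _ _ _) (hr.rewrite hw c {.wU a, .wU b} ∅) (by simp [hx, hn])
  case cDown_cUp E Γ a b m c d p q r s fresh =>
    have hp : p < n ∧ q < n ∧ r < n ∧ s < n := by refine ⟨?_, ?_, ?_, ?_⟩ <;> exact hlt _ (by simp)
    refine hden (.cDown_cUp _ _ _ _ _ _ p q r s ⟨fresh.1, fun e he => hfresh (by simp at he ⊢; tauto)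
      (fresh.2 e he)⟩) (hr.rewrite hw m {.cU a p q, .cU b r s, .cD p r c, .cD q s d} {p, q, r, s}
      (by simp [hp]) (by simpa [hp] using fresh.2)) (by simp [hx, hn, hp])
  case iDown_cUp E Γ m b c d p q fresh =>
    have hp : p < n ∧ q < n := by refine ⟨?_, ?_⟩ <;> exact hlt _ (by simp)
    refine hden (.iDown_cUp _ _ _ _ _ p q ⟨fresh.1, fun e he => hfresh (by simp at he ⊢; tauto)
      (fresh.2 e he)⟩) (hr.rewrite hw m {.iD c p, .iD d q, .cD p q b} {p, q}
      (by simp [hp]) (by simpa [hp] using fresh.2)) (by simp [hx, hn, hp])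

end lift

theorem Diagram.Step.rename {D D' : Diagram} (h : D.Step D') (σ : Equiv.Perm ℕ) :
    (D.rename σ).Step (D'.rename σ) := by
  have hc : ∀ (b c : ℕ) (Γ : Multiset Node),
      nmap σ (nmap (fun e => if e = c then b else e) Γ) =
        nmap (fun e => if e = σ c then σ b else e) (nmap σ Γ) := by
    intro b c Γ
    rw [nmap_nmap, nmap_nmap]
    refine nmap_congr fun e _ => ?_
    by_cases h : e = c
    · subst h; simp
    · simp [h]
  have hE : ∀ (E : Finset ℕ) (a : ℕ),
      (E.erase a).map σ.toEmbedding = (E.map σ.toEmbedding).erase (σ a) := by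
    intro E a; rw [Finset.map_erase]; rfl
  cases h with
  | wDown_cDown E Γ a b c =>
    simp only [Diagram.rename, Multiset.map_cons, Node.map_wD, Node.map_cD, hE, hc]
    exact .wDown_cDown _ _ _ _ _
  | iDown_wUp E Γ a b =>
    simp only [Diagram.rename, Multiset.map_cons, Node.map_wD, Node.map_iD, Node.map_wU, hE]
    exact .iDown_wUp _ _ _ _
  | cUp_wUp E Γ a b c =>
    simp only [Diagram.rename, Multiset.map_cons, Node.map_wU, Node.map_cU, hE, hc]
    exact .cUp_wUp _ _ _ _ _
  | wDown_cUp E Γ a b c =>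
    simp only [Diagram.rename, Multiset.map_cons, Node.map_wD, Node.map_cU, hE]
    exact .wDown_cUp _ _ _ _ _
  | wDown_wUp E Γ a =>
    simp only [Diagram.rename, Multiset.map_cons, Node.map_wD, Node.map_wU, hE]
    exact .wDown_wUp _ _ _
  | cDown_wUp E Γ a b c =>
    simp only [Diagram.rename, Multiset.map_cons, Node.map_cD, Node.map_wU, hE]
    exact .cDown_wUp _ _ _ _ _
  | cDown_cUp E Γ a b m c d p q r s fresh =>
    simp only [Diagram.rename, Multiset.map_cons, Node.map_cD, Node.map_cU, hE, Finset.map_union,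
      Finset.map_insert, Finset.map_singleton, Equiv.coe_toEmbedding]
    exact .cDown_cUp _ _ _ _ _ _ _ _ _ _ _ ⟨by simpa using fresh.1, by simpa using fresh.2⟩
  | iDown_cUp E Γ m b c d p q fresh =>
    simp only [Diagram.rename, Multiset.map_cons, Node.map_cD, Node.map_cU, Node.map_iD, hE,
      Finset.map_union, Finset.map_insert, Finset.map_singleton, Equiv.coe_toEmbedding]
    exact .iDown_cUp _ _ _ _ _ _ _ _ ⟨by simpa using fresh.1, by simpa using fresh.2⟩

theorem Diagram.IsFlow.rename {D : Diagram} (h : D.IsFlow) (σ : Equiv.Perm ℕ) :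
    (D.rename σ).IsFlow := by
  obtain ⟨hk, him, hom, hi, ho, d, hd⟩ := h
  have hmem : ∀ n ∈ (D.rename σ).nodes, ∃ m ∈ D.nodes, n = m.map σ := by
    intro n hn
    obtain ⟨m, hm, rfl⟩ := Multiset.mem_map.1 hn
    exact ⟨m, hm, rfl⟩
  refine ⟨?_, ?_, ?_, ?_, ?_, d ∘ σ.symm, ?_⟩
  · intro n hn
    obtain ⟨m, hm, rfl⟩ := hmem n hn
    exact Node.Kind.map (hk m hm) σ
  · intro n hn e he
    obtain ⟨m, hm, rfl⟩ := hmem n hn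
    obtain ⟨e, he', rfl⟩ := Multiset.mem_map.1 he
    exact Finset.mem_map_of_mem _ (him m hm e he')
  · intro n hn e he
    obtain ⟨m, hm, rfl⟩ := hmem n hn
    obtain ⟨e, he', rfl⟩ := Multiset.mem_map.1 he
    exact Finset.mem_map_of_mem _ (hom m hm e he')
  · have := hi.map σ.injective
    rwa [← nins, ← nins_map] at this
  · have := ho.map σ.injective
    rwa [← nouts, ← nouts_map] at this
  · intro n hn a ha b hb
    obtain ⟨m, hm, rfl⟩ := hmem n hn
    obtain ⟨a, ha', rfl⟩ := Multiset.mem_map.1 ha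
    obtain ⟨b, hb', rfl⟩ := Multiset.mem_map.1 hb
    simpa using hd m hm a ha' b hb'

theorem Flow.peak {φ φ₁ φ₂ : Flow} (h₁ : Flow.Step φ φ₁) (h₂ : Flow.Step φ φ₂) :
    ∃ N N₁ N₂, WFlow N ∧ RS N N₁ ∧ RS N N₂ ∧ Den N₁ φ₁ ∧ Den N₂ φ₂ := by
  obtain ⟨⟨D, hD⟩, ⟨D₁, hD₁⟩, rfl, rfl, hs₁⟩ := h₁
  obtain ⟨⟨D', hD'⟩, ⟨D₂, hD₂⟩, he, rfl, hs₂⟩ := h₂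
  obtain ⟨σ, hσ⟩ := Quotient.exact he
  have hs₂' := hs₂.rename σ
  simp only at hσ hs₁ hs₂'
  rw [← hσ] at hs₂'
  obtain ⟨k, hk⟩ := exists_fresh D.edges 0
  obtain ⟨k₁, hk₁⟩ := lift_step hD hD₁ hs₁
  have hflow := hD₂.rename σ
  obtain ⟨k₂, hk₂⟩ := lift_step hD hflow hs₂'
  have hn : ∀ e ∈ D.edges, e < max k (max k₁ k₂) := fun e he => by
    by_contra h
    exact (hk e ((le_max_left _ _).trans (not_lt.1 h))).1 he
  obtain ⟨N₁, h₁, hd₁⟩ := hk₁ (max k (max k₁ k₂)) (by simp)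
  obtain ⟨N₂, h₂, hd₂⟩ := hk₂ (max k (max k₁ k₂)) (by simp)
  refine ⟨_, N₁, N₂, lift_wflow hD hn, h₁, h₂, hd₁, ?_⟩
  convert hd₂ using 1
  exact Quotient.sound ⟨σ, rfl⟩

theorem Red.rename {N : Multiset Node} {g : ℕ → ℕ}
    (hg : ∀ x ∈ nm N, ∀ y ∈ nm N, g x = g y → x = y) : Red N (nmap g N) := by
  have h : Contr g 0 N := by
    refine ⟨by simp, ?_, by simp [nm]⟩
    simp only [zero_add]
    intro x hx y hy
    exact ⟨fun h => hg x hx y hy h ▸ .refl _,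
      fun h => by rw [eqvGen_isolated h (by simp [WRel]) (by simp [WRel])]⟩
  simpa using h.red

theorem contr_wire {g : ℕ → ℕ} {b c : ℕ} {Γ : Multiset Node} (hgb : g b = g c)
    (hg : ∀ x ∈ nm (wire b c ::ₘ Γ), ∀ y ∈ nm (wire b c ::ₘ Γ), g x = g y →
      x = y ∨ (x = b ∧ y = c) ∨ (x = c ∧ y = b))
    (hm : b ∈ nm Γ ∨ c ∈ nm Γ) : Contr g {wire b c} Γ := by
  refine ⟨by simp, ?_, ?_⟩
  · rw [singleton_add]
    have hr : EqvGen (WRel {wire b c}) b c := .rel _ _ (by simp [WRel])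
    intro x hx y hy
    constructor
    · intro h
      rcases hg x hx y hy h with rfl | ⟨rfl, rfl⟩ | ⟨rfl, rfl⟩
      · exact .refl _
      · exact hr
      · exact .symm _ _ hr
    · intro h
      clear hx hy
      induction h with
      | rel x y h =>
        have : x = b ∧ y = c := by simpa [WRel, wire] using h
        rw [this.1, this.2, hgb]
      | refl x => rfl
      | symm x y _ ih => exact ih.symm
      | trans x y z _ _ ih₁ ih₂ => exact ih₁.trans ih₂
  · intro x hx
    have : x = b ∨ x = c := by simpa [nm, wire] using hx
    rcases this with rfl | rfl <;> rcases hm with h | h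
    · exact ⟨x, h, rfl⟩
    · exact ⟨c, h, hgb.symm⟩
    · exact ⟨b, h, hgb⟩
    · exact ⟨x, h, rfl⟩

/-- Contraction of a wire whose lower edge enters one of the nodes in `M`. -/
theorem red_wire_down {b c : ℕ} {M Γ : Multiset Node} (hc : c ∈ nins M) :
    Red (wire b c ::ₘ (M + Γ)) (nmap (fun e => if e = c then b else e) M + Γ) :=
  Red.with fun hw => by
  have h : Contr (fun e => if e = c then b else e) {wire b c} (M + Γ) := by
    refine contr_wire ?_ ?_ (Or.inr (by simp [mem_nm, hc]))
    · simp
    · intro x _ y _ h; grind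
  obtain ⟨-, hi, ho, -⟩ := hw
  simp [wire, nodup_add] at hi ho
  have hΓ : c ∉ nm Γ := by
    rw [mem_nm, not_or]
    exact ⟨Multiset.disjoint_left.1 hi.2.2.2 hc, ho.1.2⟩
  have := h.red
  simp only [singleton_add, nmap, Multiset.map_add] at this
  rwa [← nmap, ← nmap, nmap_id' (N := Γ)] at this
  intro x hx
  rw [if_neg]; rintro rfl; exact hΓ hx

/-- Contraction of a wire whose upper edge leaves one of the nodes in `M`. -/
theorem red_wire_up {b c : ℕ} {M Γ : Multiset Node} (hb : b ∈ nouts M) :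
    Red (wire b c ::ₘ (M + Γ)) (nmap (fun e => if e = b then c else e) M + Γ) :=
  Red.with fun hw => by
  have h : Contr (fun e => if e = b then c else e) {wire b c} (M + Γ) := by
    refine contr_wire ?_ ?_ (Or.inl (by simp [mem_nm, hb]))
    · simp
    · intro x _ y _ h; grind
  obtain ⟨-, hi, ho, -⟩ := hw
  simp [wire, nodup_add] at hi ho
  have hΓ : b ∉ nm Γ := by
    rw [mem_nm, not_or]
    exact ⟨hi.1.2, Multiset.disjoint_left.1 ho.2.2.2 hb⟩
  have := h.red
  simp only [singleton_add, nmap, Multiset.map_add] at this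
  rwa [← nmap, ← nmap, nmap_id' (N := Γ)] at this
  intro x hx
  rw [if_neg]; rintro rfl; exact hΓ hx

theorem Node.iD_comm (a b : ℕ) : iD a b = iD b a := by
  rw [iD, Multiset.pair_comm]; rfl
theorem Node.cD_comm (a b c : ℕ) : cD a b c = cD b a c := by
  rw [cD, Multiset.pair_comm]; rfl
theorem Node.cU_comm (a b c : ℕ) : cU a b c = cU a c b := by
  rw [cU, Multiset.pair_comm]; rfl

/-- Two diagrams have a common reduct. -/
def Join (N₁ N₂ : Multiset Node) : Prop := ∃ M, Red N₁ M ∧ Red N₂ M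

theorem Join.symm {N₁ N₂ : Multiset Node} (h : Join N₁ N₂) : Join N₂ N₁ := by
  obtain ⟨M, h₁, h₂⟩ := h; exact ⟨M, h₂, h₁⟩

theorem Join.of_eq {N₁ N₂ N₁' N₂' : Multiset Node} (h : Join N₁ N₂)
    (h₁ : N₁' = N₁ := by exact ac_eq) (h₂ : N₂' = N₂ := by exact ac_eq) : Join N₁' N₂' := h₁ ▸ h₂ ▸ h

theorem Red.then {A B X Y : Multiset Node} (h : Red A B) (h' : Red B Y) (e : X = A) : Red X Y :=
  e ▸ h.trans h'

theorem Red.eq_eq {A B X Y : Multiset Node} (h : Red A B) (e : X = A := by simp)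
    (e' : B = Y := by simp) : Red X Y :=
  e ▸ e' ▸ h

theorem Red.rename_new {N N' : Multiset Node} (l : List (ℕ × ℕ)) (h : (l.map Prod.fst).Nodup)
    (h' : (l.map Prod.snd).Nodup) (hl : ∀ x ∈ nm N, x ∈ nm N' ∨ ∃ e ∈ l, e.1 = x)
    (hf : ∀ e ∈ l, e.1 ∉ nm N' ∧ e.2 ∉ nm N') :
    ∃ g : ℕ → ℕ, (∀ x ∈ nm N', g x = x) ∧ (∀ e ∈ l, g e.1 = e.2) ∧ Red N (nmap g N) := by
  obtain ⟨g, hg, hg'⟩ := exists_update (N := N') id l h (fun e he => (hf e he).1)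
  refine ⟨g, hg, hg', Red.rename ?_⟩
  intro x hx y hy hxy
  rcases hl x hx with hx | ⟨e, he, rfl⟩ <;> rcases hl y hy with hy | ⟨e', he', rfl⟩
  · simpa [hg x hx, hg y hy] using hxy
  · rw [hg x hx, hg' e' he'] at hxy
    exact absurd (hxy ▸ hx) (hf e' he').2
  · rw [hg y hy, hg' e he] at hxy
    exact absurd (hxy ▸ hy) (hf e he).2
  · rw [hg' e he, hg' e' he'] at hxy
    rw [List.inj_on_of_nodup_map h' he he' hxy]

section fresh
variable {Γ : Multiset Node} {a b c d m p q r s P Q R S : ℕ}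

theorem red_rename_cDown_cUp
    (hf : [p, q, r, s].Nodup ∧ ∀ e ∈ [p, q, r, s], e ∉ nm (.cD a b m ::ₘ .cU m c d ::ₘ Γ))
    (hf' : [P, Q, R, S].Nodup ∧ ∀ e ∈ [P, Q, R, S], e ∉ nm (.cD a b m ::ₘ .cU m c d ::ₘ Γ)) :
    Red (.cU a p q ::ₘ .cU b r s ::ₘ .cD p r c ::ₘ .cD q s d ::ₘ Γ)
      (.cU a P Q ::ₘ .cU b R S ::ₘ .cD P R c ::ₘ .cD Q S d ::ₘ Γ) := by
  obtain ⟨g, h1, h2, h3⟩ := Red.rename_new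
    (N := .cU a p q ::ₘ .cU b r s ::ₘ .cD p r c ::ₘ .cD q s d ::ₘ Γ)
    (N' := .cD a b m ::ₘ .cU m c d ::ₘ Γ) [(p, P), (q, Q), (r, R), (s, S)] hf.1 hf'.1
    (by intro x hx; simp [nm_cons, cU, cD] at hx ⊢; grind)
    (by
      have h1 := hf.2
      have h2 := hf'.2
      simp only [List.mem_cons, List.not_mem_nil, or_false] at h1 h2 ⊢
      rintro e (rfl | rfl | rfl | rfl) <;> exact ⟨h1 _ (by simp), h2 _ (by simp)⟩)
  simp at h2
  obtain ⟨hp, hq, hr, hs⟩ := h2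
  have ha := h1 a (by simp [nm_cons, cD])
  have hb := h1 b (by simp [nm_cons, cD])
  have hc := h1 c (by simp [nm_cons, cU])
  have hd := h1 d (by simp [nm_cons, cU])
  refine h3.eq_eq rfl ?_
  have hG : nmap g Γ = Γ := nmap_id' fun x hx => h1 x (by simp [nm_cons, hx])
  simp [hp, hq, hr, hs, ha, hb, hc, hd, hG]

theorem red_rename_iDown_cUp
    (hf : [p, q].Nodup ∧ ∀ e ∈ [p, q], e ∉ nm (.iD m b ::ₘ .cU m c d ::ₘ Γ))
    (hf' : [P, Q].Nodup ∧ ∀ e ∈ [P, Q], e ∉ nm (.iD m b ::ₘ .cU m c d ::ₘ Γ)) :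
    Red (.iD c p ::ₘ .iD d q ::ₘ .cD p q b ::ₘ Γ)
      (.iD c P ::ₘ .iD d Q ::ₘ .cD P Q b ::ₘ Γ) := by
  obtain ⟨g, h1, h2, h3⟩ := Red.rename_new
    (N := .iD c p ::ₘ .iD d q ::ₘ .cD p q b ::ₘ Γ)
    (N' := .iD m b ::ₘ .cU m c d ::ₘ Γ) [(p, P), (q, Q)] hf.1 hf'.1
    (by intro x hx; simp [nm_cons, cU, cD, iD] at hx ⊢; grind)
    (by
      have h1 := hf.2
      have h2 := hf'.2
      simp only [List.mem_cons, List.not_mem_nil, or_false] at h1 h2 ⊢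
      rintro e (rfl | rfl) <;> exact ⟨h1 _ (by simp), h2 _ (by simp)⟩)
  simp at h2
  obtain ⟨hp, hq⟩ := h2
  have hb := h1 b (by simp [nm_cons, iD])
  have hc := h1 c (by simp [nm_cons, cU])
  have hd := h1 d (by simp [nm_cons, cU])
  refine h3.eq_eq rfl ?_
  have hG : nmap g Γ = Γ := nmap_id' fun x hx => h1 x (by simp [nm_cons, hx])
  simp [hp, hq, hb, hc, hd, hG]

end fresh

section critical
variable {Δ : Multiset Node} {a b c d e f m p q r s : ℕ}

theorem join_iD_wU_wU : Join (.wD b ::ₘ .wU b ::ₘ Δ) (.wD a ::ₘ .wU a ::ₘ Δ) :=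
  ⟨Δ, (RS.wDown_wUp Δ b).red, (RS.wDown_wUp Δ a).red⟩

theorem join_iD_wU_cU : Join (.wD a ::ₘ .cU a c d ::ₘ Δ)
    (.iD c p ::ₘ .iD d q ::ₘ .cD p q b ::ₘ .wU b ::ₘ Δ) := by
  refine ⟨.wD c ::ₘ .wD d ::ₘ Δ, (RS.wDown_cUp Δ a c d).red, ?_⟩
  refine (RS.cDown_wUp (.iD c p ::ₘ .iD d q ::ₘ Δ) p q b).red.then ?_
    ac_eq
  refine (RS.iDown_wUp (.wU q ::ₘ .iD d q ::ₘ Δ) p c).red.then ?_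
    (by simp only [← singleton_add, Node.iD_comm p c]; ac_rfl)
  exact (RS.iDown_wUp (.wD c ::ₘ Δ) q d).red.eq_eq
    (by simp only [← singleton_add, Node.iD_comm q d]; ac_rfl)
    ac_eq

theorem red_iD_cU_cU {P Q X Y : ℕ → ℕ} {N : Multiset Node}
    (hN : N = .iD m b ::ₘ .cU m c d ::ₘ .cU b e f ::ₘ Δ)
    (hf : [p, q].Nodup ∧ ∀ x ∈ [p, q], x ∉ nm N)
    (hX : [P 0, P 1, Q 0, Q 1, X 0, X 1, Y 0, Y 1].Nodup)
    (hX' : ∀ x ∈ [P 0, P 1, Q 0, Q 1, X 0, X 1, Y 0, Y 1], x ∉ nm N ∧ x ∉ [p, q]) :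
    Red (.iD c p ::ₘ .iD d q ::ₘ .cD p q b ::ₘ .cU b e f ::ₘ Δ)
      (.iD (P 0) (X 0) ::ₘ .iD (P 1) (X 1) ::ₘ .iD (Q 0) (Y 0) ::ₘ .iD (Q 1) (Y 1) ::ₘ
        .cD (X 0) (X 1) c ::ₘ .cD (Y 0) (Y 1) d ::ₘ .cD (P 0) (Q 0) e ::ₘ
        .cD (P 1) (Q 1) f ::ₘ Δ) := by
  subst hN
  simp [nm_cons, iD, cU] at hf hX hX'
  refine (RS.cDown_cUp (.iD c p ::ₘ .iD d q ::ₘ Δ) p q b e f (P 0) (P 1) (Q 0) (Q 1)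
    ⟨?_, ?_⟩).red.then ?_ ac_eq
  · simp; grind
  · simp [nm_cons, iD, cU, cD]; grind
  refine (RS.iDown_cUp (.iD d q ::ₘ .cU q (Q 0) (Q 1) ::ₘ .cD (P 0) (Q 0) e ::ₘ
    .cD (P 1) (Q 1) f ::ₘ Δ) p c (P 0) (P 1) (X 0) (X 1) ⟨?_, ?_⟩).red.then ?_
    (by simp only [← singleton_add, Node.iD_comm p c]; ac_rfl)
  · simp; grind
  · simp [nm_cons, iD, cU, cD]; grind
  refine (RS.iDown_cUp (.iD (P 0) (X 0) ::ₘ .iD (P 1) (X 1) ::ₘ .cD (X 0) (X 1) c ::ₘ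
    .cD (P 0) (Q 0) e ::ₘ .cD (P 1) (Q 1) f ::ₘ Δ) q d (Q 0) (Q 1) (Y 0) (Y 1) ⟨?_, ?_⟩).red.eq_eq
    (by simp only [← singleton_add, Node.iD_comm q d]; ac_rfl)
    ac_eq
  · simp; grind
  · simp [nm_cons, iD, cU, cD]; grind

theorem join_iD_cU_cU {p' q' : ℕ}
    (hf : [p, q].Nodup ∧ ∀ x ∈ [p, q], x ∉ nm (.iD m b ::ₘ .cU m c d ::ₘ .cU b e f ::ₘ Δ))
    (hf' : [p', q'].Nodup ∧ ∀ x ∈ [p', q'], x ∉ nm (.iD m b ::ₘ .cU m c d ::ₘ .cU b e f ::ₘ Δ)) :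
    Join (.iD c p ::ₘ .iD d q ::ₘ .cD p q b ::ₘ .cU b e f ::ₘ Δ)
      (.iD e p' ::ₘ .iD f q' ::ₘ .cD p' q' m ::ₘ .cU m c d ::ₘ Δ) := by
  obtain ⟨k, hk⟩ := exists_fresh (nm (.iD m b ::ₘ .cU m c d ::ₘ .cU b e f ::ₘ Δ) ∪ {p, q, p', q'}) 0
  have hk' : ∀ i, k + i ∉ nm (.iD m b ::ₘ .cU m c d ::ₘ .cU b e f ::ₘ Δ) ∧
      k + i ∉ [p, q] ∧ k + i ∉ [p', q'] := by
    intro i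
    have := (hk (k + i) (by omega)).1
    simp only [Finset.mem_union, Finset.mem_insert, Finset.mem_singleton] at this
    simp only [List.mem_cons, List.not_mem_nil, or_false]
    tauto
  refine ⟨_, red_iD_cU_cU (P := fun i => k + i) (Q := fun i => k + (2 + i))
    (X := fun i => k + (4 + i)) (Y := fun i => k + (6 + i)) rfl hf (by simp) ?_, ?_⟩
  · simp only [List.mem_cons, List.not_mem_nil, or_false]
    have h0 := hk' 0
    simp only [add_zero] at h0
    rintro x (rfl | rfl | rfl | rfl | rfl | rfl | rfl | rfl) <;>
      first | exact ⟨(hk' _).1, by simpa using (hk' _).2.1⟩ | exact ⟨h0.1, by simpa using h0.2.1⟩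
  · refine (red_iD_cU_cU (P := fun i => if i = 0 then k + 4 else k + 6)
      (Q := fun i => if i = 0 then k + 5 else k + 7)
      (X := fun i => if i = 0 then k else k + 2)
      (Y := fun i => if i = 0 then k + 1 else k + 3) (m := b) (b := m) (c := e) (d := f)
      (e := c) (f := d) (Δ := Δ) (by
        simp only [← singleton_add, Node.iD_comm b m]; ac_rfl) hf' (by simp) ?_).eq_eq
      rfl ?_
    · simp only [List.mem_cons, List.not_mem_nil, or_false, if_true, one_ne_zero, if_false]
      have h0 := hk' 0
      simp only [add_zero] at h0
      rintro x (rfl | rfl | rfl | rfl | rfl | rfl | rfl | rfl) <;>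
        first | exact ⟨(hk' _).1, by simpa using (hk' _).2.2⟩ | exact ⟨h0.1, by simpa using h0.2.2⟩
    · simp only [if_true, one_ne_zero, if_false, add_zero, ← singleton_add]
      rw [Node.iD_comm (k + 4), Node.iD_comm (k + 6), Node.iD_comm (k + 5), Node.iD_comm (k + 7)]
      ac_rfl

theorem join_cU_wU_wU : Join (.wire a c ::ₘ .wU c ::ₘ Δ) (.wire a b ::ₘ .wU b ::ₘ Δ) :=
  ⟨.wU a ::ₘ Δ, (red_wire_down (b := a) (c := c) (M := {.wU c}) (Γ := Δ) (by simp [wU])).eq_eq,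
    (red_wire_down (b := a) (c := b) (M := {.wU b}) (Γ := Δ) (by simp [wU])).eq_eq⟩

theorem join_wD_wD_cD : Join (.wire b c ::ₘ .wD b ::ₘ Δ) (.wire a c ::ₘ .wD a ::ₘ Δ) :=
  ⟨.wD c ::ₘ Δ, (red_wire_up (b := b) (c := c) (M := {.wD b}) (Γ := Δ) (by simp [wD])).eq_eq,
    (red_wire_up (b := a) (c := c) (M := {.wD a}) (Γ := Δ) (by simp [wD])).eq_eq⟩

theorem join_wD_cD_wU :
    Join (.wire b c ::ₘ .wU c ::ₘ Δ) (.wU a ::ₘ .wU b ::ₘ .wD a ::ₘ Δ) :=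
  ⟨.wU b ::ₘ Δ, (red_wire_down (b := b) (c := c) (M := {.wU c}) (Γ := Δ) (by simp [wU])).eq_eq,
    (RS.wDown_wUp (.wU b ::ₘ Δ) a).red.eq_eq
      ac_eq rfl⟩

theorem join_wD_cU_wU :
    Join (.wD b ::ₘ .wD c ::ₘ .wU b ::ₘ Δ) (.wire a c ::ₘ .wD a ::ₘ Δ) :=
  ⟨.wD c ::ₘ Δ, (RS.wDown_wUp (.wD c ::ₘ Δ) b).red.eq_eq
      ac_eq rfl,
    (red_wire_up (b := a) (c := c) (M := {.wD a}) (Γ := Δ) (by simp [wD])).eq_eq⟩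

theorem join_wD_cD_cU
    (hf : [p, q, r, s].Nodup ∧ ∀ x ∈ [p, q, r, s],
      x ∉ nm (.cD a b m ::ₘ .cU m c d ::ₘ .wD a ::ₘ Δ)) :
    Join (.wire b m ::ₘ .cU m c d ::ₘ Δ)
      (.cU a p q ::ₘ .cU b r s ::ₘ .cD p r c ::ₘ .cD q s d ::ₘ .wD a ::ₘ Δ) := by
  refine Exists.intro (.cU b c d ::ₘ Δ) ⟨Red.with fun hw => ?_, ?_⟩
  · obtain ⟨-, hi, ho, h, hd⟩ := hw
    simp [wire, cU] at hi ho hd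
    have h1 : c ≠ m := by rintro rfl; omega
    have h2 : d ≠ m := by rintro rfl; omega
    exact (red_wire_down (b := b) (c := m) (M := {.cU m c d}) (Γ := Δ) (by simp [cU])).eq_eq (by simp)
      (by simp [h1, h2])
  · simp [nm_cons, cU, cD] at hf
    refine (RS.wDown_cUp (.cU b r s ::ₘ .cD p r c ::ₘ .cD q s d ::ₘ Δ) a p q).red.then ?_
      ac_eq
    refine (RS.wDown_cDown (.wD q ::ₘ .cU b r s ::ₘ .cD q s d ::ₘ Δ) p r c).red.then ?_
      ac_eq
    refine (red_wire_up (b := r) (c := c) (M := {.cU b r s})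
      (Γ := .wD q ::ₘ .cD q s d ::ₘ Δ) (by simp [cU])).then ?_
      ac_eq
    have hb : b ≠ r := by grind
    have hs : s ≠ r := by grind
    refine (RS.wDown_cDown (.cU b c s ::ₘ Δ) q s d).red.then ?_
      (by simp only [← singleton_add, nmap, Multiset.map_singleton, Node.map_cU, if_true,
        if_neg hb, if_neg hs]; ac_rfl)
    have hb : b ≠ s := by grind
    have hc : c ≠ s := by grind
    exact (red_wire_up (b := s) (c := d) (M := {.cU b c s}) (Γ := Δ)
      (by simp [cU])).eq_eq (by simp) (by simp [hb, hc])

theorem join_cD_cU_wU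
    (hf : [p, q, r, s].Nodup ∧ ∀ x ∈ [p, q, r, s],
      x ∉ nm (.cD a b m ::ₘ .cU m c d ::ₘ .wU c ::ₘ Δ)) :
    Join (.cU a p q ::ₘ .cU b r s ::ₘ .cD p r c ::ₘ .cD q s d ::ₘ .wU c ::ₘ Δ)
      (.wire m d ::ₘ .cD a b m ::ₘ Δ) := by
  refine Exists.intro (.cD a b d ::ₘ Δ) ⟨?_, Red.with fun hw => ?_⟩
  · simp [nm_cons, cU, cD] at hf
    refine (RS.cDown_wUp (.cU a p q ::ₘ .cU b r s ::ₘ .cD q s d ::ₘ Δ) p r c).red.then ?_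
      ac_eq
    refine (RS.cUp_wUp (.wU r ::ₘ .cU b r s ::ₘ .cD q s d ::ₘ Δ) a p q).red.then ?_
      ac_eq
    refine (red_wire_down (b := a) (c := q) (M := {.cD q s d})
      (Γ := .wU r ::ₘ .cU b r s ::ₘ Δ) (by simp [cD])).then ?_
      ac_eq
    have hd : d ≠ q := by grind
    have hs : s ≠ q := by grind
    refine (RS.cUp_wUp (.cD a s d ::ₘ Δ) b r s).red.then ?_
      (by simp only [← singleton_add, nmap, Multiset.map_singleton, Node.map_cD, if_true,
        if_neg hd, if_neg hs]; ac_rfl)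
    have hd : d ≠ s := by grind
    have ha : a ≠ s := by grind
    exact (red_wire_down (b := b) (c := s) (M := {.cD a s d}) (Γ := Δ)
      (by simp [cD])).eq_eq (by simp) (by simp [hd, ha])
  · obtain ⟨-, hi, ho, h, hd⟩ := hw
    simp [wire, cD] at hi ho hd
    have h1 : a ≠ m := by rintro rfl; omega
    have h2 : b ≠ m := by rintro rfl; omega
    exact (red_wire_up (b := m) (c := d) (M := {.cD a b m}) (Γ := Δ) (by simp [cD])).eq_eq (by simp)
      (by simp [h1, h2])

theorem join_iD_cU_wU
    (hf : [p, q].Nodup ∧ ∀ x ∈ [p, q], x ∉ nm (.iD m b ::ₘ .cU m c d ::ₘ .wU c ::ₘ Δ)) :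
    Join (.iD c p ::ₘ .iD d q ::ₘ .cD p q b ::ₘ .wU c ::ₘ Δ)
      (.wire m d ::ₘ .iD m b ::ₘ Δ) := by
  refine Exists.intro (.iD d b ::ₘ Δ) ⟨?_, Red.with fun hw => ?_⟩
  · simp [nm_cons, cU, iD] at hf
    refine (RS.iDown_wUp (.iD d q ::ₘ .cD p q b ::ₘ Δ) c p).red.then ?_
      ac_eq
    refine (RS.wDown_cDown (.iD d q ::ₘ Δ) p q b).red.then ?_
      ac_eq
    have hd : d ≠ q := by grind
    exact (red_wire_up (b := q) (c := b) (M := {.iD d q}) (Γ := Δ)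
      (by simp [iD])).eq_eq (by simp) (by simp [hd])
  · obtain ⟨-, hi, ho, h, hd⟩ := hw
    simp [wire, iD] at hi ho hd
    have h2 : b ≠ m := by rintro rfl; simp at ho
    exact (red_wire_up (b := m) (c := d) (M := {.iD m b}) (Γ := Δ) (by simp [iD])).eq_eq (by simp)
      (by simp [h2])

end critical

@[simp] theorem nm_zero : nm 0 = ∅ := rfl

/-- The redexes: upper node, lower node, replacement, new names. -/
inductive Redex (n m : Node) (R : Multiset Node) (S : List ℕ) : Prop
  | wDown_cDown (a b c : ℕ) (hn : n = .wD a) (hm : m = .cD a b c) (hR : R = {.wire b c})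
      (hS : S = [])
  | iDown_wUp (a b : ℕ) (hn : n = .iD a b) (hm : m = .wU a) (hR : R = {.wD b}) (hS : S = [])
  | cUp_wUp (a b c : ℕ) (hn : n = .cU a b c) (hm : m = .wU b) (hR : R = {.wire a c}) (hS : S = [])
  | wDown_cUp (a b c : ℕ) (hn : n = .wD a) (hm : m = .cU a b c) (hR : R = {.wD b, .wD c})
      (hS : S = [])
  | wDown_wUp (a : ℕ) (hn : n = .wD a) (hm : m = .wU a) (hR : R = 0) (hS : S = [])
  | cDown_wUp (a b c : ℕ) (hn : n = .cD a b c) (hm : m = .wU c) (hR : R = {.wU a, .wU b})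
      (hS : S = [])
  | cDown_cUp (a b e c d p q r s : ℕ) (hn : n = .cD a b e) (hm : m = .cU e c d)
      (hR : R = {.cU a p q, .cU b r s, .cD p r c, .cD q s d}) (hS : S = [p, q, r, s])
  | iDown_cUp (e b c d p q : ℕ) (hn : n = .iD e b) (hm : m = .cU e c d)
      (hR : R = {.iD c p, .iD d q, .cD p q b}) (hS : S = [p, q])

theorem RS.redex {N N' : Multiset Node} (h : RS N N') : ∃ n m R S Γ, Redex n m R S ∧
    N = n ::ₘ m ::ₘ Γ ∧ N' = R + Γ ∧ S.Nodup ∧ ∀ e ∈ S, e ∉ nm N := by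
  cases h with
  | wDown_cDown Γ a b c =>
    exact ⟨_, _, _, _, Γ, .wDown_cDown a b c rfl rfl rfl rfl, rfl, by simp, by simp, by simp⟩
  | iDown_wUp Γ a b =>
    exact ⟨_, _, _, _, Γ, .iDown_wUp a b rfl rfl rfl rfl, rfl, by simp, by simp, by simp⟩
  | cUp_wUp Γ a b c =>
    exact ⟨_, _, _, _, Γ, .cUp_wUp a b c rfl rfl rfl rfl, rfl, by simp, by simp, by simp⟩
  | wDown_cUp Γ a b c =>
    exact ⟨_, _, _, _, Γ, .wDown_cUp a b c rfl rfl rfl rfl, rfl, by simp, by simp, by simp⟩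
  | wDown_wUp Γ a =>
    exact ⟨_, _, _, _, N', .wDown_wUp a rfl rfl rfl rfl, rfl, by simp, by simp, by simp⟩
  | cDown_wUp Γ a b c =>
    exact ⟨_, _, _, _, Γ, .cDown_wUp a b c rfl rfl rfl rfl, rfl, by simp, by simp, by simp⟩
  | cDown_cUp Γ a b m c d p q r s fresh =>
    exact ⟨_, _, _, _, Γ, .cDown_cUp a b m c d p q r s rfl rfl rfl rfl, rfl, by simp, fresh.1,
      fresh.2⟩
  | iDown_cUp Γ m b c d p q fresh =>
    exact ⟨_, _, _, _, Γ, .iDown_cUp m b c d p q rfl rfl rfl rfl, rfl, by simp, fresh.1, fresh.2⟩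

theorem Redex.red {n m : Node} {R Γ : Multiset Node} {S : List ℕ} (h : Redex n m R S)
    (hS : S.Nodup) (hS' : ∀ e ∈ S, e ∉ nm (n ::ₘ m ::ₘ Γ)) : Red (n ::ₘ m ::ₘ Γ) (R + Γ) := by
  cases h with
  | wDown_cDown a b c hn hm hR hS => subst hn hm hR; simpa using (RS.wDown_cDown Γ a b c).red
  | iDown_wUp a b hn hm hR hS => subst hn hm hR; simpa using (RS.iDown_wUp Γ a b).red
  | cUp_wUp a b c hn hm hR hS => subst hn hm hR; simpa using (RS.cUp_wUp Γ a b c).red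
  | wDown_cUp a b c hn hm hR hS => subst hn hm hR; simpa using (RS.wDown_cUp Γ a b c).red
  | wDown_wUp a hn hm hR hS => subst hn hm hR; simpa using (RS.wDown_wUp Γ a).red
  | cDown_wUp a b c hn hm hR hS => subst hn hm hR; simpa using (RS.cDown_wUp Γ a b c).red
  | cDown_cUp a b e c d p q r s hn hm hR hS =>
    subst hn hm hR hS; simpa using (RS.cDown_cUp Γ a b e c d p q r s ⟨hS, hS'⟩).red
  | iDown_cUp e b c d p q hn hm hR hS =>
    subst hn hm hR hS; simpa using (RS.iDown_cUp Γ e b c d p q ⟨hS, hS'⟩).red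

theorem Redex.names {n m : Node} {R : Multiset Node} {S : List ℕ} (h : Redex n m R S) :
    ∀ x ∈ nm R, x ∈ nm {n, m} ∨ x ∈ S := by
  intro x
  cases h <;> subst_vars <;>
    simp [nm_cons, ← Multiset.cons_zero, wD, cD, iD, wU, cU, wire] <;>
    grind

theorem Redex.refresh {n m : Node} {R Γ : Multiset Node} {S : List ℕ} (h : Redex n m R S)
    (hS : S.Nodup) (hS' : ∀ e ∈ S, e ∉ nm (n ::ₘ m ::ₘ Γ)) (T : Finset ℕ) :
    ∃ R' S', Redex n m R' S' ∧ S'.Nodup ∧ (∀ e ∈ S', e ∉ nm (n ::ₘ m ::ₘ Γ)) ∧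
      (∀ e ∈ S', e ∉ T) ∧ Red (R + Γ) (R' + Γ) := by
  obtain ⟨k, hk⟩ := exists_fresh (T ∪ nm (n ::ₘ m ::ₘ Γ)) 0
  have hk1 : ∀ i, k + i ∉ nm (n ::ₘ m ::ₘ Γ) := fun i h =>
    (hk (k + i) (by omega)).1 (Finset.mem_union_right _ h)
  have hk2 : ∀ i, k + i ∉ T := fun i h =>
    (hk (k + i) (by omega)).1 (Finset.mem_union_left _ h)
  by_cases hnil : S = []
  · subst hnil
    exact ⟨R, [], h, by simp, by simp, by simp, .refl _⟩
  have key : ∀ e ∈ [k + 0, k + 1, k + 2, k + 3], e ∉ nm (n ::ₘ m ::ₘ Γ) ∧ e ∉ T := by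
    simp only [List.mem_cons, List.not_mem_nil, or_false]
    rintro e (h | h | h | h) <;> rw [h] <;> exact ⟨hk1 _, hk2 _⟩
  cases h with
  | cDown_cUp a b e c d p q r s hn hm hR hS =>
    subst hn hm hR hS
    refine ⟨_, _, .cDown_cUp a b e c d (k + 0) (k + 1) (k + 2) (k + 3) rfl rfl rfl rfl, by simp,
      fun e he => (key e he).1, fun e he => (key e he).2, ?_⟩
    exact (red_rename_cDown_cUp (Γ := Γ) ⟨hS, hS'⟩ ⟨by simp, fun e he => (key e he).1⟩).eq_eq
  | iDown_cUp e b c d p q hn hm hR hS =>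
    subst hn hm hR hS
    refine ⟨_, _, .iDown_cUp e b c d (k + 0) (k + 1) rfl rfl rfl rfl, by simp,
      fun e he => (key e (by simp at he ⊢; tauto)).1,
      fun e he => (key e (by simp at he ⊢; tauto)).2, ?_⟩
    exact (red_rename_iDown_cUp (Γ := Γ) (P := k + 0) (Q := k + 1) ⟨hS, hS'⟩
      ⟨by simp, fun e he => (key e (by simp at he ⊢; tauto)).1⟩).eq_eq
  | _ => contradiction

theorem join_disjoint {n m n' m' : Node} {R R' Δ : Multiset Node} {S S' : List ℕ}
    (h : Redex n m R S) (h' : Redex n' m' R' S') (hS : S.Nodup)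
    (hS1 : ∀ e ∈ S, e ∉ nm (n ::ₘ m ::ₘ n' ::ₘ m' ::ₘ Δ)) (hS' : S'.Nodup)
    (hS1' : ∀ e ∈ S', e ∉ nm (n ::ₘ m ::ₘ n' ::ₘ m' ::ₘ Δ)) :
    Join (R + (n' ::ₘ m' ::ₘ Δ)) (R' + (n ::ₘ m ::ₘ Δ)) := by
  have e1 : n ::ₘ m ::ₘ n' ::ₘ m' ::ₘ Δ = n' ::ₘ m' ::ₘ n ::ₘ m ::ₘ Δ := ac_eq
  rw [e1] at hS1'
  obtain ⟨R2, S2, h2, h2S, h2N, h2T, h2r⟩ := h'.refresh hS' hS1' S.toFinset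
  rw [← e1] at h2N
  refine ⟨R2 + (R + Δ), ?_, h2r.trans ?_⟩
  · refine (h2.red (Γ := R + Δ) h2S ?_).eq_eq
      ac_eq rfl
    intro e he hne
    have h3 := h2N e he
    have h4 := h2T e he
    have h5 := h.names e
    simp [nm_cons, nm_add, ← Multiset.cons_zero] at hne h3 h4 h5
    grind
  · refine (h.red (Γ := R2 + Δ) hS ?_).eq_eq
      ac_eq
      (by ac_rfl)
    intro e he hne
    have h3 := hS1 e he
    have h4 := fun h => h2T e h (by simpa using he)
    have h5 := h2.names e
    simp [nm_cons, nm_add, ← Multiset.cons_zero] at hne h3 h4 h5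
    grind

theorem pair_inj {a b c d : ℕ} (h : ({a, b} : Multiset ℕ) = {c, d}) :
    (a = c ∧ b = d) ∨ (a = d ∧ b = c) := by
  have := Multiset.coe_eq_coe.1 (show (([a, b] : List ℕ) : Multiset ℕ) = ([c, d] : List ℕ) from h)
  have h1 := this.subset
  have h2 := this.symm.subset
  simp at h1 h2
  grind

namespace Node
variable {a b c a' b' c' : ℕ}

theorem iD_inj (h : iD a b = iD a' b') : (a = a' ∧ b = b') ∨ (a = b' ∧ b = a') :=
  pair_inj (congrArg outs h)
theorem wD_inj (h : wD a = wD a') : a = a' := by simpa [wD] using h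
theorem wU_inj (h : wU a = wU a') : a = a' := by simpa [wU] using h
theorem cD_inj (h : cD a b c = cD a' b' c') : ((a = a' ∧ b = b') ∨ (a = b' ∧ b = a')) ∧ c = c' :=
  ⟨pair_inj (congrArg ins h), by simpa [cD] using congrArg outs h⟩
theorem cU_inj (h : cU a b c = cU a' b' c') : a = a' ∧ ((b = b' ∧ c = c') ∨ (b = c' ∧ c = b')) :=
  ⟨by simpa [cU] using congrArg ins h, pair_inj (congrArg outs h)⟩

/-- The numbers of upper and lower edges. -/
def arity (n : Node) : ℕ × ℕ := (n.ins.card, n.outs.card)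

@[simp] theorem arity_iD (a b : ℕ) : (iD a b).arity = (0, 2) := rfl
@[simp] theorem arity_wD (a : ℕ) : (wD a).arity = (0, 1) := rfl
@[simp] theorem arity_cD (a b c : ℕ) : (cD a b c).arity = (2, 1) := rfl
@[simp] theorem arity_iU (a b : ℕ) : (iU a b).arity = (2, 0) := rfl
@[simp] theorem arity_wU (a : ℕ) : (wU a).arity = (1, 0) := rfl
@[simp] theorem arity_cU (a b c : ℕ) : (cU a b c).arity = (1, 2) := rfl
@[simp] theorem arity_wire (a b : ℕ) : (wire a b).arity = (1, 1) := rfl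
end Node

section overlap
variable {n m n' m' : Node} {R R' Δ : Multiset Node} {S S' : List ℕ}

theorem Redex.link (h : Redex n m R S) : ∃ e, e ∈ n.outs ∧ e ∈ m.ins := by
  cases h <;> subst_vars <;> simp [wD, cD, iD, wU, cU]

theorem Redex.upper_outs (h : Redex n m R S) (h' : Redex n m' R' S') (hne : m ≠ m')
    (hw : WFlow (n ::ₘ m ::ₘ m' ::ₘ Δ)) : n.outs.card ≠ 1 := by
  intro hc
  obtain ⟨e, he⟩ := Multiset.card_eq_one.1 hc
  obtain ⟨x, hx, hx'⟩ := h.link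
  obtain ⟨y, hy, hy'⟩ := h'.link
  rw [he] at hx hy
  simp only [mem_singleton] at hx hy
  subst hx hy
  exact hne (ins_unique hw.ins_nodup (by simp) (by simp) hx' hy')

theorem Redex.lower_ins (h : Redex n m R S) (h' : Redex n' m R' S') (hne : n ≠ n')
    (hw : WFlow (n ::ₘ n' ::ₘ m ::ₘ Δ)) : m.ins.card ≠ 1 := by
  intro hc
  obtain ⟨e, he⟩ := Multiset.card_eq_one.1 hc
  obtain ⟨x, hx', hx⟩ := h.link
  obtain ⟨y, hy', hy⟩ := h'.link
  rw [he] at hx hy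
  simp only [mem_singleton] at hx hy
  subst hx hy
  exact hne (outs_unique hw.outs_nodup (by simp) (by simp) hx' hy')

theorem join_same (h : Redex n m R S) (h' : Redex n m R' S') (hS : S.Nodup)
    (hS1 : ∀ e ∈ S, e ∉ nm (n ::ₘ m ::ₘ Δ)) (hS' : S'.Nodup)
    (hS1' : ∀ e ∈ S', e ∉ nm (n ::ₘ m ::ₘ Δ)) (hw : WFlow (n ::ₘ m ::ₘ Δ)) :
    Join (R + Δ) (R' + Δ) := by
  suffices R = R' ∨ Red (R + Δ) (R' + Δ) by
    rcases this with rfl | h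
    · exact ⟨_, .refl _, .refl _⟩
    · exact ⟨_, h, .refl _⟩
  obtain ⟨-, hi, ho, -⟩ := hw
  cases h <;> rename_i hn hm hR hS0 <;> cases h' <;> rename_i hn' hm' hR' hS0' <;>
    first
    | (have h0 := congrArg Node.arity (hn.symm.trans hn'); simp at h0; done)
    | (have h0 := congrArg Node.arity (hm.symm.trans hm'); simp at h0; done)
    | skip
  all_goals have hn0 := hn.symm.trans hn'
  all_goals have hm0 := hm.symm.trans hm'
  all_goals clear hn' hm'
  all_goals subst_vars
  · obtain rfl := Node.wD_inj hn0
    obtain ⟨h, rfl⟩ := Node.cD_inj hm0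
    left; grind
  · obtain rfl := Node.wU_inj hm0
    have := Node.iD_inj hn0
    left; grind
  · obtain rfl := Node.wU_inj hm0
    obtain ⟨rfl, h⟩ := Node.cU_inj hn0
    left; grind
  · obtain rfl := Node.wD_inj hn0
    rcases Node.cU_inj hm0 with ⟨-, ⟨rfl, rfl⟩ | ⟨rfl, rfl⟩⟩
    · left; rfl
    · left; rw [Multiset.pair_comm]
  · left; rfl
  · obtain ⟨⟨rfl, rfl⟩ | ⟨rfl, rfl⟩, -⟩ := Node.cD_inj hn0
    · left; rfl
    · left; rw [Multiset.pair_comm]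
  · obtain ⟨h, rfl⟩ := Node.cD_inj hn0
    obtain ⟨-, h'⟩ := Node.cU_inj hm0
    right
    clear hn0 hm0
    rename_i a b e c d p q r s a' b' c' d' p' q' r' s'
    rcases h with ⟨rfl, rfl⟩ | ⟨rfl, rfl⟩ <;> rcases h' with ⟨rfl, rfl⟩ | ⟨rfl, rfl⟩
    · exact (red_rename_cDown_cUp (Γ := Δ) ⟨hS, hS1⟩ ⟨hS', hS1'⟩).eq_eq
    · refine (red_rename_cDown_cUp (Γ := Δ) (P := q') (Q := p') (R := s') (S := r')
        ⟨hS, hS1⟩ ⟨?_, ?_⟩).eq_eq (by simp) ?_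
      · simp at hS' ⊢; grind
      · simp at hS1' ⊢; grind
      · rw [Node.cU_comm _ q', Node.cU_comm _ s']
        exact ac_eq
    · refine (red_rename_cDown_cUp (Γ := Δ) (P := r') (Q := s') (R := p') (S := q')
        ⟨hS, hS1⟩ ⟨?_, ?_⟩).eq_eq (by simp) ?_
      · simp at hS' ⊢; grind
      · simp at hS1' ⊢; grind
      · rw [Node.cD_comm r', Node.cD_comm s']
        exact ac_eq
    · refine (red_rename_cDown_cUp (Γ := Δ) (P := s') (Q := r') (R := q') (S := p')
        ⟨hS, hS1⟩ ⟨?_, ?_⟩).eq_eq (by simp) ?_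
      · simp at hS' ⊢; grind
      · simp at hS1' ⊢; grind
      · rw [Node.cD_comm r', Node.cD_comm s', Node.cU_comm _ q', Node.cU_comm _ s']
        exact ac_eq
  · obtain ⟨rfl, h'⟩ := Node.cU_inj hm0
    have h := Node.iD_inj hn0
    right
    clear hn0 hm0
    rename_i e b c d p q b' c' d' p' q'
    obtain rfl : b = b' := by grind
    rcases h' with ⟨rfl, rfl⟩ | ⟨rfl, rfl⟩
    · exact (red_rename_iDown_cUp (Γ := Δ) ⟨hS, hS1⟩ ⟨hS', hS1'⟩).eq_eq
    · refine (red_rename_iDown_cUp (Γ := Δ) (P := q') (Q := p') ⟨hS, hS1⟩ ⟨?_, ?_⟩).eq_eq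
        (by simp) ?_
      · simp at hS' ⊢; grind
      · simp at hS1' ⊢; grind
      · rw [Node.cD_comm q']
        exact ac_eq

theorem join_upper (h : Redex n m R S) (h' : Redex n m' R' S') (hne : m ≠ m') (hS : S.Nodup)
    (hS1 : ∀ e ∈ S, e ∉ nm (n ::ₘ m ::ₘ m' ::ₘ Δ)) (hS' : S'.Nodup)
    (hS1' : ∀ e ∈ S', e ∉ nm (n ::ₘ m ::ₘ m' ::ₘ Δ)) (hw : WFlow (n ::ₘ m ::ₘ m' ::ₘ Δ)) :
    Join (R + (m' ::ₘ Δ)) (R' + (m ::ₘ Δ)) := by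
  have hn1 := h.upper_outs h' hne hw
  obtain ⟨-, hi, ho, -⟩ := hw
  cases h <;> rename_i hn hm hR hS0 <;> cases h' <;> rename_i hn' hm' hR' hS0' <;>
    first
    | (have h0 := congrArg Node.arity (hn.symm.trans hn'); simp at h0; done)
    | (rw [hn] at hn1; simp [wD, cD] at hn1; done)
    | skip
  all_goals have hn0 := hn.symm.trans hn'
  all_goals clear hn'
  all_goals subst_vars
  · rename_i a b a' b'
    rcases Node.iD_inj hn0 with ⟨rfl, rfl⟩ | ⟨rfl, rfl⟩
    · simp at hne
    · exact (join_iD_wU_wU (a := a) (b := b) (Δ := Δ)).of_eq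
  · rename_i a b e b' c d p q
    rcases Node.iD_inj hn0 with ⟨rfl, rfl⟩ | ⟨rfl, rfl⟩
    · simp [wU, cU] at hi
    · exact (join_iD_wU_cU (a := b) (b := a) (c := c) (d := d) (p := p) (q := q) (Δ := Δ)).of_eq
  · rename_i a b c a' b' c'
    obtain ⟨rfl, ⟨rfl, rfl⟩ | ⟨rfl, rfl⟩⟩ := Node.cU_inj hn0
    · simp at hne
    · exact (join_cU_wU_wU (a := a) (b := b) (c := c) (Δ := Δ)).of_eq
  · rename_i e b c d p q a b'
    rcases Node.iD_inj hn0 with ⟨rfl, rfl⟩ | ⟨rfl, rfl⟩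
    · simp [wU, cU] at hi
    · exact (join_iD_wU_cU (a := e) (b := b) (c := c) (d := d) (p := p) (q := q) (Δ := Δ)).symm.of_eq
  · rename_i e b c d p q e' b' c' d' p' q'
    rcases Node.iD_inj hn0 with ⟨rfl, rfl⟩ | ⟨rfl, rfl⟩
    · simp [cU] at hi
    · exact (join_iD_cU_cU (Δ := Δ) ⟨hS, hS1⟩ ⟨hS', hS1'⟩).of_eq

theorem join_lower (h : Redex n m R S) (h' : Redex n' m R' S') (hne : n ≠ n')
    (hw : WFlow (n ::ₘ n' ::ₘ m ::ₘ Δ)) :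
    Join (R + (n' ::ₘ Δ)) (R' + (n ::ₘ Δ)) := by
  have hn1 := h.lower_ins h' hne hw
  obtain ⟨-, hi, ho, -⟩ := hw
  cases h <;> rename_i hn hm hR hS0 <;> cases h' <;> rename_i hn' hm' hR' hS0' <;>
    first
    | (have h0 := congrArg Node.arity (hm.symm.trans hm'); simp at h0; done)
    | (rw [hm] at hn1; simp [wU, cU] at hn1; done)
    | skip
  have hm0 := hm.symm.trans hm'
  clear hm'
  subst_vars
  rename_i a b c a' b' c'
  obtain ⟨⟨rfl, rfl⟩ | ⟨rfl, rfl⟩, rfl⟩ := Node.cD_inj hm0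
  · simp at hne
  · exact (join_wD_wD_cD (a := a) (b := b) (c := c) (Δ := Δ)).of_eq

theorem join_chain (h : Redex n m R S) (h' : Redex m m' R' S') (hS : S.Nodup)
    (hS1 : ∀ e ∈ S, e ∉ nm (n ::ₘ m ::ₘ m' ::ₘ Δ)) (hS' : S'.Nodup)
    (hS1' : ∀ e ∈ S', e ∉ nm (n ::ₘ m ::ₘ m' ::ₘ Δ)) :
    Join (R + (m' ::ₘ Δ)) (R' + (n ::ₘ Δ)) := by
  cases h <;> rename_i hn hm hR hS0 <;> cases h' <;> rename_i hn' hm' hR' hS0' <;>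
    first
    | (have h0 := congrArg Node.arity (hm.symm.trans hn'); simp at h0; done)
    | skip
  all_goals have hm0 := hm.symm.trans hn'
  all_goals clear hn'
  all_goals subst_vars
  · rename_i a b c a' b' c'
    obtain ⟨⟨rfl, rfl⟩ | ⟨rfl, rfl⟩, rfl⟩ := Node.cD_inj hm0
    · exact (join_wD_cD_wU (a := a) (b := b) (c := c) (Δ := Δ)).of_eq
    · exact (join_wD_cD_wU (a := a) (b := b) (c := c) (Δ := Δ)).of_eq
  · rename_i a b c a' b' e' c' d' p q r s
    obtain ⟨⟨rfl, rfl⟩ | ⟨rfl, rfl⟩, rfl⟩ := Node.cD_inj hm0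
    · refine (join_wD_cD_cU (a := a) (b := b) (Δ := Δ) ⟨hS', ?_⟩).of_eq ac_eq ?_
      · simp [nm_cons] at hS1' ⊢; grind
      · exact ac_eq
    · refine (join_wD_cD_cU (a := a) (b := b) (p := r) (q := s) (r := p) (s := q) (Δ := Δ)
        ⟨?_, ?_⟩).of_eq ac_eq ?_
      · simp at hS' ⊢; grind
      · rw [Node.cD_comm a b]
        simp [nm_cons] at hS1' ⊢; grind
      · rw [Node.cD_comm r, Node.cD_comm s]
        exact ac_eq
  · rename_i a b c a' b' c'
    obtain ⟨rfl, ⟨rfl, rfl⟩ | ⟨rfl, rfl⟩⟩ := Node.cU_inj hm0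
    · exact (join_wD_cU_wU (a := a) (b := b) (c := c) (Δ := Δ)).of_eq
    · exact (join_wD_cU_wU (a := a) (b := c) (c := b) (Δ := Δ)).of_eq
  · rename_i a b e c d p q r s a' b' c'
    obtain ⟨rfl, ⟨rfl, rfl⟩ | ⟨rfl, rfl⟩⟩ := Node.cU_inj hm0
    · exact (join_cD_cU_wU (a := a) (b := b) (Δ := Δ) ⟨hS, hS1⟩).of_eq
    · refine (join_cD_cU_wU (a := a) (b := b) (c := d) (d := c) (p := q) (q := p) (r := s) (s := r) (Δ := Δ)
        ⟨?_, ?_⟩).of_eq ?_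
      · simp at hS ⊢; grind
      · rw [Node.cU_comm e]
        simp [nm_cons] at hS1 ⊢; grind
      · rw [Node.cU_comm a, Node.cU_comm b]
        exact ac_eq
  · rename_i e b c d p q a' b' c'
    obtain ⟨rfl, ⟨rfl, rfl⟩ | ⟨rfl, rfl⟩⟩ := Node.cU_inj hm0
    · exact (join_iD_cU_wU (b := b) (Δ := Δ) ⟨hS, hS1⟩).of_eq
    · refine (join_iD_cU_wU (b := b) (c := d) (d := c) (p := q) (q := p) (Δ := Δ)
        ⟨?_, ?_⟩).of_eq ?_
      · simp at hS ⊢; grind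
      · rw [Node.cU_comm e]
        simp [nm_cons] at hS1 ⊢; grind
      · rw [Node.cD_comm q]
        exact ac_eq

end overlap

theorem Redex.ne {n m n' m' : Node} {R R' : Multiset Node} {S S' : List ℕ}
    (h : Redex n m R S) (h' : Redex n' m' R' S') {N : Multiset Node} (hw : WFlow N) (hn : n ∈ N)
    (hm : m ∈ N) : ¬ (m = n' ∧ m' = n) := by
  rintro ⟨rfl, rfl⟩
  obtain ⟨e, he, he'⟩ := h.link
  obtain ⟨f, hf, hf'⟩ := h'.link
  obtain ⟨-, -, -, d, hd⟩ := hw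
  have h1 := hd _ hn f hf' e he
  have h2 := hd _ hm e he' f hf
  omega

theorem RS.join {N N₁ N₂ : Multiset Node} (hw : WFlow N) (h₁ : RS N N₁) (h₂ : RS N N₂) :
    Join N₁ N₂ := by
  obtain ⟨n, m, R, S, Γ, h, rfl, rfl, hS, hS1⟩ := h₁.redex
  obtain ⟨n', m', R', S', Γ', h', he, rfl, hS', hS1'⟩ := h₂.redex
  clear h₁ h₂
  have hn' : n' ∈ n ::ₘ m ::ₘ Γ := by simp [he]
  have hm' : m' ∈ n ::ₘ m ::ₘ Γ := by simp [he]
  have hcyc := h.ne h' hw (by simp) (by simp)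
  have hself : m' ≠ n' := fun e => h'.ne h' hw hn' hm' ⟨e, e⟩
  by_cases e1 : n' = n <;> by_cases e2 : m' = m
  · subst e1 e2
    obtain rfl : Γ = Γ' := by simpa using he
    exact join_same h h' hS hS1 hS' hS1' hw
  · subst e1
    have : m' ∈ Γ := by simp at hm'; tauto
    obtain ⟨Δ, rfl⟩ := Multiset.exists_cons_of_mem this
    obtain rfl : Γ' = m ::ₘ Δ := by
      rw [Multiset.cons_swap m] at he; simpa using he.symm
    exact join_upper h h' (Ne.symm e2) hS hS1 hS' hS1' hw
  · subst e2
    have : n' ∈ Γ := by simp at hn'; tauto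
    obtain ⟨Δ, rfl⟩ := Multiset.exists_cons_of_mem this
    obtain rfl : Γ' = n ::ₘ Δ := by
      have : n ::ₘ m' ::ₘ n' ::ₘ Δ = n' ::ₘ m' ::ₘ n ::ₘ Δ := ac_eq
      rw [this] at he; simpa using he.symm
    rw [Multiset.cons_swap m'] at hw
    exact join_lower h h' (Ne.symm e1) hw
  · by_cases e3 : n' = m
    · subst e3
      have : m' ∈ Γ := by simp at hm'; tauto
      obtain ⟨Δ, rfl⟩ := Multiset.exists_cons_of_mem this
      obtain rfl : Γ' = n ::ₘ Δ := by
        have : n ::ₘ n' ::ₘ m' ::ₘ Δ = n' ::ₘ m' ::ₘ n ::ₘ Δ := ac_eq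
        rw [this] at he; simpa using he.symm
      exact join_chain h h' hS hS1 hS' hS1'
    have h3 : n' ∈ Γ := by simp at hn'; tauto
    by_cases e4 : m' = n
    · subst e4
      obtain ⟨Δ, rfl⟩ := Multiset.exists_cons_of_mem h3
      have e5 : m' ::ₘ m ::ₘ n' ::ₘ Δ = n' ::ₘ m' ::ₘ m ::ₘ Δ := ac_eq
      rw [e5] at he hS1 hS1'
      obtain rfl : Γ' = m ::ₘ Δ := by simpa using he.symm
      exact (join_chain h' h hS' hS1' hS hS1).symm
    · have h4 : m' ∈ Γ := by simp at hm'; tauto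
      obtain ⟨Δ', rfl⟩ := Multiset.exists_cons_of_mem h3
      have h4 : m' ∈ Δ' := by simp at h4; tauto
      obtain ⟨Δ, rfl⟩ := Multiset.exists_cons_of_mem h4
      obtain rfl : Γ' = n ::ₘ m ::ₘ Δ := by
        have : n ::ₘ m ::ₘ n' ::ₘ m' ::ₘ Δ = n' ::ₘ m' ::ₘ n ::ₘ m ::ₘ Δ := ac_eq
        rw [this] at he; simpa using he.symm
      exact join_disjoint h h' hS hS1 hS' hS1'

namespace Node

/-- Admissible bounds `d` and `u` for the numbers of downward and upward copies of edges. -/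
def Adm (d u : ℕ → ℕ) (n : Node) : Prop :=
  (n.arity = (1, 2) → (n.outs.map d).sum ≤ (n.ins.map d).sum ∧
    ∀ x ∈ n.ins, ∀ y ∈ n.outs, u x ≤ u y) ∧
  (n.arity = (2, 1) → (n.ins.map u).sum ≤ (n.outs.map u).sum ∧
    ∀ x ∈ n.ins, ∀ y ∈ n.outs, d y ≤ d x) ∧
  ∀ x y, n = iD x y → d y ≤ u x

/-- The weight of a node. -/
def wt (u : ℕ → ℕ) (n : Node) : ℕ :=
  if n.arity = (1, 2) then 10 * (n.ins.map u).sum - 3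
  else if n.arity = (2, 1) then 2 else if n.arity = (2, 0) then 0 else 1

section
variable (d u : ℕ → ℕ) (a b c : ℕ)

theorem ne_iD {n : Node} (h : n.arity ≠ (0, 2)) (x y : ℕ) : n ≠ iD x y := fun e => h (e ▸ rfl)

@[simp] theorem adm_wD : (wD a).Adm d u :=
  ⟨by simp, by simp, fun x y h => absurd h (ne_iD (by simp) x y)⟩
@[simp] theorem adm_wU : (wU a).Adm d u :=
  ⟨by simp, by simp, fun x y h => absurd h (ne_iD (by simp) x y)⟩
@[simp] theorem adm_iU : (iU a b).Adm d u :=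
  ⟨by simp, by simp, fun x y h => absurd h (ne_iD (by simp) x y)⟩
@[simp] theorem adm_cU : (cU a b c).Adm d u ↔ d b + d c ≤ d a ∧ u a ≤ u b ∧ u a ≤ u c := by
  have : ∀ x y, cU a b c ≠ iD x y := ne_iD (by simp)
  simp [Adm, this]; simp [cU]
@[simp] theorem adm_cD : (cD a b c).Adm d u ↔ u a + u b ≤ u c ∧ d c ≤ d a ∧ d c ≤ d b := by
  have : ∀ x y, cD a b c ≠ iD x y := ne_iD (by simp)
  simp [Adm, this]; simp [cD]
@[simp] theorem adm_iD : (iD a b).Adm d u ↔ d b ≤ u a ∧ d a ≤ u b := by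
  simp only [Adm, arity_iD, Prod.mk.injEq, OfNat.ofNat_ne_one, OfNat.zero_ne_ofNat, zero_ne_one,
    false_and, IsEmpty.forall_iff, true_and]
  constructor
  · intro h; exact ⟨h a b rfl, h b a (iD_comm a b)⟩
  · rintro ⟨h1, h2⟩ x y h
    rcases iD_inj h with ⟨rfl, rfl⟩ | ⟨rfl, rfl⟩ <;> assumption

@[simp] theorem wt_iD : (iD a b).wt u = 1 := by simp [wt]
@[simp] theorem wt_wD : (wD a).wt u = 1 := by simp [wt]
@[simp] theorem wt_cD : (cD a b c).wt u = 2 := by simp [wt]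
@[simp] theorem wt_iU : (iU a b).wt u = 0 := by simp [wt]
@[simp] theorem wt_wU : (wU a).wt u = 1 := by simp [wt]
@[simp] theorem wt_cU : (cU a b c).wt u = 10 * u a - 3 := by simp [wt]; simp [cU]
end

theorem adm_congr {d u d' u' : ℕ → ℕ} {n : Node} (hk : n.Kind)
    (h : ∀ x, x ∈ n.ins ∨ x ∈ n.outs → d' x = d x ∧ u' x = u x) :
    (n.Adm d' u' ↔ n.Adm d u) ∧ n.wt u' = n.wt u := by
  rcases hk with ⟨a, b, rfl⟩ | ⟨a, rfl⟩ | ⟨a, b, c, rfl⟩ | ⟨a, b, rfl⟩ | ⟨a, rfl⟩ | ⟨a, b, c, rfl⟩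
  · simp [iD] at h; simp [h]
  · simp
  · simp [cD] at h; simp [h]
  · simp
  · simp
  · simp [cU] at h; simp [h]

theorem adm_merge {d u : ℕ → ℕ} {n : Node} (hk : n.Kind) {b c : ℕ} (hd : d c ≤ d b) (hu : u b ≤ u c)
    (hc : c ∉ n.outs) (h : n.Adm d u) :
    (n.map fun e => if e = c then b else e).Adm d u ∧
      (n.map fun e => if e = c then b else e).wt u ≤ n.wt u := by
  rcases hk with ⟨a, b, rfl⟩ | ⟨a, rfl⟩ | ⟨a, b, c, rfl⟩ | ⟨a, b, rfl⟩ | ⟨a, rfl⟩ | ⟨a, b, c, rfl⟩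
  · simp [iD] at hc; simp at h ⊢; grind
  · simp
  · simp [cD] at hc; simp at h ⊢; grind
  · simp
  · simp
  · simp [cU] at hc; simp at h ⊢; grind

end Node

/-- A measure for termination. -/
def Diagram.Bounded (D : Diagram) (k : ℕ) : Prop :=
  ∃ d u : ℕ → ℕ, (∀ x, 1 ≤ d x ∧ 1 ≤ u x) ∧ (∀ n ∈ D.nodes, n.Adm d u) ∧
    (D.nodes.map (Node.wt u)).sum = k

theorem bounded_merge {d u : ℕ → ℕ} {Γ : Multiset Node} {b c : ℕ} (hk : ∀ n ∈ Γ, n.Kind)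
    (hd : d c ≤ d b) (hu : u b ≤ u c) (hc : c ∉ nouts Γ) (h : ∀ n ∈ Γ, n.Adm d u) :
    (∀ n ∈ nmap (fun e => if e = c then b else e) Γ, n.Adm d u) ∧
      ((nmap (fun e => if e = c then b else e) Γ).map (Node.wt u)).sum ≤
        (Γ.map (Node.wt u)).sum := by
  have key := fun n (hn : n ∈ Γ) => Node.adm_merge (hk n hn) hd hu
    (fun h => hc (mem_nouts.2 ⟨n, hn, h⟩)) (h n hn)
  constructor
  · intro n hn
    obtain ⟨m, hm, rfl⟩ := Multiset.mem_map.1 hn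
    exact (key m hm).1
  · rw [Multiset.map_map]
    exact Multiset.sum_map_le_sum_map _ _ fun n hn => (key n hn).2

theorem bounded_fresh {d u d' u' : ℕ → ℕ} {Γ : Multiset Node} (hk : ∀ n ∈ Γ, n.Kind)
    (h : ∀ n ∈ Γ, n.Adm d u) (hd : ∀ x ∈ nm Γ, d' x = d x ∧ u' x = u x) :
    (∀ n ∈ Γ, n.Adm d' u') ∧ (Γ.map (Node.wt u')).sum = (Γ.map (Node.wt u)).sum := by
  have key := fun n (hn : n ∈ Γ) => Node.adm_congr (hk n hn) (d := d) (u := u) (d' := d') (u' := u')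
    (fun x hx => hd x (mem_nm.2 (hx.imp (fun h => mem_nins.2 ⟨n, hn, h⟩)
      (fun h => mem_nouts.2 ⟨n, hn, h⟩))))
  exact ⟨fun n hn => (key n hn).1.2 (h n hn),
    congrArg _ (Multiset.map_congr rfl fun n hn => (key n hn).2)⟩

theorem Diagram.Step.bounded {D D' : Diagram} (h : D.Step D') (hD : D.IsFlow) {k : ℕ}
    (hk : D.Bounded k) : ∃ k' < k, D'.Bounded k' := by
  obtain ⟨d, u, hpos, hadm, rfl⟩ := hk
  have hnm := hD.nm_subset
  obtain ⟨kd, -, -, -, ho, -⟩ := hD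
  change (nouts _).Nodup at ho
  cases h with
  | wDown_cDown E Γ a b c =>
    simp only [forall_mem_cons, Node.adm_cD] at hadm
    have hc : c ∉ nouts Γ := by
      simp [cD, wD] at ho; grind
    have := bounded_merge (b := b) (c := c) (fun n hn => kd n (by simp [hn])) (by tauto)
      (by have := hpos a; omega) hc hadm.2.2
    refine ⟨_, ?_, d, u, hpos, this.1, rfl⟩
    have := this.2
    simp at this ⊢; omega
  | iDown_wUp E Γ a b =>
    exact ⟨_, by simp, d, u, hpos, by simp at hadm ⊢; tauto, rfl⟩
  | cUp_wUp E Γ a b c =>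
    simp only [forall_mem_cons, Node.adm_cU] at hadm
    have hc : c ∉ nouts Γ := by
      simp [cU, wU] at ho; grind
    have := bounded_merge (b := a) (c := c) (fun n hn => kd n (by simp [hn])) (by omega)
      (by tauto) hc hadm.2.2
    refine ⟨_, ?_, d, u, hpos, this.1, rfl⟩
    have := this.2
    simp at this ⊢; omega
  | wDown_cUp E Γ a b c =>
    refine ⟨_, ?_, d, u, hpos, by simp at hadm ⊢; tauto, rfl⟩
    have := hpos a
    simp; omega
  | wDown_wUp E Γ a =>
    exact ⟨_, by simp; omega, d, u, hpos, by simp at hadm ⊢; tauto, rfl⟩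
  | cDown_wUp E Γ a b c =>
    exact ⟨_, by simp, d, u, hpos, by simp at hadm ⊢; tauto, rfl⟩
  | cDown_cUp E Γ a b m c e p q r s fresh =>
    simp only [forall_mem_cons, Node.adm_cU, Node.adm_cD] at hadm
    simp only [nm_cons, cD, cU] at hnm
    have fr : ∀ x ∈ E, x ≠ p ∧ x ≠ q ∧ x ≠ r ∧ x ≠ s := by
      intro x hx
      have := fresh.2
      simp at this
      refine ⟨?_, ?_, ?_, ?_⟩ <;> rintro rfl <;> tauto
    have := bounded_fresh (fun n hn => kd n (by simp [hn])) hadm.2.2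
      (d' := fun x => if x = p ∨ x = r then d c else if x = q ∨ x = s then d e else d x)
      (u' := fun x => if x = p ∨ x = q then u a else if x = r ∨ x = s then u b else u x) (by
        intro x hx
        have := fr x (hnm (by simp [hx]))
        simp [this])
    refine ⟨_, ?_, fun x => if x = p ∨ x = r then d c else if x = q ∨ x = s then d e else d x, fun x => if x = p ∨ x = q then u a else if x = r ∨ x = s then u b else u x, ?_, ?_, rfl⟩
    · have := this.2
      have ha := fr a (hnm (by simp))
      have hb := fr b (hnm (by simp))
      have := hpos a
      have := hpos b
      simp [ha, hb, *]
      omega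
    · intro x
      have := hpos a; have := hpos b; have := hpos c; have := hpos e; have := hpos x
      simp only; split_ifs <;> omega
    · have ha := fr a (hnm (by simp))
      have hb := fr b (hnm (by simp))
      have hc := fr c (hnm (by simp))
      have he := fr e (hnm (by simp))
      have hf := fresh.1
      simp at hf
      simp only [forall_mem_cons, Node.adm_cU, Node.adm_cD]
      refine ⟨?_, ?_, ?_, ?_, this.1⟩ <;> grind
  | iDown_cUp E Γ m b c e p q fresh =>
    simp only [forall_mem_cons, Node.adm_cU, Node.adm_iD] at hadm
    simp only [nm_cons, iD, cU] at hnm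
    have fr : ∀ x ∈ E, x ≠ p ∧ x ≠ q := by
      intro x hx
      have := fresh.2
      simp at this
      refine ⟨?_, ?_⟩ <;> rintro rfl <;> tauto
    have := bounded_fresh (fun n hn => kd n (by simp [hn])) hadm.2.2
      (d' := fun x => if x = p ∨ x = q then d b else d x)
      (u' := fun x => if x = p then d c else if x = q then d e else u x) (by
        intro x hx
        have := fr x (hnm (by simp [hx]))
        simp [this])
    refine ⟨_, ?_, fun x => if x = p ∨ x = q then d b else d x, fun x => if x = p then d c else if x = q then d e else u x, ?_, ?_, rfl⟩
    · have := this.2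
      have := hpos m
      simp [*]
      omega
    · intro x
      have := hpos b; have := hpos c; have := hpos e; have := hpos x
      simp only; split_ifs <;> omega
    · have hb := fr b (hnm (by simp))
      have hc := fr c (hnm (by simp))
      have he := fr e (hnm (by simp))
      have hf := fresh.1
      simp at hf
      simp only [forall_mem_cons, Node.adm_iD, Node.adm_cD]
      refine ⟨?_, ?_, ?_, this.1⟩ <;> grind

theorem Diagram.IsFlow.exists_bounded {D : Diagram} (h : D.IsFlow) : ∃ k, D.Bounded k := by
  obtain ⟨kd, hi, ho, -, -, f, hf⟩ := h
  have hH : ∀ x ∈ D.edges, f x ≤ D.edges.sup f := fun x hx => Finset.le_sup hx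
  set H := D.edges.sup f
  have pw : ∀ {i j : ℕ}, i < j → 2 ^ i + 2 ^ i ≤ 2 ^ j := by
    intro i j hij
    rw [← two_mul, ← pow_succ']
    exact Nat.pow_le_pow_right (by omega) hij
  have pl : ∀ {i j : ℕ}, i ≤ j → 2 ^ i ≤ 2 ^ j := fun h => Nat.pow_le_pow_right (by omega) h
  refine ⟨_, fun x => 2 ^ (H - f x), fun x => 2 ^ (H + f x),
    fun x => ⟨Nat.one_le_two_pow, Nat.one_le_two_pow⟩, ?_, rfl⟩
  intro n hn
  rcases kd n hn with ⟨a, b, rfl⟩ | ⟨a, rfl⟩ | ⟨a, b, c, rfl⟩ | ⟨a, b, rfl⟩ | ⟨a, rfl⟩ |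
    ⟨a, b, c, rfl⟩ <;> simp only [Node.adm_iD, Node.adm_wD, Node.adm_wU, Node.adm_iU, Node.adm_cD,
      Node.adm_cU]
  · exact ⟨pl (by omega), pl (by omega)⟩
  · have h1 := hf _ hn a (by simp [cD]) c (by simp [cD])
    have h2 := hf _ hn b (by simp [cD]) c (by simp [cD])
    have h3 := pw (i := H + (max (f a) (f b))) (j := H + f c) (by omega)
    have h4 := pl (i := H + f a) (j := H + (max (f a) (f b))) (by omega)
    have h5 := pl (i := H + f b) (j := H + (max (f a) (f b))) (by omega)
    exact ⟨by omega, pl (by omega), pl (by omega)⟩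
  · have h1 := hf _ hn a (by simp [cU]) b (by simp [cU])
    have h2 := hf _ hn a (by simp [cU]) c (by simp [cU])
    have h6 := hH b (ho _ hn b (by simp [cU]))
    have h7 := hH c (ho _ hn c (by simp [cU]))
    have h3 := pw (i := H - (min (f b) (f c))) (j := H - f a) (by omega)
    have h4 := pl (i := H - f b) (j := H - (min (f b) (f c))) (by omega)
    have h5 := pl (i := H - f c) (j := H - (min (f b) (f c))) (by omega)
    exact ⟨by omega, pl (by omega), pl (by omega)⟩

theorem Diagram.Bounded.rename {D : Diagram} {k : ℕ} (h : D.Bounded k) (σ : Equiv.Perm ℕ)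
    (hk : ∀ n ∈ D.nodes, n.Kind) : (D.rename σ).Bounded k := by
  obtain ⟨d, u, hpos, hadm, rfl⟩ := h
  refine ⟨d ∘ σ.symm, u ∘ σ.symm, fun x => hpos _, ?_, ?_⟩
  · intro n hn
    obtain ⟨m, hm, rfl⟩ := Multiset.mem_map.1 hn
    have := hadm m hm
    rcases hk m hm with ⟨a, b, rfl⟩ | ⟨a, rfl⟩ | ⟨a, b, c, rfl⟩ | ⟨a, b, rfl⟩ | ⟨a, rfl⟩ |
      ⟨a, b, c, rfl⟩ <;> simpa using this
  · simp only [Diagram.rename, Multiset.map_map]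
    refine congrArg _ (Multiset.map_congr rfl fun m hm => ?_)
    rcases hk m hm with ⟨a, b, rfl⟩ | ⟨a, rfl⟩ | ⟨a, b, c, rfl⟩ | ⟨a, b, rfl⟩ | ⟨a, rfl⟩ |
      ⟨a, b, c, rfl⟩ <;> simp

theorem Flow.step_wf : WellFounded (Function.swap Flow.Step) := by
  have key : ∀ k D (hD : D.IsFlow), D.Bounded k → Acc (Function.swap Flow.Step) ⟦⟨D, hD⟩⟧ := by
    intro k
    induction k using Nat.strong_induction_on with
    | _ k ih =>
      intro D hD hb
      constructor
      rintro φ ⟨⟨D', hD'⟩, ⟨D₁, hD₁⟩, he, rfl, hs⟩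
      obtain ⟨σ, hσ⟩ := Quotient.exact he.symm
      simp only at hσ hs
      subst hσ
      obtain ⟨k', hk', hb'⟩ := hs.bounded hD' (hb.rename σ hD.kind)
      exact ih k' hk' D₁ hD₁ hb'
  refine ⟨fun φ => ?_⟩
  induction φ using Quotient.inductionOn with
  | h D =>
    obtain ⟨k, hk⟩ := D.2.exists_bounded
    exact key k D.1 D.2 hk

theorem Flow.locally_confluent {φ φ₁ φ₂ : Flow} (h₁ : Flow.Step φ φ₁) (h₂ : Flow.Step φ φ₂) :
    ∃ χ, ReflTransGen Flow.Step φ₁ χ ∧ ReflTransGen Flow.Step φ₂ χ := by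
  obtain ⟨N, N₁, N₂, hw, hs₁, hs₂, hd₁, hd₂⟩ := Flow.peak h₁ h₂
  obtain ⟨M, hM₁, hM₂⟩ := RS.join hw hs₁ hs₂
  obtain ⟨hM, k₁⟩ := hM₁ (hs₁.wflow hw)
  obtain ⟨-, k₂⟩ := hM₂ (hs₂.wflow hw)
  obtain ⟨χ, hχ⟩ := Den.exists hM
  exact ⟨χ, k₁ _ _ hd₁ hχ, k₂ _ _ hd₂ hχ⟩

theorem Flow.exists_normalForm (φ : Flow) : ∃ ψ, Flow.IsNormalForm φ ψ := by
  induction φ using Flow.step_wf.induction with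
  | _ φ ih =>
    by_cases h : ∃ χ, Flow.Step φ χ
    · obtain ⟨χ, h⟩ := h
      obtain ⟨ν, hν⟩ := ih χ h
      exact ⟨ν, .head h hν.1, hν.2⟩
    · exact ⟨φ, .refl, fun χ h' => h ⟨χ, h'⟩⟩

theorem Flow.exists_unique_normalForm (φ : Flow) : ∃! ψ, Flow.IsNormalForm φ ψ := by
  induction φ using Flow.step_wf.induction with
  | _ φ ih =>
    by_cases hφ : ∃ χ, Flow.Step φ χ
    · obtain ⟨χ, hχ⟩ := hφ
      obtain ⟨ψ, hψ, hu⟩ := ih χ hχ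
      refine ⟨ψ, ⟨.head hχ hψ.1, hψ.2⟩, ?_⟩
      rintro ψ' ⟨h', hn'⟩
      rcases h'.cases_head with rfl | ⟨χ', hχ', h'⟩
      · exact absurd hχ (hn' _)
      obtain ⟨ω, hω, hω'⟩ := Flow.locally_confluent hχ hχ'
      obtain ⟨ψ₁, hψ₁, hu₁⟩ := ih χ' hχ'
      have e1 := hu₁ ψ' ⟨h', hn'⟩
      obtain ⟨ν, hν⟩ := Flow.exists_normalForm ω
      have e2 := hu ν ⟨hω.trans hν.1, hν.2⟩
      have e3 := hu₁ ν ⟨hω'.trans hν.1, hν.2⟩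
      rw [e1, ← e3, e2]
    · exact ⟨φ, ⟨.refl, fun χ h => hφ ⟨χ, h⟩⟩, fun ψ ⟨h, _⟩ => by
        rcases h.cases_head with rfl | ⟨χ, h, -⟩
        · rfl
        · exact absurd ⟨χ, h⟩ hφ⟩

/-! ### Substitution of patterns for atoms -/

namespace Fm

/-- Substitution. -/
def bind {α β : Type} (f : α → Fm β) : Fm α → Fm β
  | top => top
  | bot => bot
  | atom a => f a
  | and A B => and (A.bind f) (B.bind f)
  | or A B => or (A.bind f) (B.bind f)

theorem Eqv.bind {α β : Type} (f : α → Fm β) {A B : Fm α} (h : Eqv A B) :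
    Eqv (A.bind f) (B.bind f) := by
  induction h with
  | refl => exact .refl _
  | symm _ ih => exact .symm ih
  | trans _ _ ih₁ ih₂ => exact .trans ih₁ ih₂
  | and_congr C _ ih => exact .and_congr _ ih
  | or_congr C _ ih => exact .or_congr _ ih
  | or_comm A B => exact .or_comm _ _
  | and_comm A B => exact .and_comm _ _
  | or_assoc A B C => exact .or_assoc _ _ _
  | and_assoc A B C => exact .and_assoc _ _ _
  | or_bot A => exact .or_bot _
  | and_top A => exact .and_top _
  | top_or_top => exact .top_or_top
  | bot_and_bot => exact .bot_and_bot

/-- Labellings of the atom occurrences of a formula. -/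
def GLab {α : Type} (β : Type) : Fm α → Type
  | top | bot => Unit
  | atom _ => β
  | and A B | or A B => A.GLab β × B.GLab β

variable {α β : Type}

/-- The labels, read from left to right. -/
def GLab.toList : (A : Fm α) → A.GLab β → List β
  | top, _ => []
  | bot, _ => []
  | atom _, p => [p]
  | and A B, l => GLab.toList A l.1 ++ GLab.toList B l.2
  | or A B, l => GLab.toList A l.1 ++ GLab.toList B l.2

/-- The labelling by the values of a function at the positions, counted from `n`. -/
def GLab.tab (f : ℕ → β) : (A : Fm α) → ℕ → A.GLab β
  | top, _ => ()
  | bot, _ => ()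
  | atom _, n => f n
  | and A B, n => (GLab.tab f A n, GLab.tab f B (n + A.numAtoms))
  | or A B, n => (GLab.tab f A n, GLab.tab f B (n + A.numAtoms))

/-- Apply a function to labels that are numbers. -/
def GLab.ofLab (f : ℕ → β) : (A : Fm α) → A.Lab → A.GLab β
  | top, _ => ()
  | bot, _ => ()
  | atom _, n => f n
  | and A B, l => (GLab.ofLab f A l.1, GLab.ofLab f B l.2)
  | or A B, l => (GLab.ofLab f A l.1, GLab.ofLab f B l.2)

@[simp] theorem GLab.length_toList (A : Fm α) (l : A.GLab β) :
    (GLab.toList A l).length = A.numAtoms := by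
  induction A with
  | top | bot | atom a => rfl
  | and A B ihA ihB | or A B ihA ihB => simp [toList, numAtoms, ihA, ihB]

theorem GLab.toList_ofLab (f : ℕ → β) (A : Fm α) (l : A.Lab) :
    GLab.toList A (GLab.ofLab f A l) = (Lab.toList A l).map f := by
  induction A with
  | top | bot | atom a => rfl
  | and A B ihA ihB | or A B ihA ihB => simp [toList, ofLab, Lab.toList, ihA, ihB]

theorem GLab.toList_tab (f : ℕ → β) (A : Fm α) (n : ℕ) :
    GLab.toList A (GLab.tab f A n) = (List.range' n A.numAtoms).map f := by
  induction A generalizing n with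
  | top | bot | atom a => rfl
  | and A B ihA ihB | or A B ihA ihB =>
    simp only [toList, tab, numAtoms, ihA, ihB]
    rw [← List.map_append, List.range'_append_1]

/-- Replace the atom occurrence `a` with label `p` by `s a p`. -/
def sub (s : α → β → Fm α) : (A : Fm α) → A.GLab β → Fm α
  | top, _ => top
  | bot, _ => bot
  | atom a, p => s a p
  | and A B, l => and (sub s A l.1) (sub s B l.2)
  | or A B, l => or (sub s A l.1) (sub s B l.2)

/-- The labelling of `sub s A l` that numbers consecutively, from `off i` on, the atom occurrences
that replace an occurrence labelled `i`. -/
def slots (s : α → β → Fm α) (off : ℕ → ℕ) :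
    (A : Fm α) → A.Lab → (l : A.GLab β) → (sub s A l).Lab
  | top, _, _ => ()
  | bot, _, _ => ()
  | atom a, i, p => (s a p).numbering (off i)
  | and A B, t, l => (slots s off A t.1 l.1, slots s off B t.2 l.2)
  | or A B, t, l => (slots s off A t.1 l.1, slots s off B t.2 l.2)

section
variable {s : α → β → Fm α} {w : β → ℕ} (hw : ∀ a p, (s a p).numAtoms = w p)
include hw

theorem numAtoms_sub (A : Fm α) (l : A.GLab β) :
    (sub s A l).numAtoms = ((GLab.toList A l).map w).sum := by
  induction A with
  | top | bot => rfl
  | atom a => simp [sub, GLab.toList]; exact hw a l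
  | and A B ihA ihB | or A B ihA ihB => simp [sub, GLab.toList, numAtoms, ihA, ihB]

theorem bind_decorate_numbering [Inhabited β] (ps : List β) (A : Fm α) (l : A.GLab β)
    (pre post : List β) (h : ps = pre ++ (GLab.toList A l ++ post)) :
    (A.decorate (A.numbering pre.length)).bind
      (fun e => (s e.1 (ps.getD e.2 default)).decorate
        ((s e.1 (ps.getD e.2 default)).numbering ((ps.take e.2).map w).sum)) =
    (sub s A l).decorate ((sub s A l).numbering (pre.map w).sum) := by
  induction A generalizing pre post with
  | top | bot => rfl
  | atom a =>
    have key : ∀ p : β, ps = pre ++ ([p] ++ post) →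
        (s a (ps.getD pre.length default)).decorate
          ((s a (ps.getD pre.length default)).numbering ((ps.take pre.length).map w).sum) =
        (s a p).decorate ((s a p).numbering (pre.map w).sum) := by
      intro p hp
      have h1 : ps.getD pre.length default = p := by subst hp; simp [List.getD]
      have h2 : ps.take pre.length = pre := by subst hp; simp
      rw [h1, h2]
    exact key l h
  | and A B ihA ihB | or A B ihA ihB =>
    simp only [decorate, numbering, bind, sub]
    rw [ihA l.1 pre (GLab.toList B l.2 ++ post) (by simp [h, GLab.toList])]
    have := ihB l.2 (pre ++ GLab.toList A l.1) post (by simp [h, GLab.toList])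
    simp only [List.length_append, GLab.length_toList] at this
    rw [this, numAtoms_sub hw A]; simp

omit hw in
theorem bind_decorate (f : ℕ → β) (off : ℕ → ℕ) (A : Fm α) (t : A.Lab) (l : A.GLab β)
    (h : GLab.toList A l = (Lab.toList A t).map f) :
    (A.decorate t).bind (fun e => (s e.1 (f e.2)).decorate ((s e.1 (f e.2)).numbering (off e.2))) =
    (sub s A l).decorate (slots s off A t l) := by
  induction A with
  | top | bot => rfl
  | atom a =>
    have key : ∀ (p : β) (i : ℕ), [p] = [i].map f →
        (s a (f i)).decorate ((s a (f i)).numbering (off i)) =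
          (s a p).decorate ((s a p).numbering (off i)) := by
      intro p i hp
      obtain rfl : p = f i := by simpa using hp
      rfl
    exact key l t h
  | and A B ihA ihB | or A B ihA ihB =>
    simp only [GLab.toList, Lab.toList, List.map_append] at h
    have h' := List.append_inj h (by simp [Lab.length_toList])
    simp only [decorate, bind, sub, slots]
    rw [ihA _ _ h'.1, ihB _ _ h'.2]

theorem toList_slots (off : ℕ → ℕ) (A : Fm α) (t : A.Lab) (l : A.GLab β) :
    Lab.toList (sub s A l) (slots s off A t l) =
      (List.zipWith (fun i p => List.range' (off i) (w p)) (Lab.toList A t)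
        (GLab.toList A l)).flatten := by
  induction A with
  | top | bot => rfl
  | atom a =>
    have key : ∀ (p : β) (i : ℕ), Lab.toList (s a p) ((s a p).numbering (off i)) =
        (List.zipWith (fun i p => List.range' (off i) (w p)) [i] [p]).flatten := by
      intro p i
      simp [toList_numbering, hw]
    exact key l t
  | and A B ihA ihB | or A B ihA ihB =>
    simp only [slots, sub, Lab.toList, GLab.toList]
    rw [List.zipWith_append (by simp [Lab.length_toList]), List.flatten_append, ihA, ihB]

theorem Eqv.sub_eqv [Inhabited β] {A B : Fm α} {t : B.Lab}
    (h : Eqv (A.decorate (A.numbering 0)) (B.decorate t)) (l : A.GLab β) (m : B.GLab β)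
    (hm : GLab.toList B m = (Lab.toList B t).map ((GLab.toList A l).getD · default)) :
    Eqv ((sub s A l).decorate ((sub s A l).numbering 0))
      ((sub s B m).decorate (slots s (fun i => (((GLab.toList A l).take i).map w).sum) B t m)) := by
  rw [← bind_decorate (s := s) _ _ B t m hm]
  have := bind_decorate_numbering hw (GLab.toList A l) A l [] [] (by simp)
  simp only [List.length_nil, List.map_nil, List.sum_nil] at this
  rw [← this]
  exact h.bind _

end

theorem Eqv.perm {A B : Fm α} {t : B.Lab}
    (h : Eqv (A.decorate (A.numbering 0)) (B.decorate t)) :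
    (Lab.toList B t).Perm (List.range A.numAtoms) := by
  have h1 := congrArg (Multiset.map Prod.snd) h.atoms_eq
  rw [atoms_decorate, atoms_decorate, toList_numbering] at h1
  rw [List.range_eq_range']
  exact (Multiset.coe_eq_coe.1 h1).symm

end Fm

/-- Patterns for the copies of an edge. -/
inductive Pat : Type
  | unit : Pat
  | leaf : Pat
  | node (p q : Pat) : Pat

instance : Inhabited Pat := ⟨.leaf⟩

namespace Pat

/-- The number of leaves. -/
def leaves : Pat → ℕ
  | unit => 0
  | leaf => 1
  | node p q => p.leaves + q.leaves

/-- The conjunction of copies of an atom arranged according to a pattern. -/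
def fm (a : Lit) : Pat → Formula
  | unit => .top
  | leaf => .atom a
  | node p q => .and (p.fm a) (q.fm a)

theorem numAtoms_fm (a : Lit) (p : Pat) : (p.fm a).numAtoms = p.leaves := by
  induction p with
  | unit | leaf => rfl
  | node p q ihp ihq => simp [fm, Fm.numAtoms, leaves, ihp, ihq]

end Pat

/-- Keep an atom or replace it by `⊥`. -/
def keep (a : Lit) : Bool → Formula
  | true => .atom a
  | false => .bot

theorem numAtoms_keep (a : Lit) (b : Bool) : (keep a b).numAtoms = if b then 1 else 0 := by
  cases b <;> rfl

/-- The formula in which atoms are copied according to labels. -/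
abbrev copies (A : Formula) (l : A.GLab Pat) : Formula := A.sub Pat.fm l

/-- The formula in which the atoms labelled `false` are replaced by `⊥`. -/
abbrev erase (A : Formula) (l : A.GLab Bool) : Formula := A.sub keep l

/-! ### Building derivations -/

namespace Der

/-- A derivation that consists of one rule instance. -/
def inf {A B : Formula} (ρ : Inf A B) : Der A B := step (fm A) ρ (fm B)

/-- Rewriting a formula without permuting its atoms. -/
def re (A B : Formula)
    (h : Fm.Eqv (A.decorate (A.numbering 0)) (B.decorate (B.numbering 0))) : Der A B :=
  inf (.eq (B.numbering 0) h)

/-- Composition. -/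
def comp {A B C : Formula} (Φ : Der A B) (Ψ : Der B C) : Der A C :=
  step Φ (.eq (B.numbering 0) (.refl _)) Ψ

/-- Change the conclusion to an equal formula. -/
def castR {A B C : Formula} (h : B = C) (Φ : Der A B) : Der A C := h ▸ Φ

end Der

/-- Commutativity of disjunction. -/
def Inf.orComm (A B : Formula) : Inf (.or A B) (.or B A) :=
  .eq (B.numbering (0 + A.numAtoms), A.numbering 0) (.or_comm _ _)

/-- Commutativity of conjunction. -/
def Inf.andComm (A B : Formula) : Inf (.and A B) (.and B A) :=
  .eq (B.numbering (0 + A.numAtoms), A.numbering 0) (.and_comm _ _)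

/-- Substitution in an instance of the rule `=`. -/
def eqSub {β : Type} [Inhabited β] (s : Lit → β → Formula) (w : β → ℕ)
    (hw : ∀ a p, (s a p).numAtoms = w p) {A B : Formula} (t : B.Lab)
    (h : Fm.Eqv (A.decorate (A.numbering 0)) (B.decorate t)) (l : A.GLab β) (m : B.GLab β)
    (hm : Fm.GLab.toList B m = (Fm.Lab.toList B t).map ((Fm.GLab.toList A l).getD · default)) :
    Der (A.sub s l) (B.sub s m) :=
  .inf (.eq _ (h.sub_eqv hw l m hm))

open Der Fm

theorem Fm.Eqv.bot_bot_top : Eqv (bot : Fm (Lit × ℕ)) (and bot (or bot top)) :=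
  .trans (.symm (.and_top _)) (.and_congr _ (.trans (.symm (.or_bot _)) (.or_comm _ _)))

theorem Fm.Eqv.bot_bot_or_top : Eqv (or (and bot bot) top : Fm (Lit × ℕ)) top :=
  .trans (.or_comm _ _) (.trans (.or_congr _ .bot_and_bot) (.or_bot _))

theorem Fm.Eqv.top_and {α : Type} (A : Fm α) : Eqv A (and top A) :=
  .symm (.trans (.and_comm _ _) (.and_top _))

theorem Fm.Eqv.bot_or {α : Type} (A : Fm α) : Eqv (or bot A) A :=
  .trans (.or_comm _ _) (.or_bot _)

/-- A derivation from `⊥` to `⊤`. -/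
def botTop : Der .bot .top :=
  comp (re .bot (.and .bot (.or .bot .top)) .bot_bot_top)
    (comp (inf (.switch .bot .bot .top)) (re (.or (.and .bot .bot) .top) .top .bot_bot_or_top))

/-- Weakening with copies of an atom. -/
def weak (a : Lit) : (p : Pat) → Der .bot (p.fm a)
  | .unit => botTop
  | .leaf => inf (.wDown a)
  | .node p q => comp (re .bot (.and .bot .bot) (.symm .bot_and_bot)) (.and (weak a p) (weak a q))

/-- Contraction of copies of an atom. -/
def contr (a : Lit) : (p : Pat) → Der (.or (p.fm a) (p.fm a)) (p.fm a)
  | .unit => re (.or .top .top) .top .top_or_top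
  | .leaf => inf (.cDown a)
  | .node p q => comp (inf (.medial _ _ _ _)) (.and (contr a p) (contr a q))

/-- `(B ∨ C) ∧ (A ∨ C) → (A ∧ B) ∨ C`, if `C ∨ C → C`. -/
def distribute (A B C : Formula) (Φ : Der (.or C C) C) :
    Der (.and (.or B C) (.or A C)) (.or (.and A B) C) :=
  comp (inf (.switch (.or B C) A C)) <|
  comp (.or (comp (inf (Inf.andComm (.or B C) A)) (inf (.switch A B C))) (.fm C)) <|
  comp (re (.or (.or (.and A B) C) C) (.or (.and A B) (.or C C)) (by
      simpa [decorate, numbering, numAtoms, add_assoc] using .or_assoc _ _ _))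
    (.or (.fm (.and A B)) Φ)

/-- Disjunctions of `C` and copies of an atom `a`, obtained from `a ∨ C`. -/
def spread (a : Lit) (C : Formula) (κ : Der (.or C C) C) (ω : Der .bot C)
    (Φ : Der .top (.or (.atom a) C)) : (p : Pat) → Der .top (.or (p.fm a) C)
  | .unit => comp (re .top (.or .top .bot) (.symm (.or_bot _))) (.or (.fm .top) ω)
  | .leaf => Φ
  | .node p q => comp (re .top (.and .top .top) (.symm (.and_top _))) <|
      comp (.and (spread a C κ ω Φ q) (spread a C κ ω Φ p)) (distribute (p.fm a) (q.fm a) C κ)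

/-- Identity with copies of the atoms. -/
def iden (a : Lit) (p q : Pat) : Der .top (.or (p.fm a) (q.fm a.dual)) :=
  spread a (q.fm a.dual) (contr a.dual q) (weak a.dual q)
    (comp (spread a.dual (.atom a) (contr a .leaf) (weak a .leaf)
      (comp (inf (.iDown a)) (inf (.orComm _ _))) q) (inf (.orComm _ _))) p

/-- The pattern for the upper edge of a cocontraction, from those for the lower edges. If `m` holds,
the cocontraction is kept. -/
def Pat.join (m : Bool) : Pat → Pat → Pat
  | unit, q => q
  | leaf, unit => leaf
  | leaf, leaf => if m then leaf else node leaf leaf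
  | leaf, node r s => node leaf (node r s)
  | node r s, unit => node r s
  | node r s, leaf => node (node r s) leaf
  | node r s, node r' s' => node (node r s) (node r' s')

/-- Cocontraction with copies of the atom. -/
def cocontr (a : Lit) : (m : Bool) → (p q : Pat) →
    Der ((p.join m q).fm a) (.and (p.fm a) (q.fm a))
  | _, .unit, q => re (q.fm a) (.and .top (q.fm a)) (by
      simpa [decorate, numbering, numAtoms] using .top_and _)
  | _, .leaf, .unit => re (.atom a) (.and (.atom a) .top) (.symm (.and_top _))
  | true, .leaf, .leaf => inf (.cUp a)
  | false, .leaf, .leaf => .fm _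
  | _, .leaf, .node _ _ => .fm _
  | _, .node r s, .unit =>
    re ((Pat.node r s).fm a) (.and ((Pat.node r s).fm a) .top) (.symm (.and_top _))
  | _, .node _ _, .leaf => .fm _
  | _, .node _ _, .node _ _ => .fm _

/-- Labels of the premiss of a rule instance, from those of the conclusion. -/
def Inf.upLab (m : Bool) : {A B : Formula} → Inf A B → B.GLab Pat → A.GLab Pat
  | A, B, eq t _, l =>
    GLab.tab (fun i => (GLab.toList B l).getD ((Lab.toList B t).idxOf i) default) A 0
  | _, _, iDown _, _ => ()
  | _, _, wDown _, _ => ()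
  | _, _, cDown _, p => (p, p)
  | _, _, iUp _, _ => (Pat.leaf, Pat.leaf)
  | _, _, wUp _, _ => Pat.unit
  | _, _, cUp _, l => Pat.join m l.1 l.2
  | _, _, switch _ _ _, l => (l.1.1, (l.1.2, l.2))
  | _, _, medial _ _ _ _, l => ((l.1.1, l.2.1), (l.1.2, l.2.2))

theorem getD_idxOf {β : Type} [Inhabited β] {n : ℕ} {t : List ℕ} {l : List β}
    (ht : t.Perm (List.range n)) (hl : l.length = t.length) :
    l = t.map (fun i => (((List.range n).map
      fun i => l.getD (t.idxOf i) default).getD i default)) := by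
  apply List.ext_getElem
  · simp [hl]
  · intro i h1 h2
    have h3 : i < t.length := by omega
    have h4 : t[i] < n := List.mem_range.1 (ht.subset (List.getElem_mem h3))
    have h5 : t.Nodup := ht.nodup_iff.2 List.nodup_range
    simp [h4, h5.idxOf_getElem, h1]

/-- Labels and derivation for the rule instance after copying. -/
def Inf.up (m : Bool) : {A B : Formula} → (ρ : Inf A B) → (l : B.GLab Pat) →
    Der (copies A (ρ.upLab m l)) (copies B l)
  | A, B, eq t h, l => eqSub Pat.fm Pat.leaves Pat.numAtoms_fm t h _ l (by
      rw [upLab, GLab.toList_tab, ← List.range_eq_range']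
      exact getD_idxOf h.perm (by simp [Lab.length_toList]))
  | _, _, iDown a, l => iden a l.1 l.2
  | _, _, wDown a, p => weak a p
  | _, _, cDown a, p => contr a p
  | _, _, iUp a, _ => .inf (.iUp a)
  | _, _, wUp _, _ => .fm .top
  | _, _, cUp a, l => cocontr a m l.1 l.2
  | _, _, switch A B C, l => .inf (.switch (copies A l.1.1) (copies B l.1.2) (copies C l.2))
  | _, _, medial A B C D, l => .inf (.medial (copies A l.1.1) (copies B l.2.1) (copies C l.1.2)
      (copies D l.2.2))

/-- Labels of the premiss of a derivation, from those of the conclusion. -/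
def Der.upLab (m : Bool) : {A B : Formula} → Der A B → B.GLab Pat → A.GLab Pat
  | _, _, fm _, l => l
  | _, _, and Φ Ψ, l => (Φ.upLab m l.1, Ψ.upLab m l.2)
  | _, _, or Φ Ψ, l => (Φ.upLab m l.1, Ψ.upLab m l.2)
  | _, _, step Φ ρ Ψ, l => Φ.upLab m (ρ.upLab m (Ψ.upLab m l))

/-- Permute coweakenings and cocontractions upwards. -/
def Der.up (m : Bool) : {A B : Formula} → (Φ : Der A B) → (l : B.GLab Pat) →
    Der (copies A (Φ.upLab m l)) (copies B l)
  | _, _, fm A, l => fm (copies A l)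
  | _, _, and Φ Ψ, l => and (Φ.up m l.1) (Ψ.up m l.2)
  | _, _, or Φ Ψ, l => or (Φ.up m l.1) (Ψ.up m l.2)
  | _, _, step Φ ρ Ψ, l =>
    comp (Φ.up m (ρ.upLab m (Ψ.upLab m l))) (comp (ρ.up m (Ψ.upLab m l)) (Ψ.up m l))

/-- Weakening of an atom that is labelled `false`. -/
def fillAtom (a : Lit) : (b : Bool) → Der (keep a b) (.atom a)
  | true => .fm (.atom a)
  | false => .inf (.wDown a)

/-- Weakenings for all atoms that are labelled `false`. -/
def fill : (A : Formula) → (l : A.GLab Bool) → Der (erase A l) A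
  | .top, _ => .fm .top
  | .bot, _ => .fm .bot
  | .atom a, b => fillAtom a b
  | .and A B, l => .and (fill A l.1) (fill B l.2)
  | .or A B, l => .or (fill A l.1) (fill B l.2)

/-- Contraction of atoms that may be missing. -/
def mergeD (a : Lit) : (p q : Bool) → Der (.or (keep a p) (keep a q)) (keep a (p || q))
  | false, false => re (.or .bot .bot) .bot (.or_bot _)
  | false, true => re (.or .bot (.atom a)) (.atom a) (.bot_or _)
  | true, false => re (.or (.atom a) .bot) (.atom a) (.or_bot _)
  | true, true => .inf (.cDown a)

/-- Cocontraction of an atom that may be missing. -/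
def splitD (a : Lit) : (p : Bool) → Der (keep a p) (.and (keep a p) (keep a p))
  | false => re .bot (.and .bot .bot) (.symm .bot_and_bot)
  | true => .inf (.cUp a)

/-- Labels of the conclusion of a rule instance, from those of the premiss. -/
def Inf.downLab : {A B : Formula} → Inf A B → A.GLab Bool → B.GLab Bool
  | A, B, eq t _, l => GLab.ofLab ((GLab.toList A l).getD · default) B t
  | _, _, iDown _, _ => (true, true)
  | _, _, wDown _, _ => false
  | _, _, cDown _, l => (l.1 || l.2 : Bool)
  | _, _, iUp _, _ => ()
  | _, _, wUp _, _ => ()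
  | _, _, cUp _, b => (b, b)
  | _, _, switch _ _ _, l => ((l.1, l.2.1), l.2.2)
  | _, _, medial _ _ _ _, l => ((l.1.1, l.2.1), (l.1.2, l.2.2))

/-- The derivation for a rule instance some of whose atoms are missing. -/
def Inf.down : {A B : Formula} → (ρ : Inf A B) → (l : A.GLab Bool) →
    Der (erase A l) (erase B (ρ.downLab l))
  | A, B, eq t h, l => eqSub keep _ numAtoms_keep t h l _ (GLab.toList_ofLab _ _ _)
  | _, _, iDown a, _ => .inf (.iDown a)
  | _, _, wDown _, _ => .fm .bot
  | _, _, cDown a, l => mergeD a l.1 l.2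
  | _, _, iUp a, l => comp (.and (fillAtom a l.1) (fillAtom a.dual l.2)) (.inf (.iUp a))
  | _, _, wUp a, b => comp (fillAtom a b) (.inf (.wUp a))
  | _, _, cUp a, b => splitD a b
  | _, _, switch A B C, l => .inf (.switch (erase A l.1) (erase B l.2.1) (erase C l.2.2))
  | _, _, medial A B C D, l => .inf (.medial (erase A l.1.1) (erase B l.1.2) (erase C l.2.1)
      (erase D l.2.2))

/-- Labels of the conclusion of a derivation, from those of the premiss. -/
def Der.downLab : {A B : Formula} → Der A B → A.GLab Bool → B.GLab Bool
  | _, _, fm _, l => l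
  | _, _, and Φ Ψ, l => (Φ.downLab l.1, Ψ.downLab l.2)
  | _, _, or Φ Ψ, l => (Φ.downLab l.1, Ψ.downLab l.2)
  | _, _, step Φ ρ Ψ, l => Ψ.downLab (ρ.downLab (Φ.downLab l))

/-- Permute weakenings downwards. -/
def Der.down : {A B : Formula} → (Φ : Der A B) → (l : A.GLab Bool) →
    Der (erase A l) (erase B (Φ.downLab l))
  | _, _, fm A, l => fm (erase A l)
  | _, _, and Φ Ψ, l => and (Φ.down l.1) (Ψ.down l.2)
  | _, _, or Φ Ψ, l => or (Φ.down l.1) (Ψ.down l.2)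
  | _, _, step Φ ρ Ψ, l =>
    comp (Φ.down l) (comp (ρ.down (Φ.downLab l)) (Ψ.down (ρ.downLab (Φ.downLab l))))

/-- Copies of one atom. -/
def copyAtom (a : Lit) : (p : Pat) → Der (.atom a) (p.fm a)
  | .unit => .inf (.wUp a)
  | .leaf => .fm (.atom a)
  | .node p q => comp (.inf (.cUp a)) (.and (copyAtom a p) (copyAtom a q))

/-- Copies of all atoms, as prescribed by the labels. -/
def copyAll : (A : Formula) → (l : A.GLab Pat) → Der A (copies A l)
  | .top, _ => .fm .top
  | .bot, _ => .fm .bot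
  | .atom a, p => copyAtom a p
  | .and A B, l => .and (copyAll A l.1) (copyAll B l.2)
  | .or A B, l => .or (copyAll A l.1) (copyAll B l.2)

/-- The labelling with a constant label. -/
def const {β : Type} (b : β) (A : Formula) : A.GLab β := GLab.tab (fun _ => b) A 0

theorem copies_const (A : Formula) (n : ℕ) :
    copies A (GLab.tab (fun _ => .leaf) A n) = A := by
  induction A generalizing n with
  | top | bot | atom a => rfl
  | and A B ihA ihB => exact congrArg₂ Fm.and (ihA n) (ihB _)
  | or A B ihA ihB => exact congrArg₂ Fm.or (ihA n) (ihB _)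

theorem erase_const (A : Formula) (n : ℕ) : erase A (GLab.tab (fun _ => true) A n) = A := by
  induction A generalizing n with
  | top | bot | atom a => rfl
  | and A B ihA ihB => exact congrArg₂ Fm.and (ihA n) (ihB _)
  | or A B ihA ihB => exact congrArg₂ Fm.or (ihA n) (ihB _)

namespace Der
variable {A B : Formula}

/-- Change the premiss to an equal formula. -/
def castL {A B C : Formula} (h : A = C) (Φ : Der A B) : Der C B := h ▸ Φ

/-- The premiss after a pass upwards. -/
abbrev lab (m : Bool) (Φ : Der A B) : A.GLab Pat := Φ.upLab m (const .leaf B)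

/-- A pass upwards. -/
def raise (m : Bool) (Φ : Der A B) : Der (copies A (Φ.lab m)) B :=
  castR (copies_const B 0) (Φ.up m (const .leaf B))

/-- A pass downwards. -/
def lower (Φ : Der A B) : Der A B :=
  comp (castL (erase_const A 0) (Φ.down (const true A))) (fill B (Φ.downLab (const true A)))

/-- A derivation after coweakenings have been permuted upwards and weakenings downwards. -/
def trim (Φ : Der A B) : Der (copies A (Φ.lab true)) B := (Φ.raise true).lower

/-- The derivation whose flow is the normal form of the flow of `Φ`. -/
def normalize (Φ : Der A B) : Der A B :=
  comp (copyAll A (Φ.lab true)) (comp (copyAll _ (Φ.trim.lab false)) (Φ.trim.raise false))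

end Der

/-! ### Realizations of derivations by diagrams with wires -/

/-- A chain of wires from one edge to another. -/
inductive Chain : ℕ → ℕ → Multiset Node → Prop
  | nil (a : ℕ) : Chain a a 0
  | cons {a b c : ℕ} {N : Multiset Node} : Chain b c N → Chain a c (.wire a b ::ₘ N)

theorem Chain.append {a b c : ℕ} {N M : Multiset Node} (h : Chain a b N) (h' : Chain b c M) :
    Chain a c (N + M) := by
  induction h with
  | nil a => simpa using h'
  | cons _ ih => rw [Multiset.cons_add]; exact .cons (ih h')

/-- Chains of wires between edges in the same positions of two lists. -/
inductive Chains : List ℕ → List ℕ → Multiset Node → Prop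
  | nil : Chains [] [] 0
  | cons {a b : ℕ} {i o : List ℕ} {N M : Multiset Node} : Chain a b N → Chains i o M →
      Chains (a :: i) (b :: o) (N + M)

theorem Chains.refl (i : List ℕ) : Chains i i 0 := by
  induction i with
  | nil => exact .nil
  | cons a i ih => simpa using Chains.cons (.nil a) ih

theorem Chains.length {i o : List ℕ} {N : Multiset Node} (h : Chains i o N) :
    i.length = o.length := by
  induction h with
  | nil => rfl
  | cons _ _ ih => simp [ih]

theorem Chains.append {i o i' o' : List ℕ} {N M : Multiset Node} (h : Chains i o N)
    (h' : Chains i' o' M) : Chains (i ++ i') (o ++ o') (N + M) := by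
  induction h with
  | nil => simpa using h'
  | cons h _ ih => rw [add_assoc]; exact .cons h ih

theorem Chains.trans {i x o : List ℕ} {N M : Multiset Node} (h : Chains i x N)
    (h' : Chains x o M) : Chains i o (N + M) := by
  induction h generalizing o M with
  | nil => cases h'; simpa using Chains.nil
  | cons h _ ih =>
    cases h' with
    | cons h₁ h₂ =>
      rw [add_add_add_comm]; exact .cons (h.append h₁) (ih h₂)

/-- Diagrams that lie side by side, one for each position of two lists. -/
inductive Par {β : Type} (R : β → ℕ → List ℕ → Multiset Node → Prop) :
    List β → List ℕ → List ℕ → Multiset Node → Prop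
  | nil : Par R [] [] [] 0
  | cons {p : β} {x : ℕ} {y : List ℕ} {N : Multiset Node} {ps : List β} {xs ys : List ℕ}
      {M : Multiset Node} : R p x y N → Par R ps xs ys M →
      Par R (p :: ps) (x :: xs) (y ++ ys) (N + M)

section Par
variable {β : Type} {R : β → ℕ → List ℕ → Multiset Node → Prop}

theorem Par.append {ps qs : List β} {xs ys xs' ys' : List ℕ} {N M : Multiset Node}
    (h : Par R ps xs ys N) (h' : Par R qs xs' ys' M) :
    Par R (ps ++ qs) (xs ++ xs') (ys ++ ys') (N + M) := by
  induction h with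
  | nil => simpa using h'
  | cons h _ ih => rw [add_assoc, List.append_assoc]; exact .cons h ih

theorem Par.split {ps qs : List β} {xs xs' ys : List ℕ} {N : Multiset Node}
    (h : Par R (ps ++ qs) (xs ++ xs') ys N) (hl : ps.length = xs.length) :
    ∃ y y' M M', ys = y ++ y' ∧ N = M + M' ∧ Par R ps xs y M ∧ Par R qs xs' y' M' := by
  induction ps generalizing xs ys N with
  | nil =>
    obtain rfl : xs = [] := List.length_eq_zero_iff.1 hl.symm
    exact ⟨[], ys, 0, N, rfl, by simp, .nil, h⟩
  | cons p ps ih =>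
    cases xs with
    | nil => simp at hl
    | cons x xs =>
      cases h with
      | cons h₁ h₂ =>
        obtain ⟨y, y', M, M', rfl, rfl, h₃, h₄⟩ := ih h₂ (by simpa using hl)
        exact ⟨_, y', _, M', (List.append_assoc _ _ _).symm, (add_assoc _ _ _).symm, .cons h₁ h₃,
          h₄⟩

theorem Par.single {p : β} {x : ℕ} {y : List ℕ} {N : Multiset Node} (h : R p x y N) :
    Par R [p] [x] y N := by simpa using Par.cons h .nil

theorem Par.of_single {p : β} {x : ℕ} {y : List ℕ} {N : Multiset Node} (h : Par R [p] [x] y N) :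
    R p x y N := by
  cases h with
  | cons h h' => cases h'; simpa using h

theorem Par.of_pair {p q : β} {x x' : ℕ} {y : List ℕ} {N : Multiset Node}
    (h : Par R [p, q] [x, x'] y N) :
    ∃ z z' M M', y = z ++ z' ∧ N = M + M' ∧ R p x z M ∧ R q x' z' M' := by
  obtain ⟨z, z', M, M', h1, h2, h3, h4⟩ := Par.split (ps := [p]) (xs := [x]) h rfl
  exact ⟨z, z', M, M', h1, h2, h3.of_single, h4.of_single⟩

/-- A list of instances of `R`. -/
theorem Par.iff {ps : List β} {xs ys : List ℕ} {N : Multiset Node} :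
    Par R ps xs ys N ↔ ∃ L : List (β × ℕ × List ℕ × Multiset Node),
      (∀ e ∈ L, R e.1 e.2.1 e.2.2.1 e.2.2.2) ∧ ps = L.map (·.1) ∧ xs = L.map (·.2.1) ∧
      ys = (L.map (·.2.2.1)).flatten ∧ N = (L.map (·.2.2.2)).sum := by
  constructor
  · intro h
    induction h with
    | nil => exact ⟨[], by simp⟩
    | cons h _ ih =>
      obtain ⟨L, h1, rfl, rfl, rfl, rfl⟩ := ih
      exact ⟨(_, _, _, _) :: L, List.forall_mem_cons.2 ⟨h, h1⟩, rfl, rfl, rfl, rfl⟩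
  · rintro ⟨L, h, rfl, rfl, rfl, rfl⟩
    induction L with
    | nil => exact .nil
    | cons e L ih =>
      exact .cons (h e (by simp)) (ih fun e he => h e (by simp [he]))

end Par

theorem getD_append_range {β : Type} (a b c : List β) (d : β) :
    (List.range' a.length b.length).map (fun i => (a ++ (b ++ c)).getD i d) = b := by
  apply List.ext_getElem
  · simp
  · intro i h1 h2
    simp only [List.length_map, List.length_range'] at h1
    simp [List.getD, List.getElem?_append, h1]

theorem flatten_slots {β : Type} (LL : List (List β)) (d : β) (i : ℕ) (hi : i < LL.length) :
    (List.range' ((LL.take i).map List.length).sum (LL[i]).length).map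
      (fun j => LL.flatten.getD j d) = LL[i] := by
  have h1 : LL = LL.take i ++ (LL[i] :: LL.drop (i + 1)) := by simp
  have h2 : LL.flatten = (LL.take i).flatten ++ (LL[i] ++ (LL.drop (i + 1)).flatten) := by
    conv_lhs => rw [h1]
    rw [List.flatten_append, List.flatten_cons]
  rw [h2]
  have h3 : ((LL.take i).map List.length).sum = (LL.take i).flatten.length := by
    rw [List.length_flatten]
  rw [h3]
  exact getD_append_range _ _ _ _

section perm
variable {β : Type} [Inhabited β] {R : β → ℕ → List ℕ → Multiset Node → Prop} {w : β → ℕ}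
  (hR : ∀ p x y N, R p x y N → y.length = w p)
include hR

theorem Par.permute {ps : List β} {xs ys : List ℕ} {N : Multiset Node} (h : Par R ps xs ys N)
    {t : List ℕ} (ht : t.Perm (List.range ps.length)) :
    Par R (t.map (ps.getD · default)) (t.map (xs.getD · 0))
      ((t.map fun i => List.range' ((ps.take i).map w).sum (w (ps.getD i default))).flatten.map
        (ys.getD · 0)) N := by
  obtain ⟨L, hL, rfl, rfl, rfl, rfl⟩ := Par.iff.1 h
  have hd : ∀ i ∈ t, i < L.length := fun i hi => by simpa using ht.subset hi
  rw [Par.iff]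
  refine ⟨t.map (fun i => L.getD i (default, 0, [], 0)), ?_, ?_, ?_, ?_, ?_⟩
  · intro e he
    obtain ⟨i, hi, rfl⟩ := List.mem_map.1 he
    have h := hd i hi
    rw [List.getD_eq_getElem _ _ h]
    exact hL _ (List.getElem_mem h)
  · rw [List.map_map]
    refine List.map_congr_left fun i hi => ?_
    have h := hd i hi
    simp [List.getD, h]
  · rw [List.map_map]
    refine List.map_congr_left fun i hi => ?_
    have h := hd i hi
    simp [List.getD, h]
  · rw [List.map_flatten, List.map_map, List.map_map]
    congr 1
    refine List.map_congr_left fun i hi => ?_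
    have h := hd i hi
    have h2 := flatten_slots (L.map (·.2.2.1)) 0 i (by simpa using h)
    simp only [Function.comp_apply, List.getD_eq_getElem _ _ h]
    rw [List.getD_eq_getElem _ _ (by simpa using h)]
    have h3 : ∀ e ∈ L, w e.1 = e.2.2.1.length := fun e he => (hR _ _ _ _ (hL e he)).symm
    have h4 : ((L.map (·.1)).take i).map w = ((L.map (·.2.2.1)).take i).map List.length := by
      rw [← List.map_take, ← List.map_take, List.map_map, List.map_map]
      exact List.map_congr_left fun e he => h3 e (List.mem_of_mem_take he)
    rw [h4]
    simp only [List.getElem_map] at h2 ⊢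
    rw [h3 _ (List.getElem_mem h)]
    exact h2
  · rw [List.map_map]
    have h1 : (t.map ((·.2.2.2) ∘ fun i => L.getD i (default, 0, [], 0))).Perm
        ((List.range L.length).map ((·.2.2.2) ∘ fun i => L.getD i (default, 0, [], 0))) := by
      refine List.Perm.map _ ?_
      simpa using ht
    rw [h1.sum_eq]
    congr 1
    apply List.ext_getElem
    · simp
    · intro i h1 h2
      simp at h1
      simp [h1]

theorem Par.unpermute {ps : List β} {xs o : List ℕ} {N : Multiset Node} {t : List ℕ}
    (ht : t.Perm (List.range ps.length)) (hx : xs.length = ps.length)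
    (h : Par R (t.map (ps.getD · default)) (t.map (xs.getD · 0)) o N) :
    ∃ ys, Par R ps xs ys N ∧ o =
      (t.map fun i => List.range' ((ps.take i).map w).sum (w (ps.getD i default))).flatten.map
        (ys.getD · 0) := by
  have hlen : t.length = ps.length := by simpa using ht.length_eq
  have hnd : t.Nodup := ht.nodup_iff.2 List.nodup_range
  have hmem : ∀ i, i < ps.length → t.idxOf i < t.length := fun i hi =>
    List.idxOf_lt_length_iff.2 (ht.symm.subset (List.mem_range.2 hi))
  obtain ⟨L, hL, h1, h2, rfl, rfl⟩ := Par.iff.1 h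
  have hLl : L.length = t.length := by simpa using (congrArg List.length h1).symm
  have e1 : ∀ i (h : i < L.length) (h' : i < t.length), L[i].1 = ps.getD t[i] default := by
    intro i h h'
    have := List.getElem_of_eq h1 (i := i) (by simpa using h')
    simpa using this.symm
  have e2 : ∀ i (h : i < L.length) (h' : i < t.length), L[i].2.1 = xs.getD t[i] 0 := by
    intro i h h'
    have := List.getElem_of_eq h2 (i := i) (by simpa using h')
    simpa using this.symm
  let L' := (List.range ps.length).map (fun i => L.getD (t.idxOf i) (default, 0, [], 0))
  have hL' : L'.length = ps.length := by simp [L']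
  have hP : Par R ps xs (L'.map (·.2.2.1)).flatten (L.map (·.2.2.2)).sum := by
    rw [Par.iff]
    refine ⟨L', ?_, ?_, ?_, rfl, ?_⟩
    · intro e he
      obtain ⟨i, hi, rfl⟩ := List.mem_map.1 he
      have h := hmem i (by simpa using hi)
      rw [← hLl] at h
      simp only [List.getD_eq_getElem _ _ h]
      exact hL _ (List.getElem_mem h)
    · apply List.ext_getElem
      · simp [L']
      · intro i h3 h4
        have h5 := hmem i h3
        have h6 : t.idxOf i < L.length := hLl ▸ h5
        simp only [L', List.getElem_map, List.getElem_range, List.getD_eq_getElem _ _ h6]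
        rw [e1 _ h6 h5]
        simp [h3]
    · apply List.ext_getElem
      · simp [L', hx]
      · intro i h3 h4
        have h5 := hmem i (hx ▸ h3)
        have h6 : t.idxOf i < L.length := hLl ▸ h5
        simp only [L', List.getElem_map, List.getElem_range, List.getD_eq_getElem _ _ h6]
        rw [e2 _ h6 h5]
        simp [h3]
    · have h3 : L'.Perm (t.map (fun i => L.getD (t.idxOf i) (default, 0, [], 0))) :=
        (ht.symm.map _)
      rw [(h3.map _).sum_eq]
      congr 2
      apply List.ext_getElem
      · simp [hLl]
      · intro i h4 h5
        have h6 : i < t.length := by simpa using h5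
        simp [hnd.idxOf_getElem, h4]
  refine ⟨_, hP, ?_⟩
  rw [List.map_flatten, List.map_map]
  congr 1
  apply List.ext_getElem
  · simp [hLl]
  · intro i h3 h4
    have h6 : i < t.length := by simpa using h4
    have h7 : t[i] < ps.length := by simpa using ht.subset (List.getElem_mem h6)
    have h8 : i < L.length := by omega
    have h9 := flatten_slots (L'.map (·.2.2.1)) 0 t[i] (by simpa [hL'] using h7)
    have e3 : L'[t[i]] = L[i] := by
      simp [L', hnd.idxOf_getElem, h8]
    have h10 : w (ps.getD t[i] default) = L[i].2.2.1.length := by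
      rw [← e1 i h8 h6, hR _ _ _ _ (hL _ (List.getElem_mem h8))]
    have h11 : (ps.take t[i]).map w = ((L'.map (·.2.2.1)).take t[i]).map List.length := by
      apply List.ext_getElem
      · simp [hL']
      · intro j h12 h13
        have h14 : j < ps.length := by simp at h12; omega
        have h15 := hmem j h14
        have h16 : t.idxOf j < L.length := by omega
        have h17 := hR _ _ _ _ (hL _ (List.getElem_mem h16))
        simp only [List.getElem_map, List.getElem_take, L', List.getElem_range,
          List.getD_eq_getElem _ _ h16]
        rw [h17, e1 _ h16 h15]
        simp [h14]
    simp only [List.getElem_map, Function.comp_apply, h10, h11]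
    simp only [List.getElem_map, e3] at h9
    exact h9.symm

end perm

/-- Reduction in all contexts. -/
def LRed (N N' : Multiset Node) : Prop := ∀ Γ, Red (N + Γ) (N' + Γ)

theorem LRed.refl (N : Multiset Node) : LRed N N := fun _ => .refl _

theorem LRed.trans {N M K : Multiset Node} (h : LRed N M) (h' : LRed M K) : LRed N K :=
  fun Γ => (h Γ).trans (h' Γ)

theorem LRed.add {N N' M M' : Multiset Node} (h : LRed N N') (h' : LRed M M') :
    LRed (N + M) (N' + M') := fun Γ =>
  (h (M + Γ)).trans ((h' (N' + Γ)).eq_eq (by ac_rfl) (by ac_rfl)) |>.eq_eq (by ac_rfl) rfl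

theorem LRed.eq_eq {A B X Y : Multiset Node} (h : LRed A B) (e : X = A) (e' : B = Y) : LRed X Y :=
  e ▸ e' ▸ h

theorem WFlow.ne_of_mem {N : Multiset Node} (h : WFlow N) {n : Node} (hn : n ∈ N) {a b : ℕ}
    (ha : a ∈ n.ins) (hb : b ∈ n.outs) : a ≠ b := by
  obtain ⟨-, -, -, d, hd⟩ := h
  have := hd n hn a ha b hb
  rintro rfl; omega

theorem LRed.wire_wU (a b : ℕ) : LRed {.wire a b, .wU b} {.wU a} := fun Γ =>
  (red_wire_down (b := a) (c := b) (M := {.wU b}) (Γ := Γ) (by simp [wU])).eq_eq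
    (by simp) (by simp)

theorem LRed.wire_cU (a b c d : ℕ) : LRed {.wire a b, .cU b c d} {.cU a c d} := fun Γ =>
  Red.with fun hw => by
    have h1 := hw.ne_of_mem (n := .cU b c d) (a := b) (b := c) (by simp) (by simp [cU])
      (by simp [cU])
    have h2 := hw.ne_of_mem (n := .cU b c d) (a := b) (b := d) (by simp) (by simp [cU])
      (by simp [cU])
    exact (red_wire_down (b := a) (c := b) (M := {.cU b c d}) (Γ := Γ) (by simp [cU])).eq_eq
      (by simp) (by simp [h1.symm, h2.symm])

theorem LRed.wire_wD (a b : ℕ) : LRed {.wire a b, .wD a} {.wD b} := fun Γ =>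
  (red_wire_up (b := a) (c := b) (M := {.wD a}) (Γ := Γ) (by simp [wD])).eq_eq
    (by simp) (by simp)

/-- The diagrams that copy an edge according to a pattern. -/
def Op : Pat → ℕ → List ℕ → Multiset Node → Prop
  | .unit, x, ys, N => ys = [] ∧ N = {.wU x}
  | .leaf, x, ys, N => ∃ y, ys = [y] ∧ Chain x y N
  | .node p q, x, ys, N => ∃ b c y z P Q, ys = y ++ z ∧ N = .cU x b c ::ₘ (P + Q) ∧
      Op p b y P ∧ Op q c z Q

/-- The diagrams that produce an edge from an edge or from nothing. -/
def Cl : Bool → ℕ → List ℕ → Multiset Node → Prop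
  | true, x, ys, N => ∃ y, ys = [y] ∧ Chain y x N
  | false, x, ys, N => ys = [] ∧ N = {.wD x}

theorem Op.length (p : Pat) (x : ℕ) (ys : List ℕ) (N : Multiset Node) (h : Op p x ys N) :
    ys.length = p.leaves := by
  induction p generalizing x ys N with
  | unit => simp [h.1, Pat.leaves]
  | leaf => obtain ⟨y, rfl, -⟩ := h; rfl
  | node p q ihp ihq =>
    obtain ⟨b, c, y, z, P, Q, rfl, -, h1, h2⟩ := h
    simp [Pat.leaves, ihp _ _ _ h1, ihq _ _ _ h2]

theorem Cl.length (p : Bool) (x : ℕ) (ys : List ℕ) (N : Multiset Node) (h : Cl p x ys N) :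
    ys.length = if p then 1 else 0 := by
  cases p
  · simp [h.1]
  · obtain ⟨y, rfl, -⟩ := h; rfl

theorem Op.pre {p : Pat} {a b : ℕ} {ys : List ℕ} {C P : Multiset Node} (h : Chain a b C)
    (h' : Op p b ys P) : ∃ P', Op p a ys P' ∧ LRed (C + P) P' := by
  induction h generalizing P with
  | nil a => exact ⟨P, h', (LRed.refl P).eq_eq (by simp) rfl⟩
  | @cons a b c N h ih =>
    obtain ⟨P₁, h₁, r⟩ := ih h'
    suffices ∃ P', Op p a ys P' ∧ LRed (.wire a b ::ₘ P₁) P' by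
      obtain ⟨P', h₂, r'⟩ := this
      exact ⟨P', h₂, (((LRed.refl {.wire a b}).add r).eq_eq (by simp [add_assoc])
        (by simp)).trans r'⟩
    cases p with
    | unit =>
      obtain ⟨rfl, rfl⟩ := h₁
      exact ⟨_, ⟨rfl, rfl⟩, LRed.wire_wU a b⟩
    | leaf =>
      obtain ⟨y, rfl, h₁⟩ := h₁
      exact ⟨_, ⟨y, rfl, h₁.cons⟩, .refl _⟩
    | node p q =>
      obtain ⟨c, d, y, z, P, Q, rfl, rfl, h2, h3⟩ := h₁
      exact ⟨_, ⟨c, d, y, z, P, Q, rfl, rfl, h2, h3⟩,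
        ((LRed.wire_cU a b c d).add (.refl (P + Q))).eq_eq (by simp) (by simp)⟩

theorem Cl.post {p : Bool} {a b : ℕ} {ys : List ℕ} {C P : Multiset Node} (h : Chain a b C)
    (h' : Cl p a ys P) : ∃ P', Cl p b ys P' ∧ LRed (P + C) P' := by
  induction h generalizing P with
  | nil a => exact ⟨P, h', (LRed.refl P).eq_eq (by simp) rfl⟩
  | @cons a b c N h ih =>
    suffices ∃ P', Cl p b ys P' ∧ LRed (.wire a b ::ₘ P) P' by
      obtain ⟨P₁, h₂, r'⟩ := this
      obtain ⟨P', h₁, r⟩ := ih h₂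
      exact ⟨P', h₁, ((r'.add (.refl N)).eq_eq
        ac_eq rfl).trans r⟩
    cases p with
    | false =>
      obtain ⟨rfl, rfl⟩ := h'
      exact ⟨_, ⟨rfl, rfl⟩, LRed.wire_wD a b⟩
    | true =>
      obtain ⟨y, rfl, h₁⟩ := h'
      exact ⟨_, ⟨y, rfl, h₁.append (.cons (.nil b))⟩, (LRed.refl _).eq_eq rfl
        (by rw [← singleton_add, add_comm]; simp)⟩

theorem Par.pre {ps : List Pat} {i x ys : List ℕ} {C P : Multiset Node} (h : Chains i x C)
    (h' : Par Op ps x ys P) : ∃ P', Par Op ps i ys P' ∧ LRed (C + P) P' := by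
  induction h generalizing ps ys P with
  | nil => exact ⟨P, h', (LRed.refl P).eq_eq (by simp) rfl⟩
  | cons h _ ih =>
    cases h' with
    | cons h1 h2 =>
      obtain ⟨P₁, h3, r⟩ := ih h2
      obtain ⟨P₂, h4, r'⟩ := Op.pre h h1
      exact ⟨_, .cons h4 h3, (r'.add r).eq_eq (by ac_rfl) rfl⟩

theorem Par.post {ps : List Bool} {x o ys : List ℕ} {C P : Multiset Node} (h : Chains x o C)
    (h' : Par Cl ps x ys P) : ∃ P', Par Cl ps o ys P' ∧ LRed (P + C) P' := by
  induction h generalizing ps ys P with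
  | nil => exact ⟨P, h', (LRed.refl P).eq_eq (by simp) rfl⟩
  | cons h _ ih =>
    cases h' with
    | cons h1 h2 =>
      obtain ⟨P₁, h3, r⟩ := ih h2
      obtain ⟨P₂, h4, r'⟩ := Cl.post h h1
      exact ⟨_, .cons h4 h3, (r'.add r).eq_eq (by ac_rfl) rfl⟩

/-- `ρ.Real i o N`: with edges `i` above and `o` below, `N` is the diagram of `ρ`. -/
def Inf.Real : {A B : Formula} → Inf A B → List ℕ → List ℕ → Multiset Node → Prop
  | A, B, eq t _, i, o, N =>
    i.length = A.numAtoms ∧ o = (Lab.toList B t).map (i.getD · 0) ∧ N = 0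
  | _, _, iDown _, i, o, N => ∃ a b, i = [] ∧ o = [a, b] ∧ N = {.iD a b}
  | _, _, wDown _, i, o, N => ∃ a, i = [] ∧ o = [a] ∧ N = {.wD a}
  | _, _, cDown _, i, o, N => ∃ a b c, i = [a, b] ∧ o = [c] ∧ N = {.cD a b c}
  | _, _, iUp _, i, o, N => ∃ a b, i = [a, b] ∧ o = [] ∧ N = {.iU a b}
  | _, _, wUp _, i, o, N => ∃ a, i = [a] ∧ o = [] ∧ N = {.wU a}
  | _, _, cUp _, i, o, N => ∃ a b c, i = [a] ∧ o = [b, c] ∧ N = {.cU a b c}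
  | _, _, switch A B C, i, o, N =>
    i.length = A.numAtoms + (B.numAtoms + C.numAtoms) ∧ o = i ∧ N = 0
  | _, _, medial A B C D, i, o, N => ∃ a b c d : List ℕ, a.length = A.numAtoms ∧
      b.length = B.numAtoms ∧ c.length = C.numAtoms ∧ d.length = D.numAtoms ∧
      i = (a ++ b) ++ (c ++ d) ∧ o = (a ++ c) ++ (b ++ d) ∧ N = 0

/-- `Φ.Real i o N`: with edges `i` above and `o` below, `N` is the diagram of `Φ`, possibly with
wires at formulae. -/
def Der.Real : {A B : Formula} → Der A B → List ℕ → List ℕ → Multiset Node → Prop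
  | _, _, fm A, i, o, N => i.length = A.numAtoms ∧ Chains i o N
  | _, _, and Φ Ψ, i, o, N => ∃ i₁ i₂ o₁ o₂ N₁ N₂, i = i₁ ++ i₂ ∧ o = o₁ ++ o₂ ∧ N = N₁ + N₂ ∧
      Φ.Real i₁ o₁ N₁ ∧ Ψ.Real i₂ o₂ N₂
  | _, _, or Φ Ψ, i, o, N => ∃ i₁ i₂ o₁ o₂ N₁ N₂, i = i₁ ++ i₂ ∧ o = o₁ ++ o₂ ∧ N = N₁ + N₂ ∧
      Φ.Real i₁ o₁ N₁ ∧ Ψ.Real i₂ o₂ N₂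
  | _, _, step Φ ρ Ψ, i, o, N => ∃ x y N₁ N₂ N₃, N = N₁ + N₂ + N₃ ∧ Φ.Real i x N₁ ∧
      ρ.Real x y N₂ ∧ Ψ.Real y o N₃

theorem Fm.Eqv.numAtoms_eq {A B : Formula} {t : B.Lab}
    (h : Eqv (A.decorate (A.numbering 0)) (B.decorate t)) : B.numAtoms = A.numAtoms := by
  simpa [Lab.length_toList] using h.perm.length_eq

theorem Inf.Real.length {A B : Formula} {ρ : Inf A B} {i o : List ℕ} {N : Multiset Node}
    (h : ρ.Real i o N) : i.length = A.numAtoms ∧ o.length = B.numAtoms := by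
  cases ρ with
  | eq t h' => obtain ⟨h1, rfl, -⟩ := h; exact ⟨h1, by simp [Lab.length_toList]⟩
  | iDown a => obtain ⟨a, b, rfl, rfl, -⟩ := h; exact ⟨rfl, rfl⟩
  | wDown a => obtain ⟨a, rfl, rfl, -⟩ := h; exact ⟨rfl, rfl⟩
  | cDown a => obtain ⟨a, b, c, rfl, rfl, -⟩ := h; exact ⟨rfl, rfl⟩
  | iUp a => obtain ⟨a, b, rfl, rfl, -⟩ := h; exact ⟨rfl, rfl⟩
  | wUp a => obtain ⟨a, rfl, rfl, -⟩ := h; exact ⟨rfl, rfl⟩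
  | cUp a => obtain ⟨a, b, c, rfl, rfl, -⟩ := h; exact ⟨rfl, rfl⟩
  | switch A B C => obtain ⟨h, rfl, -⟩ := h; exact ⟨h, by simp [numAtoms, h, add_assoc]⟩
  | medial A B C D =>
    obtain ⟨a, b, c, d, ha, hb, hc, hd, rfl, rfl, -⟩ := h
    simp [numAtoms, ha, hb, hc, hd, add_assoc]

theorem Der.Real.length {A B : Formula} {Φ : Der A B} {i o : List ℕ} {N : Multiset Node}
    (h : Φ.Real i o N) : i.length = A.numAtoms ∧ o.length = B.numAtoms := by
  induction Φ generalizing i o N with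
  | fm A => exact ⟨h.1, h.2.length ▸ h.1⟩
  | and Φ Ψ ih₁ ih₂ | or Φ Ψ ih₁ ih₂ =>
    obtain ⟨i₁, i₂, o₁, o₂, N₁, N₂, rfl, rfl, -, h₁, h₂⟩ := h
    simp [numAtoms, ih₁ h₁, ih₂ h₂]
  | step Φ ρ Ψ ih₁ ih₂ =>
    obtain ⟨x, y, N₁, N₂, N₃, -, h₁, -, h₃⟩ := h
    exact ⟨(ih₁ h₁).1, (ih₂ h₃).2⟩

namespace Der
variable {A B C D : Formula} {i x o i' o' : List ℕ} {N M K : Multiset Node}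

theorem Real.of_fm (h : i.length = A.numAtoms) : (fm A).Real i i 0 := ⟨h, .refl i⟩

theorem Real.and {Φ : Der A B} {Ψ : Der C D} (h : Φ.Real i o N) (h' : Ψ.Real i' o' M) :
    (Φ.and Ψ).Real (i ++ i') (o ++ o') (N + M) := ⟨_, _, _, _, _, _, rfl, rfl, rfl, h, h'⟩

theorem Real.or {Φ : Der A B} {Ψ : Der C D} (h : Φ.Real i o N) (h' : Ψ.Real i' o' M) :
    (Φ.or Ψ).Real (i ++ i') (o ++ o') (N + M) := ⟨_, _, _, _, _, _, rfl, rfl, rfl, h, h'⟩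

theorem map_getD_range (l : List ℕ) : (List.range' 0 l.length).map (l.getD · 0) = l := by
  simpa using getD_append_range [] l [] 0

theorem Real.comp {Φ : Der A B} {Ψ : Der B C} (h : Φ.Real i x N) (h' : Ψ.Real x o M) :
    (Φ.comp Ψ).Real i o (N + M) := by
  refine ⟨x, x, N, 0, M, by simp, h, ⟨h.length.2, ?_, rfl⟩, h'⟩
  rw [toList_numbering, ← h.length.2, map_getD_range]

theorem Real.inf_chains {ρ : Inf A B} (h : Chains i' i M) (h' : ρ.Real i o N) (h'' : Chains o o' K) :
    (Der.inf ρ).Real i' o' (M + N + K) :=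
  ⟨i, o, M, N, K, rfl, ⟨h.length.trans h'.length.1, h⟩, h', ⟨h'.length.2, h''⟩⟩

theorem Real.inf {ρ : Inf A B} (h' : ρ.Real i o N) : (Der.inf ρ).Real i o N := by
  simpa using Real.inf_chains (.refl i) h' (.refl o)

theorem Real.re {h} (hi : i.length = A.numAtoms) : (Der.re A B h).Real i i 0 := by
  refine Real.inf ⟨hi, ?_, rfl⟩
  rw [toList_numbering, h.numAtoms_eq, ← hi, map_getD_range]

theorem Real.castR {h : B = C} {Φ : Der A B} (hΦ : Φ.Real i o N) : (Der.castR h Φ).Real i o N := by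
  subst h; exact hΦ

theorem Real.castL {h : A = C} {Φ : Der A B} (hΦ : Φ.Real i o N) : (Der.castL h Φ).Real i o N := by
  subst h; exact hΦ

theorem comm_labels (h : i.length = A.numAtoms) (h' : i'.length = B.numAtoms) :
    (List.range' (0 + A.numAtoms) B.numAtoms ++ List.range' 0 A.numAtoms).map
      ((i ++ i').getD · 0) = i' ++ i := by
  rw [List.map_append, zero_add, ← h, ← h']
  congr 1
  · simpa using getD_append_range i i' [] 0
  · simpa using getD_append_range [] i i' 0

theorem Real.andComm (h : i.length = A.numAtoms) (h' : i'.length = B.numAtoms) :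
    (Der.inf (Inf.andComm A B)).Real (i ++ i') (i' ++ i) 0 := by
  refine Real.inf ⟨by simp [h, h', numAtoms], ?_, rfl⟩
  simp only [Lab.toList, toList_numbering]
  exact (comm_labels h h').symm

theorem Real.orComm (h : i.length = A.numAtoms) (h' : i'.length = B.numAtoms) :
    (Der.inf (Inf.orComm A B)).Real (i ++ i') (i' ++ i) 0 := by
  refine Real.inf ⟨by simp [h, h', numAtoms], ?_, rfl⟩
  simp only [Lab.toList, toList_numbering]
  exact (comm_labels h h').symm

theorem Real.distribute {Φ : Der (.or C C) C} {a b c c' z : List ℕ} (ha : a.length = A.numAtoms)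
    (hb : b.length = B.numAtoms) (hc : c.length = C.numAtoms) (hc' : c'.length = C.numAtoms)
    (h : Φ.Real (c ++ c') z N) :
    (distribute A B C Φ).Real ((b ++ c) ++ (a ++ c')) ((a ++ b) ++ z) N := by
  have h1 : (Der.inf (.switch (.or B C) A C)).Real ((b ++ c) ++ (a ++ c')) (((b ++ c) ++ a) ++ c') 0 :=
    Real.inf ⟨by simp [numAtoms, ha, hb, hc, hc', add_assoc], by simp, rfl⟩
  have h2 := Real.andComm (A := .or B C) (B := A) (i := b ++ c) (i' := a)
    (by simp [numAtoms, hb, hc]) ha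
  have h3 : (Der.inf (.switch A B C)).Real (a ++ (b ++ c)) ((a ++ b) ++ c) 0 :=
    Real.inf ⟨by simp [ha, hb, hc], by simp, rfl⟩
  have h4 := Real.of_fm hc'
  have h5 : (Der.re (.or (.or (.and A B) C) C) (.or (.and A B) (.or C C)) (by
      simpa [decorate, numbering, numAtoms, add_assoc] using .or_assoc _ _ _)).Real
      (((a ++ b) ++ c) ++ c') ((a ++ b) ++ (c ++ c')) 0 := by
    convert Real.re _ using 1
    · simp
    · simp [numAtoms, ha, hb, hc, hc', add_assoc]
  have h6 := Real.of_fm (A := .and A B) (i := a ++ b) (by simp [numAtoms, ha, hb])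
  have := h1.comp (((h2.comp h3).or h4).comp (h5.comp (h6.or h)))
  simpa [SKS.distribute] using this

end Der

/-- In every context, `N` reduces to some diagram that satisfies `Q`. -/
def Sim (N : Multiset Node) (Q : Multiset Node → Prop) : Prop :=
  ∀ Γ, ∃ N', Q N' ∧ Red (N + Γ) (N' + Γ)

section Sim
variable {N M N' : Multiset Node} {Q Q' S : Multiset Node → Prop}

theorem LRed.sim (h : LRed N N') (hQ : Q N') : Sim N Q := fun Γ => ⟨N', hQ, h Γ⟩

theorem Sim.of (hQ : Q N) : Sim N Q := (LRed.refl N).sim hQ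

theorem Sim.bind (h : Sim N Q) (h' : ∀ N', Q N' → Sim N' S) : Sim N S := fun Γ => by
  obtain ⟨N₁, h₁, r₁⟩ := h Γ
  obtain ⟨N₂, h₂, r₂⟩ := h' N₁ h₁ Γ
  exact ⟨N₂, h₂, r₁.trans r₂⟩

theorem LRed.bind (h : LRed N N') (h' : Sim N' S) : Sim N S := Sim.bind (Q := fun K => K = N') (h.sim rfl)
  fun _ e => e ▸ h'

theorem Sim.mono (h : Sim N Q) (h' : ∀ N', Q N' → S N') : Sim N S :=
  h.bind fun N' hN => .of (h' N' hN)

theorem Sim.add (h : Sim N Q) (h' : Sim M Q')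
    (hS : ∀ N' M', Q N' → Q' M' → S (N' + M')) : Sim (N + M) S := fun Γ => by
  obtain ⟨N₁, h₁, r₁⟩ := h (M + Γ)
  obtain ⟨N₂, h₂, r₂⟩ := h' (N₁ + Γ)
  exact ⟨N₁ + N₂, hS _ _ h₁ h₂, (r₁.eq_eq (by ac_rfl) (by ac_rfl)).trans
    (r₂.eq_eq (A := M + (N₁ + Γ)) rfl (by ac_rfl))⟩

theorem Sim.frame (h : Sim N Q) (M : Multiset Node) (hS : ∀ N', Q N' → S (N' + M)) :
    Sim (N + M) S := h.add (Q' := fun K => K = M) (.of rfl) fun _ _ h₁ h₂ => h₂ ▸ hS _ h₁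

theorem Sim.frame_bind (h : Sim N Q) (h' : ∀ N', Q N' → Sim (N' + M) S) : Sim (N + M) S :=
  (h.frame M (S := fun K => ∃ N', Q N' ∧ K = N' + M) fun _ h => ⟨_, h, rfl⟩).bind
    fun _ ⟨_, h, e⟩ => e ▸ h' _ h

theorem Sim.congr (h : Sim N Q) (e : M = N) : Sim M Q := e ▸ h

end Sim

theorem RS.lred {N N' : Multiset Node} (h : ∀ Γ, RS (N + Γ) (N' + Γ)) : LRed N N' :=
  fun Γ => (h Γ).red

theorem LRed.wD_cD (a b c : ℕ) : LRed {.wD a, .cD a b c} {.wire b c} :=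
  RS.lred fun Γ => by simpa using RS.wDown_cDown Γ a b c
theorem LRed.wD_cD' (a b c : ℕ) : LRed {.wD b, .cD a b c} {.wire a c} :=
  Node.cD_comm a b c ▸ LRed.wD_cD b a c
theorem LRed.iD_wU (a b : ℕ) : LRed {.iD a b, .wU a} {.wD b} :=
  RS.lred fun Γ => by simpa using RS.iDown_wUp Γ a b
theorem LRed.cU_wU (a b c : ℕ) : LRed {.cU a b c, .wU b} {.wire a c} :=
  RS.lred fun Γ => by simpa using RS.cUp_wUp Γ a b c
theorem LRed.cU_wU' (a b c : ℕ) : LRed {.cU a b c, .wU c} {.wire a b} :=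
  Node.cU_comm a b c ▸ LRed.cU_wU a c b
theorem LRed.wD_cU (a b c : ℕ) : LRed {.wD a, .cU a b c} {.wD b, .wD c} :=
  RS.lred fun Γ => by simpa using RS.wDown_cUp Γ a b c
theorem LRed.wD_wU (a : ℕ) : LRed {.wD a, .wU a} 0 :=
  RS.lred fun Γ => by simpa using RS.wDown_wUp Γ a
theorem LRed.cD_wU (a b c : ℕ) : LRed {.cD a b c, .wU c} {.wU a, .wU b} :=
  RS.lred fun Γ => by simpa using RS.cDown_wUp Γ a b c

theorem Sim.cD_cU (a b m c d : ℕ) : Sim {.cD a b m, .cU m c d}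
    (fun K => ∃ p q r s, K = {.cU a p q, .cU b r s, .cD p r c, .cD q s d}) := fun Γ => by
  obtain ⟨k, hk⟩ := exists_fresh (nm (.cD a b m ::ₘ .cU m c d ::ₘ Γ)) 0
  refine ⟨_, ⟨k, k + 1, k + 2, k + 3, rfl⟩, ?_⟩
  have h := RS.cDown_cUp Γ a b m c d k (k + 1) (k + 2) (k + 3) ⟨by simp, fun e he => by
    apply (hk e _).1
    simp at he; omega⟩
  simpa using h.red

theorem Sim.iD_cU (m b c d : ℕ) : Sim {.iD m b, .cU m c d}
    (fun K => ∃ p q, K = {.iD c p, .iD d q, .cD p q b}) := fun Γ => by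
  obtain ⟨k, hk⟩ := exists_fresh (nm (.iD m b ::ₘ .cU m c d ::ₘ Γ)) 0
  refine ⟨_, ⟨k, k + 1, rfl⟩, ?_⟩
  have h := RS.iDown_cUp Γ m b c d k (k + 1) ⟨by simp, fun e he => by
    apply (hk e _).1
    simp at he; omega⟩
  simpa using h.red

theorem Chains.split {i i' o : List ℕ} {N : Multiset Node} (h : Chains (i ++ i') o N) :
    ∃ o₁ o₂ N₁ N₂, o = o₁ ++ o₂ ∧ N = N₁ + N₂ ∧ Chains i o₁ N₁ ∧ Chains i' o₂ N₂ := by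
  induction i generalizing o N with
  | nil => exact ⟨[], o, 0, N, rfl, by simp, .nil, h⟩
  | cons a i ih =>
    cases h with
    | cons h₁ h₂ =>
      obtain ⟨o₁, o₂, N₁, N₂, rfl, rfl, h₃, h₄⟩ := ih h₂
      exact ⟨_, o₂, _, N₂, rfl, (add_assoc _ _ _).symm, .cons h₁ h₃, h₄⟩

theorem Chains.single {a b : ℕ} {N : Multiset Node} (h : Chain a b N) : Chains [a] [b] N := by
  simpa using Chains.cons h .nil

namespace Der
variable {A B C D : Formula} {i x o i' o' : List ℕ} {N M K : Multiset Node}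

theorem Real.chains {Φ : Der A B} (h : Φ.Real i o N) (h' : Chains o o' M) :
    Φ.Real i o' (N + M) := by
  induction Φ generalizing i o o' N M with
  | fm A => exact ⟨h.1, h.2.trans h'⟩
  | and Φ Ψ ih₁ ih₂ | or Φ Ψ ih₁ ih₂ =>
    obtain ⟨i₁, i₂, o₁, o₂, N₁, N₂, rfl, rfl, rfl, h₁, h₂⟩ := h
    obtain ⟨o₃, o₄, M₁, M₂, rfl, rfl, h₃, h₄⟩ := h'.split
    rw [add_add_add_comm]
    exact (ih₁ h₁ h₃).and (ih₂ h₂ h₄)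
  | step Φ ρ Ψ ih₁ ih₂ =>
    obtain ⟨x, y, N₁, N₂, N₃, rfl, h₁, h₂, h₃⟩ := h
    exact ⟨x, y, N₁, N₂, N₃ + M, (add_assoc _ _ _), h₁, h₂, ih₂ h₃ h'⟩

theorem Real.of_eq {Φ : Der A B} (h : Φ.Real i o N) (hi : i = i') (ho : o = o') (hN : N = M) :
    Φ.Real i' o' M := hi ▸ ho ▸ hN ▸ h

theorem Real.botTop : Der.Real botTop [] [] 0 := by
  have h1 := Real.re (A := .bot) (B := .and .bot (.or .bot .top)) (h := .bot_bot_top) (i := []) rfl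
  have h2 : (Der.inf (.switch .bot .bot .top)).Real [] [] 0 := Real.inf ⟨rfl, rfl, rfl⟩
  have h3 := Real.re (A := .or (.and .bot .bot) .top) (B := .top) (h := .bot_bot_or_top)
    (i := []) rfl
  exact (h1.comp (h2.comp h3)).of_eq rfl rfl (by simp)

end Der
open Der

theorem sim_weak (a : Lit) (p : Pat) {x : ℕ} {ys : List ℕ} {P : Multiset Node}
    (h : Op p x ys P) : Sim ({.wD x} + P) ((weak a p).Real [] ys) := by
  induction p generalizing x ys P with
  | unit =>
    obtain ⟨rfl, rfl⟩ := h
    exact (LRed.wD_wU x).sim Real.botTop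
  | leaf =>
    obtain ⟨y, rfl, h⟩ := h
    refine .of ?_
    have : (Der.inf (.wDown a)).Real [] [x] {.wD x} := Real.inf ⟨x, rfl, rfl, rfl⟩
    exact this.chains (.single h)
  | node p q ihp ihq =>
    obtain ⟨b, c, y, z, P, Q, rfl, rfl, h1, h2⟩ := h
    refine (((LRed.wD_cU x b c).add (.refl (P + Q))).eq_eq
      ac_eq rfl).bind ?_
    refine ((ihp h1).add (ihq h2) fun N' M' h3 h4 => ?_).congr
      ac_eq
    have h5 := Real.re (A := .bot) (B := .and .bot .bot) (h := .symm .bot_and_bot) (i := []) rfl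
    exact (h5.comp (h3.and h4)).of_eq rfl rfl (by simp)

theorem sim_contr (a : Lit) (p : Pat) {x y z : ℕ} {zs : List ℕ} {P : Multiset Node}
    (h : Op p z zs P) : Sim ({.cD x y z} + P) (fun K => ∃ xs ys X Y M, K = X + Y + M ∧
      Op p x xs X ∧ Op p y ys Y ∧ (contr a p).Real (xs ++ ys) zs M) := by
  induction p generalizing x y z zs P with
  | unit =>
    obtain ⟨rfl, rfl⟩ := h
    exact (LRed.cD_wU x y z).sim ⟨[], [], {.wU x}, {.wU y}, 0, by simp, ⟨rfl, rfl⟩,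
      ⟨rfl, rfl⟩, Real.re rfl⟩
  | leaf =>
    obtain ⟨y', rfl, h⟩ := h
    refine .of ⟨[x], [y], 0, 0, _, (zero_add _).symm, ⟨x, rfl, .nil x⟩, ⟨y, rfl, .nil y⟩, ?_⟩
    have : (Der.inf (.cDown a)).Real [x, y] [z] {.cD x y z} := Real.inf ⟨x, y, z, rfl, rfl, rfl⟩
    exact this.chains (.single h)
  | node p q ihp ihq =>
    obtain ⟨b, c, us, vs, P, Q, rfl, rfl, h1, h2⟩ := h
    refine ((Sim.cD_cU x y z b c).frame (P + Q) (S := fun K => ∃ d e f g, K =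
      ({.cU x d e, .cU y f g} : Multiset Node) + (({.cD d f b} + P) + ({.cD e g c} + Q)))
      ?_).congr ac_eq |>.bind ?_
    · rintro _ ⟨d, e, f, g, rfl⟩
      exact ⟨d, e, f, g, by
        exact ac_eq⟩
    · rintro _ ⟨d, e, f, g, rfl⟩
      refine (((ihp h1).add (ihq h2) (S := fun K => ∃ ds es fs gs X Y X' Y' M M', K =
        X + Y + M + (X' + Y' + M') ∧ Op p d ds X ∧ Op p f fs Y ∧ Op q e es X' ∧ Op q g gs Y' ∧
        (contr a p).Real (ds ++ fs) us M ∧ (contr a q).Real (es ++ gs) vs M') ?_).frame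
          ({.cU x d e, .cU y f g} : Multiset Node) ?_).congr (add_comm _ _)
      · rintro _ _ ⟨ds, fs, X, Y, M, rfl, h3, h4, h5⟩ ⟨es, gs, X', Y', M', rfl, h6, h7, h8⟩
        exact ⟨ds, es, fs, gs, X, Y, X', Y', M, M', rfl, h3, h4, h6, h7, h5, h8⟩
      · rintro _ ⟨ds, es, fs, gs, X, Y, X', Y', M, M', rfl, h3, h4, h5, h6, h7, h8⟩
        refine ⟨ds ++ es, fs ++ gs, .cU x d e ::ₘ (X + X'), .cU y f g ::ₘ (Y + Y'), M + M', ?_,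
          ⟨d, e, ds, es, X, X', rfl, rfl, h3, h5⟩, ⟨f, g, fs, gs, Y, Y', rfl, rfl, h4, h6⟩, ?_⟩
        · exact ac_eq
        · have h9 : (Der.inf (.medial (p.fm a) (q.fm a) (p.fm a) (q.fm a))).Real
              ((ds ++ es) ++ (fs ++ gs)) ((ds ++ fs) ++ (es ++ gs)) 0 := by
            refine Real.inf ⟨ds, es, fs, gs, ?_, ?_, ?_, ?_, rfl, rfl, rfl⟩ <;>
            rw [Pat.numAtoms_fm] <;> apply Op.length <;> assumption
          exact (h9.comp (h7.and h8)).of_eq rfl rfl (zero_add _)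

theorem sim_spread (a b : Lit) (q : Pat) (Φ : Der .top (.or (.atom a) (q.fm b)))
    (hΦ : ∀ x y ys Q, Op q y ys Q → Sim ({.iD x y} + Q) (Φ.Real [] (x :: ys)))
    (p : Pat) {x y : ℕ} {xs ys : List ℕ} {P Q : Multiset Node} (hp : Op p x xs P)
    (hq : Op q y ys Q) : Sim ({.iD x y} + P + Q)
      ((spread a (q.fm b) (contr b q) (weak b q) Φ p).Real [] (xs ++ ys)) := by
  induction p generalizing x y xs ys P Q with
  | unit =>
    obtain ⟨rfl, rfl⟩ := hp
    refine ((LRed.iD_wU x y).add (.refl Q)).bind (N := {.iD x y} + {.wU x} + Q) ?_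
    refine (sim_weak b q hq).mono fun N' h => ?_
    have h5 := Real.re (A := .top) (B := .or .top .bot) (h := .symm (.or_bot _)) (i := []) rfl
    have h6 := Real.of_fm (A := .top) (i := []) rfl
    exact (h5.comp (h6.or h)).of_eq rfl rfl (by simp)
  | leaf =>
    obtain ⟨x', rfl, hp⟩ := hp
    refine ((hΦ x y ys Q hq).frame P fun N' h => ?_).congr (by ac_rfl)
    exact (h.chains ((Chains.single hp).append (.refl ys))).of_eq rfl rfl (by simp)
  | node p r ihp ihr =>
    obtain ⟨c, d, us, vs, P, P', rfl, rfl, h1, h2⟩ := hp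
    refine ((Sim.iD_cU x y c d).frame (P + P' + Q) (S := fun K => ∃ e f,
      K = ({.cD f e y} + Q) + ({.iD c e, .iD d f} + P + P')) ?_).congr
        ac_eq |>.bind ?_
    · rintro _ ⟨e, f, rfl⟩
      exact ⟨e, f, by
        rw [Node.cD_comm f e]
        exact ac_eq⟩
    · rintro _ ⟨e, f, rfl⟩
      refine ((sim_contr b q hq).frame _ (S := fun K => ∃ es fs X Y M, K = M +
        (({.iD d f} + P' + Y) + ({.iD c e} + P + X)) ∧ Op q e es X ∧ Op q f fs Y ∧
        (contr b q).Real (fs ++ es) ys M) ?_).bind ?_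
      · rintro _ ⟨fs, es, Y, X, M, rfl, h3, h4, h5⟩
        exact ⟨es, fs, X, Y, M, by
          exact ac_eq, h4, h3, h5⟩
      · rintro _ ⟨es, fs, X, Y, M, rfl, h3, h4, h5⟩
        refine (((ihr h2 h4).add (ihp h1 h3) fun _ _ h h' => ⟨_, _, rfl, h, h'⟩).frame M
          (S := (spread a (q.fm b) (contr b q) (weak b q) Φ (.node p r)).Real [] (us ++ vs ++ ys))
          (Q := fun K => ∃ N N', K = N + N' ∧ Der.Real _ _ _ N ∧ Der.Real _ _ _ N') ?_).congr
            (add_comm _ _)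
        rintro _ ⟨N, N', rfl, h6, h7⟩
        have h8 := Real.re (A := .top) (B := .and .top .top) (h := .symm (.and_top _)) (i := []) rfl
        have h9 := Real.distribute (A := p.fm a) (B := r.fm a) (C := q.fm b) (a := us) (b := vs)
          (by rw [Pat.numAtoms_fm, Op.length _ _ _ _ h1])
          (by rw [Pat.numAtoms_fm, Op.length _ _ _ _ h2])
          (by rw [Pat.numAtoms_fm, Op.length _ _ _ _ h4])
          (by rw [Pat.numAtoms_fm, Op.length _ _ _ _ h3]) h5
        exact (h8.comp ((h6.and h7).comp h9)).of_eq rfl rfl (by simp)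

open Der

theorem sim_iden (a : Lit) (p q : Pat) {x y : ℕ} {xs ys : List ℕ} {P Q : Multiset Node}
    (hp : Op p x xs P) (hq : Op q y ys Q) :
    Sim ({.iD x y} + P + Q) ((iden a p q).Real [] (xs ++ ys)) := by
  refine sim_spread a a.dual q _ (fun x y ys Q hq => ?_) p hp hq
  have h := sim_spread a.dual a .leaf (comp (inf (.iDown a)) (inf (.orComm _ _)))
    (fun x y ys Q hq => ?_) q (x := y) (y := x) (xs := ys) (ys := [x]) (P := Q) (Q := 0) hq
    ⟨x, rfl, .nil x⟩
  · refine (h.mono fun N h => ?_).congr (by rw [Node.iD_comm]; simp)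
    exact (h.comp (Real.orComm (by rw [Pat.numAtoms_fm, Op.length _ _ _ _ hq]) rfl)).of_eq rfl rfl
      (by simp)
  · obtain ⟨y', rfl, hy⟩ := hq
    refine .of ?_
    have h1 : (Der.inf (.iDown a)).Real [] [y, x] {.iD y x} := Real.inf ⟨y, x, rfl, rfl, rfl⟩
    have h2 := h1.comp (Real.orComm (A := .atom a) (B := .atom a.dual) (i := [y]) (i' := [x])
      rfl rfl)
    exact (h2.chains (.cons (.nil x) (.single hy))).of_eq rfl rfl (by rw [Node.iD_comm]; simp)

theorem sim_cocontr (a : Lit) (m : Bool) (p q : Pat) {x y z : ℕ} {ys zs : List ℕ}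
    {P Q : Multiset Node} (hp : Op p y ys P) (hq : Op q z zs Q) :
    Sim ({.cU x y z} + P + Q) (fun K => ∃ us X M, K = X + M ∧ Op (p.join m q) x us X ∧
      (cocontr a m p q).Real us (ys ++ zs) M) := by
  have key : Sim ({.cU x y z} + P + Q) (fun K => ∃ us X M, K = X + M ∧ Op (.node p q) x us X ∧
      (Der.fm ((Pat.node p q).fm a)).Real us (ys ++ zs) M) :=
    .of ⟨ys ++ zs, _, 0, (add_zero _).symm, ⟨y, z, ys, zs, P, Q, rfl, by simp [add_assoc], hp, hq⟩,
      .of_fm (by simp [Pat.numAtoms_fm, Pat.leaves, Op.length _ _ _ _ hp, Op.length _ _ _ _ hq])⟩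
  have hr : q = .unit → ∀ {r : Pat} (h), p.join m q = r → p = r →
      Sim ({.cU x y z} + P + Q) (fun K => ∃ us X M, K = X + M ∧ Op r x us X ∧
      (re (r.fm a) (.and (r.fm a) .top) h).Real us (ys ++ zs) M) := by
    rintro rfl r h - rfl
    obtain ⟨rfl, rfl⟩ := hq
    obtain ⟨X, hX, h1⟩ := Op.pre (.cons (.nil y)) hp
    refine (((LRed.cU_wU' x y z).add (.refl P)).eq_eq
      ac_eq rfl).bind
      ((h1.eq_eq rfl rfl).sim
      ⟨ys, X, 0, by simp, hX, ?_⟩)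
    exact (Real.re (by simp [Pat.numAtoms_fm, Op.length _ _ _ _ hp])).of_eq rfl (by simp) rfl
  match m, p, q with
  | m, .unit, q =>
    obtain ⟨rfl, rfl⟩ := hp
    obtain ⟨X, hX, h1⟩ := Op.pre (.cons (.nil z)) hq
    refine (((LRed.cU_wU x y z).add (.refl Q)).eq_eq
      ac_eq rfl).bind
      ((h1.eq_eq rfl rfl).sim
      ⟨zs, X, 0, by simp, ?_, ?_⟩)
    · simpa [Pat.join] using hX
    · simp only [cocontr]
      exact Real.re (by simp [Pat.numAtoms_fm, Op.length _ _ _ _ hq, Pat.join])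
  | m, .leaf, .unit => cases m <;> exact hr rfl _ rfl rfl
  | true, .leaf, .leaf =>
    obtain ⟨y', rfl, hy⟩ := hp
    obtain ⟨z', rfl, hz⟩ := hq
    refine .of ⟨[x], 0, _, (zero_add _).symm, ⟨x, rfl, .nil x⟩, ?_⟩
    have : (Der.inf (.cUp a)).Real [x] [y, z] {.cU x y z} := Real.inf ⟨x, y, z, rfl, rfl, rfl⟩
    exact (this.chains (.cons hy (.single hz))).of_eq rfl rfl (add_assoc _ _ _).symm
  | false, .leaf, .leaf => exact key
  | m, .leaf, .node _ _ => cases m <;> exact key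
  | m, .node _ _, .unit => cases m <;> exact hr rfl _ rfl rfl
  | m, .node _ _, .leaf => cases m <;> exact key
  | m, .node _ _, .node _ _ => cases m <;> exact key

theorem Par.length_eq {β : Type} {R : β → ℕ → List ℕ → Multiset Node → Prop} {w : β → ℕ}
    (hR : ∀ p x y N, R p x y N → y.length = w p) {ps : List β} {x ys : List ℕ}
    {N : Multiset Node} (h : Par R ps x ys N) : ys.length = (ps.map w).sum := by
  induction h with
  | nil => rfl
  | cons h _ ih => simp [hR _ _ _ _ h, ih]

theorem Par.length_copies {A : Formula} {l : A.GLab Pat} {x ys : List ℕ} {N : Multiset Node}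
    (h : Par Op (GLab.toList A l) x ys N) : ys.length = numAtoms (copies A l) := by
  rw [numAtoms_sub Pat.numAtoms_fm, h.length_eq Op.length]

theorem Par.length_erase {A : Formula} {l : A.GLab Bool} {x ys : List ℕ} {N : Multiset Node}
    (h : Par Cl (GLab.toList A l) x ys N) : ys.length = numAtoms (erase A l) := by
  rw [numAtoms_sub numAtoms_keep, h.length_eq Cl.length]

theorem slots_real {β : Type} [Inhabited β] {R : β → ℕ → List ℕ → Multiset Node → Prop}
    {s : Lit → β → Formula} {w : β → ℕ} (hw : ∀ a p, (s a p).numAtoms = w p)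
    (hR : ∀ p x y N, R p x y N → y.length = w p) {A B : Formula} (t : B.Lab)
    (h : Eqv (A.decorate (A.numbering 0)) (B.decorate t)) (l : A.GLab β) (m : B.GLab β)
    (hm : GLab.toList B m = (Lab.toList B t).map ((GLab.toList A l).getD · default))
    {x ys : List ℕ} {N : Multiset Node} (hP : Par R (GLab.toList A l) x ys N) :
    (eqSub s w hw t h l m hm).Real ys (((Lab.toList B t).map fun i =>
      List.range' (((GLab.toList A l).take i).map w).sum
        (w ((GLab.toList A l).getD i default))).flatten.map (ys.getD · 0)) 0 := by
  refine Real.inf ⟨?_, ?_, rfl⟩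
  · rw [numAtoms_sub hw, hP.length_eq hR]
  · rw [toList_slots hw, hm, List.zipWith_map_right]
    simp

theorem Inf.sim_up (m : Bool) {A B : Formula} (ρ : Inf A B) (l : B.GLab Pat)
    {i o ys : List ℕ} {N P : Multiset Node} (h : ρ.Real i o N)
    (hP : Par Op (GLab.toList B l) o ys P) :
    Sim (N + P) (fun K => ∃ zs X M, K = X + M ∧ Par Op (GLab.toList A (ρ.upLab m l)) i zs X ∧
      (ρ.up m l).Real zs ys M) := by
  cases ρ with
  | eq t he =>
    obtain ⟨hi, rfl, rfl⟩ := h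
    have hm : GLab.toList B l = (Lab.toList B t).map
        ((GLab.toList A (Inf.upLab m (.eq t he) l)).getD · default) := by
      rw [upLab, GLab.toList_tab, ← List.range_eq_range']
      exact getD_idxOf he.perm (by simp [Lab.length_toList])
    rw [hm] at hP
    obtain ⟨zs, hz, rfl⟩ := Par.unpermute Op.length (ps := GLab.toList A (Inf.upLab m (.eq t he) l))
      (by simpa using he.perm) (by simpa using hi) hP
    refine .of ⟨zs, P, 0, by simp, hz, ?_⟩
    exact slots_real Pat.numAtoms_fm Op.length t he _ l hm hz
  | iDown a =>
    obtain ⟨x, y, rfl, rfl, rfl⟩ := h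
    obtain ⟨z, z', M, M', rfl, rfl, h1, h2⟩ := hP.of_pair
    refine ((sim_iden a l.1 l.2 h1 h2).mono fun N h => ?_).congr (add_assoc _ _ _).symm
    exact ⟨[], 0, N, by simp, .nil, h⟩
  | wDown a =>
    obtain ⟨x, rfl, rfl, rfl⟩ := h
    refine (sim_weak a l hP.of_single).mono fun N h => ?_
    exact ⟨[], 0, N, by simp, .nil, h⟩
  | cDown a =>
    obtain ⟨x, y, z, rfl, rfl, rfl⟩ := h
    refine (sim_contr a l hP.of_single).mono ?_
    rintro _ ⟨xs, ys, X, Y, M, rfl, h1, h2, h3⟩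
    exact ⟨xs ++ ys, X + Y, M, rfl, (Par.single h1).append (.single h2), h3⟩
  | iUp a =>
    obtain ⟨x, y, rfl, rfl, rfl⟩ := h
    cases hP
    refine .of ⟨[x, y], 0, {.iU x y}, by simp, ?_, Real.inf ⟨x, y, rfl, rfl, rfl⟩⟩
    have h (x : ℕ) : Op .leaf x [x] 0 := ⟨x, rfl, .nil x⟩
    exact (Par.single (h x)).append (.single (h y))
  | wUp a =>
    obtain ⟨x, rfl, rfl, rfl⟩ := h
    cases hP
    exact .of ⟨[], {.wU x}, 0, by simp, .single ⟨rfl, rfl⟩, .of_fm rfl⟩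
  | cUp a =>
    obtain ⟨x, y, z, rfl, rfl, rfl⟩ := h
    obtain ⟨u, v, M, M', rfl, rfl, h1, h2⟩ := hP.of_pair
    refine ((sim_cocontr a m l.1 l.2 h1 h2).mono ?_).congr (add_assoc _ _ _).symm
    rintro _ ⟨us, X, M, rfl, h3, h4⟩
    exact ⟨us, X, M, rfl, .single h3, h4⟩
  | switch A B C =>
    obtain ⟨hi, rfl, rfl⟩ := h
    refine .of ⟨ys, P, 0, by simp, ?_, Real.inf ⟨?_, rfl, rfl⟩⟩
    · simpa [Inf.upLab, GLab.toList] using hP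
    · simpa [sub, numAtoms, add_assoc] using hP.length_copies
  | medial A B C D =>
    obtain ⟨a, b, c, d, ha, hb, hc, hd, rfl, rfl, rfl⟩ := h
    obtain ⟨y, y', M, M', rfl, rfl, h1, h2⟩ := hP.split (by simp [numAtoms, ha, hc])
    obtain ⟨e, g, M₁, M₂, rfl, rfl, h3, h4⟩ := h1.split (by simp [ha])
    obtain ⟨f, k, M₃, M₄, rfl, rfl, h5, h6⟩ := h2.split (by simp [hb])
    refine .of ⟨(e ++ f) ++ (g ++ k), (M₁ + M₃) + (M₂ + M₄), 0, by abel,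
      (h3.append h5).append (h4.append h6), Real.inf ⟨e, f, g, k, h3.length_copies,
        h5.length_copies, h4.length_copies, h6.length_copies, rfl, rfl, rfl⟩⟩

theorem Der.sim_up (m : Bool) {A B : Formula} (Φ : Der A B) (l : B.GLab Pat)
    {i o ys : List ℕ} {N P : Multiset Node} (h : Φ.Real i o N)
    (hP : Par Op (GLab.toList B l) o ys P) :
    Sim (N + P) (fun K => ∃ zs X M, K = X + M ∧ Par Op (GLab.toList A (Φ.upLab m l)) i zs X ∧
      (Φ.up m l).Real zs ys M) := by
  induction Φ generalizing i o ys N P with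
  | fm A =>
    obtain ⟨X, hX, r⟩ := hP.pre h.2
    exact r.sim ⟨ys, X, 0, by simp, hX, .of_fm hX.length_copies⟩
  | and Φ Ψ ih₁ ih₂ | or Φ Ψ ih₁ ih₂ =>
    obtain ⟨i₁, i₂, o₁, o₂, N₁, N₂, rfl, rfl, rfl, h₁, h₂⟩ := h
    obtain ⟨y, y', M, M', rfl, rfl, h3, h4⟩ := hP.split (by simp [h₁.length])
    refine ((ih₁ l.1 h₁ h3).add (ih₂ l.2 h₂ h4) ?_).congr (add_add_add_comm _ _ _ _)
    rintro _ _ ⟨zs, X, M, rfl, h5, h6⟩ ⟨zs', X', M', rfl, h7, h8⟩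
    exact ⟨_, _, _, add_add_add_comm _ _ _ _, h5.append h7, h6.and h8⟩
  | step Φ ρ Ψ ih₁ ih₂ =>
    obtain ⟨x, y, N₁, N₂, N₃, rfl, h₁, h₂, h₃⟩ := h
    refine ((ih₂ l h₃ hP).frame_bind (M := N₁ + N₂) ?_).congr (by abel)
    rintro _ ⟨zs, X, M, rfl, h4, h5⟩
    refine ((ρ.sim_up m _ h₂ h4).frame_bind (M := N₁ + M) ?_).congr (by abel)
    rintro _ ⟨us, Y, M', rfl, h6, h7⟩
    refine ((ih₁ _ h₁ h6).frame (M' + M) ?_).congr (by abel)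
    rintro _ ⟨vs, Z, M'', rfl, h8, h9⟩
    exact ⟨vs, Z, M'' + (M' + M), add_assoc _ _ _, h8, h9.comp (h7.comp h5)⟩

theorem Real.fillAtom (a : Lit) (b : Bool) {x : ℕ} {ys : List ℕ} {P : Multiset Node}
    (h : Cl b x ys P) : (fillAtom a b).Real ys [x] P := by
  cases b with
  | true =>
    obtain ⟨y, rfl, h⟩ := h
    exact ⟨rfl, .single h⟩
  | false =>
    obtain ⟨rfl, rfl⟩ := h
    exact Der.Real.inf ⟨x, rfl, rfl, rfl⟩

theorem Real.fill {A : Formula} {l : A.GLab Bool} {xs ys : List ℕ} {P : Multiset Node}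
    (h : Par Cl (GLab.toList A l) xs ys P) (hx : xs.length = A.numAtoms) :
    (fill A l).Real ys xs P := by
  induction A generalizing xs ys P with
  | top | bot => cases h; exact .of_fm rfl
  | atom a =>
    obtain ⟨x, rfl⟩ := List.length_eq_one_iff.1 hx
    exact Real.fillAtom a l h.of_single
  | and A B ihA ihB | or A B ihA ihB =>
    obtain ⟨x, x', rfl, hx, hx'⟩ : ∃ x x', xs = x ++ x' ∧ x.length = A.numAtoms ∧
        x'.length = B.numAtoms := ⟨xs.take A.numAtoms, xs.drop A.numAtoms, by simp, by
      simp [hx, numAtoms], by simp [hx, numAtoms]⟩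
    obtain ⟨y, y', M, M', rfl, rfl, h1, h2⟩ := h.split (by simp [hx])
    exact (ihA h1 hx).and (ihB h2 hx')

theorem Real.copyAtom (a : Lit) (p : Pat) {x : ℕ} {ys : List ℕ} {P : Multiset Node}
    (h : Op p x ys P) : (copyAtom a p).Real [x] ys P := by
  induction p generalizing x ys P with
  | unit =>
    obtain ⟨rfl, rfl⟩ := h
    exact Der.Real.inf ⟨x, rfl, rfl, rfl⟩
  | leaf =>
    obtain ⟨y, rfl, h⟩ := h
    exact ⟨rfl, .single h⟩
  | node p q ihp ihq =>
    obtain ⟨b, c, y, z, P, Q, rfl, rfl, h1, h2⟩ := h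
    have : (Der.inf (.cUp a)).Real [x] [b, c] {.cU x b c} := Der.Real.inf ⟨x, b, c, rfl, rfl, rfl⟩
    exact (this.comp ((ihp h1).and (ihq h2))).of_eq rfl rfl (by simp)

theorem Real.copyAll {A : Formula} {l : A.GLab Pat} {xs ys : List ℕ} {P : Multiset Node}
    (h : Par Op (GLab.toList A l) xs ys P) (hx : xs.length = A.numAtoms) :
    (copyAll A l).Real xs ys P := by
  induction A generalizing xs ys P with
  | top | bot => cases h; exact .of_fm rfl
  | atom a =>
    obtain ⟨x, rfl⟩ := List.length_eq_one_iff.1 hx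
    exact Real.copyAtom a l h.of_single
  | and A B ihA ihB | or A B ihA ihB =>
    obtain ⟨x, x', rfl, hx, hx'⟩ : ∃ x x', xs = x ++ x' ∧ x.length = A.numAtoms ∧
        x'.length = B.numAtoms := ⟨xs.take A.numAtoms, xs.drop A.numAtoms, by simp, by
      simp [hx, numAtoms], by simp [hx, numAtoms]⟩
    obtain ⟨y, y', M, M', rfl, rfl, h1, h2⟩ := h.split (by simp [hx])
    exact (ihA h1 hx).and (ihB h2 hx')

theorem sim_merge (a : Lit) (p q : Bool) {x y z : ℕ} {xs ys : List ℕ} {P Q : Multiset Node}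
    (hp : Cl p x xs P) (hq : Cl q y ys Q) : Sim (P + Q + {.cD x y z}) (fun K => ∃ zs X M,
      K = M + X ∧ (mergeD a p q).Real (xs ++ ys) zs M ∧ Cl (p || q) z zs X) := by
  match p, q with
  | false, q =>
    obtain ⟨rfl, rfl⟩ := hp
    obtain ⟨X, hX, r⟩ := Cl.post (.cons (.nil z)) hq
    refine (((LRed.wD_cD x y z).add (.refl Q)).eq_eq
      ac_eq rfl).bind
      ((r.eq_eq (add_comm _ _) rfl).sim ⟨ys, X, 0, by simp, ?_, by simpa using hX⟩)
    have := Cl.length _ _ _ _ hq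
    cases q <;> exact Der.Real.re (by simpa [numAtoms, numAtoms_keep] using this)
  | true, false =>
    obtain ⟨rfl, rfl⟩ := hq
    obtain ⟨X, hX, r⟩ := Cl.post (.cons (.nil z)) hp
    refine (((LRed.wD_cD' x y z).add (.refl P)).eq_eq
      ac_eq rfl).bind
      ((r.eq_eq (add_comm _ _) rfl).sim ⟨xs, X, 0, by simp, ?_, by simpa using hX⟩)
    have := Cl.length _ _ _ _ hp
    exact (Der.Real.re (by simpa [numAtoms, numAtoms_keep] using this)).of_eq (by simp) rfl rfl
  | true, true =>
    obtain ⟨x', rfl, hx⟩ := hp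
    obtain ⟨y', rfl, hy⟩ := hq
    refine .of ⟨[z], 0, _, (add_zero _).symm, ?_, ⟨z, rfl, .nil z⟩⟩
    exact (Der.Real.inf_chains (ρ := .cDown a) (.cons hx (.single hy)) ⟨x, y, z, rfl, rfl, rfl⟩
      (.refl [z])).of_eq rfl rfl (by simp)

theorem sim_split (a : Lit) (p : Bool) {x y z : ℕ} {xs : List ℕ} {P : Multiset Node}
    (hp : Cl p x xs P) : Sim (P + {.cU x y z}) (fun K => ∃ ys zs Y Z M,
      K = M + (Y + Z) ∧ (splitD a p).Real xs (ys ++ zs) M ∧ Cl p y ys Y ∧ Cl p z zs Z) := by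
  match p with
  | false =>
    obtain ⟨rfl, rfl⟩ := hp
    exact (LRed.wD_cU x y z).sim ⟨[], [], {.wD y}, {.wD z}, 0, by simp, Der.Real.re rfl,
      ⟨rfl, rfl⟩, ⟨rfl, rfl⟩⟩
  | true =>
    obtain ⟨x', rfl, hx⟩ := hp
    refine .of ⟨[y], [z], 0, 0, _, (add_zero _).symm, ?_, ⟨y, rfl, .nil y⟩, ⟨z, rfl, .nil z⟩⟩
    exact (Der.Real.inf_chains (ρ := .cUp a) (.single hx) ⟨x, y, z, rfl, rfl, rfl⟩
      (.refl [y, z])).of_eq rfl rfl (by simp)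

theorem Inf.sim_down {A B : Formula} (ρ : Inf A B) (l : A.GLab Bool)
    {i o ys : List ℕ} {N P : Multiset Node} (h : ρ.Real i o N)
    (hP : Par Cl (GLab.toList A l) i ys P) :
    Sim (P + N) (fun K => ∃ zs X M, K = M + X ∧ (ρ.down l).Real ys zs M ∧
      Par Cl (GLab.toList B (ρ.downLab l)) o zs X) := by
  cases ρ with
  | eq t he =>
    obtain ⟨hi, rfl, rfl⟩ := h
    have hm := GLab.toList_ofLab ((GLab.toList A l).getD · default) B t
    have h1 := hP.permute Cl.length (t := Lab.toList B t) (by simpa using he.perm)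
    rw [← hm] at h1
    exact .of ⟨_, P, 0, by simp, slots_real numAtoms_keep Cl.length t he l _ hm hP, h1⟩
  | iDown a =>
    obtain ⟨x, y, rfl, rfl, rfl⟩ := h
    cases hP
    have h (x : ℕ) : Cl true x [x] 0 := ⟨x, rfl, .nil x⟩
    exact .of ⟨[x, y], 0, {.iD x y}, by simp, Der.Real.inf ⟨x, y, rfl, rfl, rfl⟩,
      (Par.single (h x)).append (.single (h y))⟩
  | wDown a =>
    obtain ⟨x, rfl, rfl, rfl⟩ := h
    cases hP
    exact .of ⟨[], {.wD x}, 0, by simp, .of_fm rfl, .single ⟨rfl, rfl⟩⟩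
  | cDown a =>
    obtain ⟨x, y, z, rfl, rfl, rfl⟩ := h
    obtain ⟨u, v, M, M', rfl, rfl, h1, h2⟩ := hP.of_pair
    refine (sim_merge a l.1 l.2 h1 h2).mono ?_
    rintro _ ⟨zs, X, M, rfl, h3, h4⟩
    exact ⟨zs, X, M, rfl, h3, .single h4⟩
  | iUp a =>
    obtain ⟨x, y, rfl, rfl, rfl⟩ := h
    obtain ⟨u, v, M, M', rfl, rfl, h1, h2⟩ := hP.of_pair
    refine .of ⟨[], 0, _, (add_zero _).symm, ?_, .nil⟩
    have h3 := (Real.fillAtom a _ h1).and (Real.fillAtom a.dual _ h2)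
    exact h3.comp (Der.Real.inf ⟨x, y, rfl, rfl, rfl⟩)
  | wUp a =>
    obtain ⟨x, rfl, rfl, rfl⟩ := h
    refine .of ⟨[], 0, _, (add_zero _).symm, ?_, .nil⟩
    exact (Real.fillAtom a _ hP.of_single).comp (Der.Real.inf ⟨x, rfl, rfl, rfl⟩)
  | cUp a =>
    obtain ⟨x, y, z, rfl, rfl, rfl⟩ := h
    refine (sim_split a l hP.of_single).mono ?_
    rintro _ ⟨ys, zs, Y, Z, M, rfl, h3, h4, h5⟩
    exact ⟨_, _, M, rfl, h3, (Par.single h4).append (.single h5)⟩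
  | switch A B C =>
    obtain ⟨hi, rfl, rfl⟩ := h
    refine .of ⟨ys, P, 0, by simp, Der.Real.inf ⟨?_, rfl, rfl⟩, ?_⟩
    · simpa [sub, numAtoms, add_assoc] using hP.length_erase
    · simpa [Inf.downLab, GLab.toList] using hP
  | medial A B C D =>
    obtain ⟨a, b, c, d, ha, hb, hc, hd, rfl, rfl, rfl⟩ := h
    obtain ⟨y, y', M, M', rfl, rfl, h1, h2⟩ := hP.split (by simp [numAtoms, ha, hb])
    obtain ⟨e, g, M₁, M₂, rfl, rfl, h3, h4⟩ := h1.split (by simp [ha])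
    obtain ⟨f, k, M₃, M₄, rfl, rfl, h5, h6⟩ := h2.split (by simp [hc])
    exact .of ⟨(e ++ f) ++ (g ++ k), (M₁ + M₃) + (M₂ + M₄), 0, by abel,
      Der.Real.inf ⟨e, g, f, k, h3.length_erase,
        h4.length_erase, h5.length_erase, h6.length_erase, rfl, rfl, rfl⟩,
      (h3.append h5).append (h4.append h6)⟩

theorem Der.sim_down {A B : Formula} (Φ : Der A B) (l : A.GLab Bool)
    {i o ys : List ℕ} {N P : Multiset Node} (h : Φ.Real i o N)
    (hP : Par Cl (GLab.toList A l) i ys P) :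
    Sim (P + N) (fun K => ∃ zs X M, K = M + X ∧ (Φ.down l).Real ys zs M ∧
      Par Cl (GLab.toList B (Φ.downLab l)) o zs X) := by
  induction Φ generalizing i o ys N P with
  | fm A =>
    obtain ⟨X, hX, r⟩ := hP.post h.2
    exact r.sim ⟨ys, X, 0, by simp, .of_fm hX.length_erase, hX⟩
  | and Φ Ψ ih₁ ih₂ | or Φ Ψ ih₁ ih₂ =>
    obtain ⟨i₁, i₂, o₁, o₂, N₁, N₂, rfl, rfl, rfl, h₁, h₂⟩ := h
    obtain ⟨y, y', M, M', rfl, rfl, h3, h4⟩ := hP.split (by simp [h₁.length])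
    refine ((ih₁ l.1 h₁ h3).add (ih₂ l.2 h₂ h4) ?_).congr (add_add_add_comm _ _ _ _)
    rintro _ _ ⟨zs, X, M, rfl, h5, h6⟩ ⟨zs', X', M', rfl, h7, h8⟩
    exact ⟨_, _, _, add_add_add_comm _ _ _ _, h5.and h7, h6.append h8⟩
  | step Φ ρ Ψ ih₁ ih₂ =>
    obtain ⟨x, y, N₁, N₂, N₃, rfl, h₁, h₂, h₃⟩ := h
    refine ((ih₁ l h₁ hP).frame_bind (M := N₂ + N₃) ?_).congr (by abel)
    rintro _ ⟨zs, X, M, rfl, h4, h5⟩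
    refine ((ρ.sim_down _ h₂ h5).frame_bind (M := N₃ + M) ?_).congr (by abel)
    rintro _ ⟨us, Y, M', rfl, h6, h7⟩
    refine ((ih₂ _ h₃ h7).frame (M + M') ?_).congr (by abel)
    rintro _ ⟨vs, Z, M'', rfl, h8, h9⟩
    exact ⟨vs, Z, M + (M' + M''), by abel, h4.comp (h6.comp h8), h9⟩

theorem Par.const {β : Type} {R : β → ℕ → List ℕ → Multiset Node → Prop} {b : β}
    (hR : ∀ x, R b x [x] 0) (A : Formula) {xs : List ℕ} (hx : xs.length = A.numAtoms) :
    Par R (GLab.toList A (const b A)) xs xs 0 := by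
  rw [SKS.const, GLab.toList_tab, List.map_const', List.length_range', ← hx]
  clear hx
  induction xs with
  | nil => exact .nil
  | cons x xs ih => simpa [List.replicate_succ] using Par.cons (hR x) ih

namespace Der
variable {A B : Formula} {Φ : Der A B} {i o : List ℕ} {N : Multiset Node}

theorem sim_raise (m : Bool) (h : Φ.Real i o N) :
    Sim N (fun K => ∃ zs X M, K = X + M ∧ Par Op (GLab.toList A (Φ.lab m)) i zs X ∧
      (Φ.raise m).Real zs o M) := by
  refine ((Φ.sim_up m _ h (Par.const (b := Pat.leaf) (fun x => ?_) B h.length.2)).mono ?_).congr (by simp)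
  · exact ⟨x, rfl, .nil x⟩
  · rintro _ ⟨zs, X, M, rfl, h1, h2⟩
    exact ⟨zs, X, M, rfl, h1, h2.castR⟩

theorem sim_lower (h : Φ.Real i o N) : Sim N (Φ.lower.Real i o) := by
  refine ((Φ.sim_down _ h (Par.const (b := true) (fun x => ?_) A h.length.1)).mono ?_).congr (by simp)
  · exact ⟨x, rfl, .nil x⟩
  · rintro _ ⟨zs, X, M, rfl, h1, h2⟩
    exact h1.castL.comp (SKS.Real.fill h2 h.length.2)

theorem sim_normalize (h : Φ.Real i o N) : Sim N (Φ.normalize.Real i o) := by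
  refine (sim_raise true h).bind ?_
  rintro _ ⟨zs, X, M, rfl, h1, h2⟩
  refine ((sim_lower h2).frame_bind (M := X) ?_).congr (add_comm _ _)
  intro N' h3
  refine ((sim_raise false h3).frame X ?_)
  rintro _ ⟨us, Y, M', rfl, h4, h5⟩
  exact ((SKS.Real.copyAll h1 h.length.1).comp ((SKS.Real.copyAll h4 h3.length.1).comp h5)).of_eq
    rfl rfl (by abel)

end Der

/-! ### Realizations and flows -/

theorem Chain.balance {a b : ℕ} {N : Multiset Node} (h : Chain a b N) :
    {a} + nouts N = nins N + {b} := by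
  induction h with
  | nil a => simp
  | @cons a b c N _ ih =>
    rw [nins_cons, nouts_cons, wire, add_assoc, ← ih]

theorem Chains.balance {i o : List ℕ} {N : Multiset Node} (h : Chains i o N) :
    (i : Multiset ℕ) + nouts N = nins N + (o : Multiset ℕ) := by
  induction h with
  | nil => simp
  | @cons a b i o N M h _ ih =>
    have := h.balance
    rw [← Multiset.cons_coe, ← Multiset.cons_coe, ← singleton_add,
      ← singleton_add, nins_add, nouts_add, add_add_add_comm, this, ih]
    ac_rfl

theorem Inf.Real.balance {A B : Formula} {ρ : Inf A B} {i o : List ℕ} {N : Multiset Node}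
    (h : ρ.Real i o N) : (i : Multiset ℕ) + nouts N = nins N + (o : Multiset ℕ) := by
  cases ρ with
  | eq t h' =>
    obtain ⟨h1, rfl, rfl⟩ := h
    have h2 := h'.perm.map (i.getD · 0)
    rw [← h1] at h2
    have h3 : (List.range i.length).map (i.getD · 0) = i := by
      rw [List.range_eq_range', map_getD_range]
    rw [h3] at h2
    simpa using h2.symm
  | iDown a => obtain ⟨a, b, rfl, rfl, rfl⟩ := h; simp [iD]; rfl
  | wDown a => obtain ⟨a, rfl, rfl, rfl⟩ := h; simp [wD]
  | cDown a => obtain ⟨a, b, c, rfl, rfl, rfl⟩ := h; simp [cD]; rfl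
  | iUp a => obtain ⟨a, b, rfl, rfl, rfl⟩ := h; simp [iU]; rfl
  | wUp a => obtain ⟨a, rfl, rfl, rfl⟩ := h; simp [wU]
  | cUp a => obtain ⟨a, b, c, rfl, rfl, rfl⟩ := h; simp only [nouts_singleton, nins_singleton, cU]; rfl
  | switch A B C => obtain ⟨h, rfl, rfl⟩ := h; simp
  | medial A B C D =>
    obtain ⟨a, b, c, d, ha, hb, hc, hd, rfl, rfl, rfl⟩ := h
    simp only [← Multiset.coe_add, nouts_zero, nins_zero, add_zero, zero_add]
    exact add_add_add_comm _ _ _ _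

theorem Der.Real.balance {A B : Formula} {Φ : Der A B} {i o : List ℕ} {N : Multiset Node}
    (h : Φ.Real i o N) : (i : Multiset ℕ) + nouts N = nins N + (o : Multiset ℕ) := by
  induction Φ generalizing i o N with
  | fm A => exact h.2.balance
  | and Φ Ψ ih₁ ih₂ | or Φ Ψ ih₁ ih₂ =>
    obtain ⟨i₁, i₂, o₁, o₂, N₁, N₂, rfl, rfl, rfl, h₁, h₂⟩ := h
    rw [← Multiset.coe_add, ← Multiset.coe_add, nins_add, nouts_add, add_add_add_comm, ih₁ h₁,
      ih₂ h₂, add_add_add_comm]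
  | step Φ ρ Ψ ih₁ ih₂ =>
    obtain ⟨x, y, N₁, N₂, N₃, rfl, h₁, h₂, h₃⟩ := h
    rw [nouts_add, nouts_add, nins_add, nins_add, ← add_assoc, ← add_assoc, ih₁ h₁,
      add_assoc (nins N₁), h₂.balance, ← add_assoc, add_assoc (nins N₁ + nins N₂), ih₂ h₃]
    ac_rfl

/-- `f` extends `f₀` to the lower edges in `N` so that `N` becomes `T`, wires become equalities and
the edges `o` become `l`. -/
structure Track (o : List ℕ) (N : Multiset Node) (f₀ f : ℕ → ℕ) (l : List ℕ) (T : Multiset Node) :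
    Prop where
  frame : ∀ x, x ∉ nouts N → f x = f₀ x
  out : l = o.map f
  nodes : nmap f (N.filter fun n => ¬ n.IsWire) = T
  wire : ∀ a b, wire a b ∈ N → f a = f b

section Track
variable {i x o o' l l' : List ℕ} {N M T T' : Multiset Node} {f₀ f f' : ℕ → ℕ}

theorem Track.nil (o : List ℕ) (f : ℕ → ℕ) : Track o 0 f f (o.map f) 0 :=
  ⟨fun _ _ => rfl, rfl, rfl, by simp⟩

theorem Track.of_eq {f : ℕ → ℕ} (h : l = o.map f) : Track o 0 f f l 0 := h ▸ .nil o f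

theorem Track.pre (hN : (i : Multiset ℕ) + nouts N = nins N + (o : Multiset ℕ))
    (hd : ((i : Multiset ℕ) + nouts (N + M)).Nodup) :
    ∀ x, (x ∈ nm N ∨ x ∈ o) → x ∉ nouts M := by
  intro x hx hx'
  rw [nouts_add, ← add_assoc, hN, nodup_add] at hd
  refine Multiset.disjoint_left.1 hd.2.2 ?_ hx'
  rcases hx with hx | hx
  · rcases mem_nm.1 hx with hx | hx
    · exact Multiset.mem_add.2 (Or.inl hx)
    · exact hN ▸ Multiset.mem_add.2 (Or.inr hx)
  · exact Multiset.mem_add.2 (Or.inr hx)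

theorem Track.par (hN : (i : Multiset ℕ) + nouts N = nins N + (o : Multiset ℕ))
    (hd : ((i : Multiset ℕ) + nouts (N + M)).Nodup) (h : Track o N f₀ f l T)
    (h' : Track o' M f f' l' T') : Track (o ++ o') (N + M) f₀ f' (l ++ l') (T + T') := by
  have hp := Track.pre hN hd
  refine ⟨fun x hx => ?_, ?_, ?_, fun a b hab => ?_⟩
  · rw [nouts_add, mem_add, not_or] at hx
    rw [h'.frame x hx.2, h.frame x hx.1]
  · rw [List.map_append, ← h'.out, h.out]
    congr 1
    exact List.map_congr_left fun x hx => (h'.frame x (hp x (Or.inr hx))).symm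
  · rw [Multiset.filter_add, nmap, Multiset.map_add, ← h'.nodes, ← h.nodes]
    congr 1
    refine nmap_congr fun x hx => h'.frame x (hp x (Or.inl ?_))
    exact nm_mono (Multiset.filter_le _ _) hx
  · rcases Multiset.mem_add.1 hab with hab | hab
    · rw [h'.frame a, h'.frame b, h.wire a b hab]
      · exact hp b (Or.inl (mem_nm.2 (Or.inr (mem_nouts.2 ⟨_, hab, by simp [Node.wire]⟩))))
      · exact hp a (Or.inl (mem_nm.2 (Or.inl (mem_nins.2 ⟨_, hab, by simp [Node.wire]⟩))))
    · exact h'.wire a b hab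

theorem Track.seq (hN : (i : Multiset ℕ) + nouts N = nins N + (x : Multiset ℕ))
    (hd : ((i : Multiset ℕ) + nouts (N + M)).Nodup) (h : Track x N f₀ f l T)
    (h' : Track o M f f' l' T') : Track o (N + M) f₀ f' l' (T + T') := by
  have h1 := Track.par hN hd h h'
  exact ⟨h1.frame, h'.out, h1.nodes, h1.wire⟩

theorem nodup_left (hd : ((i : Multiset ℕ) + nouts (N + M)).Nodup) :
    ((i : Multiset ℕ) + nouts N).Nodup := by
  rw [nouts_add, ← add_assoc] at hd; exact (Multiset.nodup_add.1 hd).1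

theorem nodup_seq (hN : (i : Multiset ℕ) + nouts N = nins N + (x : Multiset ℕ))
    (hd : ((i : Multiset ℕ) + nouts (N + M)).Nodup) : ((x : Multiset ℕ) + nouts M).Nodup := by
  rw [nouts_add, ← add_assoc, hN, add_assoc] at hd; exact (Multiset.nodup_add.1 hd).2.1

theorem nodup_right {i' : List ℕ} (hd : (((i ++ i' : List ℕ) : Multiset ℕ) + nouts (N + M)).Nodup) :
    ((i' : Multiset ℕ) + nouts M).Nodup ∧ ∀ x ∈ i', x ∉ nouts N := by
  rw [nouts_add, ← Multiset.coe_add, add_add_add_comm] at hd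
  refine ⟨(Multiset.nodup_add.1 hd).2.1, fun x hx hx' => ?_⟩
  exact Multiset.disjoint_left.1 (Multiset.nodup_add.1 hd).2.2 (Multiset.mem_add.2 (Or.inr hx'))
    (Multiset.mem_add.2 (Or.inl hx))

end Track

theorem Chain.track {a b : ℕ} {N : Multiset Node} (h : Chain a b N)
    (hd : (({a} : Multiset ℕ) + nouts N).Nodup) (f₀ : ℕ → ℕ) :
    ∃ f, Track [b] N f₀ f [f₀ a] 0 := by
  induction h generalizing f₀ with
  | nil a => exact ⟨f₀, .nil [a] f₀⟩
  | @cons a b c N h ih =>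
    rw [nouts_cons, wire] at hd
    have hd' := (Multiset.nodup_add.1 hd).2.1
    have hab : a ≠ b := by
      rintro rfl
      exact Multiset.disjoint_left.1 (Multiset.nodup_add.1 hd).2.2 (mem_singleton_self a)
        (by simp)
    have ha : a ∉ nouts N := fun h => Multiset.disjoint_left.1 (Multiset.nodup_add.1 hd).2.2
      (mem_singleton_self a) (Multiset.mem_add.2 (Or.inr h))
    have hb : b ∉ nouts N := Multiset.disjoint_left.1 (Multiset.nodup_add.1 hd').2.2
      (mem_singleton_self b)
    obtain ⟨f, hf⟩ := ih hd' (Function.update f₀ b (f₀ a))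
    have hfa : f a = f₀ a := by rw [hf.frame a ha, Function.update_of_ne hab]
    have hfb : f b = f₀ a := by rw [hf.frame b hb]; simp
    refine ⟨f, fun x hx => ?_, ?_, ?_, fun a' b' hab' => ?_⟩
    · rw [nouts_cons, wire, mem_add, not_or, mem_singleton] at hx
      rw [hf.frame x hx.2, Function.update_of_ne hx.1]
    · rw [← hf.out]; simp
    · rw [Multiset.filter_cons_of_neg _ (by simp)]; exact hf.nodes
    · rcases Multiset.mem_cons.1 hab' with h | h
      · simp [wire] at h
        obtain ⟨rfl, rfl⟩ := h
        rw [hfa, hfb]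
      · exact hf.wire _ _ h

theorem Chains.track {i o : List ℕ} {N : Multiset Node} (h : Chains i o N)
    (hd : ((i : Multiset ℕ) + nouts N).Nodup) (f₀ : ℕ → ℕ) :
    ∃ f, Track o N f₀ f (i.map f₀) 0 := by
  induction h generalizing f₀ with
  | nil => exact ⟨f₀, .nil [] f₀⟩
  | @cons a b i o N M h h' ih =>
    have hd' := nodup_right (i := [a]) (i' := i) hd
    obtain ⟨f, hf⟩ := h.track (nodup_left (i := [a]) (M := M) (by
      rw [← Multiset.cons_coe, Multiset.cons_add] at hd
      rw [Multiset.coe_singleton, singleton_add]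
      rw [Multiset.nodup_cons] at hd ⊢
      exact ⟨fun h => hd.1 (Multiset.mem_add.2 (Or.inr h)), (Multiset.nodup_add.1 hd.2).2.1⟩)) f₀
    obtain ⟨f', hf'⟩ := ih hd'.1 f
    have := Track.par (i := [a]) (o := [b]) h.balance (by
      rw [← Multiset.cons_coe, Multiset.cons_add] at hd
      rw [Multiset.coe_singleton, singleton_add]
      rw [Multiset.nodup_cons] at hd ⊢
      exact ⟨fun h => hd.1 (Multiset.mem_add.2 (Or.inr h)), (Multiset.nodup_add.1 hd.2).2.1⟩) hf hf'
    refine ⟨f', ?_⟩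
    have h1 : (a :: i).map f₀ = [f₀ a] ++ i.map f := by
      rw [List.map_cons, List.singleton_append]
      congr 1
      exact List.map_congr_left fun x hx => (hf.frame x (hd'.2 x hx)).symm
    rw [h1]; exact this

theorem Inf.Real.track {A B : Formula} {ρ : Inf A B} {i o : List ℕ} {N : Multiset Node}
    (h : ρ.Real i o N) (hd : ((i : Multiset ℕ) + nouts N).Nodup) (f₀ : ℕ → ℕ) (l : A.Lab) (k : ℕ)
    (hl : Lab.toList A l = i.map f₀) :
    ∃ f, Track o N f₀ f (Lab.toList B (ρ.trace l k).1) (ρ.trace l k).2.1 := by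
  cases ρ with
  | eq t h' =>
    obtain ⟨h1, rfl, rfl⟩ := h
    refine ⟨f₀, ?_⟩
    refine Track.of_eq ?_
    simp only [Inf.trace, Lab.toList_map, List.map_map, hl]
    refine List.map_congr_left fun j hj => ?_
    have : j < i.length := h1 ▸ List.mem_range.1 (h'.perm.subset hj)
    simp [this]
  | iDown a =>
    obtain ⟨a, b, rfl, rfl, rfl⟩ := h
    have hab : a ≠ b := by simpa [iD] using hd
    refine ⟨Function.update (Function.update f₀ a k) b (k + 1), fun x hx => ?_, ?_, ?_, ?_⟩
    · simp [iD] at hx; simp [hx]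
    · simp [Inf.trace, Lab.toList, hab]; rfl
    · simp [Inf.trace, Multiset.filter_singleton, hab]
    · intro x y h; simpa [wire, iD] using congrArg Node.ins (Multiset.mem_singleton.1 h)
  | wDown a =>
    obtain ⟨a, rfl, rfl, rfl⟩ := h
    refine ⟨Function.update f₀ a k, fun x hx => ?_, ?_, ?_, ?_⟩
    · simp [wD] at hx; simp [hx]
    · simp [Inf.trace, Lab.toList]
    · simp [Inf.trace, Multiset.filter_singleton]
    · intro x y h; simpa [wire, wD] using congrArg Node.ins (Multiset.mem_singleton.1 h)
  | cDown a =>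
    obtain ⟨a, b, c, rfl, rfl, rfl⟩ := h
    have hab : (a ≠ b ∧ a ≠ c) ∧ b ≠ c := by
      have : ({a, b, c} : Multiset ℕ).Nodup := hd
      simpa using this
    have h1 : l.1 = f₀ a := by
      have : [(l.1 : ℕ), l.2] = [f₀ a, f₀ b] := hl
      exact (List.cons.inj this).1
    have h2 : l.2 = f₀ b := by
      have : [(l.1 : ℕ), l.2] = [f₀ a, f₀ b] := hl
      exact (List.cons.inj (List.cons.inj this).2).1
    refine ⟨Function.update f₀ c k, fun x hx => ?_, ?_, ?_, ?_⟩
    · simp [cD] at hx; simp [hx]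
    · simp [Inf.trace, Lab.toList]
    · simp [Inf.trace, Multiset.filter_singleton, hab, h1, h2]
    · intro x y h
      simpa [wire, cD] using congrArg (Multiset.card ∘ Node.ins) (Multiset.mem_singleton.1 h)
  | iUp a =>
    obtain ⟨a, b, rfl, rfl, rfl⟩ := h
    have h1 : l.1 = f₀ a := by
      have : [(l.1 : ℕ), l.2] = [f₀ a, f₀ b] := hl
      exact (List.cons.inj this).1
    have h2 : l.2 = f₀ b := by
      have : [(l.1 : ℕ), l.2] = [f₀ a, f₀ b] := hl
      exact (List.cons.inj (List.cons.inj this).2).1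
    refine ⟨f₀, fun x hx => rfl, ?_, ?_, ?_⟩
    · simp [Inf.trace, Lab.toList]
    · simp [Inf.trace, Multiset.filter_singleton, h1, h2]
    · intro x y h; simpa [wire, iU] using congrArg Node.outs (Multiset.mem_singleton.1 h)
  | wUp a =>
    obtain ⟨a, rfl, rfl, rfl⟩ := h
    have h1 : l = f₀ a := by
      have : [(l : ℕ)] = [f₀ a] := hl
      exact (List.cons.inj this).1
    refine ⟨f₀, fun x hx => rfl, ?_, ?_, ?_⟩
    · simp [Inf.trace, Lab.toList]
    · simp [Inf.trace, Multiset.filter_singleton, h1]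
    · intro x y h; simpa [wire, wU] using congrArg Node.outs (Multiset.mem_singleton.1 h)
  | cUp a =>
    obtain ⟨a, b, c, rfl, rfl, rfl⟩ := h
    have hab : (a ≠ b ∧ a ≠ c) ∧ b ≠ c := by
      have : ({a, b, c} : Multiset ℕ).Nodup := hd
      simpa using this
    have h1 : l = f₀ a := by
      have : [(l : ℕ)] = [f₀ a] := hl
      exact (List.cons.inj this).1
    refine ⟨Function.update (Function.update f₀ b k) c (k + 1), fun x hx => ?_, ?_, ?_, ?_⟩
    · simp [cU] at hx; simp [hx]
    · simp [Inf.trace, Lab.toList, hab]; rfl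
    · simp [Inf.trace, Multiset.filter_singleton, hab, h1]
    · intro x y h
      simpa [wire, cU] using congrArg (Multiset.card ∘ Node.outs) (Multiset.mem_singleton.1 h)
  | switch A B C =>
    obtain ⟨h, rfl, rfl⟩ := h
    refine ⟨f₀, ?_⟩
    refine Track.of_eq ?_
    rw [← hl]; simp [Inf.trace, Lab.toList]
  | medial A B C D =>
    obtain ⟨a, b, c, d, ha, hb, hc, hd, rfl, rfl, rfl⟩ := h
    refine ⟨f₀, ?_⟩
    refine Track.of_eq ?_
    simp only [Lab.toList, List.map_append] at hl
    obtain ⟨h1, h2⟩ := List.append_inj hl (by simp [Lab.length_toList, ha, hb])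
    obtain ⟨h3, h4⟩ := List.append_inj h1 (by simp [Lab.length_toList, ha])
    obtain ⟨h5, h6⟩ := List.append_inj h2 (by simp [Lab.length_toList, hc])
    simp [Inf.trace, Lab.toList, h3, h4, h5, h6]

theorem Der.Real.track {A B : Formula} {Φ : Der A B} {i o : List ℕ} {N : Multiset Node}
    (h : Φ.Real i o N) (hd : ((i : Multiset ℕ) + nouts N).Nodup) (f₀ : ℕ → ℕ) (l : A.Lab) (k : ℕ)
    (hl : Lab.toList A l = i.map f₀) :
    ∃ f, Track o N f₀ f (Lab.toList B (Φ.trace l k).1) (Φ.trace l k).2.1 := by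
  induction Φ generalizing i o N f₀ k with
  | fm A =>
    obtain ⟨f, hf⟩ := h.2.track hd f₀
    exact ⟨f, hl ▸ hf⟩
  | and Φ Ψ ih₁ ih₂ | or Φ Ψ ih₁ ih₂ =>
    obtain ⟨i₁, i₂, o₁, o₂, N₁, N₂, rfl, rfl, rfl, h₁, h₂⟩ := h
    simp only [Lab.toList, List.map_append] at hl
    obtain ⟨h3, h4⟩ := List.append_inj hl (by simp [Lab.length_toList, h₁.length])
    have hd₁ : ((i₁ : Multiset ℕ) + nouts (N₁ + N₂)).Nodup := by
      rw [← Multiset.coe_add, add_assoc, add_left_comm] at hd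
      exact (Multiset.nodup_add.1 hd).2.1
    have hd₂ := nodup_right hd
    obtain ⟨f, hf⟩ := ih₁ h₁ (nodup_left hd₁) f₀ l.1 k h3
    obtain ⟨f', hf'⟩ := ih₂ h₂ hd₂.1 f l.2 (Φ.trace l.1 k).2.2 (by
      rw [h4]; exact List.map_congr_left fun x hx => (hf.frame x (hd₂.2 x hx)).symm)
    exact ⟨f', Track.par h₁.balance hd₁ hf hf'⟩
  | step Φ ρ Ψ ih₁ ih₂ =>
    obtain ⟨x, y, N₁, N₂, N₃, rfl, h₁, h₂, h₃⟩ := h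
    have hd' := hd
    rw [add_assoc] at hd'
    obtain ⟨f, hf⟩ := ih₁ h₁ (nodup_left hd') f₀ l k hl
    have hd₂ := nodup_seq h₁.balance hd'
    obtain ⟨f', hf'⟩ := h₂.track (nodup_left hd₂) f _ (Φ.trace l k).2.2 hf.out
    obtain ⟨f'', hf''⟩ := ih₂ h₃ (nodup_seq h₂.balance hd₂) f' _
      (ρ.trace (Φ.trace l k).1 (Φ.trace l k).2.2).2.2 hf'.out
    have := Track.seq h₁.balance hd' hf (Track.seq h₂.balance hd₂ hf' hf'')
    rw [← add_assoc, ← add_assoc] at this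
    exact ⟨f'', this⟩

theorem WFlow.root {N : Multiset Node} (hw : WFlow N) (x : ℕ) :
    ∃ y, (y = x ∨ y ∈ nins N) ∧ EqvGen (WRel N) y x ∧
      (y ∉ nouts N ∨ y ∈ nouts (N.filter fun n => ¬ n.IsWire)) := by
  obtain ⟨-, -, -, h, hh⟩ := hw
  induction hx : h x using Nat.strong_induction_on generalizing x with
  | _ n ih =>
    by_cases hxn : x ∈ nouts N
    · obtain ⟨m, hm, hxm⟩ := mem_nouts.1 hxn
      by_cases hmw : m.IsWire
      · obtain ⟨a, b, rfl⟩ := Node.isWire_iff.1 hmw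
        obtain rfl : x = b := by simpa [wire] using hxm
        have hlt := hh _ hm a (by simp [wire]) x hxm
        obtain ⟨y, h1, h2, h3⟩ := ih (h a) (hx ▸ hlt) a rfl
        refine ⟨y, Or.inr ?_, h2.trans _ _ _ (.rel _ _ hm), h3⟩
        rcases h1 with rfl | h1
        · exact mem_nins.2 ⟨_, hm, by simp [wire]⟩
        · exact h1
      · exact ⟨x, Or.inl rfl, .refl x, Or.inr (mem_nouts.2 ⟨m, by simp [hm, hmw], hxm⟩)⟩
    · exact ⟨x, Or.inl rfl, .refl x, Or.inl hxn⟩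

theorem Der.Real.den {A B : Formula} {Φ : Der A B} {i o : List ℕ} {N : Multiset Node}
    (h : Φ.Real i o N) (hw : WFlow N) (hi : i.Nodup) (hio : ∀ x ∈ i, x ∉ o) : Den N Φ.flow := by
  have hb := h.balance
  have hin : ∀ x ∈ i, x ∈ nins N := fun x hx => by
    have : x ∈ nins N + (o : Multiset ℕ) := hb ▸ Multiset.mem_add.2 (Or.inl hx)
    exact (Multiset.mem_add.1 this).resolve_right (hio x hx)
  have hd : ((i : Multiset ℕ) + nouts N).Nodup := by
    refine Multiset.nodup_add.2 ⟨hi, hw.outs_nodup, Multiset.disjoint_left.2 fun {x} hx hx' => ?_⟩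
    have h1 : 2 ≤ Multiset.count x ((i : Multiset ℕ) + nouts N) := by
      rw [Multiset.count_add]
      have := Multiset.count_pos.2 hx
      have := Multiset.count_pos.2 hx'
      omega
    rw [hb, Multiset.count_add, Multiset.count_eq_zero_of_notMem (s := (o : Multiset ℕ)) (hio x hx)] at h1
    have := Multiset.nodup_iff_count_le_one.1 hw.ins_nodup x
    omega
  have hl : Lab.toList A (A.numbering 0) = i.map (i.idxOf ·) := by
    rw [toList_numbering, ← h.length.1]
    apply List.ext_getElem
    · simp
    · intro j h1 h2
      simp [hi.idxOf_getElem]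
  obtain ⟨f, hf⟩ := h.track hd (i.idxOf ·) _ A.numAtoms hl
  have ht := Φ.traceOK (A.numbering 0) A.numAtoms
  set k := (Φ.trace (A.numbering 0) A.numAtoms).2.2 with hk
  set F := N.filter fun n => ¬ n.IsWire with hF
  have hFN : nouts F ≤ nouts N := by
    rw [← Multiset.filter_add_not Node.IsWire N, nouts_add]; exact Multiset.le_add_left _ _
  have hfi : (i : Multiset ℕ).map f = Multiset.Ico 0 A.numAtoms := by
    have : (i : Multiset ℕ).map f = (i.map (i.idxOf ·) : List ℕ) := by
      rw [Multiset.map_coe, Multiset.coe_eq_coe]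
      refine List.Perm.of_eq (List.map_congr_left fun x hx => hf.frame x ?_)
      exact Multiset.disjoint_left.1 (Multiset.nodup_add.1 hd).2.2 hx
    rw [this, ← hl, toList_numbering]; rfl
  have hfo : (nouts F).map f = Multiset.Ico A.numAtoms k := by
    rw [← nouts_map, hf.nodes]; exact ht.outs
  have hroots : ((i : Multiset ℕ) + nouts F).map f = Multiset.Ico 0 k := by
    rw [Multiset.map_add, hfi, hfo, Multiset.Ico_add_Ico_eq_Ico (Nat.zero_le _) ht.le]
  have hwire : ∀ a b, EqvGen (WRel N) a b → f a = f b := by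
    intro a b hab
    induction hab with
    | rel a b h => exact hf.wire a b h
    | refl a => rfl
    | symm a b _ ih => exact ih.symm
    | trans a b c _ _ ih₁ ih₂ => exact ih₁.trans ih₂
  have hroot : ∀ x ∈ nm N, ∃ y ∈ ((i : Multiset ℕ) + nouts F), EqvGen (WRel N) y x := by
    intro x hx
    obtain ⟨y, h1, h2, h3⟩ := hw.root x
    refine ⟨y, Multiset.mem_add.2 ?_, h2⟩
    rcases h3 with h3 | h3
    · have h4 : y ∈ nins N := by
        rcases h1 with rfl | h1
        · exact (mem_nm.1 hx).resolve_right h3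
        · exact h1
      have : y ∈ (i : Multiset ℕ) + nouts N := hb ▸ Multiset.mem_add.2 (Or.inl h4)
      exact Or.inl ((Multiset.mem_add.1 this).resolve_right h3)
    · exact Or.inr h3
  have hinj := Multiset.inj_on_of_nodup_map (f := f) (hroots ▸ Multiset.nodup_Ico)
  refine ⟨f, _, Φ.diagram_isFlow, ⟨?_, hf.nodes.symm, ?_⟩, rfl⟩
  · ext e
    show e ∈ Finset.range k ↔ _
    rw [Finset.mem_range, Finset.mem_image]
    constructor
    · intro he
      have : e ∈ ((i : Multiset ℕ) + nouts F).map f := by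
        rw [hroots]; exact Multiset.mem_Ico.2 ⟨Nat.zero_le _, he⟩
      obtain ⟨y, hy, rfl⟩ := Multiset.mem_map.1 this
      refine ⟨y, mem_nm.2 ?_, rfl⟩
      rcases Multiset.mem_add.1 hy with hy | hy
      · exact Or.inl (hin y hy)
      · exact Or.inr (Multiset.mem_of_le hFN hy)
    · rintro ⟨x, hx, rfl⟩
      obtain ⟨y, hy, hyx⟩ := hroot x hx
      have := Multiset.mem_map_of_mem f hy
      rw [hroots, hwire y x hyx] at this
      exact (Multiset.mem_Ico.1 this).2
  · intro x hx y hy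
    refine ⟨fun hxy => ?_, hwire x y⟩
    obtain ⟨x', hx', hxx⟩ := hroot x hx
    obtain ⟨y', hy', hyy⟩ := hroot y hy
    have : x' = y' := hinj x' hx' y' hy' (by rw [hwire _ _ hxx, hwire _ _ hyy, hxy])
    subst this
    exact (EqvGen.symm _ _ hxx).trans _ _ _ hyy

theorem Inf.real_trace {A B : Formula} (ρ : Inf A B) (l : A.Lab) (k : ℕ) :
    ρ.Real (Lab.toList A l) (Lab.toList B (ρ.trace l k).1) (ρ.trace l k).2.1 := by
  cases ρ with
  | eq t h => exact ⟨Lab.length_toList _ _, Lab.toList_map _ _ _, rfl⟩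
  | iDown a => exact ⟨_, _, rfl, rfl, rfl⟩
  | wDown a => exact ⟨_, rfl, rfl, rfl⟩
  | cDown a => exact ⟨_, _, _, rfl, rfl, rfl⟩
  | iUp a => exact ⟨_, _, rfl, rfl, rfl⟩
  | wUp a => exact ⟨_, rfl, rfl, rfl⟩
  | cUp a => exact ⟨_, _, _, rfl, rfl, rfl⟩
  | switch A B C =>
    exact ⟨by simp [Lab.toList, Lab.length_toList], by simp [Inf.trace, Lab.toList], rfl⟩
  | medial A B C D =>
    exact ⟨Lab.toList A l.1.1, Lab.toList B l.1.2, Lab.toList C l.2.1, Lab.toList D l.2.2,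
      Lab.length_toList _ _, Lab.length_toList _ _, Lab.length_toList _ _, Lab.length_toList _ _,
      rfl, rfl, rfl⟩

theorem Der.real_trace {A B : Formula} (Φ : Der A B) (l : A.Lab) (k : ℕ) :
    Φ.Real (Lab.toList A l) (Lab.toList B (Φ.trace l k).1) (Φ.trace l k).2.1 := by
  induction Φ generalizing k with
  | fm A => exact ⟨Lab.length_toList _ _, .refl _⟩
  | and Φ Ψ ih₁ ih₂ => exact (ih₁ l.1 k).and (ih₂ l.2 _)
  | or Φ Ψ ih₁ ih₂ => exact (ih₁ l.1 k).or (ih₂ l.2 _)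
  | step Φ ρ Ψ ih₁ ih₂ => exact ⟨_, _, _, _, _, rfl, ih₁ l k, ρ.real_trace _ _, ih₂ _ _⟩

theorem Der.Real.chains_left {A B : Formula} {Φ : Der A B} {i i' o : List ℕ} {N M : Multiset Node}
    (h' : Chains i' i M) (h : Φ.Real i o N) : Φ.Real i' o (M + N) := by
  induction Φ generalizing i i' o N M with
  | fm A => exact ⟨h'.length.trans h.1, h'.trans h.2⟩
  | and Φ Ψ ih₁ ih₂ | or Φ Ψ ih₁ ih₂ =>
    obtain ⟨i₁, i₂, o₁, o₂, N₁, N₂, rfl, rfl, rfl, h₁, h₂⟩ := h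
    obtain ⟨x, y, rfl, hx⟩ : ∃ x y, i' = x ++ y ∧ x.length = i₁.length :=
      ⟨i'.take i₁.length, i'.drop i₁.length, by simp, by simp [h'.length]⟩
    obtain ⟨o₃, o₄, M₁, M₂, e, rfl, h₃, h₄⟩ := h'.split
    obtain ⟨rfl, rfl⟩ := List.append_inj e (by rw [← hx, h₃.length])
    rw [add_add_add_comm]
    exact (ih₁ h₃ h₁).and (ih₂ h₄ h₂)
  | step Φ ρ Ψ ih₁ ih₂ =>
    obtain ⟨x, y, N₁, N₂, N₃, rfl, h₁, h₂, h₃⟩ := h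
    exact ⟨x, y, M + N₁, N₂, N₃, by ac_rfl, ih₁ h' h₁, h₂, h₃⟩

theorem chains_range (k n m : ℕ) : Chains (List.range' k n) (List.range' m n)
    ((Multiset.range n).map fun j => wire (k + j) (m + j)) := by
  induction n with
  | zero => exact .nil
  | succ n ih =>
    rw [List.range'_concat, List.range'_concat, Multiset.range_succ, Multiset.map_cons, add_comm,
      ← singleton_add, add_comm {_}] at *
    simpa [add_comm] using ih.append (.single (.cons (.nil (m + n))))

theorem Der.flow_normalize {A B : Formula} (Φ : Der A B) :
    ReflTransGen Flow.Step Φ.flow Φ.normalize.flow := by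
  set n := A.numAtoms with hn
  set k := (Φ.trace (A.numbering 0) n).2.2 with hk
  have ht := Φ.traceOK (A.numbering 0) n
  have hR := Φ.real_trace (A.numbering 0) n
  set T := (Φ.trace (A.numbering 0) n).2.1 with hT
  set o := Lab.toList B (Φ.trace (A.numbering 0) n).1 with ho
  rw [toList_numbering] at ht hR
  have hlt : ∀ e ∈ ((List.range' 0 A.numAtoms : List ℕ) : Multiset ℕ), e < n := by
    intro e he; simpa using he
  have h0 := hR.chains_left (chains_range k n 0)
  set W := (Multiset.range n).map fun j => wire (k + j) (0 + j) with hW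
  have hWi : nins W = (Multiset.range n).map (k + ·) := by
    simp [hW, nins, Multiset.bind_map, wire, Multiset.bind_singleton]
  have hWo : nouts W = Multiset.range n := by
    simpa [hW, nouts, Multiset.bind_map, wire] using
      Multiset.bind_singleton (Multiset.range n) id
  have hmax : ∀ e ∈ nins T + (o : Multiset ℕ), e < k := by
    intro e he
    rw [show nins T + (o : Multiset ℕ) = _ from ht.conserve.symm] at he
    rcases Multiset.mem_add.1 he with he | he
    · exact (hlt e he).trans_le ht.le
    · exact (Multiset.mem_Ico.1 he).2
  have hTi : (nins T + (o : Multiset ℕ)).Nodup := by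
    rw [show nins T + (o : Multiset ℕ) = _ from ht.conserve.symm]
    refine Multiset.nodup_add.2 ⟨List.nodup_range', Multiset.nodup_Ico, ?_⟩
    refine Multiset.disjoint_left.2 fun {x} hx hx' => ?_
    have := hlt x hx
    have := (Multiset.mem_Ico.1 hx').1
    omega
  have hnd : WFlow (W + T) := by
    refine ⟨?_, ?_, ?_, fun x => if x < k then x + 1 else 0, ?_⟩
    · intro m hm
      rcases Multiset.mem_add.1 hm with hm | hm
      · obtain ⟨j, -, rfl⟩ := Multiset.mem_map.1 hm
        exact Or.inr (Node.isWire_wire _ _)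
      · exact Or.inl (ht.kind m hm)
    · rw [nins_add, hWi]
      refine Multiset.nodup_add.2 ⟨(Multiset.nodup_range n).map (add_right_injective k),
        (Multiset.nodup_add.1 hTi).1, Multiset.disjoint_left.2 fun {x} hx hx' => ?_⟩
      obtain ⟨j, -, rfl⟩ := Multiset.mem_map.1 hx
      have := hmax _ (Multiset.mem_add.2 (Or.inl hx'))
      omega
    · rw [nouts_add, hWo, show nouts T = _ from ht.outs]
      refine Multiset.nodup_add.2 ⟨Multiset.nodup_range n, Multiset.nodup_Ico,
        Multiset.disjoint_left.2 fun {x} hx hx' => ?_⟩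
      have := Multiset.mem_range.1 hx
      have := (Multiset.mem_Ico.1 hx').1
      omega
    · intro m hm a ha b hb
      rcases Multiset.mem_add.1 hm with hm | hm
      · obtain ⟨j, hj, rfl⟩ := Multiset.mem_map.1 hm
        simp only [wire, mem_singleton] at ha hb
        have := Multiset.mem_range.1 hj
        have := ht.le
        subst ha hb
        have h1 : ¬ k + j < k := by omega
        have h2 : 0 + j < k := by omega
        simp only [h1, h2, if_true, if_false]
        omega
      · have h1 := ht.lt hlt m hm a ha b hb
        have h2 : b ∈ Multiset.Ico n k := by
          rw [← ht.outs]; exact mem_nouts.2 ⟨m, hm, hb⟩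
        have h3 := (Multiset.mem_Ico.1 h2).2
        simp only [h3, h1.trans h3, if_true]
        omega
  have hio : ∀ x ∈ List.range' k n, x ∉ o := by
    intro x hx hx'
    have := hmax x (Multiset.mem_add.2 (Or.inr hx'))
    simp at hx
    omega
  obtain ⟨N', hN', hr⟩ := sim_normalize h0 0
  rw [add_zero, add_zero] at hr
  obtain ⟨hw', hr⟩ := hr hnd
  exact hr _ _ (h0.den hnd List.nodup_range' hio) (hN'.den hw' List.nodup_range' hio)

/-! ### Classes of edges

A realization whose edges are named by numbers that need not be distinct is a classification of the
edges of the derivation. -/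

theorem Chain.of_no_wire {a b : ℕ} {N : Multiset Node} (h : Chain a b N)
    (hN : ∀ n ∈ N, ¬ n.IsWire) : a = b ∧ N = 0 := by
  cases h with
  | nil => exact ⟨rfl, rfl⟩
  | cons h => exact absurd (Node.isWire_wire _ _) (hN _ (Multiset.mem_cons_self _ _))

theorem Chains.of_no_wire {i o : List ℕ} {N : Multiset Node} (h : Chains i o N)
    (hN : ∀ n ∈ N, ¬ n.IsWire) : i = o ∧ N = 0 := by
  induction h with
  | nil => exact ⟨rfl, rfl⟩
  | cons h _ ih =>
    obtain ⟨rfl, rfl⟩ := h.of_no_wire fun n hn => hN n (Multiset.mem_add.2 (Or.inl hn))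
    obtain ⟨rfl, rfl⟩ := ih fun n hn => hN n (Multiset.mem_add.2 (Or.inr hn))
    exact ⟨rfl, rfl⟩

theorem TraceOK.nm_lt {l l' : Multiset ℕ} {k k' : ℕ} {T : Multiset Node}
    (h : TraceOK l l' k k' T) (hl : ∀ e ∈ l, e < k) : ∀ e ∈ nm T, e < k' := by
  intro e he
  rcases mem_nm.1 he with he | he
  · have h1 : e ∈ l + Multiset.Ico k k' := by
      rw [h.conserve]; exact Multiset.mem_add.2 (Or.inl he)
    rcases Multiset.mem_add.1 h1 with h1 | h1
    · exact (hl e h1).trans_le h.le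
    · exact (Multiset.mem_Ico.1 h1).2
  · rw [show nouts T = _ from h.outs] at he
    exact (Multiset.mem_Ico.1 he).2

theorem Inf.Real.classify {A B : Formula} {ρ : Inf A B} {i o : List ℕ} {N : Multiset Node}
    (h : ρ.Real i o N) (l : A.Lab) (k : ℕ) (g₀ : ℕ → ℕ) (hl : (Lab.toList A l).map g₀ = i)
    (hk : ∀ e ∈ Lab.toList A l, e < k) :
    ∃ g : ℕ → ℕ, (∀ x < k, g x = g₀ x) ∧ (Lab.toList B (ρ.trace l k).1).map g = o ∧
      nmap g (ρ.trace l k).2.1 = N := by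
  have upd : ∀ a, ∃ g : ℕ → ℕ, (∀ x < k, g x = g₀ x) ∧ g k = a := fun a =>
    ⟨Function.update g₀ k a, fun x hx => by simp [hx.ne], by simp⟩
  have upd₂ : ∀ a b, ∃ g : ℕ → ℕ, (∀ x < k, g x = g₀ x) ∧ g k = a ∧ g (k + 1) = b := fun a b =>
    ⟨Function.update (Function.update g₀ k a) (k + 1) b, fun x hx => by
      simp [hx.ne, show x ≠ k + 1 by omega], by simp, by simp⟩
  cases ρ with
  | eq t h' =>
    obtain ⟨h1, rfl, rfl⟩ := h
    refine ⟨g₀, fun _ _ => rfl, ?_, rfl⟩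
    simp only [Inf.trace, Lab.toList_map, List.map_map, ← hl]
    refine List.map_congr_left fun j hj => ?_
    have h2 : j < (Lab.toList A l).length := by
      rw [Lab.length_toList]; exact List.mem_range.1 (h'.perm.subset hj)
    simp [h2]
  | iDown a =>
    obtain ⟨a, b, rfl, rfl, rfl⟩ := h
    obtain ⟨g, h1, h2, h3⟩ := upd₂ a b
    exact ⟨g, h1, by show [g k, g (k + 1)] = _; rw [h2, h3],
      by simp [Inf.trace, h2, h3]⟩
  | wDown a =>
    obtain ⟨a, rfl, rfl, rfl⟩ := h
    obtain ⟨g, h1, h2⟩ := upd a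
    exact ⟨g, h1, by simp [Inf.trace, Lab.toList, h2], by simp [Inf.trace, h2]⟩
  | cDown a =>
    obtain ⟨a, b, c, rfl, rfl, rfl⟩ := h
    obtain ⟨g, h1, h2⟩ := upd c
    have h3 : g₀ l.1 = a := (List.cons.inj hl).1
    have h4 : g₀ l.2 = b := (List.cons.inj (List.cons.inj hl).2).1
    have h5 : g l.1 = g₀ l.1 := h1 _ (hk l.1 (List.mem_cons_self ..))
    have h6 : g l.2 = g₀ l.2 := h1 _ (hk l.2 (List.mem_cons_of_mem _ (List.mem_cons_self ..)))
    exact ⟨g, h1, by simp [Inf.trace, Lab.toList, h2],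
      congrArg (fun n => ({n} : Multiset Node)) ((Node.map_cD g l.1 l.2 k).trans (by rw [h5, h6, h2, h3, h4]))⟩
  | iUp a =>
    obtain ⟨a, b, rfl, rfl, rfl⟩ := h
    have h3 : g₀ l.1 = a := (List.cons.inj hl).1
    have h4 : g₀ l.2 = b := (List.cons.inj (List.cons.inj hl).2).1
    exact ⟨g₀, fun _ _ => rfl, rfl,
      congrArg (fun n => ({n} : Multiset Node)) ((Node.map_iU g₀ l.1 l.2).trans (by rw [h3, h4]))⟩
  | wUp a =>
    obtain ⟨a, rfl, rfl, rfl⟩ := h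
    have h3 : g₀ l = a := (List.cons.inj hl).1
    exact ⟨g₀, fun _ _ => rfl, rfl,
      congrArg (fun n => ({n} : Multiset Node)) ((Node.map_wU g₀ l).trans (by rw [h3]))⟩
  | cUp a =>
    obtain ⟨a, b, c, rfl, rfl, rfl⟩ := h
    obtain ⟨g, h1, h2, h3⟩ := upd₂ b c
    have h4 : g₀ l = a := (List.cons.inj hl).1
    have h5 : g l = g₀ l := h1 _ (hk l (List.mem_cons_self ..))
    exact ⟨g, h1, by show [g k, g (k + 1)] = _; rw [h2, h3],
      congrArg (fun n => ({n} : Multiset Node)) ((Node.map_cU g l k (k + 1)).trans (by rw [h5, h4, h2, h3]))⟩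
  | switch A B C =>
    obtain ⟨h, rfl, rfl⟩ := h
    exact ⟨g₀, fun _ _ => rfl, by rw [← hl]; simp [Inf.trace, Lab.toList], rfl⟩
  | medial A B C D =>
    obtain ⟨a, b, c, d, ha, hb, hc, hd, rfl, rfl, rfl⟩ := h
    refine ⟨g₀, fun _ _ => rfl, ?_, rfl⟩
    simp only [Lab.toList, List.map_append] at hl
    obtain ⟨h1, h2⟩ := List.append_inj hl (by simp [Lab.length_toList, ha, hb])
    obtain ⟨h3, h4⟩ := List.append_inj h1 (by simp [Lab.length_toList, ha])
    obtain ⟨h5, h6⟩ := List.append_inj h2 (by simp [Lab.length_toList, hc])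
    simp [Inf.trace, Lab.toList, h3, h4, h5, h6]

theorem Der.Real.classify {A B : Formula} {Φ : Der A B} {i o : List ℕ} {N : Multiset Node}
    (h : Φ.Real i o N) (hN : ∀ n ∈ N, ¬ n.IsWire) (l : A.Lab) (k : ℕ) (g₀ : ℕ → ℕ)
    (hl : (Lab.toList A l).map g₀ = i) (hk : ∀ e ∈ Lab.toList A l, e < k) :
    ∃ g : ℕ → ℕ, (∀ x < k, g x = g₀ x) ∧ (Lab.toList B (Φ.trace l k).1).map g = o ∧
      nmap g (Φ.trace l k).2.1 = N := by
  induction Φ generalizing i o N g₀ k with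
  | fm A =>
    obtain ⟨rfl, rfl⟩ := h.2.of_no_wire hN
    exact ⟨g₀, fun _ _ => rfl, hl, rfl⟩
  | and Φ Ψ ih₁ ih₂ | or Φ Ψ ih₁ ih₂ =>
    obtain ⟨i₁, i₂, o₁, o₂, N₁, N₂, rfl, rfl, rfl, h₁, h₂⟩ := h
    simp only [Lab.toList, List.map_append, List.mem_append] at hl hk
    obtain ⟨h3, h4⟩ := List.append_inj hl (by simp [Lab.length_toList, h₁.length])
    have t₁ := Φ.traceOK l.1 k
    have hk₁ : ∀ e ∈ Lab.toList _ l.1, e < k := fun e he => hk e (Or.inl he)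
    have hk₂ : ∀ e ∈ Lab.toList _ l.2, e < k := fun e he => hk e (Or.inr he)
    obtain ⟨g, e1, e2, e3⟩ := ih₁ h₁ (fun n hn => hN n (Multiset.mem_add.2 (Or.inl hn))) l.1 k g₀
      h3 hk₁
    obtain ⟨g', f1, f2, f3⟩ := ih₂ h₂ (fun n hn => hN n (Multiset.mem_add.2 (Or.inr hn))) l.2
      (Φ.trace l.1 k).2.2 g (by
        rw [← h4]; exact List.map_congr_left fun x hx => e1 x (hk₂ x hx))
      (fun e he => (hk₂ e he).trans_le t₁.le)
    refine ⟨g', fun x hx => (f1 x (hx.trans_le t₁.le)).trans (e1 x hx), ?_, ?_⟩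
    · simp only [Der.trace, Lab.toList, List.map_append]
      rw [f2, ← e2]
      congr 1
      exact List.map_congr_left fun x hx => f1 x (t₁.lt_next hk₁ x hx)
    · simp only [Der.trace, nmap, Multiset.map_add]
      rw [← f3, ← e3]
      congr 1
      exact nmap_congr fun x hx => f1 x (t₁.nm_lt hk₁ x hx)
  | step Φ ρ Ψ ih₁ ih₂ =>
    obtain ⟨x, y, N₁, N₂, N₃, rfl, h₁, h₂, h₃⟩ := h
    simp only [mem_add] at hN
    have t₁ := Φ.traceOK l k
    obtain ⟨g, e1, e2, e3⟩ := ih₁ h₁ (fun n hn => hN n (Or.inl (Or.inl hn))) l k g₀ hl hk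
    have t₂ := ρ.traceOK (Φ.trace l k).1 (Φ.trace l k).2.2
    have hk₂ := t₁.lt_next hk
    obtain ⟨g', f1, f2, f3⟩ := h₂.classify _ (Φ.trace l k).2.2 g e2 hk₂
    have hk₃ := t₂.lt_next hk₂
    obtain ⟨g'', d1, d2, d3⟩ := ih₂ h₃ (fun n hn => hN n (Or.inr hn)) _
      (ρ.trace (Φ.trace l k).1 (Φ.trace l k).2.2).2.2 g' f2 hk₃
    have hle := t₁.le
    have hle' := t₂.le
    refine ⟨g'', fun x hx => ?_, d2, ?_⟩
    · rw [d1 x (by omega), f1 x (by omega), e1 x hx]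
    · simp only [Der.trace, nmap, Multiset.map_add]
      rw [← d3, ← f3, ← e3]
      congr 2
      · exact nmap_congr fun x hx => by
          have := t₁.nm_lt hk x hx
          rw [d1 x (by omega), f1 x this]
      · exact nmap_congr fun x hx => d1 x (t₂.nm_lt hk₂ x hx)

/-- A realization all of whose nodes are admitted by `ok`. -/
def Typ (ok : Node → Prop) {A B : Formula} (Φ : Der A B) (i o : List ℕ) : Prop :=
  ∃ N, Φ.Real i o N ∧ ∀ n ∈ N, ok n

section Typ
variable {ok : Node → Prop} {A B C D : Formula} {i x o i' o' : List ℕ}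

theorem Typ.of_real {Φ : Der A B} (h : Φ.Real i o 0) : Typ ok Φ i o := ⟨0, h, by simp⟩

theorem Typ.fm (h : i.length = A.numAtoms) : Typ ok (fm A) i i := .of_real (.of_fm h)

theorem Typ.and {Φ : Der A B} {Ψ : Der C D} (h : Typ ok Φ i o) (h' : Typ ok Ψ i' o') :
    Typ ok (Φ.and Ψ) (i ++ i') (o ++ o') := by
  obtain ⟨N, h1, h2⟩ := h
  obtain ⟨M, h3, h4⟩ := h'
  exact ⟨N + M, h1.and h3, fun n hn => (Multiset.mem_add.1 hn).elim (h2 n) (h4 n)⟩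

theorem Typ.or {Φ : Der A B} {Ψ : Der C D} (h : Typ ok Φ i o) (h' : Typ ok Ψ i' o') :
    Typ ok (Φ.or Ψ) (i ++ i') (o ++ o') := by
  obtain ⟨N, h1, h2⟩ := h
  obtain ⟨M, h3, h4⟩ := h'
  exact ⟨N + M, h1.or h3, fun n hn => (Multiset.mem_add.1 hn).elim (h2 n) (h4 n)⟩

theorem Typ.comp {Φ : Der A B} {Ψ : Der B C} (h : Typ ok Φ i x) (h' : Typ ok Ψ x o) :
    Typ ok (Φ.comp Ψ) i o := by
  obtain ⟨N, h1, h2⟩ := h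
  obtain ⟨M, h3, h4⟩ := h'
  exact ⟨N + M, h1.comp h3, fun n hn => (Multiset.mem_add.1 hn).elim (h2 n) (h4 n)⟩

theorem Typ.re {h} (hi : i.length = A.numAtoms) : Typ ok (re A B h) i i := .of_real (.re hi)

theorem Typ.inf {ρ : Inf A B} {n : Node} (h : ρ.Real i o {n}) (hn : ok n) :
    Typ ok (Der.inf ρ) i o := ⟨{n}, .inf h, by simpa using hn⟩

theorem Typ.inf_zero {ρ : Inf A B} (h : ρ.Real i o 0) : Typ ok (Der.inf ρ) i o := .of_real (.inf h)

theorem Typ.castR {h : B = C} {Φ : Der A B} (hΦ : Typ ok Φ i o) : Typ ok (castR h Φ) i o := by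
  subst h; exact hΦ

theorem Typ.castL {h : A = C} {Φ : Der A B} (hΦ : Typ ok Φ i o) : Typ ok (castL h Φ) i o := by
  subst h; exact hΦ

theorem Typ.of_eq {Φ : Der A B} (h : Typ ok Φ i o) (hi : i = i') (ho : o = o') :
    Typ ok Φ i' o' := hi ▸ ho ▸ h

theorem Typ.classify {Φ : Der A B} (h : Typ ok Φ i o) (hok : ∀ n, ok n → ¬ n.IsWire)
    (hi : i = List.replicate A.numAtoms 0) :
    ∃ g : ℕ → ℕ, ∀ n ∈ Φ.diagram.nodes, ok (n.map g) := by
  obtain ⟨N, h1, h2⟩ := h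
  obtain ⟨g, -, -, h3⟩ := h1.classify (fun n hn => hok n (h2 n hn)) (A.numbering 0) A.numAtoms
    (fun _ => 0) (by rw [hi, List.map_const', Lab.length_toList]) (by
      rw [toList_numbering]; simp)
  exact ⟨g, fun n hn => h2 _ (h3 ▸ Multiset.mem_map_of_mem _ hn)⟩

end Typ

/-- No coweakening and, unless `m` holds, no cocontraction. -/
def Inf.Plain (m : Bool) : {A B : Formula} → Inf A B → Prop
  | _, _, wUp _ => False
  | _, _, cUp _ => m = true
  | _, _, _ => True

/-- No coweakenings and, unless `m` holds, no cocontractions. -/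
def Der.Plain (m : Bool) : {A B : Formula} → Der A B → Prop
  | _, _, fm _ => True
  | _, _, and Φ Ψ => Φ.Plain m ∧ Ψ.Plain m
  | _, _, or Φ Ψ => Φ.Plain m ∧ Ψ.Plain m
  | _, _, step Φ ρ Ψ => Φ.Plain m ∧ ρ.Plain m ∧ Ψ.Plain m

namespace Der
variable {A B C : Formula} {m : Bool}

theorem Plain.inf {ρ : Inf A B} (h : ρ.Plain m) : (inf ρ).Plain m := ⟨trivial, h, trivial⟩
theorem Plain.re {h} : (re A B h).Plain m := ⟨trivial, trivial, trivial⟩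
theorem Plain.comp {Φ : Der A B} {Ψ : Der B C} (h : Φ.Plain m) (h' : Ψ.Plain m) :
    (Φ.comp Ψ).Plain m := ⟨h, trivial, h'⟩
theorem Plain.castR {h : B = C} {Φ : Der A B} (hΦ : Φ.Plain m) : (castR h Φ).Plain m := by
  subst h; exact hΦ
theorem Plain.orComm : (Der.inf (Inf.orComm A B)).Plain m := .inf trivial
theorem Plain.andComm : (Der.inf (Inf.andComm A B)).Plain m := .inf trivial

theorem Plain.botTop : SKS.botTop.Plain m := .comp .re (.comp (.inf trivial) .re)

theorem Plain.weak (a : Lit) (p : Pat) : (weak a p).Plain m := by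
  induction p with
  | unit => exact .botTop
  | leaf => exact .inf trivial
  | node p q ihp ihq => exact .comp .re ⟨ihp, ihq⟩

theorem Plain.contr (a : Lit) (p : Pat) : (contr a p).Plain m := by
  induction p with
  | unit => exact .re
  | leaf => exact .inf trivial
  | node p q ihp ihq => exact .comp (.inf trivial) ⟨ihp, ihq⟩

theorem Plain.distribute {Φ : Der (.or C C) C} (h : Φ.Plain m) :
    (distribute A B C Φ).Plain m :=
  .comp (.inf trivial) (.comp ⟨.comp .andComm (.inf trivial), trivial⟩ (.comp .re ⟨trivial, h⟩))

theorem Plain.spread {a : Lit} {κ : Der (.or C C) C} {ω : Der .bot C}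
    {Φ : Der .top (.or (.atom a) C)} (hκ : κ.Plain m) (hω : ω.Plain m) (hΦ : Φ.Plain m) (p : Pat) :
    (spread a C κ ω Φ p).Plain m := by
  induction p with
  | unit => exact .comp .re ⟨trivial, hω⟩
  | leaf => exact hΦ
  | node p q ihp ihq => exact .comp .re (.comp ⟨ihq, ihp⟩ (.distribute hκ))

theorem Plain.iden (a : Lit) (p q : Pat) : (iden a p q).Plain m :=
  .spread (.contr _ _) (.weak _ _)
    (.comp (.spread (.contr _ .leaf) (.weak _ .leaf)
      (.comp (.inf (ρ := .iDown a) trivial) .orComm) _) .orComm) _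

theorem Plain.cocontr (a : Lit) (p q : Pat) : (cocontr a m p q).Plain m := by
  match m, p, q with
  | m, .unit, q => exact .re
  | m, .leaf, .unit => cases m <;> exact .re
  | true, .leaf, .leaf => exact .inf rfl
  | false, .leaf, .leaf => trivial
  | m, .leaf, .node _ _ => cases m <;> trivial
  | m, .node _ _, .unit => cases m <;> exact .re
  | m, .node _ _, .leaf => cases m <;> trivial
  | m, .node _ _, .node _ _ => cases m <;> trivial

theorem Plain.up (Φ : Der A B) (l : B.GLab Pat) : (Φ.up m l).Plain m := by
  induction Φ with
  | fm A => trivial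
  | and Φ Ψ ih₁ ih₂ | or Φ Ψ ih₁ ih₂ => exact ⟨ih₁ _, ih₂ _⟩
  | step Φ ρ Ψ ih₁ ih₂ =>
    refine .comp (ih₁ _) (.comp ?_ (ih₂ _))
    cases ρ with
    | eq t h => exact .inf trivial
    | iDown a => exact .iden _ _ _
    | wDown a => exact .weak _ _
    | cDown a => exact .contr _ _
    | iUp a => exact .inf trivial
    | wUp a => trivial
    | cUp a => exact .cocontr _ _ _
    | switch A B C => exact .inf trivial
    | medial A B C D => exact .inf trivial

theorem Plain.raise (Φ : Der A B) : (Φ.raise m).Plain m := .castR (.up _ _)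

end Der

/-- `1` marks edges that are not pending above; coweakenings only take pending edges. -/
inductive OkU : Node → Prop
  | iD : OkU (.iD 1 1)
  | wD : OkU (.wD 1)
  | cD (a b : ℕ) : OkU (.cD a b 1)
  | iU (a b : ℕ) : OkU (.iU a b)
  | wU : OkU (.wU 0)
  | cU (a : ℕ) : OkU (.cU a 1 1)

/-- `1` marks edges neither pending above nor from a cocontraction; cocontractions take no such
edge. -/
inductive OkC : Node → Prop
  | iD : OkC (.iD 1 1)
  | wD : OkC (.wD 1)
  | cD (a b : ℕ) : OkC (.cD a b 1)
  | iU (a b : ℕ) : OkC (.iU a b)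
  | wU (a : ℕ) : OkC (.wU a)
  | cU : OkC (.cU 0 0 0)

/-- `1` marks edges from a weakening; contractions and cocontractions take no such edge. There are
coweakenings only if `u` holds. -/
inductive OkW (u : Prop) : Node → Prop
  | iD : OkW u (.iD 0 0)
  | wD : OkW u (.wD 1)
  | cD : OkW u (.cD 0 0 0)
  | iU {a b : ℕ} (ha : a ≤ 1) (hb : b ≤ 1) : OkW u (.iU a b)
  | wU (hu : u) (a : ℕ) : OkW u (.wU a)
  | cU : OkW u (.cU 0 0 0)

theorem OkU.not_isWire {n : Node} (h : OkU n) : ¬ n.IsWire := by cases h <;> simp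
theorem OkC.not_isWire {n : Node} (h : OkC n) : ¬ n.IsWire := by cases h <;> simp
theorem OkW.not_isWire {u : Prop} {n : Node} (h : OkW u n) : ¬ n.IsWire := by cases h <;> simp

theorem OkW.mono {n : Node} (h : OkW False n) : OkW True n := by
  cases h with
  | iD => exact .iD
  | wD => exact .wD
  | cD => exact .cD
  | iU ha hb => exact .iU ha hb
  | wU hu => exact hu.elim
  | cU => exact .cU

theorem Inf.propagate {m : Bool} {ok : Node → Prop} {A B : Formula} {ρ : Inf A B} (h : ρ.Plain m)
    (hid : ok (.iD 1 1)) (hwd : ok (.wD 1)) (hcd : ∀ a b, ok (.cD a b 1)) (hiu : ∀ a b, ok (.iU a b))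
    (hcu : m = true → ∀ a, ok (.cU a 1 1)) (i : List ℕ) (hi : i.length = A.numAtoms) :
    ∃ o N, ρ.Real i o N ∧ ∀ n ∈ N, ok n := by
  have two : ∀ {i : List ℕ}, i.length = 1 + 1 → ∃ a b, i = [a, b] := fun h =>
    List.length_eq_two.1 h
  cases ρ with
  | eq t h => exact ⟨_, 0, ⟨hi, rfl, rfl⟩, by simp⟩
  | iDown a => exact ⟨_, _, ⟨1, 1, List.length_eq_zero_iff.1 hi, rfl, rfl⟩, by simpa using hid⟩
  | wDown a => exact ⟨_, _, ⟨1, List.length_eq_zero_iff.1 hi, rfl, rfl⟩, by simpa using hwd⟩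
  | cDown a =>
    obtain ⟨a, b, rfl⟩ := two hi
    exact ⟨_, _, ⟨a, b, 1, rfl, rfl, rfl⟩, by simpa using hcd a b⟩
  | iUp a =>
    obtain ⟨a, b, rfl⟩ := two hi
    exact ⟨_, _, ⟨a, b, rfl, rfl, rfl⟩, by simpa using hiu a b⟩
  | wUp a => exact h.elim
  | cUp a =>
    obtain ⟨a, rfl⟩ := List.length_eq_one_iff.1 hi
    exact ⟨_, _, ⟨a, 1, 1, rfl, rfl, rfl⟩, by simpa using hcu h a⟩
  | switch A B C => exact ⟨i, 0, ⟨hi, rfl, rfl⟩, by simp⟩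
  | medial A B C D =>
    obtain ⟨x, y, rfl, hx, hy⟩ : ∃ x y, i = x ++ y ∧ x.length = A.numAtoms + B.numAtoms ∧
      y.length = C.numAtoms + D.numAtoms := ⟨i.take (A.numAtoms + B.numAtoms),
        i.drop (A.numAtoms + B.numAtoms), by simp, by simp [hi, numAtoms], by simp [hi, numAtoms]⟩
    refine ⟨_, 0, ⟨x.take A.numAtoms, x.drop A.numAtoms, y.take C.numAtoms, y.drop C.numAtoms,
      by simp [hx], by simp [hx], by simp [hy], by simp [hy], by simp, rfl, rfl⟩, by simp⟩

theorem Der.propagate {m : Bool} {ok : Node → Prop} {A B : Formula} {Φ : Der A B} (h : Φ.Plain m)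
    (hid : ok (.iD 1 1)) (hwd : ok (.wD 1)) (hcd : ∀ a b, ok (.cD a b 1)) (hiu : ∀ a b, ok (.iU a b))
    (hcu : m = true → ∀ a, ok (.cU a 1 1)) (i : List ℕ) (hi : i.length = A.numAtoms) :
    ∃ o, Typ ok Φ i o := by
  induction Φ generalizing i with
  | fm A => exact ⟨i, .fm hi⟩
  | @and A B C D Φ Ψ ih₁ ih₂ | @or A B C D Φ Ψ ih₁ ih₂ =>
    obtain ⟨o, ho⟩ := ih₁ h.1 (i.take A.numAtoms) (by simp [hi, numAtoms])
    obtain ⟨o', ho'⟩ := ih₂ h.2 (i.drop A.numAtoms) (by simp [hi, numAtoms])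
    exact ⟨_, (ho.and ho').of_eq (by simp) rfl⟩
  | step Φ ρ Ψ ih₁ ih₂ =>
    obtain ⟨x, N₁, h1, h2⟩ := ih₁ h.1 i hi
    obtain ⟨y, N₂, h3, h4⟩ := Inf.propagate h.2.1 hid hwd hcd hiu hcu x h1.length.2
    obtain ⟨o, N₃, h5, h6⟩ := ih₂ h.2.2 y h3.length.2
    refine ⟨o, _, ⟨x, y, N₁, N₂, N₃, rfl, h1, h3, h5⟩, fun n hn => ?_⟩
    rcases Multiset.mem_add.1 hn with hn | hn
    · exact (Multiset.mem_add.1 hn).elim (h2 n) (h4 n)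
    · exact h6 n hn

theorem Der.propagate_okU {A B : Formula} {Φ : Der A B} (h : Φ.Plain true) {i : List ℕ}
    (hi : i.length = A.numAtoms) : ∃ o, Typ OkU Φ i o :=
  propagate h .iD .wD .cD .iU (fun _ => .cU) i hi

theorem Der.propagate_okC {A B : Formula} {Φ : Der A B} (h : Φ.Plain false) {i : List ℕ}
    (hi : i.length = A.numAtoms) : ∃ o, Typ OkC Φ i o :=
  propagate h .iD .wD .cD .iU (fun h => nomatch h) i hi

namespace Pat

/-- No units. -/
def Full : Pat → Prop
  | unit => False
  | leaf => True
  | node p q => p.Full ∧ q.Full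

/-- No units, except for `unit` itself. -/
def Proper (p : Pat) : Prop := p = unit ∨ p.Full

theorem Proper.full {p : Pat} (h : p.Proper) (h' : p ≠ unit) : p.Full := h.resolve_left h'

theorem Proper.join {m : Bool} {p q : Pat} (hp : p.Proper) (hq : q.Proper) :
    (p.join m q).Proper := by
  match m, p, q with
  | m, .unit, q => exact hq
  | m, .leaf, .unit => cases m <;> exact Or.inr trivial
  | true, .leaf, .leaf => exact Or.inr trivial
  | false, .leaf, .leaf => exact Or.inr ⟨trivial, trivial⟩
  | m, .leaf, .node _ _ => cases m <;> exact Or.inr ⟨trivial, hq.full (by simp)⟩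
  | m, .node _ _, .unit => cases m <;> exact hp
  | m, .node _ _, .leaf => cases m <;> exact Or.inr ⟨hp.full (by simp), trivial⟩
  | m, .node _ _, .node _ _ => cases m <;> exact Or.inr ⟨hp.full (by simp), hq.full (by simp)⟩

end Pat

section
variable {P : Pat → Prop} {m : Bool} (hu : P .unit) (hf : P .leaf)
  (hj : ∀ p q, P p → P q → P (p.join m q)) {A B : Formula}
include hu hf hj

theorem Inf.upLab_forall (ρ : Inf A B) (l : B.GLab Pat) (hl : ∀ p ∈ GLab.toList B l, P p) :
    ∀ p ∈ GLab.toList A (ρ.upLab m l), P p := by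
  cases ρ with
  | eq t h =>
    intro p hp
    rw [upLab, GLab.toList_tab] at hp
    obtain ⟨i, -, rfl⟩ := List.mem_map.1 hp
    rw [List.getD_eq_getElem?_getD]
    rcases h : (GLab.toList B l)[(Lab.toList B t).idxOf i]? with _ | q
    · exact hf
    · exact hl _ (List.mem_of_getElem? h)
  | iDown a | wDown a => exact fun p hp => nomatch hp
  | cDown a =>
    intro p hp
    exact (List.mem_cons.1 hp).elim (fun h => hl p (List.mem_cons.2 (Or.inl h))) (fun h => hl p h)
  | iUp a =>
    intro p hp
    have : p = .leaf := by simpa [upLab, GLab.toList] using hp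
    exact this ▸ hf
  | wUp a =>
    intro p hp
    have : p = .unit := by simpa [upLab, GLab.toList] using hp
    exact this ▸ hu
  | cUp a =>
    intro p hp
    have : p = Pat.join m l.1 l.2 := by simpa [upLab, GLab.toList] using hp
    rw [this]
    exact hj _ _ (hl _ (List.mem_cons_self ..)) (hl _ (List.mem_cons_of_mem _ (List.mem_cons_self ..)))
  | switch A B C =>
    intro p hp
    refine hl p ?_
    simpa [upLab, GLab.toList, or_assoc] using hp
  | medial A B C D =>
    intro p hp
    refine hl p ?_
    simp only [upLab, GLab.toList, List.mem_append] at hp ⊢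
    tauto

theorem Der.upLab_forall (Φ : Der A B) (l : B.GLab Pat) (hl : ∀ p ∈ GLab.toList B l, P p) :
    ∀ p ∈ GLab.toList A (Φ.upLab m l), P p := by
  induction Φ with
  | fm A => exact hl
  | and Φ Ψ ih₁ ih₂ | or Φ Ψ ih₁ ih₂ =>
    simp only [upLab, GLab.toList, List.mem_append] at hl ⊢
    rintro p (hp | hp)
    · exact ih₁ _ (fun q hq => hl q (Or.inl hq)) p hp
    · exact ih₂ _ (fun q hq => hl q (Or.inr hq)) p hp
  | step Φ ρ Ψ ih₁ ih₂ => exact ih₁ _ (ρ.upLab_forall hu hf hj _ (ih₂ _ hl))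

theorem Der.lab_forall (Φ : Der A B) : ∀ p ∈ GLab.toList A (Φ.lab m), P p := by
  refine Φ.upLab_forall hu hf hj _ fun p hp => ?_
  rw [const, GLab.toList_tab] at hp
  simp only [List.map_const', List.mem_replicate] at hp
  exact hp.2 ▸ hf

end

theorem Der.upLab_proper {m : Bool} {A B : Formula} (Φ : Der A B) (l : B.GLab Pat)
    (hl : ∀ p ∈ GLab.toList B l, p.Proper) : ∀ p ∈ GLab.toList A (Φ.upLab m l), p.Proper :=
  Φ.upLab_forall (.inl rfl) (.inr trivial) (fun _ _ => .join) l hl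

theorem Der.lab_proper {m : Bool} {A B : Formula} (Φ : Der A B) :
    ∀ p ∈ GLab.toList A (Φ.lab m), p.Proper :=
  Φ.lab_forall (.inl rfl) (.inr trivial) (fun _ _ => .join)

theorem Der.Plain.copyAtom {a : Lit} {p : Pat} (hp : p.Full) : (copyAtom a p).Plain true := by
  induction p with
  | unit => exact hp.elim
  | leaf => trivial
  | node p q ihp ihq => exact .comp (.inf rfl) ⟨ihp hp.1, ihq hp.2⟩

theorem Der.Plain.copyAll {A : Formula} {l : A.GLab Pat} (hl : ∀ p ∈ GLab.toList A l, p.Full) :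
    (copyAll A l).Plain true := by
  induction A with
  | top | bot => trivial
  | atom a => exact .copyAtom (hl _ (List.mem_cons_self ..))
  | and A B ihA ihB | or A B ihA ihB =>
    simp only [GLab.toList, List.mem_append] at hl
    exact ⟨ihA fun p hp => hl p (Or.inl hp), ihB fun p hp => hl p (Or.inr hp)⟩

theorem typ_copyAll_okU {A : Formula} {l : A.GLab Pat} (hl : ∀ p ∈ GLab.toList A l, p.Proper) :
    ∃ o, Typ OkU (copyAll A l) (List.replicate A.numAtoms 0) o := by
  induction A with
  | top | bot => exact ⟨[], .fm rfl⟩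
  | atom a =>
    have key : ∀ p : Pat, p.Proper → ∃ o, Typ OkU (copyAtom a p) [0] o := by
      rintro p (rfl | hp)
      · exact ⟨[], .inf ⟨0, rfl, rfl, rfl⟩ .wU⟩
      · exact propagate_okU (.copyAtom hp) rfl
    exact key l (hl _ (List.mem_cons_self ..))
  | and A B ihA ihB | or A B ihA ihB =>
    simp only [GLab.toList, List.mem_append] at hl
    obtain ⟨o, ho⟩ := ihA (l := l.1) fun p hp => hl p (Or.inl hp)
    obtain ⟨o', ho'⟩ := ihB (l := l.2) fun p hp => hl p (Or.inr hp)
    exact ⟨_, (ho.and ho').of_eq (by simp [numAtoms]) rfl⟩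

theorem typ_copyAll_zero {ok : Node → Prop} (hw : ok (.wU 0)) (hc : ok (.cU 0 0 0)) (A : Formula)
    (l : A.GLab Pat) : Typ ok (copyAll A l) (List.replicate A.numAtoms 0)
      (List.replicate (copies A l).numAtoms 0) := by
  induction A with
  | top | bot => exact .fm rfl
  | atom a =>
    have key : ∀ p : Pat, Typ ok (copyAtom a p) [0] (List.replicate (p.fm a).numAtoms 0) := by
      intro p
      induction p with
      | unit => exact .inf ⟨0, rfl, rfl, rfl⟩ hw
      | leaf => exact .fm rfl
      | node p q ihp ihq =>
        refine (Typ.comp (.inf (ρ := .cUp a) (o := [0, 0]) ⟨0, 0, 0, rfl, rfl, rfl⟩ hc) (ihp.and ihq)).of_eq rfl ?_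
        simp [Pat.fm, numAtoms]
    exact key l
  | and A B ihA ihB => exact ((ihA l.1).and (ihB l.2)).of_eq (by simp [numAtoms]) (by simp [sub, numAtoms])
  | or A B ihA ihB => exact ((ihA l.1).or (ihB l.2)).of_eq (by simp [numAtoms]) (by simp [sub, numAtoms])

section zero
variable {ok : Node → Prop}

theorem typ_eq_zero {A B : Formula} (t : B.Lab) (h) :
    Typ ok (Der.inf (.eq (A := A) t h)) (List.replicate A.numAtoms 0)
      (List.replicate B.numAtoms 0) := by
  refine Typ.inf_zero ⟨by simp, ?_, rfl⟩
  symm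
  rw [List.eq_replicate_iff]
  refine ⟨by simp [Lab.length_toList], fun x hx => ?_⟩
  obtain ⟨j, -, rfl⟩ := List.mem_map.1 hx
  simp only [List.getD_eq_getElem?_getD, List.getElem?_replicate]
  split <;> rfl

theorem typ_fillAtom (a : Lit) (b : Bool) (hw : ok (.wD 1)) : ∃ x ≤ 1,
    Typ ok (fillAtom a b) (List.replicate (keep a b).numAtoms 0) [x] := by
  cases b with
  | true => exact ⟨0, by simp, .fm rfl⟩
  | false => exact ⟨1, le_rfl, .inf (ρ := .wDown a) ⟨1, rfl, rfl, rfl⟩ hw⟩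

theorem typ_fill (hw : ok (.wD 1)) (A : Formula) (l : A.GLab Bool) : ∃ o, (∀ x ∈ o, x ≤ 1) ∧
    Typ ok (fill A l) (List.replicate (erase A l).numAtoms 0) o := by
  induction A with
  | top | bot => exact ⟨[], by simp, .fm rfl⟩
  | atom a =>
    obtain ⟨x, hx, h⟩ := typ_fillAtom a l hw
    exact ⟨[x], by simpa using hx, h⟩
  | and A B ihA ihB | or A B ihA ihB =>
    obtain ⟨o, h1, h2⟩ := ihA l.1
    obtain ⟨o', h3, h4⟩ := ihB l.2
    exact ⟨o ++ o', fun x hx => (List.mem_append.1 hx).elim (h1 x) (h3 x),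
      (h2.and h4).of_eq (by simp [sub, numAtoms]) rfl⟩

theorem replicate_numAtoms_and (A B : Formula) : List.replicate (Fm.and A B).numAtoms 0 =
    List.replicate A.numAtoms 0 ++ List.replicate B.numAtoms 0 := by simp [numAtoms]

theorem replicate_numAtoms_or (A B : Formula) : List.replicate (Fm.or A B).numAtoms 0 =
    List.replicate A.numAtoms 0 ++ List.replicate B.numAtoms 0 := by simp [numAtoms]

theorem typ_switch_zero (A B C : Formula) : Typ ok (Der.inf (.switch A B C))
    (List.replicate (Fm.and A (Fm.or B C)).numAtoms 0)
    (List.replicate (Fm.or (Fm.and A B) C).numAtoms 0) :=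
  .inf_zero ⟨by simp [numAtoms], by simp [numAtoms, add_assoc], rfl⟩

theorem typ_medial_zero (A B C D : Formula) : Typ ok (Der.inf (.medial A B C D))
    (List.replicate (Fm.or (Fm.and A B) (Fm.and C D)).numAtoms 0)
    (List.replicate (Fm.and (Fm.or A C) (Fm.or B D)).numAtoms 0) :=
  .inf_zero ⟨.replicate A.numAtoms 0, .replicate B.numAtoms 0, .replicate C.numAtoms 0,
    .replicate D.numAtoms 0, by simp, by simp, by simp, by simp,
    by simp [replicate_numAtoms_and, replicate_numAtoms_or],
    by simp [replicate_numAtoms_and, replicate_numAtoms_or], rfl⟩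

theorem typ_contr_zero (hc : ok (.cD 0 0 0)) (a : Lit) (p : Pat) : Typ ok (contr a p)
    (List.replicate (p.fm a).numAtoms 0 ++ List.replicate (p.fm a).numAtoms 0)
    (List.replicate (p.fm a).numAtoms 0) := by
  induction p with
  | unit => exact .re rfl
  | leaf => exact .inf (ρ := .cDown a) ⟨0, 0, 0, rfl, rfl, rfl⟩ hc
  | node p q ihp ihq =>
    have := (typ_medial_zero (ok := ok) (p.fm a) (q.fm a) (p.fm a) (q.fm a)).comp
      (((ihp.and ihq)).of_eq (by simp [replicate_numAtoms_and, replicate_numAtoms_or]) rfl)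
    exact this.of_eq (by simp [replicate_numAtoms_or, Pat.fm]) (by simp [numAtoms, Pat.fm])

theorem typ_spread_zero (hc : ok (.cD 0 0 0)) (a b : Lit) (q : Pat)
    {Φ : Der .top (.or (.atom a) (q.fm b))}
    (hΦ : Typ ok Φ [] (0 :: List.replicate (q.fm b).numAtoms 0)) {p : Pat} (hp : p.Full) :
    Typ ok (spread a (q.fm b) (contr b q) (weak b q) Φ p) []
      (List.replicate (p.fm a).numAtoms 0 ++ List.replicate (q.fm b).numAtoms 0) := by
  induction p with
  | unit => exact hp.elim
  | leaf => exact hΦ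
  | node p r ihp ihr =>
    obtain ⟨N, h1, h2⟩ := typ_contr_zero hc b q
    have h3 : Typ ok (distribute (p.fm a) (r.fm a) (q.fm b) (contr b q)) _ _ :=
      ⟨N, .distribute (a := .replicate (p.fm a).numAtoms 0) (b := .replicate (r.fm a).numAtoms 0)
        (by simp) (by simp) (by simp) (by simp) h1, h2⟩
    have h4 : Typ ok (re .top (.and .top .top) (.symm (.and_top _))) [] [] := .re rfl
    exact (h4.comp (((ihr hp.2).and (ihp hp.1)).comp h3)).of_eq rfl (by simp [numAtoms, Pat.fm])

theorem typ_iden_zero (hc : ok (.cD 0 0 0)) (hi : ok (.iD 0 0)) (a : Lit) {p q : Pat}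
    (hp : p.Full) (hq : q.Full) : Typ ok (iden a p q) []
      (List.replicate (p.fm a).numAtoms 0 ++ List.replicate (q.fm a.dual).numAtoms 0) := by
  have orc : ∀ {A B : Formula} {i i' : List ℕ}, i.length = A.numAtoms → i'.length = B.numAtoms →
      Typ ok (Der.inf (.orComm A B)) (i ++ i') (i' ++ i) := fun h h' => .of_real (.orComm h h')
  have h1 : Typ ok (Der.inf (.iDown a)) [] [0, 0] :=
    .inf (ρ := .iDown a) ⟨0, 0, rfl, rfl, rfl⟩ hi
  have h2 := h1.comp (orc (i := [0]) (i' := [0]) rfl rfl)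
  have h3 := typ_spread_zero hc a.dual a .leaf h2 hq
  have h4 := h3.comp (orc (by simp) (by simp))
  exact typ_spread_zero hc a a.dual q h4 hp

end zero

theorem typ_down {A B : Formula} {Φ : Der A B} (h : Φ.Plain true) (l : A.GLab Bool) :
    Typ (OkW False) (Φ.down l) (List.replicate (erase A l).numAtoms 0)
      (List.replicate (erase B (Φ.downLab l)).numAtoms 0) := by
  induction Φ with
  | fm A => exact .fm (by simp)
  | and Φ Ψ ih₁ ih₂ =>
    exact ((ih₁ h.1 l.1).and (ih₂ h.2 l.2)).of_eq (by simp [sub, numAtoms])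
      (by rw [← List.replicate_add]; rfl)
  | or Φ Ψ ih₁ ih₂ =>
    exact ((ih₁ h.1 l.1).or (ih₂ h.2 l.2)).of_eq (by simp [sub, numAtoms])
      (by rw [← List.replicate_add]; rfl)
  | @step A B C D Φ ρ Ψ ih₁ ih₂ =>
    refine .comp (ih₁ h.1 _) (.comp ?_ (ih₂ h.2.2 _))
    have hρ := h.2.1
    generalize Φ.downLab l = l'
    clear ih₁ ih₂ h
    cases ρ with
    | eq t h => exact typ_eq_zero _ _
    | iDown a => exact .inf (ρ := .iDown a) ⟨0, 0, rfl, rfl, rfl⟩ .iD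
    | wDown a => exact .fm rfl
    | cDown a =>
      have : ∀ p q : Bool, Typ (OkW False) (mergeD a p q)
          (List.replicate (Fm.or (keep a p) (keep a q)).numAtoms 0)
          (List.replicate (keep a (p || q)).numAtoms 0) := by
        intro p q
        cases p <;> cases q
        · exact .re rfl
        · exact .re rfl
        · exact .re rfl
        · exact .inf (ρ := .cDown a) ⟨0, 0, 0, rfl, rfl, rfl⟩ .cD
      exact this _ _
    | iUp a =>
      obtain ⟨x, hx, h1⟩ := typ_fillAtom (ok := OkW False) a l'.1 .wD
      obtain ⟨y, hy, h2⟩ := typ_fillAtom (ok := OkW False) a.dual l'.2 .wD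
      exact ((h1.and h2).comp (.inf (ρ := .iUp a) ⟨x, y, rfl, rfl, rfl⟩ (.iU hx hy))).of_eq
        (by simp [sub, numAtoms]) rfl
    | wUp a => exact hρ.elim
    | cUp a =>
      have : ∀ p : Bool, Typ (OkW False) (splitD a p) (List.replicate (keep a p).numAtoms 0)
          (List.replicate (Fm.and (keep a p) (keep a p)).numAtoms 0) := by
        intro p
        cases p
        · exact .re rfl
        · exact .inf (ρ := .cUp a) ⟨0, 0, 0, rfl, rfl, rfl⟩ .cU
      exact this _
    | switch A B C => exact typ_switch_zero _ _ _
    | medial A B C D => exact typ_medial_zero _ _ _ _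

theorem typ_trim {A B : Formula} (Φ : Der A B) : ∃ o, (∀ x ∈ o, x ≤ 1) ∧
    Typ (OkW False) Φ.trim (List.replicate (copies A (Φ.lab true)).numAtoms 0) o := by
  obtain ⟨o, h1, h2⟩ := typ_fill (ok := OkW False) .wD B
    ((Φ.raise true).downLab (const true (copies A (Φ.lab true))))
  have h3 := typ_down (Der.Plain.raise (m := true) Φ) (const true _)
  refine ⟨o, h1, Typ.comp (.castL (h3.of_eq ?_ rfl)) h2⟩
  rw [const, erase_const]

/-- An edge of a class that is copied according to a pattern. -/
def CopyR (p : Pat) (x : ℕ) (ys : List ℕ) (N : Multiset Node) : Prop :=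
  p ≠ .unit ∧ p.Full ∧ x ≤ 1 ∧ (x = 1 → p = .leaf) ∧ ys = List.replicate p.leaves x ∧ N = 0

theorem OkW.of_iD {u : Prop} {a b : ℕ} (h : OkW u (.iD a b)) : a = 0 ∧ b = 0 := by
  generalize hn : Node.iD a b = n at h
  have h0 := congrArg Node.arity hn
  cases h <;> first | (simp at h0; done) | (have := Node.iD_inj hn; omega)

theorem OkW.of_wD {u : Prop} {a : ℕ} (h : OkW u (.wD a)) : a = 1 := by
  generalize hn : Node.wD a = n at h
  have h0 := congrArg Node.arity hn
  cases h <;> first | (simp at h0; done) | (have := Node.wD_inj hn; omega)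

theorem OkW.of_cD {u : Prop} {a b c : ℕ} (h : OkW u (.cD a b c)) : a = 0 ∧ b = 0 ∧ c = 0 := by
  generalize hn : Node.cD a b c = n at h
  have h0 := congrArg Node.arity hn
  cases h <;> first | (simp at h0; done) | (have := Node.cD_inj hn; omega)

theorem OkW.of_wU {u : Prop} {a : ℕ} (h : OkW u (.wU a)) : u := by
  generalize hn : Node.wU a = n at h
  have h0 := congrArg Node.arity hn
  cases h <;> first | (simp at h0; done) | (have := Node.wU_inj hn; omega)

theorem OkW.of_cU {u : Prop} {a b c : ℕ} (h : OkW u (.cU a b c)) : a = 0 ∧ b = 0 ∧ c = 0 := by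
  generalize hn : Node.cU a b c = n at h
  have h0 := congrArg Node.arity hn
  cases h <;> first | (simp at h0; done) | (have := Node.cU_inj hn; omega)

theorem OkW.of_iU {u : Prop} {a b : ℕ} (h : OkW u (.iU a b)) : a ≤ 1 ∧ b ≤ 1 := by
  generalize hn : Node.iU a b = n at h
  have h0 := congrArg Node.arity hn
  cases h <;> first | (simp at h0; done) | (have := pair_inj (congrArg Node.ins hn); omega)

theorem CopyR.length (p : Pat) (x : ℕ) (ys : List ℕ) (N : Multiset Node) (h : CopyR p x ys N) :
    ys.length = p.leaves := by simp [h.2.2.2.2.1]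

theorem CopyR.leaf {x : ℕ} (hx : x ≤ 1) : CopyR .leaf x [x] 0 :=
  ⟨by simp, trivial, hx, fun _ => rfl, rfl, rfl⟩

theorem CopyR.zero {p : Pat} (hp : p ≠ .unit) (hp' : p.Full) :
    CopyR p 0 (List.replicate p.leaves 0) 0 := ⟨hp, hp', by simp, by simp, rfl, rfl⟩

theorem Par.length_copyR {A : Formula} {l : A.GLab Pat} {x ys : List ℕ} {N : Multiset Node}
    (h : Par CopyR (GLab.toList A l) x ys N) : ys.length = numAtoms (copies A l) := by
  rw [numAtoms_sub Pat.numAtoms_fm, h.length_eq CopyR.length]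

theorem Inf.typ_up {A B : Formula} (ρ : Inf A B) (l : B.GLab Pat)
    {i o ys : List ℕ} {N P : Multiset Node} (h : ρ.Real i o N) (hN : ∀ n ∈ N, OkW False n)
    (hP : Par CopyR (GLab.toList B l) o ys P) :
    ∃ zs X, Par CopyR (GLab.toList A (ρ.upLab false l)) i zs X ∧
      Typ (OkW False) (ρ.up false l) zs ys := by
  cases ρ with
  | eq t he =>
    obtain ⟨hi, rfl, rfl⟩ := h
    have hm : GLab.toList B l = (Lab.toList B t).map
        ((GLab.toList A (Inf.upLab false (.eq t he) l)).getD · default) := by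
      rw [upLab, GLab.toList_tab, ← List.range_eq_range']
      exact getD_idxOf he.perm (by simp [Lab.length_toList])
    rw [hm] at hP
    obtain ⟨zs, hz, rfl⟩ := Par.unpermute CopyR.length
      (ps := GLab.toList A (Inf.upLab false (.eq t he) l))
      (by simpa using he.perm) (by simpa using hi) hP
    exact ⟨zs, P, hz, .of_real (slots_real Pat.numAtoms_fm CopyR.length t he _ l hm hz)⟩
  | iDown a =>
    obtain ⟨x, y, rfl, rfl, rfl⟩ := h
    obtain ⟨z, z', M, M', rfl, rfl, h1, h2⟩ := hP.of_pair
    have hok := hN _ (mem_singleton_self _)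
    obtain ⟨rfl, rfl⟩ : x = 0 ∧ y = 0 := hok.of_iD
    have key : ∀ p q, CopyR p 0 z M → CopyR q 0 z' M' →
        Typ (OkW False) (iden a p q) [] (z ++ z') := by
      rintro p q ⟨-, f1, -, -, rfl, rfl⟩ ⟨-, f2, -, -, rfl, rfl⟩
      exact (typ_iden_zero (ok := OkW False) .cD .iD a f1 f2).of_eq rfl
        (by simp only [Pat.numAtoms_fm])
    exact ⟨[], 0, .nil, key l.1 l.2 h1 h2⟩
  | wDown a =>
    obtain ⟨x, rfl, rfl, rfl⟩ := h
    have hok := hN _ (mem_singleton_self _)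
    obtain rfl := hok.of_wD
    have key : ∀ p, CopyR p 1 ys P → Typ (OkW False) (weak a p) [] ys := by
      rintro p ⟨-, -, -, h, rfl, -⟩
      obtain rfl := h rfl
      exact .inf (ρ := .wDown a) ⟨1, rfl, rfl, rfl⟩ .wD
    exact ⟨[], 0, .nil, key l hP.of_single⟩
  | cDown a =>
    obtain ⟨x, y, z, rfl, rfl, rfl⟩ := h
    have hok := hN _ (mem_singleton_self _)
    obtain ⟨rfl, rfl, rfl⟩ : x = 0 ∧ y = 0 ∧ z = 0 := hok.of_cD
    have key : ∀ p, CopyR p 0 ys P → ∃ zs X, Par CopyR [p, p] [0, 0] zs X ∧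
        Typ (OkW False) (contr a p) zs ys := by
      rintro p h
      obtain ⟨h1, h2, -, -, rfl, rfl⟩ := h
      refine ⟨_, _, (Par.single (.zero h1 h2)).append (.single (.zero h1 h2)), ?_⟩
      have := typ_contr_zero (ok := OkW False) .cD a p
      simpa only [Pat.numAtoms_fm] using this
    exact key l hP.of_single
  | iUp a =>
    obtain ⟨x, y, rfl, rfl, rfl⟩ := h
    have hok := hN _ (mem_singleton_self _)
    obtain ⟨hx, hy⟩ : x ≤ 1 ∧ y ≤ 1 := hok.of_iU
    cases hP
    exact ⟨[x, y], 0, (Par.single (CopyR.leaf hx)).append (.single (CopyR.leaf hy)),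
      .inf (ρ := .iUp a) ⟨x, y, rfl, rfl, rfl⟩ (.iU hx hy)⟩
  | wUp a =>
    obtain ⟨x, rfl, rfl, rfl⟩ := h
    exact (hN _ (mem_singleton_self _)).of_wU.elim
  | cUp a =>
    obtain ⟨x, y, z, rfl, rfl, rfl⟩ := h
    have hok := hN _ (mem_singleton_self _)
    obtain ⟨rfl, rfl, rfl⟩ : x = 0 ∧ y = 0 ∧ z = 0 := hok.of_cU
    obtain ⟨u, v, M, M', rfl, rfl, h1, h2⟩ := hP.of_pair
    have key : ∀ p q, CopyR p 0 u M → CopyR q 0 v M' → ∃ zs X,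
        Par CopyR [Pat.join false p q] [0] zs X ∧
          Typ (OkW False) (cocontr a false p q) zs (u ++ v) := by
      rintro p q ⟨n1, f1, -, -, rfl, rfl⟩ ⟨n2, f2, -, -, rfl, rfl⟩
      refine ⟨List.replicate (p.leaves + q.leaves) 0, 0, ?_, ?_⟩
      · have : p.join false q = .node p q := by
          cases p <;> cases q <;> first | exact absurd rfl n1 | exact absurd rfl n2 | rfl
        rw [this]
        exact .single (.zero (by simp) ⟨f1, f2⟩)
      · rw [← List.replicate_add]
        cases p <;> cases q <;> first | exact absurd rfl n1 | exact absurd rfl n2 |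
          exact .fm (by simp [Pat.numAtoms_fm, Pat.leaves, Pat.join])
    obtain ⟨zs, X, h3, h4⟩ := key _ _ h1 h2
    exact ⟨zs, X, h3, h4⟩
  | switch A B C =>
    obtain ⟨hi, rfl, rfl⟩ := h
    refine ⟨ys, P, ?_, .inf_zero ⟨?_, rfl, rfl⟩⟩
    · simpa [Inf.upLab, GLab.toList] using hP
    · simpa [sub, numAtoms, add_assoc] using hP.length_copyR
  | medial A B C D =>
    obtain ⟨a, b, c, d, ha, hb, hc, hd, rfl, rfl, rfl⟩ := h
    obtain ⟨y, y', M, M', rfl, rfl, h1, h2⟩ := hP.split (by simp [numAtoms, ha, hc])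
    obtain ⟨e, g, M₁, M₂, rfl, rfl, h3, h4⟩ := h1.split (by simp [ha])
    obtain ⟨f, k, M₃, M₄, rfl, rfl, h5, h6⟩ := h2.split (by simp [hb])
    exact ⟨(e ++ f) ++ (g ++ k), (M₁ + M₃) + (M₂ + M₄),
      (h3.append h5).append (h4.append h6), .inf_zero ⟨e, f, g, k, h3.length_copyR,
        h5.length_copyR, h4.length_copyR, h6.length_copyR, rfl, rfl, rfl⟩⟩

theorem Der.typ_up {A B : Formula} {Φ : Der A B} (l : B.GLab Pat) {i o ys : List ℕ}
    {P : Multiset Node} (h : Typ (OkW False) Φ i o) (hP : Par CopyR (GLab.toList B l) o ys P) :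
    ∃ zs X, Par CopyR (GLab.toList A (Φ.upLab false l)) i zs X ∧
      Typ (OkW False) (Φ.up false l) zs ys := by
  obtain ⟨N, h, hN⟩ := h
  induction Φ generalizing i o ys N P with
  | fm A =>
    obtain ⟨rfl, rfl⟩ := h.2.of_no_wire fun n hn => (hN n hn).not_isWire
    exact ⟨ys, P, hP, .fm hP.length_copyR⟩
  | and Φ Ψ ih₁ ih₂ | or Φ Ψ ih₁ ih₂ =>
    obtain ⟨i₁, i₂, o₁, o₂, N₁, N₂, rfl, rfl, rfl, h₁, h₂⟩ := h
    obtain ⟨y, y', M, M', rfl, rfl, h3, h4⟩ := hP.split (by simp [h₁.length])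
    obtain ⟨zs, X, h5, h6⟩ := ih₁ l.1 h3 N₁ h₁ fun n hn => hN n (Multiset.mem_add.2 (Or.inl hn))
    obtain ⟨zs', X', h7, h8⟩ := ih₂ l.2 h4 N₂ h₂ fun n hn => hN n (Multiset.mem_add.2 (Or.inr hn))
    exact ⟨_, _, h5.append h7, h6.and h8⟩
  | step Φ ρ Ψ ih₁ ih₂ =>
    obtain ⟨x, y, N₁, N₂, N₃, rfl, h₁, h₂, h₃⟩ := h
    simp only [mem_add] at hN
    obtain ⟨zs, X, h4, h5⟩ := ih₂ l hP N₃ h₃ fun n hn => hN n (Or.inr hn)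
    obtain ⟨us, Y, h6, h7⟩ := ρ.typ_up _ h₂ (fun n hn => hN n (Or.inl (Or.inr hn))) h4
    obtain ⟨vs, Z, h8, h9⟩ := ih₁ _ h6 N₁ h₁ fun n hn => hN n (Or.inl (Or.inl hn))
    exact ⟨vs, Z, h8, h9.comp (h7.comp h5)⟩

theorem Par.mem {β : Type} {R : β → ℕ → List ℕ → Multiset Node → Prop} {ps : List β}
    {xs ys : List ℕ} {N : Multiset Node} (h : Par R ps xs ys N) :
    ∀ p ∈ ps, ∃ x ∈ xs, ∃ y N, R p x y N := by
  induction h with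
  | nil => simp
  | cons h _ ih =>
    intro p hp
    rcases List.mem_cons.1 hp with rfl | hp
    · exact ⟨_, List.mem_cons_self .., _, _, h⟩
    · obtain ⟨x, hx, h⟩ := ih p hp
      exact ⟨x, List.mem_cons_of_mem _ hx, h⟩

theorem Par.copyR_zero {ps : List Pat} {n : ℕ} {ys : List ℕ} {N : Multiset Node}
    (h : Par CopyR ps (List.replicate n 0) ys N) : ys = List.replicate ys.length 0 := by
  generalize hx : List.replicate n 0 = xs at h
  induction h generalizing n with
  | nil => rfl
  | cons h _ ih =>
    cases n with
    | zero => simp at hx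
    | succ n =>
      rw [List.replicate_succ, List.cons.injEq] at hx
      obtain ⟨rfl, hx⟩ := hx
      have h1 := ih hx
      rw [h.2.2.2.2.1, List.length_append, List.replicate_add, ← h1]
      simp

theorem par_copyR_const {B : Formula} {o : List ℕ} (ho : ∀ x ∈ o, x ≤ 1)
    (hl : o.length = B.numAtoms) : Par CopyR (GLab.toList B (const .leaf B)) o o 0 := by
  rw [SKS.const, GLab.toList_tab, List.map_const', List.length_range', ← hl]
  clear hl
  induction o with
  | nil => exact .nil
  | cons x xs ih =>
    simpa [List.replicate_succ] using Par.cons (CopyR.leaf (ho x (by simp)))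
      (ih fun y hy => ho y (by simp [hy]))

theorem typ_raise_trim {A B : Formula} (Φ : Der A B) :
    (∀ p ∈ GLab.toList _ (Φ.trim.lab false), p.Full) ∧ ∃ o, Typ (OkW False) (Φ.trim.raise false)
      (List.replicate (copies _ (Φ.trim.lab false)).numAtoms 0) o := by
  obtain ⟨o, ho, N, h, hN⟩ := typ_trim Φ
  obtain ⟨zs, X, h1, h2⟩ := Der.typ_up (const .leaf B) ⟨N, h, hN⟩ (par_copyR_const ho h.length.2)
  refine ⟨fun p hp => ?_, o, ?_⟩
  · obtain ⟨x, -, y, N, h⟩ := h1.mem p hp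
    exact h.2.1
  · have h3 := h1.copyR_zero
    rw [h1.length_copyR] at h3
    exact Typ.castR (h2.of_eq h3 rfl)

namespace Der
variable {A B : Formula} (Φ : Der A B)

theorem Plain.mono (h : Φ.Plain false) : Φ.Plain true := by
  induction Φ with
  | fm A => trivial
  | and Φ Ψ ih₁ ih₂ | or Φ Ψ ih₁ ih₂ => exact ⟨ih₁ h.1, ih₂ h.2⟩
  | step Φ ρ Ψ ih₁ ih₂ =>
    refine ⟨ih₁ h.1, ?_, ih₂ h.2.2⟩
    have := h.2.1
    cases ρ <;> simp_all [Inf.Plain]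

theorem normalize_okU : ∃ g : ℕ → ℕ, ∀ n ∈ Φ.normalize.diagram.nodes, OkU (n.map g) := by
  obtain ⟨x, N₁, hx, h₁⟩ := typ_copyAll_okU (Φ.lab_proper (m := true))
  obtain ⟨y, N₂, hy, h₂⟩ := propagate_okU (Plain.copyAll (typ_raise_trim Φ).1) hx.length.2
  obtain ⟨z, hz⟩ := propagate_okU (Plain.mono _ (.raise (m := false) Φ.trim)) hy.length.2
  exact (Typ.comp ⟨N₁, hx, h₁⟩ (.comp ⟨N₂, hy, h₂⟩ hz)).classify (fun _ => OkU.not_isWire) rfl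

theorem normalize_okC : ∃ g : ℕ → ℕ, ∀ n ∈ Φ.normalize.diagram.nodes, OkC (n.map g) := by
  have hx := typ_copyAll_zero (ok := OkC) (.wU 0) .cU A (Φ.lab true)
  have hy := typ_copyAll_zero (ok := OkC) (.wU 0) .cU _ (Φ.trim.lab false)
  obtain ⟨z, hz⟩ := propagate_okC (Plain.raise (m := false) Φ.trim) List.length_replicate
  exact (hx.comp (hy.comp hz)).classify (fun _ => OkC.not_isWire) rfl

theorem normalize_okW : ∃ g : ℕ → ℕ, ∀ n ∈ Φ.normalize.diagram.nodes, OkW True (n.map g) := by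
  have hx := typ_copyAll_zero (ok := OkW True) (.wU trivial 0) .cU A (Φ.lab true)
  have hy := typ_copyAll_zero (ok := OkW True) (.wU trivial 0) .cU _ (Φ.trim.lab false)
  obtain ⟨-, z, N, hz, hN⟩ := typ_raise_trim Φ
  exact (hx.comp (hy.comp ⟨N, hz, fun n hn => (hN n hn).mono⟩)).classify
    (fun _ => OkW.not_isWire) rfl

end Der

theorem OkU.out {n : Node} (h : OkU n) : ∀ e ∈ n.outs, e = 1 := by
  cases h <;> simp [Node.iD, Node.wD, Node.cD, Node.iU, Node.wU, Node.cU]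

theorem OkU.of_wU {a : ℕ} (h : OkU (.wU a)) : a = 0 := by
  generalize hn : Node.wU a = n at h
  have h0 := congrArg Node.arity hn
  cases h <;> first | (simp at h0; done) | exact Node.wU_inj hn

theorem OkC.out {n : Node} (h : OkC n) (h' : n.arity ≠ (1, 2)) : ∀ e ∈ n.outs, e = 1 := by
  cases h <;> simp_all [Node.iD, Node.wD, Node.cD, Node.iU, Node.wU, Node.arity, Node.cU]

theorem OkC.of_cU {a b c : ℕ} (h : OkC (.cU a b c)) : a = 0 := by
  generalize hn : Node.cU a b c = n at h
  have h0 := congrArg Node.arity hn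
  cases h <;> first | (simp at h0; done) | exact (Node.cU_inj hn).1

theorem Diagram.not_step {D D' : Diagram} {f g h : ℕ → ℕ} (hU : ∀ n ∈ D.nodes, OkU (n.map f))
    (hC : ∀ n ∈ D.nodes, OkC (n.map g)) (hW : ∀ n ∈ D.nodes, OkW True (n.map h)) :
    ¬ D.Step D' := by
  intro hs
  have key : ∀ {n e}, OkU (Node.map f n) → OkU (Node.map f (.wU e)) → e ∈ n.outs → False := by
    intro n e h₁ h₂ he
    rw [Node.map_wU] at h₂
    have := h₁.out _ (Multiset.mem_map_of_mem f he)
    have := h₂.of_wU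
    omega
  cases hs with
  | wDown_cDown E Γ a b c =>
    simp only [forall_mem_cons, Node.map_wD, Node.map_cD] at hW
    have := hW.1.of_wD
    have := hW.2.1.of_cD
    omega
  | wDown_cUp E Γ a b c =>
    simp only [forall_mem_cons, Node.map_wD, Node.map_cU] at hW
    have := hW.1.of_wD
    have := hW.2.1.of_cU
    omega
  | iDown_wUp E Γ a b | cUp_wUp E Γ a b c | wDown_wUp E Γ a | cDown_wUp E Γ a b c =>
    exact key (hU _ (Multiset.mem_cons_self _ _))
      (hU _ (Multiset.mem_cons_of_mem (Multiset.mem_cons_self _ _)))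
      (by simp [iD, cU, wD, cD])
  | cDown_cUp E Γ a b m c d p q r s | iDown_cUp E Γ m b c d p q =>
    simp only [forall_mem_cons, Node.map_cD, Node.map_iD, Node.map_cU] at hC
    have h₁ := hC.1.out (by simp) (g m) (by simp [iD, cD])
    have := hC.2.1.of_cU
    omega

theorem Der.isNormalForm_normalize {A B : Formula} (Φ : Der A B) :
    Flow.IsNormalForm Φ.flow Φ.normalize.flow := by
  refine ⟨Φ.flow_normalize, ?_⟩
  rintro χ ⟨D, D', hD, -, hs⟩
  obtain ⟨σ, hσ⟩ := Quotient.exact hD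
  obtain ⟨f, hf⟩ := Φ.normalize_okU
  obtain ⟨g, hg⟩ := Φ.normalize_okC
  obtain ⟨h, hh⟩ := Φ.normalize_okW
  have := hs.rename σ
  rw [← hσ] at this
  exact Diagram.not_step hf hg hh this

/-! ### Sizes -/

/-- The number of edges created by a rule instance. -/
def Inf.made : {A B : Formula} → Inf A B → ℕ
  | _, _, iDown _ => 2
  | _, _, wDown _ => 1
  | _, _, cDown _ => 1
  | _, _, cUp _ => 2
  | _, _, _ => 0

/-- The number of edges created by a derivation. -/
def Der.made : {A B : Formula} → Der A B → ℕ
  | _, _, fm _ => 0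
  | _, _, and Φ Ψ => Φ.made + Ψ.made
  | _, _, or Φ Ψ => Φ.made + Ψ.made
  | _, _, step Φ ρ Ψ => Φ.made + ρ.made + Ψ.made

section
variable {A B : Formula}

theorem Der.trace_made (Φ : Der A B) (l : A.Lab) (k : ℕ) : (Φ.trace l k).2.2 = k + Φ.made := by
  induction Φ generalizing k with
  | fm A => rfl
  | and Φ Ψ ih₁ ih₂ | or Φ Ψ ih₁ ih₂ => simp [trace, made, ih₁, ih₂, add_assoc]
  | step Φ ρ Ψ ih₁ ih₂ =>
    have h : ∀ l k, (ρ.trace l k).2.2 = k + ρ.made := by cases ρ <;> intros <;> rfl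
    simp only [trace, made, ih₁, ih₂, h]
    omega

theorem Der.size_flow (Φ : Der A B) : Φ.flow.size = A.numAtoms + Φ.made := by
  simp [flow, Flow.size, diagram, trace_made]

theorem Der.numAtoms_le (Φ : Der A B) : B.numAtoms ≤ A.numAtoms + Φ.made := by
  have h := congrArg Multiset.card (Φ.traceOK (A.numbering 0) 0).conserve
  simp [Lab.length_toList, trace_made, Multiset.Ico] at h
  omega

theorem Fm.size_pos {α : Type} (A : Fm α) : 0 < A.size := by
  induction A <;> simp [Fm.size] <;> omega

theorem Fm.numAtoms_le_size {α : Type} (A : Fm α) : A.numAtoms ≤ A.size := by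
  induction A <;> simp [Fm.size, numAtoms] <;> omega

theorem Der.premiss_le (Φ : Der A B) : A.size ≤ Φ.size := by
  induction Φ <;> simp [Fm.size, size] <;> omega

theorem Der.conclusion_le (Φ : Der A B) : B.size ≤ Φ.size := by
  induction Φ <;> simp [Fm.size, size] <;> omega

theorem Der.size_pos (Φ : Der A B) : 0 < Φ.size := A.size_pos.trans_le Φ.premiss_le

@[simp] theorem Der.size_castR {C : Formula} (h : B = C) (Φ : Der A B) :
    (castR h Φ).size = Φ.size := by subst h; rfl

@[simp] theorem Der.size_castL {C : Formula} (h : A = C) (Φ : Der A B) :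
    (castL h Φ).size = Φ.size := by subst h; rfl

@[simp] theorem Der.size_inf (ρ : Inf A B) : (inf ρ).size = A.size + B.size := rfl
@[simp] theorem Der.size_re (h) : (re A B h).size = A.size + B.size := rfl
@[simp] theorem Der.size_comp {C : Formula} (Φ : Der A B) (Ψ : Der B C) :
    (comp Φ Ψ).size = Φ.size + Ψ.size := rfl

end

/-- The number of leaves and units. -/
def Pat.sz : Pat → ℕ
  | unit | leaf => 1
  | node p q => p.sz + q.sz

namespace Pat

theorem sz_pos (p : Pat) : 1 ≤ p.sz := by induction p <;> simp [sz] <;> omega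

@[simp] theorem size_fm (a : Lit) (p : Pat) : (p.fm a).size = p.sz := by
  induction p <;> simp_all [fm, sz, Fm.size]

theorem Full.sz {p : Pat} (h : p.Full) : p.sz = p.leaves := by
  induction p with
  | unit => exact h.elim
  | leaf => rfl
  | node p q ihp ihq => simp [Pat.sz, leaves, ihp h.1, ihq h.2]

theorem Proper.sz_le {p : Pat} (h : p.Proper) : p.sz ≤ p.leaves + 1 := by
  rcases h with rfl | h
  · simp [sz]
  · simp [h.sz]

theorem sz_join_true {p q : Pat} (hp : p.sz = 1) (hq : q.sz = 1) : (p.join true q).sz = 1 := by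
  have : ∀ r s : Pat, ¬ (node r s).sz = 1 := fun r s => by
    have := r.sz_pos; have := s.sz_pos; simp only [sz]; omega
  cases p <;> cases q <;> simp_all [join]

end Pat

section
variable {K : ℕ}

theorem size_copies {A : Formula} {l : A.GLab Pat} (h : ∀ p ∈ GLab.toList A l, p.sz ≤ K)
    (hK : 1 ≤ K) : (copies A l).size ≤ K * A.size := by
  induction A with
  | top | bot => simpa [sub, Fm.size]
  | atom a =>
    have key : ∀ p : Pat, p.sz ≤ K → (p.fm a).size ≤ K * 1 := by simp
    exact key l (h _ (List.mem_cons_self ..))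
  | and A B ihA ihB | or A B ihA ihB =>
    simp only [GLab.toList, List.mem_append] at h
    simp only [sub, Fm.size, mul_add]
    exact Nat.add_le_add (ihA fun p hp => h p (Or.inl hp)) (ihB fun p hp => h p (Or.inr hp))

theorem size_copyAtom (a : Lit) (p : Pat) : (copyAtom a p).size + 3 ≤ 5 * p.sz := by
  induction p with
  | unit | leaf => exact Nat.le_of_ble_eq_true rfl
  | node p q ihp ihq =>
    show 1 + 2 + ((copyAtom a p).size + (copyAtom a q).size) + 3 ≤ 5 * (p.sz + q.sz)
    omega

theorem size_copyAll {A : Formula} {l : A.GLab Pat} (h : ∀ p ∈ GLab.toList A l, p.sz ≤ K)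
    (hK : 1 ≤ K) : (copyAll A l).size ≤ 5 * K * A.size := by
  induction A with
  | top | bot => simp [copyAll, Fm.size, Der.size]; omega
  | atom a =>
    have key : ∀ p : Pat, p.sz ≤ K → (copyAtom a p).size ≤ 5 * K * 1 := fun p hp => by
      have := size_copyAtom a p; omega
    exact key l (h _ (List.mem_cons_self ..))
  | and A B ihA ihB | or A B ihA ihB =>
    simp only [GLab.toList, List.mem_append] at h
    simp only [copyAll, Fm.size, mul_add, Der.size]
    exact Nat.add_le_add (ihA fun p hp => h p (Or.inl hp)) (ihB fun p hp => h p (Or.inr hp))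

theorem size_weak (a : Lit) (p : Pat) : (weak a p).size + 6 ≤ 20 * p.sz := by
  induction p with
  | unit | leaf => exact Nat.le_of_ble_eq_true rfl
  | node p q ihp ihq =>
    show 1 + 2 + ((weak a p).size + (weak a q).size) + 6 ≤ 20 * (p.sz + q.sz)
    omega

theorem size_contr (a : Lit) (p : Pat) : (contr a p).size ≤ 4 * p.sz ^ 2 := by
  induction p with
  | unit | leaf => exact Nat.le_of_ble_eq_true rfl
  | node p q ihp ihq =>
    show ((p.fm a).size + (q.fm a).size + ((p.fm a).size + (q.fm a).size) +
      ((p.fm a).size + (p.fm a).size + ((q.fm a).size + (q.fm a).size))) +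
      ((contr a p).size + (contr a q).size) ≤ 4 * (p.sz + q.sz) ^ 2
    have h₁ := p.sz_pos
    have h₂ := q.sz_pos
    simp only [Pat.size_fm]
    nlinarith [Nat.mul_le_mul h₁ h₂]

theorem size_distribute (A B C : Formula) (Φ : Der (.or C C) C) :
    (distribute A B C Φ).size ≤ 13 * (A.size + B.size + C.size) + Φ.size := by
  simp only [distribute, size_comp, size_inf, size_re, Fm.size, Der.size]
  omega

theorem size_spread (a : Lit) (C : Formula) (κ : Der (.or C C) C) (ω : Der .bot C)
    (Φ : Der .top (.or (.atom a) C)) (p : Pat) : (spread a C κ ω Φ p).size ≤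
      (13 * C.size + κ.size + ω.size + Φ.size + 26) * p.sz ^ 2 := by
  induction p with
  | unit =>
    show 1 + 2 + (1 + ω.size) ≤ _ * 1 ^ 2
    omega
  | leaf =>
    show Φ.size ≤ _ * 1 ^ 2
    omega
  | node p q ihp ihq =>
    have h := size_distribute (p.fm a) (q.fm a) C κ
    simp only [Pat.size_fm] at h
    show 1 + 2 + ((spread a C κ ω Φ q).size + (spread a C κ ω Φ p).size +
      (distribute (p.fm a) (q.fm a) C κ).size) ≤ _ * (p.sz + q.sz) ^ 2
    generalize hD : 13 * C.size + κ.size + ω.size + Φ.size + 26 = D at *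
    have h₁ : p.sz + q.sz ≤ 2 * (p.sz * q.sz) := by nlinarith [p.sz_pos, q.sz_pos]
    have h₂ := Nat.mul_le_mul_left D (Nat.mul_le_mul p.sz_pos q.sz_pos)
    have h₃ := Nat.mul_le_mul_right (p.sz * q.sz) (show 26 ≤ D by omega)
    nlinarith

theorem size_iden (a : Lit) (p q : Pat) : (iden a p q).size ≤ 118 * q.sz ^ 2 * p.sz ^ 2 := by
  rw [iden]
  refine (size_spread _ _ _ _ _ _).trans (Nat.mul_le_mul_right _ ?_)
  have h₁ : _ ≤ 51 * q.sz ^ 2 := size_spread a.dual (.atom a) (contr a .leaf) (weak a .leaf)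
    (comp (inf (.iDown a)) (inf (.orComm _ _))) q
  have h₂ := size_contr a.dual q
  have h₃ := size_weak a.dual q
  have h₄ := q.sz_pos
  simp only [size_comp, size_inf, Fm.size, Pat.size_fm]
  nlinarith

theorem size_cocontr (a : Lit) (m : Bool) (p q : Pat) :
    (cocontr a m p q).size ≤ 2 * (p.sz + q.sz) := by
  have key : ∀ (A : Formula) (n : ℕ), A.size = n → A.size + (1 + A.size) ≤ 2 * (1 + n) ∧
      A.size + (A.size + 1) ≤ 2 * (n + 1) ∧ A.size ≤ 2 * n := by omega
  match m, p, q with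
  | m, .unit, q => exact (key _ _ (q.size_fm a)).1
  | m, .leaf, .unit => cases m <;> exact (key (.atom a) 1 rfl).2.1
  | true, .leaf, .leaf => exact Nat.le_of_ble_eq_true rfl
  | false, .leaf, .leaf => exact Nat.le_of_ble_eq_true rfl
  | m, .leaf, .node r s => cases m <;> exact (key _ _ ((Pat.node .leaf (.node r s)).size_fm a)).2.2
  | m, .node r s, .unit => cases m <;> exact (key _ _ ((Pat.node r s).size_fm a)).2.1
  | m, .node r s, .leaf => cases m <;> exact (key _ _ ((Pat.node (.node r s) .leaf).size_fm a)).2.2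
  | m, .node r s, .node t u =>
    cases m <;> exact (key _ _ ((Pat.node (.node r s) (.node t u)).size_fm a)).2.2

theorem Inf.size_up {m : Bool} {A B : Formula} (ρ : Inf A B) {l : B.GLab Pat}
    (h : ∀ p ∈ GLab.toList B l, p.sz ≤ K) (h' : ∀ p ∈ GLab.toList A (ρ.upLab m l), p.sz ≤ K)
    (hK : 1 ≤ K) : (ρ.up m l).size ≤ 118 * K ^ 4 * (A.size + B.size) := by
  have hA := size_copies h' hK
  have hB := size_copies h hK
  have hK4 : K ≤ K ^ 4 := Nat.le_self_pow (by norm_num) K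
  have h0 : (copies A (ρ.upLab m l)).size + (copies B l).size ≤
      118 * K ^ 4 * (A.size + B.size) := by
    nlinarith [A.size_pos, B.size_pos, Nat.mul_le_mul_right (A.size + B.size) hK4]
  have h2 : K ^ 2 ≤ K ^ 4 := Nat.pow_le_pow_right hK (by norm_num)
  cases ρ with
  | eq | switch | medial => exact h0
  | iDown a =>
    have key : ∀ p q : Pat, p.sz ≤ K → q.sz ≤ K → (iden a p q).size ≤ 118 * K ^ 4 * 3 := by
      intro p q hp hq
      have := Nat.mul_le_mul (Nat.pow_le_pow_left hq 2) (Nat.pow_le_pow_left hp 2)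
      have := size_iden a p q
      nlinarith
    exact key _ _ (h _ (List.mem_cons_self ..))
      (h _ (List.mem_cons_of_mem _ (List.mem_cons_self ..)))
  | wDown a =>
    have key : ∀ p : Pat, p.sz ≤ K → (weak a p).size ≤ 118 * K ^ 4 * 2 := by
      intro p hp
      have := size_weak a p
      omega
    exact key _ (h _ (List.mem_cons_self ..))
  | cDown a =>
    have key : ∀ p : Pat, p.sz ≤ K → (contr a p).size ≤ 118 * K ^ 4 * 3 := by
      intro p hp
      have := size_contr a p
      have := Nat.pow_le_pow_left hp 2
      omega
    exact key _ (h _ (List.mem_cons_self ..))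
  | iUp a =>
    show 3 ≤ 118 * K ^ 4 * 3
    omega
  | wUp a =>
    show 1 ≤ 118 * K ^ 4 * 2
    omega
  | cUp a =>
    have key : ∀ p q : Pat, p.sz ≤ K → q.sz ≤ K → (cocontr a m p q).size ≤ 118 * K ^ 4 * 3 := by
      intro p q hp hq
      have := size_cocontr a m p q
      omega
    exact key _ _ (h _ (List.mem_cons_self ..))
      (h _ (List.mem_cons_of_mem _ (List.mem_cons_self ..)))

/-- In a pass upwards, all labels have size at most `K`. -/
def Der.Below (m : Bool) (K : ℕ) : {A B : Formula} → Der A B → B.GLab Pat → Prop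
  | _, _, fm A, l => ∀ p ∈ GLab.toList A l, p.sz ≤ K
  | _, _, and Φ Ψ, l => Φ.Below m K l.1 ∧ Ψ.Below m K l.2
  | _, _, or Φ Ψ, l => Φ.Below m K l.1 ∧ Ψ.Below m K l.2
  | _, _, step Φ ρ Ψ, l => Φ.Below m K (ρ.upLab m (Ψ.upLab m l)) ∧ Ψ.Below m K l

variable {A B : Formula} {m : Bool}

theorem Der.Below.labels {Φ : Der A B} {l : B.GLab Pat} (h : Φ.Below m K l) :
    (∀ p ∈ GLab.toList A (Φ.upLab m l), p.sz ≤ K) ∧ ∀ p ∈ GLab.toList B l, p.sz ≤ K := by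
  induction Φ with
  | fm A => exact ⟨h, h⟩
  | and Φ Ψ ih₁ ih₂ | or Φ Ψ ih₁ ih₂ =>
    simp only [Der.upLab, GLab.toList, List.mem_append]
    exact ⟨fun p hp => hp.elim ((ih₁ h.1).1 p) ((ih₂ h.2).1 p),
      fun p hp => hp.elim ((ih₁ h.1).2 p) ((ih₂ h.2).2 p)⟩
  | step Φ ρ Ψ ih₁ ih₂ => exact ⟨(ih₁ h.1).1, (ih₂ h.2).2⟩

theorem Der.below_of_forall {P : Pat → Prop} (hu : P .unit) (hf : P .leaf)
    (hj : ∀ p q, P p → P q → P (p.join m q)) (hK : ∀ p, P p → p.sz ≤ K) (Φ : Der A B)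
    {l : B.GLab Pat} (hl : ∀ p ∈ GLab.toList B l, P p) : Φ.Below m K l := by
  induction Φ with
  | fm A => exact fun p hp => hK p (hl p hp)
  | and Φ Ψ ih₁ ih₂ | or Φ Ψ ih₁ ih₂ =>
    simp only [GLab.toList, List.mem_append] at hl
    exact ⟨ih₁ fun p hp => hl p (Or.inl hp), ih₂ fun p hp => hl p (Or.inr hp)⟩
  | step Φ ρ Ψ ih₁ ih₂ =>
    exact ⟨ih₁ (ρ.upLab_forall hu hf hj _ (Ψ.upLab_forall hu hf hj _ hl)), ih₂ hl⟩

theorem Der.below_of_made (Φ : Der A B) {l : B.GLab Pat}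
    (hl : ∀ p ∈ GLab.toList B l, p.Proper)
    (h : (copies A (Φ.upLab m l)).numAtoms + (Φ.up m l).made ≤ K) : Φ.Below m (K + 1) l := by
  induction Φ with
  | fm A =>
    intro p hp
    have h1 := List.single_le_sum (l := (GLab.toList A l).map Pat.leaves) (by simp) _
      (List.mem_map_of_mem hp)
    rw [← numAtoms_sub Pat.numAtoms_fm A l] at h1
    have h2 := (hl p hp).sz_le
    have : (copies A l).numAtoms ≤ K := le_of_add_le_left h
    have : (copies A l).numAtoms = (sub Pat.fm A l).numAtoms := rfl
    omega
  | and Φ Ψ ih₁ ih₂ | or Φ Ψ ih₁ ih₂ =>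
    simp only [GLab.toList, List.mem_append] at hl
    replace h : (copies _ (Φ.upLab m l.1)).numAtoms + (copies _ (Ψ.upLab m l.2)).numAtoms +
      ((Φ.up m l.1).made + (Ψ.up m l.2).made) ≤ K := h
    exact ⟨ih₁ (fun p hp => hl p (Or.inl hp)) (by omega),
      ih₂ (fun p hp => hl p (Or.inr hp)) (by omega)⟩
  | step Φ ρ Ψ ih₁ ih₂ =>
    have h0 := Ψ.upLab_proper (m := m) _ hl
    have h1 := (Φ.up m (ρ.upLab m (Ψ.upLab m l))).numAtoms_le
    have h2 := (ρ.up m (Ψ.upLab m l)).numAtoms_le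
    simp only [Der.upLab, up, comp, Der.made, Inf.made] at h
    exact ⟨ih₁ (ρ.upLab_forall (.inl rfl) (.inr trivial) (fun _ _ => .join) _ h0) (by omega),
      ih₂ hl (by omega)⟩

theorem sq_step {c x y z a b r s : ℕ} (hx : x ≤ c * a ^ 2) (hz : z ≤ c * b ^ 2)
    (hy : y ≤ c * (r + s)) (hr : r ≤ a) (hs : s ≤ b) (ha : 0 < a) (hb : 0 < b) :
    x + (y + z) ≤ c * (a + b) ^ 2 := by
  have : r + s ≤ 2 * (a * b) := by nlinarith
  nlinarith [Nat.mul_le_mul_left c this]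

theorem sq_add {c x y a b : ℕ} (hx : x ≤ c * a ^ 2) (hy : y ≤ c * b ^ 2) :
    x + y ≤ c * (a + b) ^ 2 := by
  nlinarith [Nat.zero_le (c * (a * b))]

theorem Der.Below.size_up {Φ : Der A B} {l : B.GLab Pat} (h : Φ.Below m K l) (hK : 1 ≤ K) :
    (Φ.up m l).size ≤ 118 * K ^ 4 * Φ.size ^ 2 := by
  induction Φ with
  | fm A =>
    refine (size_copies h hK).trans (Nat.mul_le_mul ?_ (Nat.le_self_pow (by norm_num) _))
    have : K ≤ K ^ 4 := Nat.le_self_pow (by norm_num) K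
    omega
  | and Φ Ψ ih₁ ih₂ | or Φ Ψ ih₁ ih₂ => exact sq_add (ih₁ h.1) (ih₂ h.2)
  | step Φ ρ Ψ ih₁ ih₂ =>
    exact sq_step (ih₁ h.1) (ih₂ h.2) (ρ.size_up h.2.labels.1 h.1.labels.2 hK) Φ.conclusion_le
      Ψ.premiss_le Φ.size_pos Ψ.size_pos

theorem size_erase (A : Formula) (l : A.GLab Bool) : (erase A l).size = A.size := by
  induction A with
  | top | bot => rfl
  | atom a =>
    have key : ∀ b, (keep a b).size = 1 := by rintro (_ | _) <;> rfl
    exact key l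
  | and A B ihA ihB | or A B ihA ihB => simp [sub, Fm.size, ihA, ihB]

theorem size_fillAtom (a : Lit) (b : Bool) : (fillAtom a b).size ≤ 2 := by
  cases b <;> simp [fillAtom, keep, Fm.size, Der.size]

theorem size_fill (A : Formula) (l : A.GLab Bool) : (fill A l).size ≤ 2 * A.size := by
  induction A with
  | top | bot => exact Nat.le_of_ble_eq_true rfl
  | atom a => exact size_fillAtom a l
  | and A B ihA ihB | or A B ihA ihB =>
    have := ihA l.1
    have := ihB l.2
    simp only [fill, Der.size, Fm.size]
    omega

theorem Inf.size_down (ρ : Inf A B) (l : A.GLab Bool) :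
    (ρ.down l).size ≤ 3 * (A.size + B.size) := by
  cases ρ with
  | eq t h =>
    show (erase _ _).size + (erase _ _).size ≤ _
    rw [size_erase, size_erase]
    omega
  | switch A B C =>
    show (erase A l.1).size + ((erase B l.2.1).size + (erase C l.2.2).size) +
      ((erase A l.1).size + (erase B l.2.1).size + (erase C l.2.2).size) ≤
      3 * (A.size + (B.size + C.size) + (A.size + B.size + C.size))
    simp only [size_erase]
    omega
  | medial A B C D =>
    show (erase A l.1.1).size + (erase B l.1.2).size + ((erase C l.2.1).size +
      (erase D l.2.2).size) + ((erase A l.1.1).size + (erase C l.2.1).size +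
      ((erase B l.1.2).size + (erase D l.2.2).size)) ≤
      3 * (A.size + B.size + (C.size + D.size) + (A.size + C.size + (B.size + D.size)))
    simp only [size_erase]
    omega
  | iDown a | wDown a => exact Nat.le_of_ble_eq_true rfl
  | cDown a =>
    have key : ∀ p q, (mergeD a p q).size ≤ 9 := by
      rintro (_ | _) (_ | _) <;> exact Nat.le_of_ble_eq_true rfl
    exact key l.1 l.2
  | iUp a =>
    have := size_fillAtom a l.1
    have := size_fillAtom a.dual l.2
    show (fillAtom a l.1).size + (fillAtom a.dual l.2).size + 3 ≤ 9
    omega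
  | wUp a =>
    have := size_fillAtom a l
    show (fillAtom a l).size + 2 ≤ 6
    omega
  | cUp a =>
    have key : ∀ p, (splitD a p).size ≤ 9 := by
      rintro (_ | _) <;> exact Nat.le_of_ble_eq_true rfl
    exact key l

theorem Der.size_down (Φ : Der A B) (l : A.GLab Bool) : (Φ.down l).size ≤ 3 * Φ.size ^ 2 := by
  induction Φ with
  | fm A => simp only [down, size, size_erase]; nlinarith [A.size_pos]
  | and Φ Ψ ih₁ ih₂ | or Φ Ψ ih₁ ih₂ => exact sq_add (ih₁ _) (ih₂ _)
  | step Φ ρ Ψ ih₁ ih₂ =>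
    exact sq_step (ih₁ _) (ih₂ _) (ρ.size_down _) Φ.conclusion_le Ψ.premiss_le Φ.size_pos
      Ψ.size_pos

theorem forall_const_leaf {P : Pat → Prop} (h : P .leaf) (B : Formula) :
    ∀ p ∈ GLab.toList B (const .leaf B), P p := by
  intro p hp
  rw [const, GLab.toList_tab, List.map_const', List.mem_replicate] at hp
  exact hp.2 ▸ h

theorem Der.size_raise_true (Φ : Der A B) : (Φ.raise true).size ≤ 118 * Φ.size ^ 2 := by
  exact (size_castR (copies_const B 0) _).trans_le
    ((below_of_forall (K := 1) (P := fun p => p.sz = 1) rfl rfl (fun _ _ => Pat.sz_join_true)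
      (fun _ h => h.le) Φ (forall_const_leaf (P := fun p => p.sz = 1) rfl B)).size_up le_rfl)

theorem Der.size_trim (Φ : Der A B) : Φ.trim.size ≤ 70000 * Φ.size ^ 4 := by
  have h₁ := Φ.size_raise_true
  have h₂ := (Φ.raise true).size_down (const true _)
  have h₃ := size_fill B ((Φ.raise true).downLab (const true _))
  have h₄ := (Φ.raise true).conclusion_le
  have h₅ := Nat.pow_le_pow_left h₁ 2
  have h₆ := (size_castL (erase_const _ 0) ((Φ.raise true).down (const true _))).trans_le h₂
  have h₇ : (Φ.raise true).size ≤ (Φ.raise true).size ^ 2 := Nat.le_self_pow (by norm_num) _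
  calc Φ.trim.size ≤ 3 * (Φ.raise true).size ^ 2 + 2 * B.size := Nat.add_le_add h₆ h₃
    _ ≤ 5 * (118 * Φ.size ^ 2) ^ 2 := by omega
    _ = 69620 * Φ.size ^ 4 := by ring
    _ ≤ 70000 * Φ.size ^ 4 := by omega

theorem made_castR {C : Formula} (h : B = C) (Ψ : Der A B) : (castR h Ψ).made = Ψ.made := by
  subst h; rfl

theorem Der.below_raise_false (Φ : Der A B)
    (h : (copies A (Φ.lab false)).numAtoms + (Φ.raise false).made ≤ K) :
    Φ.Below false (K + 1) (const .leaf B) := by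
  rw [show (Φ.raise false).made = _ from made_castR (copies_const B 0) _] at h
  exact below_of_made Φ (forall_const_leaf (.inr trivial) B) h

theorem Der.size_normalize (Φ : Der A B) :
    Φ.normalize.size ≤ 10 ^ 12 * (Φ.size + Φ.normalize.flow.size + 1) ^ 12 := by
  have h₁ := (copyAll A (Φ.lab true)).numAtoms_le
  have h₂ := (copyAll _ (Φ.trim.lab false)).numAtoms_le
  have h₃ := Φ.normalize.size_flow
  have h₄ : Φ.normalize.made = _ + 0 + (_ + 0 + _) := rfl
  have hb := below_raise_false (K := Φ.normalize.flow.size) Φ.trim (by omega)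
  have h₅ : (copyAll A (Φ.lab true)).size ≤ _ := size_copyAll (K := 1) (fun p hp =>
    (Φ.lab_forall (P := fun p => p.sz = 1) rfl rfl (fun _ _ => Pat.sz_join_true) p hp).le) le_rfl
  have h₆ : (copyAll _ (Φ.trim.lab false)).size ≤ _ := size_copyAll hb.labels.1 (by omega)
  have h₇ : (Φ.trim.raise false).size ≤ _ :=
    (size_castR (copies_const B 0) _).trans_le (hb.size_up (by omega))
  have h₈ := Φ.size_trim
  generalize Φ.normalize.flow.size = k at *
  have hX : Φ.trim.size ≤ 70000 * (Φ.size + k + 1) ^ 4 :=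
    h₈.trans (Nat.mul_le_mul_left _ (Nat.pow_le_pow_left (by omega) _))
  have hk : k + 1 ≤ Φ.size + k + 1 := by omega
  have hs : Φ.size ≤ Φ.size + k + 1 := by omega
  generalize Φ.size + k + 1 = X at *
  have hX0 : 1 ≤ X := by omega
  calc Φ.normalize.size = (copyAll A (Φ.lab true)).size +
        ((copyAll _ (Φ.trim.lab false)).size + (Φ.trim.raise false).size) := rfl
    _ ≤ 5 * 1 * X + (5 * X * (70000 * X ^ 4) + 118 * X ^ 4 * (70000 * X ^ 4) ^ 2) := by
      refine Nat.add_le_add (h₅.trans ?_) (Nat.add_le_add (h₆.trans ?_) (h₇.trans ?_))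
      · exact Nat.mul_le_mul_left _ (Φ.premiss_le.trans hs)
      · exact Nat.mul_le_mul (by omega) (Φ.trim.premiss_le.trans hX)
      · gcongr
    _ = 5 * X ^ 1 + 350000 * X ^ 5 + 578200000000 * X ^ 12 := by ring
    _ ≤ 5 * X ^ 12 + 350000 * X ^ 12 + 578200000000 * X ^ 12 := by gcongr <;> omega
    _ ≤ 10 ^ 12 * X ^ 12 := by omega

theorem Formula.size_toTree (A : Formula) : A.toTree.size + 11 ≤ 22 * A.size := by
  induction A with
  | top | bot => exact Nat.le_of_ble_eq_true rfl
  | atom a => rcases a with ⟨n, _ | _⟩ <;> simp [Formula.toTree, Tree.size, Tree.ofNat, Fm.size]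
  | and A B ihA ihB | or A B ihA ihB =>
    simp only [Formula.toTree, Tree.size, Tree.ofNat, Fm.size]
    omega

theorem Tree.size_ofNat (n : ℕ) : (Tree.ofNat n).size = 2 * n + 1 := by
  induction n with
  | zero => rfl
  | succ n ih => simp only [ofNat, size, ih]; omega

theorem size_labToTree {n : ℕ} {B : Formula} {t : B.Lab} (h : ∀ i ∈ Lab.toList B t, i < n) :
    (labToTree B t).size + 1 ≤ (2 * n + 2) * B.size := by
  induction B with
  | top | bot => simp [labToTree, Tree.size, Fm.size]
  | atom a =>
    have key : ∀ i < n, (Tree.ofNat i).size + 1 ≤ (2 * n + 2) * 1 := fun i hi => by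
      rw [Tree.size_ofNat]; omega
    exact key t (h _ (List.mem_cons_self ..))
  | and A B ihA ihB | or A B ihA ihB =>
    simp only [Lab.toList, List.mem_append] at h
    have h₁ := ihA (t := t.1) fun i hi => h i (Or.inl hi)
    have h₂ := ihB (t := t.2) fun i hi => h i (Or.inr hi)
    simp only [labToTree, Tree.size, Fm.size, mul_add] at *
    omega

theorem Inf.size_toTree (ρ : Inf A B) :
    ρ.toTree.size ≤ 19 + (2 * A.size + 2) * B.size := by
  cases ρ with
  | eq t h =>
    have h₁ := size_labToTree (n := A.numAtoms) (t := t) fun i hi =>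
      List.mem_range.1 (h.perm.subset hi)
    have h₂ := Nat.mul_le_mul_right B.size (Nat.mul_le_mul_left 2 A.numAtoms_le_size)
    simp only [toTree, Tree.size, Tree.ofNat]
    nlinarith
  | _ => exact le_add_right (Nat.le_of_ble_eq_true rfl)

theorem Der.size_toTree (Φ : Der A B) : Φ.toTree.size + 11 ≤ 50 * Φ.size ^ 2 := by
  induction Φ with
  | fm A =>
    have := Formula.size_toTree A
    simp only [toTree, Tree.size, Tree.ofNat, Der.size]
    nlinarith [A.size_pos]
  | and Φ Ψ ih₁ ih₂ | or Φ Ψ ih₁ ih₂ =>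
    simp only [toTree, Tree.size, Tree.ofNat, Der.size]
    nlinarith [Φ.size_pos, Ψ.size_pos]
  | @step A B C D Φ ρ Ψ ih₁ ih₂ =>
    have h := ρ.size_toTree
    have h₁ := Nat.mul_le_mul (Nat.add_le_add_right (Nat.mul_le_mul_left 2 Φ.conclusion_le) 2)
      Ψ.premiss_le
    have h₂ := Nat.mul_le_mul Φ.size_pos Ψ.size_pos
    have h₃ := Nat.mul_le_mul_right Ψ.size Φ.size_pos
    simp only [toTree, Tree.size, Tree.ofNat, Der.size]
    nlinarith

end

/-! ### Recursive programs -/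

/-- Expressions. -/
inductive Ex : Type
  | var : Ex
  | lit (n : ℕ) : Ex
  | fst (e : Ex) : Ex
  | snd (e : Ex) : Ex
  | cons (e e' : Ex) : Ex
  | same (e : Ex) : Ex

/-- The value of an expression. -/
def Ex.eval : Ex → Tree → Tree
  | var, x => x
  | lit n, _ => .ofNat n
  | fst e, x => (e.eval x).fst
  | snd e, x => (e.eval x).snd
  | cons e e', x => .cons (e.eval x) (e'.eval x)
  | same e, x => (e.eval x).sameName

/-- Whether a tree is a pair. -/
def Tree.isPair : Tree → Bool
  | cons _ _ => true
  | _ => false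

theorem Tree.isPair_iff {x : Tree} : x.isPair = true ↔ x.IsPair := by
  cases x <;> simp [isPair, IsPair]

theorem Tree.size_pos (x : Tree) : 1 ≤ x.size := by cases x <;> simp [size]

/-- Bodies of functions that are named by elements of `F`: return a value, call a function and put
its value in front of the environment, or branch. -/
inductive Body (F : Type) : Type
  | ret (e : Ex) : Body F
  | call (f : F) (e : Ex) (b : Body F) : Body F
  | ite (c : Ex) (p q : Body F) : Body F

/-- A program runs in linear time. -/
def Lin (p : Prog) (f : Tree → Tree) : Prop :=
  ∃ K, ∀ x, (f x).size ≤ K * x.size ∧ ∃ t ≤ K * x.size, Runs p x (f x) t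

namespace Lin
variable {p q c : Prog} {f g h : Tree → Tree}

theorem of_le (hf : ∀ x, (f x).size ≤ x.size) (hp : ∀ x, Runs p x (f x) x.size) : Lin p f :=
  ⟨1, fun x => ⟨by simpa using hf x, x.size, by simp, hp x⟩⟩

theorem id : Lin .id fun x => x := of_le (fun _ => le_rfl) .id
theorem nil : Lin .nil fun _ => .nil := of_le Tree.size_pos .nil
theorem fst : Lin .fst Tree.fst :=
  of_le (fun x => by cases x <;> simp [Tree.fst, Tree.size]; omega) .fst
theorem snd : Lin .snd Tree.snd :=
  of_le (fun x => by cases x <;> simp [Tree.snd, Tree.size]; omega) .snd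
theorem same : Lin .sameName Tree.sameName := by
  refine of_le (fun x => ?_) .sameName
  unfold Tree.sameName
  split
  · split <;> simp [Tree.size]
  · exact x.size_pos

theorem pair (hf : Lin p f) (hg : Lin q g) : Lin (.pair p q) fun x => .cons (f x) (g x) := by
  obtain ⟨K, hK⟩ := hf
  obtain ⟨L, hL⟩ := hg
  refine ⟨K + L + 1, fun x => ?_⟩
  obtain ⟨h1, s, hs, h2⟩ := hK x
  obtain ⟨h3, t, ht, h4⟩ := hL x
  have := x.size_pos
  refine ⟨?_, _, ?_, h2.pair h4⟩
  · simp only [Tree.size]; nlinarith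
  · nlinarith

theorem comp (hf : Lin p f) (hg : Lin q g) : Lin (.comp q p) fun x => g (f x) := by
  obtain ⟨K, hK⟩ := hf
  obtain ⟨L, hL⟩ := hg
  refine ⟨L * K + K + 1, fun x => ?_⟩
  obtain ⟨h1, s, hs, h2⟩ := hK x
  obtain ⟨h3, t, ht, h4⟩ := hL (f x)
  have := x.size_pos
  have := Nat.mul_le_mul_left L h1
  refine ⟨?_, _, ?_, h2.comp h4⟩ <;> nlinarith

theorem ite (hc : Lin c h) (hf : Lin p f) (hg : Lin q g) :
    Lin (.ite c p q) fun x => bif (h x).isPair then f x else g x := by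
  obtain ⟨J, hJ⟩ := hc
  obtain ⟨K, hK⟩ := hf
  obtain ⟨L, hL⟩ := hg
  refine ⟨J + K + L + 1, fun x => ?_⟩
  beta_reduce
  obtain ⟨-, r, hr, h0⟩ := hJ x
  obtain ⟨h1, s, hs, h2⟩ := hK x
  obtain ⟨h3, t, ht, h4⟩ := hL x
  have := x.size_pos
  cases hx : (h x).isPair with
  | true => exact ⟨show (f x).size ≤ _ by nlinarith, _, by nlinarith,
      h0.ite_true (Tree.isPair_iff.1 hx) h2⟩
  | false => exact ⟨show (g x).size ≤ _ by nlinarith, _, by nlinarith,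
      h0.ite_false (fun h' => by simp [Tree.isPair_iff.2 h'] at hx) h4⟩

theorem lit (n : ℕ) : ∃ p, Lin p fun _ => .ofNat n := by
  induction n with
  | zero => exact ⟨_, nil⟩
  | succ n ih => exact ⟨_, nil.pair ih.choose_spec⟩

theorem ex (e : Ex) : ∃ p, Lin p e.eval := by
  induction e with
  | var => exact ⟨_, id⟩
  | lit n => exact lit n
  | fst e ih => exact ⟨_, ih.choose_spec.comp fst⟩
  | snd e ih => exact ⟨_, ih.choose_spec.comp snd⟩
  | cons e e' ih ih' => exact ⟨_, ih.choose_spec.pair ih'.choose_spec⟩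
  | same e ih => exact ⟨_, ih.choose_spec.comp same⟩

end Lin

namespace Body
variable {F : Type}

/-- Resolve the branchings at the beginning of a body. -/
def head : Body F → Tree → Body F
  | ite c p q, x => bif (c.eval x).isPair then p.head x else q.head x
  | b, _ => b

/-- The parts of a body. -/
def subs : Body F → List (Body F)
  | ret e => [ret e]
  | call f e b => call f e b :: b.subs
  | ite c p q => ite c p q :: (p.subs ++ q.subs)

/-- The number of nested calls. -/
def depth : Body F → ℕ
  | ret _ => 0
  | call _ _ b => b.depth + 1
  | ite _ p q => max p.depth q.depth

theorem self_mem_subs (b : Body F) : b ∈ b.subs := by cases b <;> simp [subs]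

theorem subs_trans {b c d : Body F} (h : b ∈ c.subs) (h' : d ∈ b.subs) : d ∈ c.subs := by
  induction c with
  | ret e => simp only [subs, List.mem_singleton] at h; exact h ▸ h'
  | call f e c ih =>
    rcases List.mem_cons.1 h with rfl | h
    · exact h'
    · exact List.mem_cons_of_mem _ (ih h)
  | ite c p q ihp ihq =>
    rcases List.mem_cons.1 h with rfl | h
    · exact h'
    · exact List.mem_cons_of_mem _ (List.mem_append.2 ((List.mem_append.1 h).imp ihp ihq))

theorem head_mem (b : Body F) (x : Tree) : b.head x ∈ b.subs := by
  induction b with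
  | ret | call => exact self_mem_subs _
  | ite c p q ihp ihq =>
    simp only [head, subs]
    cases (c.eval x).isPair <;> simp [ihp, ihq]

theorem depth_head (b : Body F) (x : Tree) : (b.head x).depth ≤ b.depth := by
  induction b with
  | ret | call => exact le_rfl
  | ite c p q ihp ihq =>
    simp only [head, depth]
    cases (c.eval x).isPair <;> simp [ihp, ihq]

end Body

/-- Evaluation of a body `b` in the environment `x` to the value `y`: `n` bounds the number of calls
on level `ℓ`, `M` bounds the sizes of the arguments and values of calls and, for each call to a lower
level, the number of calls on that level. -/
inductive Ev {F : Type} (T : F → Body F) (M : ℕ) : ℕ → Body F → Tree → Tree → ℕ → Prop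
  | ret {ℓ b x e n} (h : b.head x = .ret e) : Ev T M ℓ b x (e.eval x) n
  | same {ℓ b x f e b' v y n₁ n₂ n} (h : b.head x = .call f e b')
      (h₁ : Ev T M ℓ (T f) (e.eval x) v n₁) (hs : (e.eval x).size + v.size ≤ M)
      (h₂ : Ev T M ℓ b' (.cons v x) y n₂) (hn : n₁ + n₂ + 1 ≤ n) : Ev T M ℓ b x y n
  | low {ℓ' ℓ b x f e b' v y n₁ n} (h : b.head x = .call f e b') (hℓ : ℓ' < ℓ)
      (h₁ : Ev T M ℓ' (T f) (e.eval x) v n₁) (hs : (e.eval x).size + v.size ≤ M) (hn : n₁ ≤ M)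
      (h₂ : Ev T M ℓ b' (.cons v x) y n) : Ev T M ℓ b x y n

section
variable {F : Type} (T : F → Body F) (L : List (Body F))

open Classical in
/-- The address of a part of a program. -/
noncomputable def addr (b : Body F) : ℕ := L.idxOf b

/-- One step of the evaluation of a body. A state consists of an address and an environment, and of
a stack of such pairs. -/
noncomputable def stepFun : Body F → Tree → Tree
  | .ret e, s => bif s.snd.isPair then
      .cons (.cons s.snd.fst.fst (.cons (e.eval s.fst.snd) s.snd.fst.snd)) s.snd.snd
      else .cons .nil (e.eval s.fst.snd)
  | .call f e b, s => .cons (.cons (.ofNat (addr L (T f))) (e.eval s.fst.snd))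
      (.cons (.cons (.ofNat (addr L b)) s.fst.snd) s.snd)
  | .ite c p q, s =>
      bif (c.eval s.fst.snd).isPair then stepFun p s else stepFun q s

theorem stepFun_head (b : Body F) (s : Tree) :
    stepFun T L b s = stepFun T L (b.head s.fst.snd) s := by
  induction b with
  | ret | call => rfl
  | ite c p q ihp ihq =>
    simp only [stepFun, Body.head]
    cases (c.eval s.fst.snd).isPair <;> simp [ihp, ihq]

theorem lin_stepFun (b : Body F) : ∃ p, Lin p (stepFun T L b) := by
  have env := Lin.fst.comp Lin.snd
  have top := Lin.snd.comp Lin.fst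
  induction b with
  | ret e =>
    obtain ⟨p, hp⟩ := Lin.ex e
    exact ⟨_, .ite .snd (.pair (.pair (top.comp .fst) (.pair (env.comp hp) (top.comp .snd)))
      (Lin.snd.comp .snd)) (Lin.nil.pair (env.comp hp))⟩
  | call f e b =>
    obtain ⟨p, hp⟩ := Lin.ex e
    obtain ⟨q, hq⟩ := Lin.lit (addr L (T f))
    obtain ⟨r, hr⟩ := Lin.lit (addr L b)
    exact ⟨_, .pair (.pair hq (env.comp hp)) (.pair (.pair hr env) .snd)⟩
  | ite c p q ihp ihq =>
    obtain ⟨r, hr⟩ := Lin.ex c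
    exact ⟨_, .ite (env.comp hr) ihp.choose_spec ihq.choose_spec⟩

theorem lin_dispatch (bs : List (Body F)) {p : Prog} {g : Tree → Tree} (hp : Lin p g) :
    ∃ q f, Lin q f ∧ ∀ s i (h : i < bs.length), g s = .ofNat i → f s = stepFun T L bs[i] s := by
  induction bs generalizing p g with
  | nil => exact ⟨_, _, .id, fun s i h => (Nat.not_lt_zero _ h).elim⟩
  | cons b bs ih =>
    obtain ⟨q, f, hq, h⟩ := ih (hp.comp .snd)
    obtain ⟨r, hr⟩ := lin_stepFun T L b
    refine ⟨_, _, .ite hp hq hr, fun s i hi hs => ?_⟩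
    cases i with
    | zero => simp [hs, Tree.ofNat, Tree.isPair]
    | succ i =>
      simpa [hs, Tree.ofNat, Tree.isPair] using h s i (by simpa using hi) (by simp [hs, Tree.ofNat,
        Tree.snd])

/-- The state in which a value is returned. -/
def retState : Tree → Tree → Tree
  | .cons a k, v => .cons (.cons a.fst (.cons v a.snd)) k
  | _, v => .cons .nil v

theorem stepFun_ret (e : Ex) (a x k : Tree) :
    stepFun T L (.ret e) (.cons (.cons a x) k) = retState k (e.eval x) := by
  cases k <;> rfl

/-- `W` evaluates the bodies in the list `L`, at cost `C` times the size of the state per step. -/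
structure IsMachine (W : Prog) (C : ℕ) : Prop where
  halts (v : Tree) : ∃ t ≤ C * v.size + C, Runs W (.cons .nil v) (.cons .nil v) t
  step {b : Body F} (hb : b ∈ L) {x k z : Tree} {u : ℕ}
    (h : Runs W (stepFun T L b (.cons (.cons (.ofNat (addr L b)) x) k)) z u) :
    ∃ t ≤ C * (x.size + k.size + 2 * L.length + 3),
      Runs W (.cons (.cons (.ofNat (addr L b)) x) k) z (u + t)

theorem exists_machine : ∃ W C, IsMachine T L W C := by
  classical
  obtain ⟨q, f, ⟨K, hK⟩, hf⟩ := lin_dispatch T L L (Lin.fst.comp Lin.fst)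
  refine ⟨.while .fst q, K + 3, fun v => ⟨_, ?_, Runs.while_stop (.fst _) (by simp [Tree.fst,
    Tree.IsPair])⟩, fun {b} hb {x k z u} h => ?_⟩
  · simp only [Tree.size]; nlinarith
  have hi : addr L b < L.length := List.idxOf_lt_length_iff.2 hb
  have hf' := hf (.cons (.cons (.ofNat (addr L b)) x) k) _ hi rfl
  have hg : L[addr L b] = b := List.getElem_idxOf hi
  rw [hg] at hf'
  obtain ⟨-, t, ht, hr⟩ := hK (.cons (.cons (.ofNat (addr L b)) x) k)
  rw [hf'] at hr
  have := Runs.while_step (.fst _) (by simp [Tree.fst, Tree.IsPair]) hr h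
  refine ⟨(Tree.cons (.cons (.ofNat (addr L b)) x) k).size + t + 1, ?_, by
    convert this using 1; omega⟩
  simp only [Tree.size, Tree.size_ofNat] at ht ⊢
  have h1 : 2 * addr L b + 1 + x.size + 1 + k.size + 1 ≤ x.size + k.size + 2 * L.length + 3 := by
    omega
  have h2 := Nat.mul_le_mul_left K h1
  nlinarith

/-- With stack `k`, the machine evaluates `b` in the environment `x` to `y` in `N` steps; `S` bounds
the sizes of stack frames. -/
def Evals (W : Prog) (C S : ℕ) (b : Body F) (x y : Tree) (N : ℕ) : Prop :=
  ∀ k z u, Runs W (retState k y) z u → ∃ t ≤ N * (C * (k.size + N * S)),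
    Runs W (.cons (.cons (.ofNat (addr L b)) x) k) z (u + t)

variable {T L} {W : Prog} {C S : ℕ} (hW : IsMachine T L W C)
include hW

theorem IsMachine.ret {b : Body F} {x : Tree} {e : Ex} (hb : b ∈ L) (h : b.head x = .ret e)
    (hS : x.size + 2 * L.length + 3 ≤ S) : Evals L W C S b x (e.eval x) 1 := by
  intro k z u hr
  rw [← stepFun_ret T L e (.ofNat (addr L b)) x k, ← h] at hr
  obtain ⟨t, ht, h'⟩ := hW.step hb (x := x) (k := k) (by rw [stepFun_head]; exact hr)
  exact ⟨t, ht.trans (by rw [one_mul]; exact Nat.mul_le_mul_left _ (by omega)), h'⟩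

theorem IsMachine.call {b b' : Body F} {x v y : Tree} {f : F} {e : Ex} {N₁ N₂ : ℕ} (hb : b ∈ L)
    (hb' : b' ∈ L) (h : b.head x = .call f e b') (hS : x.size + 2 * L.length + 3 ≤ S)
    (h₁ : Evals L W C S (T f) (e.eval x) v N₁) (h₂ : Evals L W C S b' (.cons v x) y N₂) :
    Evals L W C S b x y (1 + N₁ + N₂) := by
  classical
  intro k z u hr
  obtain ⟨t₂, ht₂, h₂⟩ := h₂ k z u hr
  obtain ⟨t₁, ht₁, h₁⟩ := h₁ (.cons (.cons (.ofNat (addr L b')) x) k) z _ h₂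
  obtain ⟨t, ht, h'⟩ := hW.step hb (x := x) (k := k) (u := u + t₂ + t₁) (z := z) (by
    rw [stepFun_head, show Tree.snd _ = x from rfl, h]; exact h₁)
  refine ⟨t₂ + t₁ + t, ?_, by convert h' using 1; omega⟩
  have hi : addr L b' < L.length := List.idxOf_lt_length_iff.2 hb'
  simp only [Tree.size, Tree.size_ofNat] at ht₁
  have h2 : N₂ * S ≤ (1 + N₁ + N₂) * S := Nat.mul_le_mul_right _ (by omega)
  have h1 : S + N₁ * S ≤ (1 + N₁ + N₂) * S := by
    rw [add_comm S, ← Nat.succ_mul]; exact Nat.mul_le_mul_right _ (by omega)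
  refine (Nat.add_le_add (Nat.add_le_add
    (ht₂.trans (Nat.mul_le_mul_left _ (Nat.mul_le_mul_left _ (Nat.add_le_add_left h2 _))))
    (ht₁.trans (Nat.mul_le_mul_left N₁ (Nat.mul_le_mul_left C
      (show _ ≤ k.size + (1 + N₁ + N₂) * S by omega)))))
    (ht.trans (Nat.mul_le_mul_left C (show _ ≤ k.size + (1 + N₁ + N₂) * S by omega)))).trans
    (le_of_eq (by ring))

theorem IsMachine.sim {M D : ℕ} (hT : ∀ f, (T f).subs ⊆ L) (hD : ∀ f, (T f).depth ≤ D)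
    {ℓ n : ℕ} {b : Body F} {x y : Tree} (h : Ev T M ℓ b x y n) (hb : b.subs ⊆ L)
    (hS : x.size + b.depth * (M + 1) + 2 * L.length + 3 ≤ S)
    (hS' : (D + 1) * (M + 1) + 2 * L.length + 3 ≤ S) :
    ∃ N ≤ (b.depth + 1 + n * (D + 1)) * (1 + (D + 1) * (M + 1)) ^ ℓ, Evals L W C S b x y N := by
  have hP : ∀ ℓ, 1 ≤ (1 + (D + 1) * (M + 1)) ^ ℓ := fun ℓ => Nat.one_le_pow _ _ (by omega)
  have hcall : ∀ {b b' : Body F} {x v : Tree} {f : F} {e : Ex}, b.subs ⊆ L →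
      x.size + b.depth * (M + 1) + 2 * L.length + 3 ≤ S → b.head x = .call f e b' →
      (e.eval x).size + v.size ≤ M → b'.subs ⊆ L ∧
      (e.eval x).size + (T f).depth * (M + 1) + 2 * L.length + 3 ≤ S ∧
      (Tree.cons v x).size + b'.depth * (M + 1) + 2 * L.length + 3 ≤ S ∧
      b'.depth + 1 ≤ b.depth := by
    intro b b' x v f e hb hS h hs
    have h1 := b.head_mem x
    have h2 := b.depth_head x
    rw [h] at h1 h2
    have h3 := Nat.mul_le_mul_right (M + 1) (hD f)
    have h4 := Nat.mul_le_mul_right (M + 1) h2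
    simp only [Body.depth, Tree.size, add_mul, one_mul] at *
    exact ⟨fun c hc => hb (Body.subs_trans (Body.subs_trans h1 (List.mem_cons_of_mem _
      b'.self_mem_subs)) hc), by omega, by omega, h2⟩
  induction h with
  | @ret ℓ b x e n h =>
    exact ⟨1, (hP ℓ).trans (Nat.le_mul_of_pos_left _ (by omega)),
      hW.ret (hb b.self_mem_subs) h (by omega)⟩
  | @same ℓ b x f e b' v y n₁ n₂ n h h₁ hs h₂ hn ih₁ ih₂ =>
    obtain ⟨h1, h2, h3, h4⟩ := hcall hb hS h hs
    obtain ⟨N₁, hN₁, s₁⟩ := ih₁ (hT f) h2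
    obtain ⟨N₂, hN₂, s₂⟩ := ih₂ h1 h3
    refine ⟨_, ?_, hW.call (hb b.self_mem_subs) (h1 b'.self_mem_subs) h (by omega) s₁ s₂⟩
    have := hP ℓ
    have h5 : (T f).depth + 1 + n₁ * (D + 1) + (b'.depth + 1 + n₂ * (D + 1)) + 1 ≤
        b.depth + 1 + n * (D + 1) := by
      have := hD f
      have := Nat.mul_le_mul_right (D + 1) hn
      simp only [add_mul, one_mul] at *
      omega
    refine le_trans ?_ (Nat.mul_le_mul_right _ h5)
    rw [add_mul, add_mul]
    omega
  | @low ℓ' ℓ b x f e b' v y n₁ n h hℓ h₁ hs hn h₂ ih₁ ih₂ =>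
    obtain ⟨h1, h2, h3, h4⟩ := hcall hb hS h hs
    obtain ⟨N₁, hN₁, s₁⟩ := ih₁ (hT f) h2
    obtain ⟨N₂, hN₂, s₂⟩ := ih₂ h1 h3
    refine ⟨_, ?_, hW.call (hb b.self_mem_subs) (h1 b'.self_mem_subs) h (by omega) s₁ s₂⟩
    have h5 : 1 + N₁ ≤ (1 + (D + 1) * (M + 1)) ^ ℓ := by
      refine le_trans ?_ (Nat.pow_le_pow_right (by omega) hℓ)
      have h6 : (T f).depth + 1 + n₁ * (D + 1) ≤ (D + 1) * (M + 1) := by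
        have := hD f
        have := Nat.mul_le_mul_right (D + 1) hn
        nlinarith
      rw [pow_succ']
      have := hN₁.trans (Nat.mul_le_mul_right _ h6)
      have := hP ℓ'
      nlinarith
    have h7 := Nat.mul_le_mul_right ((1 + (D + 1) * (M + 1)) ^ ℓ)
      (show b'.depth + 1 + n * (D + 1) + 1 ≤ b.depth + 1 + n * (D + 1) by omega)
    rw [add_mul _ 1] at h7
    omega

end

/-- Evaluation of recursive programs in polynomial time. -/
theorem exists_prog {F : Type} (T : F → Body F) (fs : List F) (hfs : ∀ f, f ∈ fs) (f : F) (ℓ : ℕ) :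
    ∃ (p : Prog) (q : Polynomial ℕ), ∀ M x y n, Ev T M ℓ (T f) x y n → x.size + y.size ≤ M →
      n ≤ M → ∃ t ≤ q.eval M, Runs p x y t := by
  let L := fs.flatMap fun f => (T f).subs
  let D := (fs.map fun f => (T f).depth).sum
  have hT : ∀ f, (T f).subs ⊆ L := fun f b hb => List.mem_flatMap.2 ⟨f, hfs f, hb⟩
  have hD : ∀ f, (T f).depth ≤ D := fun f =>
    List.single_le_sum (by simp) _ (List.mem_map_of_mem (hfs f))
  obtain ⟨W, C, hW⟩ := exists_machine T L
  obtain ⟨a, K, ha⟩ := Lin.lit (addr L (T f))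
  let P : Polynomial ℕ := 1 + (.C D + 1) * (.X + 1)
  let N := (.C D + 1 + .X * (.C D + 1)) * P ^ ℓ
  refine ⟨.comp .snd (.comp W (.pair (.pair a .id) .nil)), .C C * .X + .C C +
    N * (.C C * (1 + N * (P + 2 * .C L.length + 3))) + .C K * .X + 4 * .X + 10,
    fun M x y n h hs hn => ?_⟩
  obtain ⟨m, hm, h'⟩ := hW.sim (S := 1 + (D + 1) * (M + 1) + 2 * L.length + 3) hT hD h (hT f)
    (by have := Nat.mul_le_mul_right (M + 1) (hD f); simp only [add_mul, one_mul] at *; omega)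
    (by omega)
  obtain ⟨s, hs', hr⟩ := hW.halts y
  obtain ⟨t, ht, hr'⟩ := h' .nil _ _ hr
  obtain ⟨-, r, hr₁, ha⟩ := ha x
  have hx : x.size ≤ M := by omega
  have hy : y.size ≤ M := by omega
  refine ⟨_, ?_, .comp (.comp (.pair (.pair ha (.id x)) (.nil x)) hr') (.snd _)⟩
  have h1 : m ≤ (D + 1 + M * (D + 1)) * (1 + (D + 1) * (M + 1)) ^ ℓ :=
    hm.trans (Nat.mul_le_mul_right _ (Nat.add_le_add (Nat.add_le_add_right (hD f) 1)
      (Nat.mul_le_mul_right _ hn)))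
  have h2 : t ≤ _ := ht.trans (Nat.mul_le_mul h1 (Nat.mul_le_mul_left C (Nat.add_le_add_left
    (Nat.mul_le_mul_right _ h1) _)))
  have h3 := Nat.mul_le_mul_left C hy
  have h4 := Nat.mul_le_mul_left K hx
  simp only [N, P, Polynomial.eval_add, Polynomial.eval_mul, Polynomial.eval_C, Polynomial.eval_X,
    Polynomial.eval_one, Polynomial.eval_pow, Polynomial.eval_ofNat]
  simp only [Tree.size] at h2 ⊢
  omega

namespace Ex

/-- The environment without the values of the last `k` calls. -/
def arg : ℕ → Ex
  | 0 => var
  | k + 1 => snd (arg k)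

/-- The value of the last call but `k`. -/
def res (k : ℕ) : Ex := fst (arg k)

/-- The left part of a formula or derivation. -/
def left (e : Ex) : Ex := fst (snd e)

/-- The right part of a formula or derivation. -/
def right (e : Ex) : Ex := snd (snd e)

/-- A binary node of a formula or derivation. -/
def bin (k : ℕ) (a b : Ex) : Ex := cons (lit k) (cons a b)

/-- A formula as a derivation. -/
def fm (a : Ex) : Ex := cons (lit 0) a

/-- A rule instance as a derivation. -/
def inf (a r b : Ex) : Ex := bin 3 (fm a) (cons r (fm b))

/-- The rule with number `k`. -/
def rule (k : ℕ) : Ex := cons (lit k) (lit 0)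

/-- A constant. -/
def tree : Tree → Ex
  | .cons x y => cons (tree x) (tree y)
  | _ => lit 0

end Ex

/-- Branch according to a numeral. -/
def Body.sw {F : Type} (e : Ex) : List (Body F) → Body F
  | [] => .ret e
  | [b] => b
  | b :: c :: bs => .ite e (sw (.snd e) (c :: bs)) b

/-- The functions that are used to normalize derivations. -/
inductive Fun : Type
  | num | cnt | has | ends (b : Bool) | re | comp | comm | weak | contr | distr | spread | cocontr | eqn | find
  | tab | flat | drop | slots | eqs | infUp | up | fill | copyAll | infDown | down | main

open Ex Body in
/-- Their definitions. -/
def code : Fun → Body Fun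
  | .num => sw (fst (fst var)) [ret (cons (lit 0) (snd var)), ret (cons (lit 0) (snd var)),
      ret (cons (snd var) (cons (lit 0) (snd var))),
      call .num (cons (left (fst var)) (snd var)) <|
      call .num (cons (right (fst (arg 1))) (snd (res 0))) <|
      ret (cons (cons (fst (res 1)) (fst (res 0))) (snd (res 0)))]
  | .cnt => sw (fst (fst var)) [ret (snd var), ret (snd var), ret (cons (lit 0) (snd var)),
      call .cnt (cons (left (fst var)) (snd var)) <|
      call .cnt (cons (right (fst (arg 1))) (res 0)) <| ret (res 0)]
  | .has => sw (fst var) [ret (lit 0), ret (lit 0), ret (lit 1), call .has (left var) <|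
      ite (res 0) (ret (res 0)) (call .has (right (arg 1)) <| ret (res 0))]
  | .ends b => sw (fst var) [ret (snd var),
      call (.ends b) (left var) <| call (.ends b) (right (arg 1)) <| ret (bin 3 (res 1) (res 0)),
      call (.ends b) (left var) <| call (.ends b) (right (arg 1)) <| ret (bin 4 (res 1) (res 0)),
      call (.ends b) (bif b then left var else snd (right var)) <| ret (res 0)]
  | .re => call .num (cons (snd var) (lit 0)) <|
      ret (inf (fst (arg 1)) (cons (lit 0) (fst (res 0))) (snd (arg 1)))
  | .comp => call (.ends true) (snd var) <| call .num (cons (res 0) (lit 0)) <|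
      ret (bin 3 (fst (arg 2)) (cons (cons (lit 0) (fst (res 0))) (snd (arg 2))))
  | .comm => call .num (cons (left var) (lit 0)) <|
      call .num (cons (right (arg 1)) (snd (res 0))) <|
      ret (inf (arg 2) (cons (lit 0) (cons (fst (res 0)) (fst (res 1))))
        (cons (fst (arg 2)) (cons (right (arg 2)) (left (arg 2)))))
  | .weak => sw (fst var) [ret (tree botTop.toTree), ret var, ret (inf (rule 1) (rule 2) var),
      call .weak (left var) <| call .weak (right (arg 1)) <|
      call .comp (cons (inf (rule 1) (cons (lit 0) (lit 1)) (bin 3 (rule 1) (rule 1)))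
        (bin 1 (res 1) (res 0))) <| ret (res 0)]
  | .contr => sw (fst var) [ret (inf (bin 4 var var) (rule 0) var), ret var,
      ret (inf (bin 4 var var) (rule 3) var),
      call .contr (left var) <| call .contr (right (arg 1)) <|
      call .comp (cons (inf (bin 4 (arg 2) (arg 2)) (rule 8)
        (bin 3 (bin 4 (left (arg 2)) (left (arg 2))) (bin 4 (right (arg 2)) (right (arg 2)))))
        (bin 1 (res 1) (res 0))) <| ret (res 0)]
  | .distr => call .comm (bin 3 (bin 4 (res 1) (res 2)) (res 0)) <|
      call .comp (cons (res 0) (inf (bin 3 (res 1) (bin 4 (res 2) (res 3))) (rule 7)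
        (bin 4 (bin 3 (res 1) (res 2)) (res 3)))) <|
      call .re (cons (bin 4 (bin 4 (bin 3 (res 2) (res 3)) (res 4)) (res 4))
        (bin 4 (bin 3 (res 2) (res 3)) (bin 4 (res 4) (res 4)))) <|
      call .comp (cons (res 0) (bin 2 (fm (bin 3 (res 3) (res 4))) (arg 6))) <|
      call .comp (cons (bin 2 (res 2) (fm (res 6))) (res 0)) <|
      call .comp (cons (inf (bin 3 (bin 4 (res 6) (res 7)) (bin 4 (res 5) (res 7))) (rule 7)
        (bin 4 (bin 3 (bin 4 (res 6) (res 7)) (res 5)) (res 7))) (res 0)) <| ret (res 0)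
  | .spread => sw (fst (res 0)) [
      call .weak (res 1) <|
      call .comp (cons (inf (rule 0) (cons (lit 0) (lit 1)) (bin 4 (rule 0) (rule 1)))
        (bin 2 (fm (rule 0)) (res 0))) <| ret (res 0),
      ret var, ret (arg 2),
      call .spread (cons (right (res 0)) (arg 1)) <| call .spread (cons (left (res 1)) (arg 2)) <|
      call .contr (res 3) <|
      call .distr (cons (left (res 3)) (cons (right (res 3)) (cons (res 4) (res 0)))) <|
      call .comp (cons (bin 1 (res 3) (res 2)) (res 0)) <|
      call .comp (cons (inf (rule 0) (cons (lit 0) (lit 1)) (bin 3 (rule 0) (rule 0))) (res 0)) <|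
      ret (res 0)]
  | .cocontr => ite (fst (res 1)) (ite (fst (arg 2)) (ite (res 0)
      (ite (snd (snd (fst (res 1)))) (ret (fm (bin 3 (res 1) (arg 2))))
        (ite (snd (snd (fst (arg 2)))) (ret (fm (bin 3 (res 1) (arg 2))))
          (ret (inf (res 1) (rule 6) (bin 3 (res 1) (arg 2))))))
      (ret (fm (bin 3 (res 1) (arg 2)))))
      (call .re (cons (res 1) (bin 3 (res 1) (rule 0))) <| ret (res 0)))
      (call .re (cons (arg 2) (bin 3 (rule 0) (arg 2))) <| ret (res 0))
  | .eqn => ite (fst var) (ite (snd var) (call .eqn (cons (snd (fst var)) (snd (snd var))) <|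
      ret (res 0)) (ret (lit 0))) (ite (snd var) (ret (lit 0)) (ret (lit 1)))
  | .find => sw (fst (res 1)) [ret (lit 0), ret (lit 0),
      call .eqn (cons (res 2) (res 0)) <| ite (res 0) (ret (cons (arg 4) (lit 0))) (ret (lit 0)),
      call .find (cons (res 0) (cons (left (res 1)) (cons (fst (res 2)) (left (arg 3))))) <|
      ite (res 0) (ret (res 0)) <|
      call .find (cons (res 1) (cons (right (res 2)) (cons (snd (res 3)) (right (arg 4))))) <|
      ret (res 0)]
  | .tab => sw (fst (res 0)) [ret (cons (res 0) (res 1)), ret (cons (res 0) (res 1)),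
      call .find (arg 1) <| ret (cons (fst (res 0)) (cons (lit 0) (res 2))),
      call .tab (cons (left (res 0)) (arg 1)) <|
      call .tab (cons (right (res 1)) (cons (snd (res 0)) (arg 3))) <|
      ret (cons (cons (fst (res 2)) (cons (fst (res 1)) (fst (res 0)))) (snd (res 0)))]
  | .flat => sw (fst (res 0)) [ret (arg 2), ret (arg 2), ret (arg 1),
      call .flat (cons (right (res 0)) (cons (right (res 1)) (arg 2))) <|
      call .flat (cons (left (res 1)) (cons (left (res 2)) (res 0))) <| ret (res 0)]
  | .drop => ite (res 0) (call .cnt (cons (fst (arg 2)) (res 1)) <|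
      call .drop (cons (snd (res 1)) (cons (res 0) (snd (arg 3)))) <| ret (res 0))
      (ret (cons (fst (arg 2)) (res 1)))
  | .slots => sw (fst (res 0)) [ret (cons (res 0) (lit 0)), ret (cons (res 0) (lit 0)),
      call .drop (cons (res 1) (cons (lit 0) (arg 2))) <| call .num (res 0) <|
      ret (cons (fst (res 1)) (fst (res 0))),
      call .slots (cons (left (res 0)) (cons (fst (res 1)) (arg 2))) <|
      call .slots (cons (right (res 1)) (cons (snd (res 2)) (arg 3))) <|
      ret (cons (cons (fst (res 2)) (cons (fst (res 1)) (fst (res 0))))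
        (cons (snd (res 1)) (snd (res 0))))]
  | .eqs => call .flat (cons (res 0) (cons (res 1) (lit 0))) <|
      call .slots (cons (res 3) (cons (arg 4) (res 0))) <|
      ret (inf (res 3) (cons (lit 0) (snd (res 0))) (fst (res 0)))
  | .infUp => sw (fst (res 0)) [
      call .tab (cons (res 1) (cons (lit 0) (cons (res 2) (cons (snd (res 0)) (res 3))))) <|
      call .eqs (cons (res 2) (cons (fst (res 0)) (cons (res 3) (snd (res 1))))) <| ret (res 0),
      call .has (left (res 3)) <| ite (res 0) (call .comm (res 3) <|
      call .comp (cons (inf (rule 0) (rule 1) (res 4)) (res 0)) <|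
      call .spread (cons (right (res 6)) (cons (left (res 5)) (res 0))) <|
      call .comm (bin 4 (right (res 7)) (left (res 6))) <| call .comp (cons (res 1) (res 0)) <|
      call .spread (cons (left (res 9)) (cons (right (res 9)) (res 0))) <| ret (res 0))
      (call .spread (cons (left (res 4)) (cons (right (res 4)) (lit 0))) <| ret (res 0)),
      call .weak (res 3) <| ret (res 0), call .contr (res 3) <| ret (res 0),
      ret (inf (res 1) (res 0) (res 2)), ret (fm (res 3)),
      call .cocontr (cons (arg 4) (snd (res 3))) <| ret (res 0),
      ret (inf (bin 3 (left (left (res 3))) (bin 4 (right (left (res 3))) (right (res 3)))) (res 0)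
        (res 3)),
      ret (inf (bin 4 (bin 3 (left (left (res 3))) (left (right (res 3))))
        (bin 3 (right (left (res 3))) (right (right (res 3))))) (res 0) (res 3))]
  | .up => sw (fst (res 0)) <| .cons (ret (fm (res 1))) <| (fun b => [b, b,
      call .up (cons (snd (right (res 0))) (arg 1)) <| call (.ends true) (res 0) <|
      call (.ends false) (left (res 2)) <| call (.ends true) (snd (right (res 3))) <|
      call .infUp (cons (fst (right (res 4)))
        (cons (res 1) (cons (res 0) (cons (res 2) (arg 6))))) <|
      call (.ends true) (res 0) <| call .up (cons (left (res 6)) (cons (res 0) (arg 8))) <|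
      call .comp (cons (res 2) (res 6)) <| call .comp (cons (res 1) (res 0)) <| ret (res 0)]) <|
      call .up (cons (left (res 0)) (cons (left (res 1)) (arg 2))) <|
      call .up (cons (right (res 1)) (cons (right (res 2)) (arg 3))) <|
      ret (cons (fst (res 2)) (cons (res 1) (res 0)))
  | .fill => sw (fst (res 0)) [ret (fm (res 0)), ret (fm (res 0)),
      ite (snd (fst (arg 1))) (ret (fm (res 0))) (ret (inf (rule 1) (rule 2) (res 0))),
      call .fill (cons (left (res 0)) (left (arg 1))) <|
      call .fill (cons (right (res 1)) (right (arg 2))) <|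
      ret (cons (snd (snd (fst (res 2)))) (cons (res 1) (res 0)))]
  | .copyAll => sw (fst (res 0)) [ret (fm (res 0)), ret (fm (res 0)),
      sw (fst (arg 1)) [ret (inf (res 0) (rule 5) (rule 0)), ret var, ret (fm (res 0)),
        call .copyAll (cons (res 0) (left (arg 1))) <|
        call .copyAll (cons (res 1) (right (arg 2))) <|
        call .comp (cons (inf (res 2) (rule 6) (bin 3 (res 2) (res 2))) (bin 1 (res 1) (res 0))) <|
        ret (res 0)],
      call .copyAll (cons (left (res 0)) (left (arg 1))) <|
      call .copyAll (cons (right (res 1)) (right (arg 2))) <|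
      ret (cons (snd (snd (fst (res 2)))) (cons (res 1) (res 0)))]
  | .infDown => sw (fst (res 0)) <| (fun b => [
      call .eqs (cons (res 1) (cons (arg 3) (cons (res 2) (snd (res 0))))) <| ret (res 0),
      ret (inf (res 1) (res 0) (res 2)), ret (fm (arg 3)),
      ite (snd (fst (left (arg 3)))) (ite (snd (fst (right (arg 3))))
        (ret (inf (arg 3) (res 0) (res 2)))
        (call .re (cons (arg 3) (left (arg 3))) <| ret (res 0)))
        (call .re (cons (arg 3) (right (arg 3))) <| ret (res 0)),
      b, b, ite (snd (fst (arg 3))) (ret (inf (arg 3) (res 0) (res 2)))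
        (ret (inf (arg 3) (cons (lit 0) (lit 1)) (bin 3 (arg 3) (arg 3)))),
      ret (inf (arg 3) (res 0) (bin 4 (bin 3 (left (arg 3)) (left (right (arg 3))))
        (right (right (arg 3))))),
      ret (inf (arg 3) (res 0) (bin 3 (bin 4 (left (left (arg 3))) (left (right (arg 3))))
        (bin 4 (right (left (arg 3))) (right (right (arg 3))))))]) <|
      call .fill (cons (res 1) (arg 3)) <|
      call .comp (cons (res 0) (inf (res 2) (res 1) (res 3))) <| ret (res 0)
  | .down => sw (fst (res 0)) <| .cons (ret (fm (arg 1))) <| (fun b => [b, b,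
      call .down (cons (left (res 0)) (arg 1)) <| call (.ends false) (res 0) <|
      call (.ends false) (left (res 2)) <| call (.ends true) (snd (right (res 3))) <|
      call .infDown (cons (fst (right (res 4))) (cons (res 1) (cons (res 0) (res 2)))) <|
      call (.ends false) (res 0) <| call .down (cons (snd (right (res 6))) (res 0)) <|
      call .comp (cons (res 2) (res 0)) <| call .comp (cons (res 7) (res 0)) <| ret (res 0)]) <|
      call .down (cons (left (res 0)) (left (arg 1))) <|
      call .down (cons (right (res 1)) (right (arg 2))) <|
      ret (cons (fst (res 2)) (cons (res 1) (res 0)))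
  | .main => call (.ends true) var <| call (.ends false) (arg 1) <|
      call .up (cons (arg 2) (cons (res 0) (lit 1))) <| call (.ends true) (res 0) <|
      call .down (cons (res 1) (res 0)) <| call (.ends false) (res 0) <|
      call .fill (cons (res 4) (res 0)) <| call .comp (cons (res 2) (res 0)) <|
      call .up (cons (res 0) (cons (res 6) (lit 0))) <| call (.ends true) (res 0) <|
      call .copyAll (cons (res 9) (res 6)) <| call .copyAll (cons (res 7) (res 1)) <|
      call .comp (cons (res 0) (res 3)) <| call .comp (cons (res 2) (res 0)) <| ret (res 0)

/-- The value of a function, computed on level `ℓ` with at most `n` calls on that level, if all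
formulae and derivations involved have size at most `K`. -/
structure Fn (K ℓ : ℕ) (f : Fun) (x y : Tree) (n : ℕ) : Prop where
  ev : Ev code (100 * K) ℓ (code f) x y n
  size : x.size + y.size ≤ 100 * K
  le : n ≤ 100 * K

section
variable {K ℓ ℓ' n n₁ n₂ : ℕ} {b b' : Body Fun} {f : Fun} {e : Ex} {x y v : Tree}

theorem Ev.ret' (h : b.head x = .ret e) (hy : e.eval x = y) : Ev code (100 * K) ℓ b x y n :=
  hy ▸ .ret h

theorem Fn.same (h : b.head x = .call f e b') (h₁ : Fn K ℓ f (e.eval x) v n₁)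
    (h₂ : Ev code (100 * K) ℓ b' (.cons v x) y n₂) (hn : n₁ + n₂ + 1 ≤ n) :
    Ev code (100 * K) ℓ b x y n := .same h h₁.ev h₁.size h₂ hn

theorem Fn.low (h : b.head x = .call f e b') (h₁ : Fn K ℓ' f (e.eval x) v n₁)
    (h₂ : Ev code (100 * K) ℓ b' (.cons v x) y n) (hℓ : ℓ' < ℓ := by decide) :
    Ev code (100 * K) ℓ b x y n := .low h hℓ h₁.ev h₁.size h₁.le h₂

end

open Fn (low same)

theorem size_omega {p : Prop} (h : p := by
    first
    | simp only [Tree.size]; omega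
    | simp only [Formula.toTree, Der.toTree, Inf.toTree, Pat.fm, sub, Tree.size, Tree.ofNat,
        Tree.size_ofNat]; omega) : p := h

theorem numAtoms_le_toTree (A : Formula) : 2 * A.numAtoms + 1 ≤ A.toTree.size := by
  induction A <;> simp only [numAtoms, Formula.toTree, Tree.size, Tree.ofNat] <;> omega

variable {K : ℕ}

theorem fn_num {A : Formula} {n : ℕ} (hA : A.toTree.size ≤ 10 * K)
    (hl : (labToTree A (A.numbering n)).size ≤ 10 * K) (hn : 2 * (n + A.numAtoms) + 1 ≤ 10 * K) :
    Fn K 0 .num (.cons A.toTree (.ofNat n))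
      (.cons (labToTree A (A.numbering n)) (.ofNat (n + A.numAtoms))) A.toTree.size := by
  have hs : (Tree.cons A.toTree (.ofNat n)).size +
      (Tree.cons (labToTree A (A.numbering n)) (.ofNat (n + A.numAtoms))).size ≤ 100 * K := size_omega
  induction A generalizing n with
  | top | bot | atom a => exact ⟨.ret' rfl rfl, hs, by omega⟩
  | and A B ihA ihB | or A B ihA ihB =>
    simp only [Formula.toTree, Tree.size, Tree.ofNat, numbering, labToTree, numAtoms,
      Tree.size_ofNat] at hA hl hn ihA ihB
    have h₂ := ihB (n := n + A.numAtoms) (by omega) (by omega) (by omega) (by omega)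
    rw [add_assoc] at h₂
    exact ⟨same rfl (ihA (n := n) (by omega) (by omega) (by omega) (by omega)) (same rfl h₂
      (.ret' (n := 0) rfl rfl) le_rfl) size_omega, hs, size_omega⟩

section
variable {A B C D : Formula}

theorem Formula.toTree_le (Φ : Der A B) : A.toTree.size ≤ 3 * Φ.toTree.size ∧
    B.toTree.size ≤ 3 * Φ.toTree.size := by
  induction Φ <;> exact size_omega

theorem step_le {Φ : Der A B} {ρ : Inf B C} {Ψ : Der C D}
    (h : (Der.step Φ ρ Ψ).toTree.size ≤ K) : Φ.toTree.size ≤ K ∧ ρ.toTree.size ≤ K ∧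
      Ψ.toTree.size ≤ K := by
  simp only [Der.toTree, Tree.size] at h
  omega

theorem comp_le {Φ : Der A B} {Ψ : Der B C} (h : (Φ.comp Ψ).toTree.size ≤ K) :
    Φ.toTree.size ≤ K ∧ Ψ.toTree.size ≤ K := ⟨(step_le h).1, (step_le h).2.2⟩

theorem and_le {Φ : Der A B} {Ψ : Der C D} (h : (Der.and Φ Ψ).toTree.size ≤ K) :
    Φ.toTree.size ≤ K ∧ Ψ.toTree.size ≤ K := by
  simp only [Der.toTree, Tree.size] at h
  omega

theorem or_le {Φ : Der A B} {Ψ : Der C D} (h : (Der.or Φ Ψ).toTree.size ≤ K) :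
    Φ.toTree.size ≤ K ∧ Ψ.toTree.size ≤ K := by
  simp only [Der.toTree, Tree.size] at h
  omega

theorem fn_ends (b : Bool) {Φ : Der A B} (h : Φ.toTree.size ≤ K) : Fn K 0 (.ends b) Φ.toTree
    (Formula.toTree (bif b then A else B)) Φ.toTree.size := by
  have h₁ := Formula.toTree_le Φ
  have hs : Φ.toTree.size + (Formula.toTree (bif b then A else B)).size ≤ 100 * K := by
    cases b <;> simp only [cond] <;> omega
  induction Φ with
  | fm A => exact ⟨.ret' rfl (by cases b <;> rfl), hs, by omega⟩
  | and Φ Ψ ih₁ ih₂ | or Φ Ψ ih₁ ih₂ =>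
    have h₂ := Formula.toTree_le Φ
    have h₃ := Formula.toTree_le Ψ
    simp only [Der.toTree, Tree.size] at h
    exact ⟨same rfl (ih₁ (by omega) h₂ (by cases b <;> simp only [cond] <;> omega)) (same rfl
      (ih₂ (by omega) h₃ (by cases b <;> simp only [cond] <;> omega)) (.ret' (n := 0) rfl
      (by cases b <;> rfl)) le_rfl) size_omega, hs, size_omega⟩
  | step Φ ρ Ψ ih₁ ih₂ =>
    have h₂ := Formula.toTree_le Φ
    have h₃ := Formula.toTree_le Ψ
    have h₄ := step_le h
    refine ⟨?_, hs, by omega⟩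
    cases b
    · exact same rfl (ih₂ h₄.2.2 h₃ (by simp only [cond]; omega)) (.ret' (n := 0) rfl rfl) size_omega
    · exact same rfl (ih₁ h₄.1 h₂ (by simp only [cond]; omega)) (.ret' (n := 0) rfl rfl) size_omega

theorem fn_prem {Φ : Der A B} (h : Φ.toTree.size ≤ K) :
    Fn K 0 (.ends true) Φ.toTree A.toTree Φ.toTree.size := fn_ends true h

theorem fn_concl {Φ : Der A B} (h : Φ.toTree.size ≤ K) :
    Fn K 0 (.ends false) Φ.toTree B.toTree Φ.toTree.size := fn_ends false h

theorem num_zero (A : Formula) (hA : A.toTree.size ≤ 10 * K)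
    (hl : (labToTree A (A.numbering 0)).size ≤ 10 * K) :
    Fn K 0 .num (.cons A.toTree (.ofNat 0))
      (.cons (labToTree A (A.numbering 0)) (.ofNat A.numAtoms)) A.toTree.size := by
  have := numAtoms_le_toTree A
  have := fn_num (n := 0) hA hl (by omega)
  rwa [zero_add] at this

theorem fn_re {h} (hK : (re A B h).toTree.size ≤ K) :
    Fn K 1 .re (.cons A.toTree B.toTree) (re A B h).toTree 0 := by
  have hs : 16 + A.toTree.size + B.toTree.size +
      (labToTree B (B.numbering 0)).size ≤ (re A B h).toTree.size := by
    change _ ≤ (Der.step (.fm A) (.eq (B.numbering 0) h) (.fm B)).toTree.size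
    exact size_omega
  exact ⟨low rfl (num_zero B (by omega) (by omega)) (.ret' rfl rfl), size_omega, by omega⟩

theorem fn_comp {Φ : Der A B} {Ψ : Der B C} (hK : (Φ.comp Ψ).toTree.size ≤ K) :
    Fn K 1 .comp (.cons Φ.toTree Ψ.toTree) (Φ.comp Ψ).toTree 0 := by
  have hs : Φ.toTree.size + Ψ.toTree.size + (labToTree B (B.numbering 0)).size + 3 ≤
      (Φ.comp Ψ).toTree.size := by
    simp only [Der.comp, Der.toTree, Inf.toTree, Tree.size, Tree.ofNat]; omega
  have := Formula.toTree_le Ψ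
  exact ⟨low rfl (fn_prem (by omega)) (low rfl (num_zero B (by omega) (by omega))
    (.ret' rfl rfl)), size_omega, by omega⟩

theorem fn_orComm (hK : (Der.inf (Inf.orComm A B)).toTree.size ≤ K) :
    Fn K 1 .comm (Formula.toTree (.or A B)) (Der.inf (Inf.orComm A B)).toTree 0 := by
  have hs : A.toTree.size + B.toTree.size + A.toTree.size +
      B.toTree.size + (labToTree B (B.numbering (0 + A.numAtoms))).size +
      (labToTree A (A.numbering 0)).size + 30 ≤ (Der.inf (Inf.orComm A B)).toTree.size := by
    simp only [Der.inf, Inf.orComm, Formula.toTree, labToTree, Der.toTree, Inf.toTree, Tree.size,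
      Tree.ofNat]
    omega
  have := numAtoms_le_toTree A
  have := numAtoms_le_toTree B
  have h₁ := fn_num (K := K) (A := A) (n := 0) (by omega) (by omega) (by omega)
  have h₂ := fn_num (K := K) (A := B) (n := 0 + A.numAtoms) (by omega) (by omega) (by omega)
  exact ⟨low rfl h₁ (low rfl h₂ (.ret' rfl rfl)), size_omega, by omega⟩

theorem fn_andComm (hK : (Der.inf (Inf.andComm A B)).toTree.size ≤ K) :
    Fn K 1 .comm (Formula.toTree (.and A B)) (Der.inf (Inf.andComm A B)).toTree 0 := by
  have hs : A.toTree.size + B.toTree.size + A.toTree.size +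
      B.toTree.size + (labToTree B (B.numbering (0 + A.numAtoms))).size +
      (labToTree A (A.numbering 0)).size + 30 ≤ (Der.inf (Inf.andComm A B)).toTree.size := by
    simp only [Der.inf, Inf.andComm, Formula.toTree, labToTree, Der.toTree, Inf.toTree, Tree.size,
      Tree.ofNat]
    omega
  have := numAtoms_le_toTree A
  have := numAtoms_le_toTree B
  have h₁ := fn_num (K := K) (A := A) (n := 0) (by omega) (by omega) (by omega)
  have h₂ := fn_num (K := K) (A := B) (n := 0 + A.numAtoms) (by omega) (by omega) (by omega)
  exact ⟨low rfl h₁ (low rfl h₂ (.ret' rfl rfl)), size_omega, by omega⟩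

end

theorem fn_weak (a : Lit) {p : Pat} (hK : (weak a p).toTree.size ≤ K) :
    Fn K 2 .weak (Formula.toTree (p.fm a)) (weak a p).toTree (Formula.toTree (p.fm a)).size := by
  have h₁ := Formula.toTree_le (weak a p)
  have hs : (Formula.toTree (p.fm a)).size + (weak a p).toTree.size ≤ 100 * K := by omega
  induction p with
  | unit | leaf => exact ⟨.ret' rfl rfl, hs, by omega⟩
  | node p q ihp ihq =>
    have h₂ := comp_le hK
    have h₃ := and_le h₂.2
    exact ⟨same rfl (ihp h₃.1 (Formula.toTree_le _) (by have := Formula.toTree_le (weak a p); omega))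
      (same rfl (ihq h₃.2 (Formula.toTree_le _) (by have := Formula.toTree_le (weak a q); omega))
      (low rfl (fn_comp hK) (.ret' (n := 0) rfl rfl)) le_rfl)
      size_omega, hs, by omega⟩

theorem fn_contr (a : Lit) {p : Pat} (hK : (contr a p).toTree.size ≤ K) :
    Fn K 2 .contr (Formula.toTree (p.fm a)) (contr a p).toTree (Formula.toTree (p.fm a)).size := by
  have h₁ := Formula.toTree_le (contr a p)
  have hs : (Formula.toTree (p.fm a)).size + (contr a p).toTree.size ≤ 100 * K := by omega
  induction p with
  | unit | leaf => exact ⟨.ret' rfl rfl, hs, by omega⟩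
  | node p q ihp ihq =>
    have h₂ := comp_le hK
    have h₃ := and_le h₂.2
    exact ⟨same rfl (ihp h₃.1 (Formula.toTree_le _) (by have := Formula.toTree_le (contr a p); omega))
      (same rfl (ihq h₃.2 (Formula.toTree_le _) (by have := Formula.toTree_le (contr a q); omega))
      (low rfl (fn_comp hK) (.ret' (n := 0) rfl rfl)) le_rfl)
      size_omega, hs, by omega⟩

open Fn (low same)
variable {K : ℕ}

theorem fn_has (a : Lit) {p : Pat} (hK : (Formula.toTree (p.fm a)).size ≤ 10 * K) :
    Fn K 0 .has (Formula.toTree (p.fm a)) (.ofNat (if p.leaves = 0 then 0 else 1))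
      (Formula.toTree (p.fm a)).size := by
  have hs : (Formula.toTree (p.fm a)).size +
      (Tree.ofNat (if p.leaves = 0 then 0 else 1)).size ≤ 100 * K := by
    have := (Formula.toTree (p.fm a)).size_pos
    split <;> exact size_omega
  induction p with
  | unit | leaf => exact ⟨.ret' rfl rfl, hs, by omega⟩
  | node p q ihp ihq =>
    have h : (Formula.toTree (p.fm a)).size + (Formula.toTree (q.fm a)).size + 9 =
        (Formula.toTree ((p.node q).fm a)).size := size_omega
    have := (Formula.toTree (p.fm a)).size_pos
    have := (Formula.toTree (q.fm a)).size_pos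
    replace ihp := ihp (by omega) (by split <;> exact size_omega)
    replace ihq := ihq (by omega) (by split <;> exact size_omega)
    refine ⟨same rfl ihp (n₂ := (Formula.toTree (q.fm a)).size + 1) ?_ (by omega), hs, by omega⟩
    by_cases hp : p.leaves = 0
    · simp only [Pat.leaves, hp, zero_add, if_true]
      exact same rfl ihq (.ret' (n := 0) rfl rfl) le_rfl
    · have : ¬ p.leaves + q.leaves = 0 := by omega
      simp only [Pat.leaves, hp, this, if_false]
      exact .ret' rfl rfl

section
variable {A B C : Formula}

theorem fn_distr {Φ : Der (.or C C) C} (hK : (distribute A B C Φ).toTree.size ≤ K) :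
    Fn K 2 .distr (.cons A.toTree (.cons B.toTree (.cons C.toTree
      Φ.toTree))) (distribute A B C Φ).toTree 0 := by
  have h₁ := comp_le hK
  have h₂ := comp_le h₁.2
  have h₃ := comp_le (or_le h₂.1).1
  have h₄ := comp_le h₂.2
  have h₅ := (or_le h₄.2).2
  have h₆ := Formula.toTree_le (distribute A B C Φ)
  simp only [Formula.toTree, Tree.size] at h₆
  exact ⟨low rfl (fn_andComm h₃.1) (low rfl (fn_comp (or_le h₂.1).1)
    (low rfl (fn_re h₄.1) (low rfl (fn_comp h₂.2) (low rfl (fn_comp h₁.2)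
    (low rfl (fn_comp hK) (.ret' rfl rfl)))))), size_omega, by omega⟩

end

theorem le_spread {a : Lit} {C : Formula} {κ : Der (.or C C) C} {ω : Der .bot C}
    {Φ : Der .top (.or (.atom a) C)} {p : Pat} (hp : p.leaves ≠ 0) :
    Φ.toTree.size ≤ (spread a C κ ω Φ p).toTree.size := by
  induction p with
  | unit => exact absurd rfl hp
  | leaf => exact le_rfl
  | node p q ihp ihq =>
    have h := and_le (comp_le (comp_le (le_refl (spread a C κ ω Φ (.node p q)).toTree.size)).2).1
    simp only [Pat.leaves] at hp
    by_cases h' : p.leaves = 0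
    · exact (ihq (by omega)).trans h.1
    · exact (ihp h').trans h.2

theorem fn_spread {a b : Lit} {p q : Pat} {Φ : Der .top (.or (.atom a) (q.fm b))} {T : Tree}
    (hT : p.leaves = 0 ∨ T = Φ.toTree) (h : T.size ≤ K)
    (hK : (spread a (q.fm b) (contr b q) (weak b q) Φ p).toTree.size ≤ K) :
    Fn K 3 .spread (.cons (Formula.toTree (p.fm a)) (.cons (Formula.toTree (q.fm b)) T))
      (spread a (q.fm b) (contr b q) (weak b q) Φ p).toTree (Formula.toTree (p.fm a)).size := by
  have h₀ := Formula.toTree_le (spread a (q.fm b) (contr b q) (weak b q) Φ p)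
  simp only [Formula.toTree, Tree.size] at h₀
  have hs : (Tree.cons (Formula.toTree (p.fm a)) (.cons (Formula.toTree (q.fm b)) T)).size +
      (spread a (q.fm b) (contr b q) (weak b q) Φ p).toTree.size ≤ 100 * K := size_omega
  induction p with
  | unit =>
    exact ⟨low rfl (fn_weak b (or_le (comp_le hK).2).2) (low rfl (fn_comp hK)
      (.ret' rfl rfl)), hs, by omega⟩
  | leaf =>
    obtain rfl := hT.resolve_left one_ne_zero
    exact ⟨.ret' rfl rfl, hs, by omega⟩
  | node p q' ihp ihq =>
    have h₁ := comp_le hK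
    have h₂ := comp_le h₁.2
    have h₃ := and_le h₂.1
    have h₄ := (or_le (comp_le (comp_le (comp_le h₂.2).2).2).2).2
    have h₅ := Formula.toTree_le (spread a (q.fm b) (contr b q) (weak b q) Φ p)
    have h₆ := Formula.toTree_le (spread a (q.fm b) (contr b q) (weak b q) Φ q')
    simp only [Formula.toTree, Tree.size] at h₅ h₆
    replace ihp := ihp (hT.imp_left fun h => by simp only [Pat.leaves] at h; omega) h₃.2 h₅
      size_omega
    replace ihq := ihq (hT.imp_left fun h => by simp only [Pat.leaves] at h; omega) h₃.1 h₆
      size_omega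
    exact ⟨same rfl ihq (same rfl ihp (low rfl (fn_contr b h₄) (low rfl (fn_distr h₂.2)
      (low rfl (fn_comp h₁.2) (low rfl (fn_comp hK) (.ret' (n := 0) rfl rfl))))) le_rfl)
      size_omega, hs, by omega⟩

theorem fn_cocontr (a : Lit) {m : Bool} {p q : Pat} (hK : (cocontr a m p q).toTree.size ≤ K) :
    Fn K 2 .cocontr (.cons (.ofNat m.toNat) (.cons (Formula.toTree (p.fm a))
      (Formula.toTree (q.fm a)))) (cocontr a m p q).toTree 0 := by
  have h₀ := (Formula.toTree_le (cocontr a m p q)).2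
  simp only [Formula.toTree, Tree.size, Tree.ofNat] at h₀
  refine ⟨?_, by cases m <;> simp only [Tree.size, Bool.toNat, cond, Tree.ofNat] <;> omega, by omega⟩
  rcases p with _ | _ | ⟨p, p'⟩
  · rcases q with _ | _ | ⟨q, q'⟩ <;> cases m <;> exact low rfl (fn_re hK) (.ret' rfl rfl)
  all_goals rcases q with _ | _ | ⟨q, q'⟩
  any_goals cases m <;> exact low rfl (fn_re hK) (.ret' rfl rfl)
  all_goals cases m <;> exact .ret' rfl rfl

theorem fn_eqn {i j : ℕ} (hi : 2 * i + 1 ≤ 40 * K) (hj : 2 * j + 1 ≤ 40 * K) :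
    Fn K 0 .eqn (.cons (.ofNat i) (.ofNat j)) (.ofNat (if i = j then 1 else 0)) i := by
  have hs (i j : ℕ) (hi : 2 * i + 1 ≤ 40 * K) (hj : 2 * j + 1 ≤ 40 * K) :
      (Tree.cons (.ofNat i) (.ofNat j)).size +
      (Tree.ofNat (if i = j then 1 else 0)).size ≤ 100 * K := by
    split <;> exact size_omega
  induction i generalizing j with
  | zero => cases j <;> exact ⟨.ret' rfl rfl, hs _ _ hi hj, by omega⟩
  | succ i ih =>
    cases j with
    | zero => exact ⟨.ret' rfl rfl, hs _ _ hi hj, by omega⟩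
    | succ j =>
      exact ⟨same rfl (ih (j := j) (by omega) (by omega)) (.ret' (n := 0) rfl
        (by simp only [Nat.add_right_cancel_iff]; rfl)) le_rfl, hs _ _ hi hj, by omega⟩

open Fn (low same)
variable {K : ℕ}

theorem fn_cnt {A : Formula} {n : ℕ} (hA : A.toTree.size ≤ 30 * K)
    (hn : 2 * (n + A.numAtoms) + 1 ≤ 30 * K) :
    Fn K 0 .cnt (.cons A.toTree (.ofNat n)) (.ofNat (n + A.numAtoms))
      A.toTree.size := by
  have hs : (Tree.cons A.toTree (.ofNat n)).size +
      (Tree.ofNat (n + A.numAtoms)).size ≤ 100 * K := size_omega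
  induction A generalizing n with
  | top | bot | atom a => exact ⟨.ret' rfl rfl, hs, by omega⟩
  | and A B ihA ihB | or A B ihA ihB =>
    simp only [Formula.toTree, Tree.size, Tree.ofNat, numAtoms, Tree.size_ofNat] at hA hn ihA ihB
    have h₂ := ihB (n := n + A.numAtoms) (by omega) (by omega) (by omega)
    rw [add_assoc] at h₂
    exact ⟨same rfl (ihA (n := n) (by omega) (by omega) (by omega)) (same rfl h₂
      (.ret' (n := 0) rfl rfl) le_rfl) size_omega, hs, size_omega⟩

theorem snd_mem_toList {A : Formula} {t : A.Lab} {a : Lit} {i : ℕ}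
    (h : (a, i) ∈ (A.decorate t).atoms) : i ∈ Lab.toList A t := by
  have := Multiset.mem_map_of_mem Prod.snd h
  rwa [atoms_decorate, Multiset.mem_coe] at this

section
variable {β : Type} [Inhabited β] (s : Lit → β → Formula)

theorem fn_find {i : ℕ} (hi : 2 * i + 1 ≤ 10 * K) {B : Formula} (t : B.Lab) (l : B.GLab β)
    (h : B.toTree.size + (labToTree B t).size + (Formula.toTree (B.sub s l)).size ≤
      35 * K) :
    (i ∉ Lab.toList B t → Fn K 1 .find (.cons (.ofNat i) (.cons B.toTree
      (.cons (labToTree B t) (Formula.toTree (B.sub s l))))) .nil B.toTree.size) ∧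
    ∀ a, (a, i) ∈ (B.decorate t).atoms → (Lab.toList B t).Nodup →
      (Formula.toTree (s a ((GLab.toList B l).getD ((Lab.toList B t).idxOf i) default))).size ≤
        (Formula.toTree (B.sub s l)).size ∧
      Fn K 1 .find (.cons (.ofNat i) (.cons B.toTree
        (.cons (labToTree B t) (Formula.toTree (B.sub s l)))))
        (.cons (Formula.toTree (s a ((GLab.toList B l).getD ((Lab.toList B t).idxOf i) default)))
          .nil) B.toTree.size := by
  have hs (z : Tree) (hz : z.size ≤ (Formula.toTree (B.sub s l)).size + 2) :
      (Tree.cons (.ofNat i) (.cons B.toTree (.cons (labToTree B t)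
        (Formula.toTree (B.sub s l))))).size + z.size ≤ 100 * K := size_omega
  have := (Formula.toTree (B.sub s l)).size_pos
  induction B with
  | top | bot =>
    exact ⟨fun _ => ⟨.ret' rfl rfl, hs _ size_omega, by omega⟩,
      fun a ha => by simp [decorate, atoms] at ha⟩
  | atom b =>
    have key (j : ℕ) (p : β) (h : (Formula.toTree (.atom b)).size + (Tree.ofNat j).size +
        (Formula.toTree (s b p)).size ≤ 35 * K) (y : Tree)
        (hy : y = if j = i then .cons (Formula.toTree (s b p)) .nil else .nil) :
        Fn K 1 .find (.cons (.ofNat i) (.cons (Formula.toTree (.atom b))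
          (.cons (.ofNat j) (Formula.toTree (s b p))))) y (Formula.toTree (.atom b)).size := by
      rw [Tree.size_ofNat] at h
      subst hy
      refine ⟨low rfl (fn_eqn (i := j) (by omega) (by omega)) ?_, ?_, by omega⟩
      · split <;> exact .ret' rfl rfl
      · split <;> simp only [Tree.size, Tree.size_ofNat] <;> omega
    refine ⟨fun hi => key t l h _ (if_neg fun hj => hi (List.mem_singleton.2 hj.symm)).symm, ?_⟩
    intro a ha _
    obtain ⟨rfl, rfl⟩ := Prod.mk.inj (Multiset.mem_singleton.1 ha)
    have h' : (GLab.toList (atom a) l).getD ((Lab.toList (atom a) i).idxOf i) default = l := by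
      simp only [Lab.toList, List.idxOf_cons_self]; rfl
    rw [h']
    exact ⟨le_rfl, key i l h _ (if_pos rfl).symm⟩
  | and A B ihA ihB | or A B ihA ihB =>
    have h₁ := (Formula.toTree (A.sub s l.1)).size_pos
    have h₂ := (Formula.toTree (B.sub s l.2)).size_pos
    simp only [Formula.toTree, labToTree, Tree.size, Tree.ofNat, sub] at h
    replace ihA := ihA t.1 l.1 (by omega) (fun z hz => size_omega) h₁
    replace ihB := ihB t.2 l.2 (by omega) (fun z hz => size_omega) h₂
    simp only [Lab.toList, GLab.toList, List.mem_append, not_or, decorate, atoms, mem_add,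
      List.nodup_append]
    refine ⟨fun h => ⟨same rfl (ihA.1 h.1) (same rfl (ihB.1 h.2) (.ret' (n := 0) rfl rfl)
      le_rfl) size_omega, hs _ size_omega, size_omega⟩,
      fun a ha hd => ?_⟩
    rcases ha with ha | ha
    · have h₃ := snd_mem_toList ha
      obtain ⟨h₅, h₄⟩ := ihA.2 a ha hd.1
      rw [List.idxOf_append_of_mem h₃, List.getD_append _ _ _ _ (by
        simpa [Lab.length_toList] using List.idxOf_lt_length_of_mem h₃)]
      exact ⟨size_omega, same rfl h₄ (.ret' (n := 0) rfl rfl) size_omega, hs _ size_omega, size_omega⟩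
    · have h₃ : i ∉ Lab.toList A t.1 := fun h => hd.2.2 _ h _ (snd_mem_toList ha) rfl
      obtain ⟨h₅, h₄⟩ := ihB.2 a ha hd.2.1
      rw [List.idxOf_append_of_notMem h₃, List.getD_append_right _ _ _ _ (by
        simp [Lab.length_toList])]
      rw [GLab.length_toList, Lab.length_toList, Nat.add_sub_cancel_left]
      exact ⟨size_omega, same rfl (ihA.1 h₃) (same rfl h₄ (.ret' (n := 0) rfl rfl) le_rfl) size_omega, hs _ size_omega, size_omega⟩

end

open Fn (low same)
variable {K : ℕ}

/-- A list of formulae as data. -/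
def listTree : List Formula → Tree
  | [] => .nil
  | A :: L => .cons A.toTree (listTree L)

theorem size_listTree_append (L L' : List Formula) :
    (listTree (L ++ L')).size + 1 = (listTree L).size + (listTree L').size := by
  induction L with
  | nil => simp only [List.nil_append, listTree, Tree.size]; omega
  | cons A L ih => simp only [List.cons_append, listTree, Tree.size]; omega

theorem size_le_listTree {A : Formula} {L : List Formula} (h : A ∈ L) :
    A.toTree.size ≤ (listTree L).size := by
  induction L with
  | nil => cases h
  | cons B L ih =>
    simp only [listTree, Tree.size]
    rcases List.mem_cons.1 h with rfl | h
    · omega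
    · have := ih h; omega

theorem length_le_listTree (L : List Formula) : L.length ≤ (listTree L).size := by
  induction L with
  | nil => exact Nat.zero_le _
  | cons A L ih => simp only [listTree, Tree.size, List.length_cons]; omega

theorem fn_drop {L : List Formula} {i n : ℕ} (hi : i < L.length)
    (hL : (listTree L).size ≤ 20 * K) (hn : 2 * (n + (L.map numAtoms).sum) + 1 ≤ 10 * K) :
    Fn K 1 .drop (.cons (.ofNat i) (.cons (.ofNat n) (listTree L)))
      (.cons (Formula.toTree L[i]) (.ofNat (n + ((L.take i).map numAtoms).sum))) i := by
  induction L generalizing i n with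
  | nil => cases hi
  | cons A L ih =>
    have h₁ := length_le_listTree L
    have h₂ := size_le_listTree (List.getElem_mem hi)
    have h₃ := List.sum_take_add_sum_drop ((A :: L).map numAtoms) i
    rw [← List.map_take] at h₃
    have hs : (Tree.cons (.ofNat i) (.cons (.ofNat n) (listTree (A :: L)))).size +
        (Tree.cons (Formula.toTree (A :: L)[i])
          (.ofNat (n + (((A :: L).take i).map numAtoms).sum))).size ≤ 100 * K := by
      simp only [listTree, List.length_cons, Tree.size] at hL hi h₂
      simp only [Tree.size, Tree.size_ofNat, listTree]
      omega
    simp only [listTree, List.length_cons, Tree.size, List.map_cons, List.sum_cons] at hL hi hn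
    cases i with
    | zero => exact ⟨.ret' rfl rfl, hs, by omega⟩
    | succ i =>
      have h₄ := ih (i := i) (n := n + A.numAtoms) (by omega) (by omega) (by omega)
      rw [add_assoc] at h₄
      exact ⟨low rfl (fn_cnt (A := A) (n := n) (by omega) (by omega)) (same rfl h₄
        (.ret' (n := 0) rfl rfl) le_rfl), hs, by omega⟩

theorem sum_take_add_le {L : List Formula} {i : ℕ} {A : Formula} (h : L[i]? = some A) :
    ((L.take i).map numAtoms).sum + A.numAtoms ≤ (L.map numAtoms).sum := by
  have h₁ := List.sum_take_add_sum_drop (L.map numAtoms) (i + 1)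
  rw [← List.map_take, List.take_succ, h, List.map_append, List.sum_append] at h₁
  have h₂ : ([A].map numAtoms).sum = A.numAtoms := List.sum_singleton
  simp only [Option.toList, h₂] at h₁
  omega

section
variable {β : Type} (s : Lit → β → Formula)

/-- The formulae that are substituted for the atom occurrences. -/
def parts : (A : Formula) → A.GLab β → List Formula
  | .top, _ => []
  | .bot, _ => []
  | .atom a, p => [s a p]
  | .and A B, l => parts A l.1 ++ parts B l.2
  | .or A B, l => parts A l.1 ++ parts B l.2

theorem size_parts (A : Formula) (l : A.GLab β) : (listTree (parts s A l)).size ≤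
    A.toTree.size + (Formula.toTree (A.sub s l)).size := by
  induction A with
  | top | bot => exact Nat.le_of_ble_eq_true rfl
  | atom a =>
    have key (p : β) : (listTree [s a p]).size ≤
        (Formula.toTree (atom a)).size + (Formula.toTree (s a p)).size := by
      have := (Tree.name a.var).size_pos
      simp only [listTree, Formula.toTree, Tree.size, Tree.ofNat] at *; omega
    exact key l
  | and A B ihA ihB | or A B ihA ihB =>
    have h₁ := size_listTree_append (parts s A l.1) (parts s B l.2)
    have h₂ := ihA l.1
    have h₃ := ihB l.2
    simp only [parts, sub, Formula.toTree, Tree.size]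
    omega

theorem map_parts {w : β → ℕ} (hw : ∀ a p, (s a p).numAtoms = w p) (A : Formula)
    (l : A.GLab β) : (parts s A l).map numAtoms = (GLab.toList A l).map w := by
  induction A with
  | top | bot => rfl
  | atom a => exact congrArg (fun n => [n]) (hw a l)
  | and A B ihA ihB | or A B ihA ihB => simp only [parts, GLab.toList, List.map_append, ihA, ihB]

theorem fn_flat {A : Formula} {l : A.GLab β} {L : List Formula}
    (hA : A.toTree.size ≤ 10 * K) (hA' : (Formula.toTree (A.sub s l)).size ≤ 10 * K)
    (h : (listTree (parts s A l ++ L)).size ≤ 25 * K) :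
    Fn K 0 .flat (.cons A.toTree (.cons (Formula.toTree (A.sub s l)) (listTree L)))
      (listTree (parts s A l ++ L)) A.toTree.size := by
  have h₀ := size_listTree_append (parts s A l) L
  have h₀' := (listTree (parts s A l)).size_pos
  have hs : (Tree.cons A.toTree (.cons (Formula.toTree (A.sub s l)) (listTree L))).size +
      (listTree (parts s A l ++ L)).size ≤ 100 * K := by
    have := A.toTree.size_pos
    exact size_omega
  induction A generalizing L with
  | top | bot | atom a => exact ⟨.ret' rfl rfl, hs, by omega⟩
  | and A B ihA ihB | or A B ihA ihB =>
    have h₁ := size_listTree_append (parts s B l.2) L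
    have h₂ := size_listTree_append (parts s A l.1) (parts s B l.2 ++ L)
    have h₃ := (listTree (parts s A l.1)).size_pos
    have h₄ := (listTree (parts s B l.2)).size_pos
    simp only [Formula.toTree, sub, Tree.size, parts, List.append_assoc] at hA hA' h
    have h₅ := ihB (l := l.2) (L := L) (by omega) (by omega) (by omega) h₁ h₄ size_omega
    have h₆ := ihA (l := l.1) (L := parts s B l.2 ++ L) (by omega) (by omega) h h₂ h₃ size_omega
    refine ⟨same rfl h₅ (same rfl h₆ (.ret' (n := 0) rfl ?_) le_rfl) size_omega, hs, size_omega⟩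
    exact congrArg listTree (List.append_assoc _ _ _).symm

variable [Inhabited β]

theorem length_parts (A : Formula) (l : A.GLab β) : (parts s A l).length = A.numAtoms := by
  induction A with
  | top | bot | atom a => rfl
  | and A B ihA ihB | or A B ihA ihB =>
    simp only [parts, List.length_append, numAtoms, ihA, ihB]

theorem parts_getElem? {A : Formula} {n : ℕ} (l : A.GLab β) {e : Lit × ℕ}
    (h : e ∈ (A.decorate (A.numbering n)).atoms) : ∃ k < A.numAtoms, e.2 = n + k ∧
      (parts s A l)[k]? = some (s e.1 ((GLab.toList A l).getD k default)) := by
  induction A generalizing n with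
  | top | bot => simp [decorate, atoms] at h
  | atom a =>
    obtain rfl := Multiset.mem_singleton.1 h
    exact ⟨0, Nat.zero_lt_one, rfl, rfl⟩
  | and A B ihA ihB | or A B ihA ihB =>
    rcases Multiset.mem_add.1 h with h | h
    · obtain ⟨k, hk, h₁, h₂⟩ := ihA l.1 h
      refine ⟨k, hk.trans_le (Nat.le_add_right _ _), h₁, ?_⟩
      rwa [parts, GLab.toList, List.getElem?_append_left (by rwa [length_parts]),
        List.getD_append _ _ _ _ (by rwa [GLab.length_toList])]
    · obtain ⟨k, hk, h₁, h₂⟩ := ihB l.2 h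
      refine ⟨A.numAtoms + k, Nat.add_lt_add_left hk _, h₁.trans (Nat.add_assoc _ _ _), ?_⟩
      rwa [parts, GLab.toList, List.getElem?_append_right (by rw [length_parts]; omega),
        List.getD_append_right _ _ _ _ (by rw [GLab.length_toList]; omega), length_parts,
        GLab.length_toList, Nat.add_sub_cancel_left]

theorem fn_tab {A B : Formula} {n : ℕ} {t : B.Lab} {l : B.GLab β} {f : ℕ → β}
    (hf : ∀ i, f i = (GLab.toList B l).getD ((Lab.toList B t).idxOf i) default)
    (hm : ∀ e ∈ (A.decorate (A.numbering n)).atoms, e ∈ (B.decorate t).atoms)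
    (ht : (Lab.toList B t).Nodup) (h : B.toTree.size + (labToTree B t).size +
      (Formula.toTree (B.sub s l)).size ≤ 35 * K) (hA : A.toTree.size ≤ 10 * K)
    (hA' : (Formula.toTree (A.sub s (GLab.tab f A n))).size ≤ 10 * K)
    (hn : 2 * (n + A.numAtoms) + 1 ≤ 10 * K) :
    Fn K 2 .tab (.cons A.toTree (.cons (.ofNat n) (.cons B.toTree
      (.cons (labToTree B t) (Formula.toTree (B.sub s l))))))
      (.cons (Formula.toTree (A.sub s (GLab.tab f A n))) (.ofNat (n + A.numAtoms)))
      A.toTree.size := by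
  have hs : (Tree.cons A.toTree (.cons (.ofNat n) (.cons B.toTree
      (.cons (labToTree B t) (Formula.toTree (B.sub s l)))))).size + (Tree.cons (Formula.toTree
      (A.sub s (GLab.tab f A n))) (.ofNat (n + A.numAtoms))).size ≤ 100 * K := size_omega
  induction A generalizing n with
  | top | bot => exact ⟨.ret' rfl rfl, hs, by omega⟩
  | atom a =>
    have h₁ := ((fn_find s (K := K) (i := n) (by omega) t l h).2 a
      (hm (a, n) (mem_singleton_self _)) ht).2
    rw [← hf] at h₁
    exact ⟨low rfl h₁ (.ret' rfl rfl), hs, by omega⟩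
  | and A B ihA ihB | or A B ihA ihB =>
    simp only [Formula.toTree, Tree.size, Tree.ofNat, numAtoms, Tree.size_ofNat, sub, GLab.tab]
      at hA hA' hn ihA ihB
    have h₁ := ihA (n := n) (fun e he => hm e (Multiset.mem_add.2 (.inl he))) (by omega) (by omega)
      (by omega) (by omega)
    have h₂ := ihB (n := n + A.numAtoms) (fun e he => hm e (Multiset.mem_add.2 (.inr he)))
      (by omega) (by omega) (by omega) (by omega)
    rw [add_assoc] at h₂
    exact ⟨same rfl h₁ (same rfl h₂
      (.ret' (n := 0) rfl rfl) le_rfl) size_omega, hs, size_omega⟩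

theorem fn_slots {B : Formula} {t : B.Lab} {l : B.GLab β} {L : List Formula} {f : ℕ → β}
    (hf : ∀ e ∈ (B.decorate t).atoms, L[e.2]? = some (s e.1 (f e.2)))
    (hl : GLab.toList B l = (Lab.toList B t).map f) {off : ℕ → ℕ}
    (ho : ∀ i, off i = ((L.take i).map numAtoms).sum)
    (hB : B.toTree.size ≤ 10 * K) (ht : (labToTree B t).size ≤ 10 * K)
    (hL : (listTree L).size ≤ 20 * K) (hn : 2 * (L.map numAtoms).sum + 1 ≤ 10 * K)
    (hB' : (Formula.toTree (B.sub s l)).size ≤ 10 * K)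
    (hs : (labToTree _ (slots s off B t l)).size ≤ 10 * K) :
    Fn K 2 .slots (.cons B.toTree (.cons (labToTree B t) (listTree L)))
      (.cons (Formula.toTree (B.sub s l)) (labToTree _ (slots s off B t l)))
      B.toTree.size := by
  have hs' : (Tree.cons B.toTree (.cons (labToTree B t) (listTree L))).size +
      (Tree.cons (Formula.toTree (B.sub s l)) (labToTree _ (slots s off B t l))).size ≤ 100 * K := by
    have := B.toTree.size_pos
    exact size_omega
  induction B with
  | top | bot => exact ⟨.ret' rfl rfl, hs', by omega⟩
  | atom b =>
    have h₁ := hf (b, t) (mem_singleton_self _)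
    obtain rfl : l = f t := List.singleton_inj.1 hl
    obtain ⟨h₂, h₃⟩ := List.getElem?_eq_some_iff.1 h₁
    have h₄ := fn_drop (K := K) (n := 0) h₂ hL (by rwa [zero_add])
    rw [zero_add, ← ho, h₃] at h₄
    have h₅ : off t + (s b (f t)).numAtoms ≤ (L.map numAtoms).sum := ho t ▸ sum_take_add_le h₁
    exact ⟨low rfl h₄ (low rfl (fn_num (A := s b (f t)) (n := off t) hB' hs (by omega)) (.ret' rfl rfl)), hs', by omega⟩
  | and A B ihA ihB | or A B ihA ihB =>
    obtain ⟨h₁, h₂⟩ := List.append_inj (hl.trans (List.map_append ..)) (by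
      simp [Lab.length_toList])
    simp only [Formula.toTree, Tree.size, Tree.ofNat, sub, labToTree, slots] at hB ht hB' hs
    have h₃ := ihA (fun e he => hf e (Multiset.mem_add.2 (.inl he))) h₁ (by omega) (by omega)
      (by omega) (by omega) size_omega
    have h₄ := ihB (fun e he => hf e (Multiset.mem_add.2 (.inr he))) h₂ (by omega) (by omega)
      (by omega) (by omega) size_omega
    exact ⟨same rfl h₃ (same rfl h₄ (.ret' (n := 0) rfl rfl) le_rfl) size_omega, hs', size_omega⟩

theorem fn_eqs {A B : Formula} {w : β → ℕ} {hw : ∀ a p, (s a p).numAtoms = w p} {t : B.Lab}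
    {h : Fm.Eqv (A.decorate (A.numbering 0)) (B.decorate t)} {l : A.GLab β} {m : B.GLab β}
    {hm : Fm.GLab.toList B m = (Fm.Lab.toList B t).map ((Fm.GLab.toList A l).getD · default)}
    (hA : A.toTree.size ≤ 10 * K) (hB : B.toTree.size ≤ 10 * K)
    (ht : (labToTree B t).size ≤ 10 * K) (hK : (eqSub s w hw t h l m hm).toTree.size ≤ K) :
    Fn K 3 .eqs (.cons A.toTree (.cons (Formula.toTree (A.sub s l))
      (.cons B.toTree (labToTree B t)))) (eqSub s w hw t h l m hm).toTree 0 := by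
  have h₁ := step_le hK
  simp only [Der.toTree, Inf.toTree, Tree.size] at h₁
  have h₂ := fn_flat s (K := K) (l := l) (L := []) hA (by omega)
  rw [List.append_nil] at h₂
  have h₃ := size_parts s A l
  have h₄ := map_parts s hw A l
  have h₅ := numAtoms_le_toTree (A.sub s l)
  rw [numAtoms_sub hw, ← h₄] at h₅
  have h₆ := fn_slots s (K := K) (l := m) (L := parts s A l) (t := t)
    (off := fun i => (((GLab.toList A l).take i).map w).sum) (fun e he => by
      rw [← h.atoms_eq] at he
      obtain ⟨k, -, h₇, h₈⟩ := parts_getElem? s l he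
      rw [h₇, zero_add, h₈]) hm (fun i => by rw [List.map_take, List.map_take, h₄]) hB ht (by omega)
    (by omega) (by omega) (by omega)
  exact ⟨low rfl (h₂ (by omega)) (low rfl h₆ (.ret' rfl rfl)), by
    simp only [Tree.size, Der.toTree] at *; omega, by omega⟩

end

open Fn (low same)
variable {K : ℕ} {A B : Formula}

theorem size_ofNat_toNat (m : Bool) : (Tree.ofNat m.toNat).size ≤ 3 := by
  cases m <;> exact Nat.le_of_ble_eq_true rfl

theorem size_iDown_orComm (a : Lit) :
    (comp (.inf (.iDown a)) (.inf (.orComm _ _))).toTree.size ≤ 200 := by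
  rcases a with ⟨v, _ | _⟩ <;> exact Nat.le_of_ble_eq_true rfl

theorem fn_infUp (hc : 200 ≤ K) {m : Bool} (ρ : Inf A B) {l : B.GLab Pat}
    (hρ : ρ.toTree.size ≤ K) (hA : A.toTree.size ≤ 3 * K)
    (hB : B.toTree.size ≤ 3 * K) (hK : (ρ.up m l).toTree.size ≤ K) :
    Fn K 4 .infUp (.cons ρ.toTree (.cons A.toTree (.cons B.toTree
      (.cons (Formula.toTree (copies B l)) (.ofNat m.toNat))))) (ρ.up m l).toTree 0 := by
  have h₀ := Formula.toTree_le (ρ.up m l)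
  have hm := size_ofNat_toNat m
  refine ⟨?_, size_omega, Nat.zero_le _⟩
  cases ρ with
  | eq t h =>
    simp only [Inf.toTree, Tree.size] at hρ
    have h₁ := numAtoms_le_toTree A
    have h₂ := fn_tab Pat.fm (K := K) (A := A) (n := 0) (t := t) (l := l) (fun i => rfl)
      (fun e he => h.atoms_eq ▸ he) (h.perm.nodup_iff.2 List.nodup_range)
      ((Nat.add_le_add_left h₀.2 _).trans (by omega)) (by omega)
      (h₀.1.trans (by omega)) (by omega)
    have h₃ : Fn K 3 .eqs _ (Inf.up m (.eq t h) l).toTree 0 :=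
      fn_eqs Pat.fm (hw := Pat.numAtoms_fm) (h := h) (hm := by
        rw [Inf.upLab, GLab.toList_tab, ← List.range_eq_range']
        exact getD_idxOf h.perm (by simp [Lab.length_toList])) (by omega) (by omega) (by omega) hK
    exact low rfl h₂ (low rfl h₃ (.ret' rfl rfl))
  | iDown a =>
    have h₁ := fn_has (K := K) a (p := l.1) (by
      have := h₀.2; simp only [sub, Formula.toTree, Tree.size] at this; omega)
    refine low rfl h₁ ?_
    by_cases hp : Pat.leaves l.1 = 0
    · rw [if_pos hp]
      exact low rfl (fn_spread (T := .nil) (.inl hp) size_omega hK)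
        (.ret' rfl rfl)
    · rw [if_neg hp]
      have h₂ := (le_spread hp).trans hK
      have h₃ := comp_le h₂
      have h₄ := (size_iDown_orComm a).trans hc
      exact low rfl (fn_orComm (comp_le h₄).2) (low rfl (fn_comp h₄) (low rfl
        (fn_spread (q := .leaf) (.inr rfl) h₄ h₃.1) (low rfl (fn_orComm h₃.2)
        (low rfl (fn_comp h₂) (low rfl (fn_spread (.inr rfl) h₂ hK) (.ret' rfl rfl))))))
  | wDown a => exact low rfl (fn_weak a hK) (.ret' rfl rfl)
  | cDown a => exact low rfl (fn_contr a hK) (.ret' rfl rfl)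
  | cUp a => exact low rfl (fn_cocontr a hK) (.ret' rfl rfl)
  | iUp a | wUp a | switch | medial => exact .ret' rfl rfl

theorem fn_up (hc : 200 ≤ K) {m : Bool} {Φ : Der A B} {l : B.GLab Pat} (hΦ : Φ.toTree.size ≤ K)
    (hK : (Φ.up m l).toTree.size ≤ K) :
    Fn K 5 .up (.cons Φ.toTree (.cons (Formula.toTree (copies B l)) (.ofNat m.toNat)))
      (Φ.up m l).toTree Φ.toTree.size := by
  have hs {A B : Formula} {Φ : Der A B} {l : B.GLab Pat} (hΦ : Φ.toTree.size ≤ K)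
      (hK : (Φ.up m l).toTree.size ≤ K) :
      (Tree.cons Φ.toTree (.cons (Formula.toTree (copies B l)) (.ofNat m.toNat))).size +
      (Φ.up m l).toTree.size ≤ 100 * K := by
    have h₀ := Formula.toTree_le (Φ.up m l)
    have hm := size_ofNat_toNat m
    exact size_omega
  induction Φ with
  | fm A => exact ⟨.ret' rfl rfl, hs hΦ hK, by omega⟩
  | and Φ Ψ ih₁ ih₂ =>
    have h₁ := and_le hΦ
    have h₂ := and_le hK
    exact ⟨same rfl (ih₁ h₁.1 h₂.1) (same rfl (ih₂ h₁.2 h₂.2)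
      (.ret' (n := 0) rfl rfl) le_rfl) size_omega, hs hΦ hK,
      by omega⟩
  | or Φ Ψ ih₁ ih₂ =>
    have h₁ := or_le hΦ
    have h₂ := or_le hK
    exact ⟨same rfl (ih₁ h₁.1 h₂.1) (same rfl (ih₂ h₁.2 h₂.2)
      (.ret' (n := 0) rfl rfl) le_rfl) size_omega, hs hΦ hK,
      by omega⟩
  | step Φ ρ Ψ ih₁ ih₂ =>
    have h₁ := step_le hΦ
    have h₂ := comp_le hK
    have h₃ := comp_le h₂.2
    have h₄ := Formula.toTree_le Φ
    have h₅ := Formula.toTree_le Ψ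
    exact ⟨same rfl (ih₂ h₁.2.2 h₃.2) (low rfl (fn_prem h₃.2)
      (low rfl (fn_concl h₁.1) (low rfl (fn_prem h₁.2.2)
      (low rfl (fn_infUp hc ρ h₁.2.1 (by omega) (by omega) h₃.1) (low rfl (fn_prem h₃.1)
      (same rfl (ih₁ h₁.1 h₂.1) (low rfl (fn_comp h₂.2)
      (low rfl (fn_comp hK) (.ret' (n := 0) rfl rfl))) le_rfl)))))) size_omega, hs hΦ hK, by omega⟩

theorem fn_fill {A : Formula} {l : A.GLab Bool} (hK : (fill A l).toTree.size ≤ K) :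
    Fn K 0 .fill (.cons A.toTree (Formula.toTree (erase A l))) (fill A l).toTree
      A.toTree.size := by
  have h₀ := Formula.toTree_le (fill A l)
  have hs : (Tree.cons A.toTree (Formula.toTree (erase A l))).size +
      (fill A l).toTree.size ≤ 100 * K := by
    have := (fill A l).toTree.size_pos
    exact size_omega
  induction A with
  | top | bot => exact ⟨.ret' rfl rfl, hs, by omega⟩
  | atom a => exact ⟨by rcases l with _ | _ <;> exact .ret' rfl rfl, hs, by omega⟩
  | and A B ihA ihB | or A B ihA ihB =>
    have h₁ : (fill A l.1).toTree.size ≤ K ∧ (fill B l.2).toTree.size ≤ K := by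
      first | exact and_le hK | exact or_le hK
    have h₂ := Formula.toTree_le (fill A l.1)
    have h₃ := Formula.toTree_le (fill B l.2)
    have h₄ := (fill A l.1).toTree.size_pos
    have h₅ := (fill B l.2).toTree.size_pos
    exact ⟨same rfl (ihA h₁.1 h₂ size_omega) (same rfl
      (ihB h₁.2 h₃ size_omega) (.ret' (n := 0) rfl rfl) le_rfl) size_omega, hs, by omega⟩

theorem fn_copyAll {A : Formula} {l : A.GLab Pat} (hK : (copyAll A l).toTree.size ≤ K) :
    Fn K 2 .copyAll (.cons A.toTree (Formula.toTree (copies A l))) (copyAll A l).toTree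
      (Formula.toTree (copies A l)).size := by
  have hs {A : Formula} {l : A.GLab Pat} (hK : (copyAll A l).toTree.size ≤ K) :
      (Tree.cons A.toTree (Formula.toTree (copies A l))).size +
      (copyAll A l).toTree.size ≤ 100 * K ∧ (Formula.toTree (copies A l)).size ≤ 100 * K := by
    have := (copyAll A l).toTree.size_pos
    have h₀ := Formula.toTree_le (copyAll A l)
    constructor <;> try simp only [Tree.size]
    all_goals omega
  induction A with
  | top | bot => exact ⟨.ret' rfl rfl, (hs hK).1, (hs hK).2⟩
  | atom a =>
    have key {p : Pat} (hK : (copyAtom a p).toTree.size ≤ K) : Fn K 2 .copyAll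
        (.cons (Formula.toTree (atom a)) (Formula.toTree (p.fm a))) (copyAtom a p).toTree
        (Formula.toTree (p.fm a)).size := by
      have hp := hs (A := atom a) (l := p) hK
      induction p with
      | unit | leaf => exact ⟨.ret' rfl rfl, hp.1, hp.2⟩
      | node p q ihp ihq =>
        have h₁ := comp_le hK
        have h₂ := and_le h₁.2
        exact ⟨same rfl (ihp h₂.1 (hs (A := atom a) (l := p) h₂.1)) (same rfl
          (ihq h₂.2 (hs (A := atom a) (l := q) h₂.2)) (low rfl (fn_comp hK)
          (.ret' (n := 0) rfl rfl)) le_rfl) size_omega, hp.1, hp.2⟩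
    exact key hK
  | and A B ihA ihB | or A B ihA ihB =>
    have h₁ : (copyAll A l.1).toTree.size ≤ K ∧ (copyAll B l.2).toTree.size ≤ K := by
      first | exact and_le hK | exact or_le hK
    exact ⟨same rfl (ihA h₁.1) (same rfl (ihB h₁.2) (.ret' (n := 0) rfl rfl) le_rfl) (by
      simp only [copies, sub, Formula.toTree, Tree.size]; omega), (hs hK).1, (hs hK).2⟩

theorem fn_infDown (ρ : Inf A B) {l : A.GLab Bool}
    (hρ : ρ.toTree.size ≤ K) (hA : A.toTree.size ≤ 3 * K)
    (hB : B.toTree.size ≤ 3 * K) (hK : (ρ.down l).toTree.size ≤ K) :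
    Fn K 4 .infDown (.cons ρ.toTree (.cons A.toTree (.cons B.toTree
      (Formula.toTree (erase A l))))) (ρ.down l).toTree 0 := by
  have h₀ := Formula.toTree_le (ρ.down l)
  have := ρ.toTree.size_pos
  refine ⟨?_, size_omega, Nat.zero_le _⟩
  cases ρ with
  | eq t h =>
    simp only [Inf.toTree, Tree.size] at hρ
    have h₁ : Fn K 3 .eqs _ (Inf.down (.eq t h) l).toTree 0 :=
      fn_eqs keep (hw := numAtoms_keep) (h := h) (hm := GLab.toList_ofLab _ _ _) (by omega)
        (by omega) (by omega) hK
    exact low rfl h₁ (.ret' rfl rfl)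
  | cDown a =>
    obtain ⟨p, q⟩ := l
    rcases p with _ | _ <;> rcases q with _ | _
    any_goals exact low rfl (fn_re hK) (.ret' rfl rfl)
    exact .ret' rfl rfl
  | cUp a => rcases l with _ | _ <;> exact .ret' rfl rfl
  | iUp a =>
    have h₁ := comp_le hK
    exact low rfl (fn_fill (A := .and (.atom a) (.atom a.dual)) (l := l) h₁.1)
      (low rfl (fn_comp hK) (.ret' rfl rfl))
  | wUp a =>
    have h₁ := comp_le hK
    exact low rfl (fn_fill (A := .atom a) (l := l) h₁.1)
      (low rfl (fn_comp hK) (.ret' rfl rfl))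
  | iDown a | wDown a | switch | medial => exact .ret' rfl rfl

theorem fn_down {Φ : Der A B} {l : A.GLab Bool} (hΦ : Φ.toTree.size ≤ K)
    (hK : (Φ.down l).toTree.size ≤ K) :
    Fn K 5 .down (.cons Φ.toTree (Formula.toTree (erase A l))) (Φ.down l).toTree
      Φ.toTree.size := by
  have hs {A B : Formula} {Φ : Der A B} {l : A.GLab Bool} (hΦ : Φ.toTree.size ≤ K)
      (hK : (Φ.down l).toTree.size ≤ K) :
      (Tree.cons Φ.toTree (Formula.toTree (erase A l))).size +
      (Φ.down l).toTree.size ≤ 100 * K := by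
    have h₀ := Formula.toTree_le (Φ.down l)
    have := Φ.toTree.size_pos
    exact size_omega
  induction Φ with
  | fm A => exact ⟨.ret' rfl rfl, hs hΦ hK, by omega⟩
  | and Φ Ψ ih₁ ih₂ =>
    have h₁ := and_le hΦ
    have h₂ := and_le hK
    exact ⟨same rfl (ih₁ h₁.1 h₂.1) (same rfl (ih₂ h₁.2 h₂.2)
      (.ret' (n := 0) rfl rfl) le_rfl) size_omega, hs hΦ hK,
      by omega⟩
  | or Φ Ψ ih₁ ih₂ =>
    have h₁ := or_le hΦ
    have h₂ := or_le hK
    exact ⟨same rfl (ih₁ h₁.1 h₂.1) (same rfl (ih₂ h₁.2 h₂.2)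
      (.ret' (n := 0) rfl rfl) le_rfl) size_omega, hs hΦ hK,
      by omega⟩
  | step Φ ρ Ψ ih₁ ih₂ =>
    have h₁ := step_le hΦ
    have h₂ := comp_le hK
    have h₃ := comp_le h₂.2
    have h₄ := Formula.toTree_le Φ
    have h₅ := Formula.toTree_le Ψ
    exact ⟨same rfl (ih₁ h₁.1 h₂.1) (low rfl (fn_concl h₂.1) (low rfl (fn_concl h₁.1)
      (low rfl (fn_prem h₁.2.2) (low rfl (fn_infDown ρ h₁.2.1 (by omega) (by omega) h₃.1)
      (low rfl (fn_concl h₃.1) (same rfl (ih₂ h₁.2.2 h₃.2) (low rfl (fn_comp h₂.2)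
      (low rfl (fn_comp hK) (.ret' (n := 0) rfl rfl))) le_rfl)))))) size_omega, hs hΦ hK, by omega⟩

theorem toTree_castR {C : Formula} (h : B = C) (Φ : Der A B) : (castR h Φ).toTree = Φ.toTree := by
  subst h; rfl

theorem toTree_castL {C : Formula} (h : A = C) (Φ : Der A B) : (castL h Φ).toTree = Φ.toTree := by
  subst h; rfl

theorem fn_raise (hc : 200 ≤ K) {m : Bool} {Φ : Der A B} (hΦ : Φ.toTree.size ≤ K)
    (hK : (Φ.raise m).toTree.size ≤ K) : Fn K 5 .up
      (.cons Φ.toTree (.cons B.toTree (.ofNat m.toNat))) (Φ.raise m).toTree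
      Φ.toTree.size := by
  have h : (Φ.raise m).toTree = (Φ.up m (const .leaf B)).toTree :=
    toTree_castR (copies_const B 0) _
  rw [h] at hK ⊢
  exact (congrArg (fun C => Fn K 5 .up (.cons _ (.cons C.toTree _)) _ _)
    (copies_const B 0)).mp (fn_up hc hΦ hK)

theorem fn_main {Φ : Der A B} (hc : 200 ≤ K) (h₁ : Φ.toTree.size ≤ K)
    (h₂ : (Φ.raise true).toTree.size ≤ K) (h₃ : Φ.trim.toTree.size ≤ K)
    (h₄ : Φ.normalize.toTree.size ≤ K) : Fn K 6 .main Φ.toTree Φ.normalize.toTree 0 := by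
  have h₅ := comp_le h₄
  have h₆ := comp_le h₅.2
  have h₇ := comp_le h₃
  have h : (castL (erase_const _ 0) ((Φ.raise true).down (const true _))).toTree =
    ((Φ.raise true).down (const true _)).toTree := toTree_castL (erase_const _ 0) _
  have d : Fn K 5 .down (.cons (Φ.raise true).toTree (Formula.toTree (copies A (Φ.lab true))))
      (castL (erase_const _ 0) ((Φ.raise true).down (const true _))).toTree
      (Φ.raise true).toTree.size := by
    rw [h]
    exact (congrArg (fun C => Fn K 5 .down (.cons _ C.toTree) _ _)
      (erase_const _ 0)).mp (fn_down h₂ (h ▸ h₇.1))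
  exact ⟨low rfl (fn_prem h₁) (low rfl (fn_concl h₁) (low rfl (fn_raise hc h₁ h₂)
    (low rfl (fn_prem h₂) (low rfl d (low rfl (fn_concl h₇.1)
    (low rfl (fn_fill h₇.2) (low rfl (fn_comp h₃) (low rfl (fn_raise hc h₃ h₆.2)
    (low rfl (fn_prem h₆.2) (low rfl (fn_copyAll h₅.1) (low rfl (fn_copyAll h₆.1)
    (low rfl (fn_comp h₅.2) (low rfl (fn_comp h₄) (.ret' rfl rfl)))))))))))))), by omega,
    Nat.zero_le _⟩

theorem liftsPolynomially_isNormalForm : LiftsPolynomially Flow.IsNormalForm := by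
  obtain ⟨p, q, h⟩ := exists_prog code [.num, .cnt, .has, .ends true, .ends false, .re, .comp,
    .comm, .weak, .contr, .distr, .spread, .cocontr, .eqn, .find, .tab, .flat, .drop, .slots, .eqs,
    .infUp, .up, .fill, .copyAll, .infDown, .down, .main]
    (fun f => by rcases f with _ | _ | _ | _ | _ <;> simp) .main 6
  refine ⟨p, q.comp (100 * (50 * (10 ^ 12 * (.X + 1) ^ 12) ^ 2)), fun A B Φ ψ hψ => ?_⟩
  obtain rfl := (Flow.exists_unique_normalForm Φ.flow).unique Φ.isNormalForm_normalize hψ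
  set N := Φ.size + Φ.normalize.flow.size with hN
  have hs (s : ℕ) (c i : ℕ) (hc : c ≤ 10 ^ 12) (hi : i ≤ 12) (h : s ≤ c * Φ.size ^ i) :
      s ≤ 10 ^ 12 * (N + 1) ^ 12 := h.trans (Nat.mul_le_mul hc
    ((Nat.pow_le_pow_left (by omega) i).trans (Nat.pow_le_pow_right (Nat.succ_pos N) hi)))
  have ht {A B : Formula} (Ψ : Der A B) (h : Ψ.size ≤ 10 ^ 12 * (N + 1) ^ 12) :
      Ψ.toTree.size ≤ 50 * (10 ^ 12 * (N + 1) ^ 12) ^ 2 :=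
    (Nat.le_add_right _ 11).trans (Ψ.size_toTree.trans
      (Nat.mul_le_mul_left 50 (Nat.pow_le_pow_left h 2)))
  have hm := fn_main (Φ := Φ) (K := 50 * (10 ^ 12 * (N + 1) ^ 12) ^ 2) (by
      have : 10 ≤ 10 ^ 12 * (N + 1) ^ 12 :=
        Nat.mul_le_mul (show 10 ≤ 10 ^ 12 by norm_num) (Nat.one_le_pow _ _ (Nat.succ_pos N))
      calc 200 ≤ 50 * 10 ^ 2 := by norm_num
        _ ≤ _ := Nat.mul_le_mul_left 50 (Nat.pow_le_pow_left this 2))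
    (ht _ (hs _ 1 1 (by norm_num) (by norm_num) (by rw [pow_one, one_mul])))
    (ht _ (hs _ _ _ (by norm_num) (by norm_num) Φ.size_raise_true))
    (ht _ (hs _ _ _ (by norm_num) (by norm_num) Φ.size_trim)) (ht _ Φ.size_normalize)
  obtain ⟨t, ht, hr⟩ := h _ _ _ _ hm.ev hm.size hm.le
  exact ⟨_, t, rfl, hr, by simpa using ht⟩

end SKS

theorem mainTheorem10 :
    (∀ φ : SKS.Flow, ∃! ψ : SKS.Flow, SKS.Flow.IsNormalForm φ ψ) ∧
      SKS.LiftsPolynomially SKS.Flow.IsNormalForm := by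
  exact ⟨SKS.Flow.exists_unique_normalForm, SKS.liftsPolynomially_isNormalForm⟩
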